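/- Let $p>2$ be a prime and $k$ a field of characteristic $p$. Let $\mathfrak g$ be a restricted Lie superalgebra over $k$ (of arbitrary dimension) and $\mathfrak h\subseteq\mathfrak g$ a restricted Lie subsuperalgebra such that $\mathfrak g/\mathfrak h$ is finite-dimensional, of even dimension $n$ and odd dimension $m$. Let $U'$ denote restricted enveloping superalgebras. For $H\in\mathfrak h$ let $\mathrm{strad}_{\mathfrak g/\mathfrak h}(H)$ be the supertrace of $\mathrm{ad}\,H$ on $\mathfrak g/\mathfrak h$. **Coinduced modules.** For a representation $(\rho,V)$ of $U'(\mathfrak h)$ put $$\mathrm{Coind}(V)=\{f:U'(\mathfrak g)\to V \text{ linear} : \langle wu,f\rangle=\rho(w)\langle u,f\rangle \ \ \forall w\in U'(\mathfrak h),\,u\in U'(\mathfrak g)\},$$ a $U'(\mathfrak g)$-module by $\langle v,u\cdot f\rangle=\langle vu,f\rangle$. Let $\mathcal A=\mathrm{Coind}(k)$, where $k$ is the trivial representation. It is a supercommutative superalgebra, and it acts on every $\mathrm{Coind}(V)$, by $$\langle u,af\rangle=\sum(-1)^{|a||u_{(2)}|}\langle u_{(1)},a\rangle\langle u_{(2)},f\rangle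 ,\qquad \Delta(u)=\sum u_{(1)}\otimes u_{(2)}.$$ Each homogeneous $X\in\mathfrak g$ acts on $\mathcal A$ by a superderivation $\delta_X$. For a character $\chi$ of $U'(\mathfrak h)$ vanishing on odd elements, $k_\chi$ is the corresponding (even) one-dimensional module, and $\Pi^m k_\chi$ is the same with the parity changed $m$ times. **Berezinian.** For a supermodule $M$ over $\mathcal A$, free with a homogeneous basis $e_1,\dots,e_n$ (even), $e_{n+1},\dots,e_{n+m}$ (odd) and dual basis $e^1,\dots,e^{n+m}$ of $M^*=\mathrm{Hom}_{\mathcal A}(M,\mathcal A)$, let $$J(M)=S_{\mathcal A}(\Pi M\oplus M^*)=\bigoplus_r S^r_{\mathcal A}(\Pi M)\otimes_{\mathcal A} S_{\mathcal A}(M^*),$$ graded by $r$, with $d$ the left multiplication by $\sum_i(-1)^{|e_i|+1}\pi e_i\otimes e^i$, and let $\mathrm{Ber}(M)=H^n(J(M))$. In $\mathrm{Ber}(M)$ the cohomological degree $n$ is not counted in the parity, so that the class of $\pi e_1\cdots\pi e_n\otimes e^{n+1}\cdots e^{n+m}$ has parity $m$. **Lie derivative.** Let $\mathrm{Der}(\mathcal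 A)$ be the $\mathcal A$-supermodule of superderivations of $\mathcal A$. For a homogeneous superderivation $D$, let $L_D$ be the superderivation of $J(\mathrm{Der}(\mathcal A)^*)$ that is $D$ on $\mathcal A$ and that acts on $\Pi\,\mathrm{Der}(\mathcal A)^*$ and $\mathrm{Der}(\mathcal A)^{**}$ through the actions induced by $E\mapsto[D,E]$ on $\mathrm{Der}(\mathcal A)$. **Proposition.** There is a character of $U'(\mathfrak h)$ extending $-\mathrm{strad}_{\mathfrak g/\mathfrak h}$ (denoted by the same symbol), and $\mathrm{Der}(\mathcal A)^*$ is a free $\mathcal A$-module with a homogeneous basis of $n$ even and $m$ odd vectors. For every such basis: 1. multiplication by any $a\in\mathcal A$, and $L_{\delta_X}$ for any homogeneous $X\in\mathfrak g$, preserve the cocycles of degree $n$ of $J(\mathrm{Der}(\mathcal A)^*)$ and induce endomorphisms of $\mathrm{Ber}(\mathrm{Der}(\mathcal A)^*)$; the rules $$a\cdot\omega=a\,\omega,\qquad X\cdot\omega=L_{\delta_X}(\omega)\qquad(a\in\mathcal A,\ X\in\mathfrak g \text{ homogeneous})$$ make $\mathrm{Ber}(\mathrm{Der}(\mathcal A)^*)$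 a left $\mathcal A$-module and a $U'(\mathfrak g)$-module; 2. there is a parity-preserving $k$-linear bijection, both $\mathcal A$-linear and $U'(\mathfrak g)$-linear, $$\mathrm{Ber}(\mathrm{Der}(\mathcal A)^*)\;\cong\;\mathrm{Coind}\bigl(\Pi^m k_{-\mathrm{strad}_{\mathfrak g/\mathfrak h}}\bigr).$$ -/

import Mathlib

/-! # Superspaces -/

open scoped TensorProduct

noncomputable section

set_option linter.unusedSectionVars false

namespace SuperLie

/-- The sign `(-1)^i` of a parity `i ∈ ℤ/2`. -/
def sgn (i : ZMod 2) : ℤ := (-1) ^ i.val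

@[simp] theorem sgn_zero : sgn 0 = 1 := rfl
@[simp] theorem sgn_one : sgn 1 = -1 := rfl

theorem sgn_add (i j : ZMod 2) : sgn (i + j) = sgn i * sgn j := by
  revert i j; decide

theorem sgn_mul_self (i : ZMod 2) : sgn i * sgn i = 1 := by
  revert i; decide

theorem zmod_two_cases (i : ZMod 2) : i = 0 ∨ i = 1 := by
  revert i; decide

theorem one_add_one : (1 + 1 : ZMod 2) = 0 := rfl

/-- A superspace over a field `k` of characteristic different from `2`: a vector space with its
parity involution `σ`, which is `1` on even vectors and `-1` on odd vectors. The homogeneous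
components are `part k V 0` and `part k V 1` below; see `isCompl_part`. -/
class Superspace (k V : Type*) [Field k] [AddCommGroup V] [Module k V] where
  σ : V →ₗ[k] V
  σ_σ : ∀ v, σ (σ v) = v

section Superspace

variable (k : Type*) [Field k] {V W : Type*} [AddCommGroup V] [Module k V] [Superspace k V]

/-- The parity involution. -/
def σ : V →ₗ[k] V := Superspace.σ

@[simp] theorem σ_σ (v : V) : σ k (σ k v) = v := Superspace.σ_σ v

/-- `σ^i` for `i ∈ ℤ/2`: it multiplies vectors of parity `j` by `(-1)^(ij)`. -/
def σpow (i : ZMod 2) : V →ₗ[k] V := (σ k) ^ i.val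

@[simp] theorem σpow_zero (v : V) : σpow k 0 v = v := rfl
@[simp] theorem σpow_one (v : V) : σpow k 1 v = σ k v := rfl

variable (V) in
/-- The homogeneous component of parity `i`. -/
def part (i : ZMod 2) : Submodule k V where
  carrier := {v | σ k v = sgn i • v}
  add_mem' := by
    intro a b ha hb
    simp only [Set.mem_ofPred_eq] at *
    rw [map_add, ha, hb, smul_add]
  zero_mem' := by simp
  smul_mem' := by
    intro c a ha
    simp only [Set.mem_ofPred_eq] at *
    rw [map_smul, ha, smul_comm]

variable {k}

theorem mem_part {i : ZMod 2} {v : V} : v ∈ part k V i ↔ σ k v = sgn i • v := Iff.rfl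

theorem mem_part_zero {v : V} : v ∈ part k V 0 ↔ σ k v = v := by simp [mem_part]

theorem mem_part_one {v : V} : v ∈ part k V 1 ↔ σ k v = -v := by simp [mem_part]

theorem σ_mem_part {i : ZMod 2} {v : V} (hv : v ∈ part k V i) : σ k v ∈ part k V i := by
  have h := mem_part.1 hv
  rw [h]
  exact (part k V i).smul_of_tower_mem (sgn i) hv

variable (k)

/-- The projection onto the homogeneous component of parity `i`. -/
def comp (i : ZMod 2) : V →ₗ[k] V := (2 : k)⁻¹ • (LinearMap.id + sgn i • σ k)

theorem comp_apply (i : ZMod 2) (v : V) : comp k i v = (2 : k)⁻¹ • (v + sgn i • σ k v) := rfl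

theorem comp_mem (i : ZMod 2) (v : V) : comp k i v ∈ part k V i := by
  rcases zmod_two_cases i with rfl | rfl
  · rw [mem_part_zero, comp_apply]; simp [add_comm]
  · rw [mem_part_one, comp_apply]; simp [← smul_neg, add_comm]

/-- The projection onto the homogeneous component of parity `i`, with values in it. -/
def compTo (i : ZMod 2) : V →ₗ[k] part k V i := (comp k i).codRestrict _ (comp_mem k i)

theorem comp_of_mem_ne {i j : ZMod 2} {v : V} (hv : v ∈ part k V i) (h : j ≠ i) :
    comp k j v = 0 := by
  rw [comp_apply, mem_part.1 hv, smul_smul]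
  rcases zmod_two_cases i with rfl | rfl <;> rcases zmod_two_cases j with rfl | rfl <;> simp_all

variable [NeZero (2 : k)]

theorem half_add_half (v : V) : (2 : k)⁻¹ • (v + v) = v := by
  rw [← two_smul k, smul_smul, inv_mul_cancel₀ (NeZero.ne (2 : k)), one_smul]

theorem comp_add_comp (v : V) : comp k 0 v + comp k 1 v = v := by
  rw [comp_apply, comp_apply, ← smul_add]
  simp only [sgn_zero, sgn_one, one_smul, neg_smul]
  rw [show v + σ k v + (v + -σ k v) = v + v by abel]
  exact half_add_half k v

theorem comp_of_mem {i : ZMod 2} {v : V} (hv : v ∈ part k V i) : comp k i v = v := by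
  rw [comp_apply, mem_part.1 hv, smul_smul]
  rcases zmod_two_cases i with rfl | rfl <;> simpa using half_add_half k v

variable (V) in
theorem isCompl_part : IsCompl (part k V 0) (part k V 1) := by
  constructor
  · rw [Submodule.disjoint_def]
    intro v h0 h1
    rw [← comp_of_mem k h0]
    exact comp_of_mem_ne k h1 (by decide)
  · rw [codisjoint_iff, eq_top_iff]
    intro v _
    rw [← comp_add_comp k v]
    exact Submodule.add_mem_sup (comp_mem k 0 v) (comp_mem k 1 v)

end Superspace

/-- The field `k`, purely even. -/
instance (k : Type*) [Field k] : Superspace k k where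
  σ := LinearMap.id
  σ_σ _ := rfl

instance {k V W : Type*} [Field k] [AddCommGroup V] [Module k V] [Superspace k V]
    [AddCommGroup W] [Module k W] [Superspace k W] : Superspace k (V × W) where
  σ := (σ k).prodMap (σ k)
  σ_σ v := by ext <;> simp

theorem σ_prod {k V W : Type*} [Field k] [AddCommGroup V] [Module k V] [Superspace k V]
    [AddCommGroup W] [Module k W] [Superspace k W] (v : V × W) :
    σ k v = (σ k v.1, σ k v.2) := rfl

/-! # Superalgebras and supermodules -/

/-- An associative unital superalgebra. -/
class Superalgebra (k A : Type*) [Field k] [Ring A] [Algebra k A] extends Superspace k A where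
  σ_mul : ∀ a b, σ (a * b) = σ a * σ b

/-- A supercommutative superalgebra. -/
class SuperCommutative (k A : Type*) [Field k] [Ring A] [Algebra k A] [Superalgebra k A] :
    Prop where
  super_comm : ∀ {i j : ZMod 2} {a b : A}, a ∈ part k A i → b ∈ part k A j →
    a * b = sgn (i * j) • (b * a)

/-- A (left) supermodule over a superalgebra. -/
class Supermodule (k A M : Type*) [Field k] [Ring A] [Algebra k A] [Superalgebra k A]
    [AddCommGroup M] [Module k M] [Superspace k M] [Module A M] : Prop
    extends IsScalarTower k A M where
  σ_smul : ∀ (a : A) (m : M), σ k (a • m) = σ k a • σ k m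

section Superalgebra

variable (k : Type*) [Field k] {A : Type*} [Ring A] [Algebra k A] [Superalgebra k A]

@[simp] theorem σ_mul (a b : A) : σ k (a * b) = σ k a * σ k b := Superalgebra.σ_mul a b

@[simp] theorem σ_one : σ k (1 : A) = 1 := by
  have h := σ_mul k (σ k (1 : A)) 1
  rw [mul_one, σ_σ, one_mul] at h
  exact h.symm

theorem one_mem_part : (1 : A) ∈ part k A 0 := by rw [mem_part_zero, σ_one]

variable {k} in
theorem mul_mem_part {i j : ZMod 2} {a b : A} (ha : a ∈ part k A i) (hb : b ∈ part k A j) :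
    a * b ∈ part k A (i + j) := by
  rw [mem_part] at *
  rw [σ_mul, ha, hb]
  rcases zmod_two_cases i with rfl | rfl <;> rcases zmod_two_cases j with rfl | rfl <;>
    simp [one_add_one]

/-- The parity involution as an algebra automorphism. -/
def σAlg : A →ₐ[k] A := AlgHom.ofLinearMap (σ k) (σ_one k) (σ_mul k)

/-- `σ^i` as an algebra endomorphism. -/
def σpowAlg (i : ZMod 2) : A →ₐ[k] A := σAlg k ^ i.val

theorem σpowAlg_apply (i : ZMod 2) (a : A) : σpowAlg k i a = σpow k i a := by
  rcases zmod_two_cases i with rfl | rfl <;> rfl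

/-- The grading of a superalgebra by `ℤ/2`, in the form of Mathlib's graded algebras. -/
instance gradedAlgebra [NeZero (2 : k)] : GradedAlgebra (part k A) where
  one_mem := one_mem_part k
  mul_mem _ _ _ _ ha hb := mul_mem_part ha hb
  decompose' a := DirectSum.of (fun i => part k A i) 0 (compTo k 0 a) +
    DirectSum.of (fun i => part k A i) 1 (compTo k 1 a)
  left_inv a := by
    rw [map_add, DirectSum.coeAddMonoidHom_of, DirectSum.coeAddMonoidHom_of]
    exact comp_add_comp k a
  right_inv x := by
    induction x using DirectSum.induction_on with
    | zero => simp
    | of i a =>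
      rw [DirectSum.coeAddMonoidHom_of]
      obtain ⟨a, ha⟩ := a
      rcases zmod_two_cases i with rfl | rfl
      · have h1 : compTo k 0 a = ⟨a, ha⟩ :=
          Subtype.ext (comp_of_mem k ha)
        have h2 : compTo k 1 a = 0 :=
          Subtype.ext (comp_of_mem_ne k ha (by decide))
        simp only [h1, h2, map_zero, add_zero]
      · have h1 : compTo k 1 a = ⟨a, ha⟩ :=
          Subtype.ext (comp_of_mem k ha)
        have h2 : compTo k 0 a = 0 :=
          Subtype.ext (comp_of_mem_ne k ha (by decide))
        simp only [h1, h2, map_zero, zero_add]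
    | add x y hx hy =>
      nth_rewrite 2 [← hx, ← hy]
      simp only [map_add]
      abel

end Superalgebra

/-- `Π^m V`: the space `V` with the parity changed `m` times. -/
@[nolint unusedArguments]
def ParityShift (_k : Type*) (_m : ℕ) (V : Type*) : Type _ := V

section ParityShift

variable (k : Type*) [Field k] (m : ℕ) (V : Type*) [AddCommGroup V] [Module k V]

instance : AddCommGroup (ParityShift k m V) := inferInstanceAs (AddCommGroup V)
instance : Module k (ParityShift k m V) := inferInstanceAs (Module k V)

/-- The canonical map `π^m : V → Π^m V`, which is the identity on underlying spaces. -/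
def ParityShift.mk : V ≃ₗ[k] ParityShift k m V := LinearEquiv.refl k V

variable [Superspace k V]

instance : Superspace k (ParityShift k m V) where
  σ := (sgn m) • (ParityShift.mk k m V).toLinearMap ∘ₗ σ k ∘ₗ (ParityShift.mk k m V).symm.toLinearMap
  σ_σ v := by
    rcases zmod_two_cases (m : ZMod 2) with h | h <;> rw [h] <;> simp

end ParityShift


/-! # Restricted Lie superalgebras -/

/-- A Lie superalgebra over `k` (of characteristic different from `2`). The last axiom follows from
the others unless the characteristic is `3`. -/
class LieSuperalgebra (k g : Type*) [Field k] [AddCommGroup g] [Module k g]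
    extends Superspace k g where
  bracket : g →ₗ[k] g →ₗ[k] g
  σ_bracket : ∀ x y, σ (bracket x y) = bracket (σ x) (σ y)
  skew : ∀ {i j : ZMod 2} {x y : g}, x ∈ part k g i → y ∈ part k g j →
    bracket x y = -(sgn (i * j) • bracket y x)
  jacobi : ∀ {i j : ZMod 2} {x y : g} (z : g), x ∈ part k g i → y ∈ part k g j →
    bracket x (bracket y z) = bracket (bracket x y) z + sgn (i * j) • bracket y (bracket x z)
  odd_cube : ∀ {x : g}, x ∈ part k g 1 → bracket x (bracket x x) = 0

/-- The bracket of a Lie superalgebra. -/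
def br (k : Type*) {g : Type*} [Field k] [AddCommGroup g] [Module k g] [LieSuperalgebra k g] :
    g →ₗ[k] g →ₗ[k] g := LieSuperalgebra.bracket

section Lie

variable (p : ℕ) (k : Type*) {g : Type*} [Field k] [AddCommGroup g] [Module k g]
  [LieSuperalgebra k g]

theorem σ_br (x y : g) : σ k (br k x y) = br k (σ k x) (σ k y) := LieSuperalgebra.σ_bracket x y

/-- `jacobsonCoeff k x y r j` is the coefficient of `t^j` in `ad(t x + y)^r (x)`. -/
def jacobsonCoeff (x y : g) : ℕ → ℕ → g
  | 0, 0 => x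
  | 0, _ + 1 => 0
  | r + 1, 0 => br k y (jacobsonCoeff x y r 0)
  | r + 1, j + 1 => br k x (jacobsonCoeff x y r j) + br k y (jacobsonCoeff x y r (j + 1))

/-- The sum `s_1(x, y) + ... + s_{p-1}(x, y)`, where `i s_i(x, y)` is the coefficient of
`t^(i-1)` in `ad(t x + y)^(p-1) (x)`. -/
def jacobsonSum (x y : g) : g :=
  ∑ j ∈ Finset.range (p - 1), ((j + 1 : ℕ) : k)⁻¹ • jacobsonCoeff k x y (p - 1) j

variable (g) in
/-- A restricted structure on a Lie superalgebra: a `p`-operation on the even part that makes it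
a restricted Lie algebra and for which the action of the even part on the whole (hence also on the
odd part) is restricted. -/
class Restricted where
  pmap : part k g 0 → part k g 0
  pmap_smul : ∀ (c : k) (x : part k g 0), pmap (c • x) = c ^ p • pmap x
  pmap_add : ∀ x y : part k g 0,
    (pmap (x + y) : g) = pmap x + pmap y + jacobsonSum p k (x : g) (y : g)
  bracket_pmap : ∀ x : part k g 0, br k (pmap x : g) = (br k (x : g)) ^ p

variable (g) [Restricted p k g]

/-- The defining relations of the restricted enveloping superalgebra. -/
inductive EnvRel : TensorAlgebra k g → TensorAlgebra k g → Prop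
  | comm {i j : ZMod 2} {x y : g} (hx : x ∈ part k g i) (hy : y ∈ part k g j) :
      EnvRel (TensorAlgebra.ι k x * TensorAlgebra.ι k y)
        (sgn (i * j) • (TensorAlgebra.ι k y * TensorAlgebra.ι k x) + TensorAlgebra.ι k (br k x y))
  | pow (x : part k g 0) :
      EnvRel (TensorAlgebra.ι k (x : g) ^ p)
        (TensorAlgebra.ι k ((Restricted.pmap p x : part k g 0) : g))

/-- The restricted enveloping superalgebra `U'(g)`. -/
def Env : Type _ := RingQuot (EnvRel p k g)

instance : Ring (Env p k g) := inferInstanceAs (Ring (RingQuot (EnvRel p k g)))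
instance : Algebra k (Env p k g) := inferInstanceAs (Algebra k (RingQuot (EnvRel p k g)))

namespace Env

/-- The quotient map from the tensor algebra. -/
def quot : TensorAlgebra k g →ₐ[k] Env p k g := RingQuot.mkAlgHom k (EnvRel p k g)

theorem quot_surjective : Function.Surjective (quot p k g) := RingQuot.mkAlgHom_surjective k _

/-- The canonical map `g → U'(g)`. -/
def ι : g →ₗ[k] Env p k g := (quot p k g).toLinearMap ∘ₗ TensorAlgebra.ι k

variable {g}

theorem ι_mul_ι {i j : ZMod 2} {x y : g} (hx : x ∈ part k g i) (hy : y ∈ part k g j) :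
    ι p k g x * ι p k g y = sgn (i * j) • (ι p k g y * ι p k g x) + ι p k g (br k x y) := by
  have h : quot p k g _ = quot p k g _ := RingQuot.mkAlgHom_rel k (EnvRel.comm (p := p) hx hy)
  rwa [map_mul, map_add, map_zsmul, map_mul] at h

theorem ι_pow (x : part k g 0) :
    ι p k g (x : g) ^ p = ι p k g ((Restricted.pmap p x : part k g 0) : g) := by
  have h : quot p k g _ = quot p k g _ := RingQuot.mkAlgHom_rel k (EnvRel.pow (p := p) x)
  rwa [map_pow] at h

variable {p k} in
/-- The universal property of `U'(g)`. -/
def lift {B : Type*} [Ring B] [Algebra k B] (f : g →ₗ[k] B)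
    (h₁ : ∀ {i j : ZMod 2} {x y : g}, x ∈ part k g i → y ∈ part k g j →
      f x * f y = sgn (i * j) • (f y * f x) + f (br k x y))
    (h₂ : ∀ x : part k g 0, f (x : g) ^ p = f ((Restricted.pmap p x : part k g 0) : g)) :
    Env p k g →ₐ[k] B :=
  RingQuot.liftAlgHom k ⟨TensorAlgebra.lift k f, by
    intro _ _ h
    induction h with
    | comm hx hy =>
      simpa only [map_mul, map_add, map_zsmul, TensorAlgebra.lift_ι_apply] using h₁ hx hy
    | pow x => simpa only [map_pow, TensorAlgebra.lift_ι_apply] using h₂ x⟩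

@[simp] theorem lift_ι {B : Type*} [Ring B] [Algebra k B] (f : g →ₗ[k] B) (h₁) (h₂) (x : g) :
    lift (p := p) f h₁ h₂ (ι p k g x) = f x := by
  unfold lift ι quot
  simp only [LinearMap.comp_apply]
  exact (RingQuot.liftAlgHom_mkAlgHom_apply k _ _ _).trans (TensorAlgebra.lift_ι_apply f x)

theorem hom_ext {B : Type*} [Ring B] [Algebra k B] {φ ψ : Env p k g →ₐ[k] B}
    (h : ∀ x, φ (ι p k g x) = ψ (ι p k g x)) : φ = ψ := by
  have : φ.comp (quot p k g) = ψ.comp (quot p k g) := by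
    apply TensorAlgebra.hom_ext
    ext x
    exact h x
  ext u
  obtain ⟨t, rfl⟩ := quot_surjective p k g u
  exact DFunLike.congr_fun this t

instance : Superalgebra k (Env p k g) :=
  let s : Env p k g →ₐ[k] Env p k g := lift (ι p k g ∘ₗ σ k)
    (fun {i j x y} hx hy => by
      simp only [LinearMap.comp_apply, σ_br]
      exact ι_mul_ι p k (σ_mem_part hx) (σ_mem_part hy))
    (fun x => by
      simp only [LinearMap.comp_apply, mem_part_zero.1 x.2,
        mem_part_zero.1 (Restricted.pmap p x : part k g 0).2]
      exact ι_pow p k x)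
  { σ := s.toLinearMap
    σ_σ := by
      have : s.comp s = AlgHom.id k _ := by
        apply hom_ext
        intro x
        simp [s]
      intro u
      exact DFunLike.congr_fun this u
    σ_mul := fun a b => map_mul s a b }

@[simp] theorem σ_ι (x : g) : σ k (ι p k g x) = ι p k g (σ k x) := lift_ι p k _ _ _ x

variable {k} in
theorem ι_mem_part {i : ZMod 2} {x : g} (hx : x ∈ part k g i) : ι p k g x ∈ part k _ i := by
  rw [mem_part, σ_ι, mem_part.1 hx, map_zsmul]

/-- A subspace of `U'(g)` that contains `1` and is stable under right multiplication by
homogeneous elements of `g` is everything. -/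
theorem eq_top_of_right [NeZero (2 : k)] (P : Submodule k (Env p k g)) (h1 : 1 ∈ P)
    (hm : ∀ u ∈ P, ∀ (i : ZMod 2) (x : g), x ∈ part k g i → u * ι p k g x ∈ P) (u) : u ∈ P := by
  suffices h : ∀ t : TensorAlgebra k g, ∀ v ∈ P, v * quot p k g t ∈ P by
    obtain ⟨t, rfl⟩ := quot_surjective p k g u
    simpa using h t 1 h1
  intro t
  induction t using TensorAlgebra.induction with
  | algebraMap r =>
    intro v hv
    rw [AlgHom.commutes, ← Algebra.commutes, ← Algebra.smul_def]
    exact P.smul_mem r hv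
  | ι x =>
    intro v hv
    rw [← comp_add_comp k x, map_add, map_add, mul_add]
    exact P.add_mem (hm v hv 0 _ (comp_mem k 0 x)) (hm v hv 1 _ (comp_mem k 1 x))
  | mul a b ha hb =>
    intro v hv
    rw [map_mul, ← mul_assoc]
    exact hb _ (ha v hv)
  | add a b ha hb =>
    intro v hv
    rw [map_add, mul_add]
    exact P.add_mem (ha v hv) (hb v hv)

variable (g) in
/-- The counit of `U'(g)`, that is, the trivial character. -/
def counit [Fact p.Prime] : Env p k g →ₐ[k] k :=
  lift 0 (by simp) (by simp [(Fact.out : p.Prime).ne_zero])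

@[simp] theorem counit_ι [Fact p.Prime] (x : g) : counit p k g (ι p k g x) = 0 :=
  lift_ι p k _ _ _ x

section Coproduct

open GradedTensorProduct

variable [NeZero (2 : k)]

variable (g) in
/-- The tensor product of superalgebras `U'(g) ⊗ U'(g)`, with
`(a ⊗ b)(c ⊗ d) = (-1)^(|b||c|) ac ⊗ bd`. -/
abbrev Sq : Type _ := part k (Env p k g) ᵍ⊗[k] part k (Env p k g)

variable {p k} in
theorem tmul_mul_tmul {i j : ZMod 2} (a : Env p k g) {b c : Env p k g} (d : Env p k g)
    (hb : b ∈ part k _ j) (hc : c ∈ part k _ i) :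
    (tmul k a b * tmul k c d : Sq p k g) = sgn (j * i) • tmul k (a * c) (b * d) := by
  have h := tmul_coe_mul_coe_tmul (R := k) (part k (Env p k g)) (part k (Env p k g)) a
    (⟨b, hb⟩ : part k (Env p k g) j) (⟨c, hc⟩ : part k (Env p k g) i) d
  refine h.trans ?_
  rcases zmod_two_cases i with rfl | rfl <;> rcases zmod_two_cases j with rfl | rfl <;>
    simp [uzpow_one]

theorem sq_add_left (a b c : Env p k g) :
    (tmul k (a + b) c : Sq p k g) = tmul k a c + tmul k b c :=
  TensorProduct.add_tmul a b c

theorem sq_add_right (a b c : Env p k g) :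
    (tmul k a (b + c) : Sq p k g) = tmul k a b + tmul k a c :=
  TensorProduct.tmul_add a b c

theorem sq_zsmul_left (r : ℤ) (a b : Env p k g) :
    (tmul k (r • a) b : Sq p k g) = r • tmul k a b := by
  rw [← Int.cast_smul_eq_zsmul k, ← Int.cast_smul_eq_zsmul k]
  exact TensorProduct.smul_tmul' _ a b

theorem sq_zsmul_right (r : ℤ) (a b : Env p k g) :
    (tmul k a (r • b) : Sq p k g) = r • tmul k a b := by
  rw [← Int.cast_smul_eq_zsmul k, ← Int.cast_smul_eq_zsmul k]
  exact TensorProduct.tmul_smul _ a b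

variable (g) in
/-- `X ↦ X ⊗ 1 + 1 ⊗ X`. -/
def prim : g →ₗ[k] Sq p k g :=
  (includeLeft (part k (Env p k g)) (part k (Env p k g))).toLinearMap ∘ₗ ι p k g +
    (includeRight (part k (Env p k g)) (part k (Env p k g))).toLinearMap ∘ₗ ι p k g

theorem prim_apply (x : g) :
    prim p k g x = tmul k (ι p k g x) 1 + tmul k 1 (ι p k g x) := rfl

variable (g) in
/-- The coproduct of `U'(g)`, for which the elements of `g` are primitive. -/
def coproduct [Fact p.Prime] [CharP k p] : Env p k g →ₐ[k] Sq p k g :=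
  lift (prim p k g)
    (fun {i j x y} hx hy => by
      have h1 := one_mem_part k (A := Env p k g)
      have hx' := ι_mem_part p hx
      have hy' := ι_mem_part p hy
      simp only [prim_apply, add_mul, mul_add]
      rw [tmul_mul_tmul _ _ h1 hy', tmul_mul_tmul _ _ h1 h1, tmul_mul_tmul _ _ hx' hy',
        tmul_mul_tmul _ _ hx' h1, tmul_mul_tmul _ _ h1 hx', tmul_mul_tmul _ _ h1 h1,
        tmul_mul_tmul _ _ hy' hx', tmul_mul_tmul _ _ hy' h1]
      simp only [mul_one, one_mul, ι_mul_ι p k hx hy]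
      simp only [sq_add_left, sq_add_right, sq_zsmul_left, sq_zsmul_right]
      rcases zmod_two_cases i with rfl | rfl <;> rcases zmod_two_cases j with rfl | rfl <;>
        simp <;> abel)
    (fun x => by
      have h1 := one_mem_part k (A := Env p k g)
      have hx' := ι_mem_part p x.2
      have hc : Commute (tmul k (ι p k g (x : g)) 1 : Sq p k g) (tmul k 1 (ι p k g (x : g))) := by
        unfold Commute SemiconjBy
        rw [tmul_mul_tmul _ _ h1 h1, tmul_mul_tmul _ _ hx' hx']
        simp
      have hp : (tmul k (ι p k g (x : g)) 1 + tmul k 1 (ι p k g (x : g)) : Sq p k g) ^ p =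
          (tmul k (ι p k g (x : g)) 1 : Sq p k g) ^ p + (tmul k 1 (ι p k g (x : g))) ^ p := by
        rcases subsingleton_or_nontrivial (Sq p k g) with _ | _
        · exact Subsingleton.elim _ _
        · have : CharP (Sq p k g) p := charP_of_injective_algebraMap' k p
          exact add_pow_char_of_commute _ hc
      have hl := map_pow (includeLeft (part k (Env p k g)) (part k (Env p k g)))
        (ι p k g (x : g)) p
      have hr := map_pow (includeRight (part k (Env p k g)) (part k (Env p k g)))
        (ι p k g (x : g)) p
      rw [ι_pow] at hl hr
      rw [prim_apply, prim_apply, hp]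
      exact congrArg₂ (· + ·) hl.symm hr.symm)

@[simp] theorem coproduct_ι [Fact p.Prime] [CharP k p] (x : g) :
    coproduct p k g (ι p k g x) = tmul k (ι p k g x) 1 + tmul k 1 (ι p k g x) :=
  lift_ι p k _ _ _ x

end Coproduct

end Env

end Lie

/-! # Restricted subsuperalgebras -/

/-- A restricted Lie subsuperalgebra: a graded subspace stable under the bracket and the
`p`-operation. -/
structure RestrictedSub (p : ℕ) (k g : Type*) [Field k] [AddCommGroup g] [Module k g]
    [LieSuperalgebra k g] [Restricted p k g] where
  carrier : Submodule k g
  σ_mem : ∀ x ∈ carrier, σ k x ∈ carrier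
  br_mem : ∀ x ∈ carrier, ∀ y ∈ carrier, br k x y ∈ carrier
  pmap_mem : ∀ x : part k g 0, (x : g) ∈ carrier →
    ((Restricted.pmap p x : part k g 0) : g) ∈ carrier

section Sub

variable {p : ℕ} {k g : Type*} [Field k] [AddCommGroup g] [Module k g]
  [LieSuperalgebra k g] [Restricted p k g] (h : RestrictedSub p k g)

namespace RestrictedSub

instance : Superspace k h.carrier where
  σ := (σ k).restrict h.σ_mem
  σ_σ x := Subtype.ext (σ_σ k (x : g))

theorem coe_σ (x : h.carrier) : ((σ k x : h.carrier) : g) = σ k (x : g) := rfl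

theorem coe_mem_part {i : ZMod 2} {x : h.carrier} :
    (x : g) ∈ part k g i ↔ x ∈ part k h.carrier i := by
  rw [mem_part, mem_part, ← coe_σ, Subtype.ext_iff]
  rfl

instance : LieSuperalgebra k h.carrier where
  bracket := LinearMap.mk₂ k (fun x y => ⟨br k (x : g) y, h.br_mem x x.2 y y.2⟩)
    (fun x x' y => Subtype.ext (by simp)) (fun c x y => Subtype.ext (by simp))
    (fun x y y' => Subtype.ext (by simp)) (fun c x y => Subtype.ext (by simp))
  σ_bracket x y := Subtype.ext (σ_br k (x : g) y)
  skew hx hy := Subtype.ext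
    (LieSuperalgebra.skew (h.coe_mem_part.2 hx) (h.coe_mem_part.2 hy))
  jacobi z hx hy := Subtype.ext
    (LieSuperalgebra.jacobi (z : g) (h.coe_mem_part.2 hx) (h.coe_mem_part.2 hy))
  odd_cube hx := Subtype.ext (LieSuperalgebra.odd_cube (h.coe_mem_part.2 hx))

theorem coe_br (x y : h.carrier) : ((br k x y : h.carrier) : g) = br k (x : g) (y : g) := rfl

theorem coe_jacobsonCoeff (x y : h.carrier) (r j : ℕ) :
    ((jacobsonCoeff k x y r j : h.carrier) : g) = jacobsonCoeff k (x : g) (y : g) r j := by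
  induction r generalizing j with
  | zero => cases j <;> simp [jacobsonCoeff]
  | succ r ih => cases j <;> simp [jacobsonCoeff, coe_br, ih]

theorem coe_jacobsonSum (x y : h.carrier) :
    ((jacobsonSum p k x y : h.carrier) : g) = jacobsonSum p k (x : g) (y : g) := by
  simp [jacobsonSum, coe_jacobsonCoeff]

theorem coe_br_pow (x y : h.carrier) (r : ℕ) :
    ((((br k x) ^ r) y : h.carrier) : g) = ((br k (x : g)) ^ r) (y : g) := by
  induction r generalizing y with
  | zero => simp
  | succ r ih => simp [pow_succ, ih, coe_br]

/-- An even element of the subalgebra as an even element of the algebra. -/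
def evenCoe : part k h.carrier 0 →ₗ[k] part k g 0 :=
  (h.carrier.subtype ∘ₗ (part k h.carrier 0).subtype).codRestrict _
    (fun x => h.coe_mem_part.2 x.2)

instance : Restricted p k h.carrier where
  pmap x := ⟨⟨(Restricted.pmap p (h.evenCoe x) : part k g 0), h.pmap_mem _ x.1.2⟩,
    h.coe_mem_part.1 (Restricted.pmap p (h.evenCoe x)).2⟩
  pmap_smul c x := Subtype.ext <| Subtype.ext <| by
    have := congrArg Subtype.val (Restricted.pmap_smul c (h.evenCoe x) (p := p))
    rw [← map_smul] at this
    exact this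
  pmap_add x y := Subtype.ext <| by
    have := Restricted.pmap_add (p := p) (h.evenCoe x) (h.evenCoe y)
    rw [← map_add] at this
    refine this.trans ?_
    simp only [Submodule.coe_add, coe_jacobsonSum]
    rfl
  bracket_pmap x := by
    ext y
    rw [coe_br_pow]
    exact LinearMap.congr_fun (Restricted.bracket_pmap (p := p) (h.evenCoe x)) (y : g)

theorem coe_pmap (x : part k h.carrier 0) :
    (((Restricted.pmap p x : part k h.carrier 0) : h.carrier) : g) =
      (Restricted.pmap p (h.evenCoe x) : part k g 0) := rfl

/-- The canonical morphism `U'(h) → U'(g)`. -/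
def incl : Env p k h.carrier →ₐ[k] Env p k g :=
  Env.lift (Env.ι p k g ∘ₗ h.carrier.subtype)
    (fun hx hy => Env.ι_mul_ι p k (h.coe_mem_part.2 hx) (h.coe_mem_part.2 hy))
    (fun x => Env.ι_pow p k (h.evenCoe x))

@[simp] theorem incl_ι (x : h.carrier) : h.incl (Env.ι p k h.carrier x) = Env.ι p k g (x : g) :=
  Env.lift_ι p k _ _ _ x

/-- The action `ad` of `h` on `g/h`. -/
def adQuot (x : h.carrier) : Module.End k (g ⧸ h.carrier) :=
  h.carrier.mapQ h.carrier (br k (x : g)) (fun y hy => h.br_mem x x.2 y hy)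

instance : Superspace k (g ⧸ h.carrier) where
  σ := h.carrier.mapQ h.carrier (σ k) h.σ_mem
  σ_σ v := by
    obtain ⟨x, rfl⟩ := h.carrier.mkQ_surjective v
    simp

/-- The even dimension of `g/h`. -/
def evenDim : ℕ := Module.finrank k (part k (g ⧸ h.carrier) 0)

/-- The odd dimension of `g/h`. -/
def oddDim : ℕ := Module.finrank k (part k (g ⧸ h.carrier) 1)

end RestrictedSub

/-- The supertrace of an endomorphism `T` of a superspace: the trace of the even-even block of `T`
minus the trace of its odd-odd block. -/
def supertrace (k : Type*) {V : Type*} [Field k] [AddCommGroup V] [Module k V] [Superspace k V] :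
    Module.End k V →ₗ[k] k := LinearMap.trace k V ∘ₗ LinearMap.mulLeft k (σ k : Module.End k V)

/-- `strad_{g/h}(H)`, the supertrace of `ad H` on `g/h`. -/
def RestrictedSub.strad (x : h.carrier) : k := supertrace k (h.adQuot x)

/-! # Coinduced representations -/

/-- The representation on `k` given by a character. -/
def charRep {B : Type*} [Ring B] [Algebra k B] (χ : B →ₐ[k] k) : B →ₐ[k] Module.End k k :=
  (Algebra.lmul k k).comp χ

/-- The representation on `Π^m V` given by one on `V`: `X · π^m v = (-1)^(m|X|) π^m (X · v)`. -/
def ParityShift.rep {B : Type*} [Ring B] [Algebra k B] [Superalgebra k B] (m : ℕ) {V : Type*}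
    [AddCommGroup V] [Module k V] (ρ : B →ₐ[k] Module.End k V) :
    B →ₐ[k] Module.End k (ParityShift k m V) :=
  ((ParityShift.mk k m V).conjAlgEquiv k).toAlgHom.comp (ρ.comp (σpowAlg k (m : ZMod 2)))

section Coind

variable {V : Type*} [AddCommGroup V] [Module k V]

/-- `Coind(V) = Hom_{U'(h)}(U'(g), V)`. The value at `u` of the function written here `f` is the
left pairing `⟨u, f⟩` of `u` and `f`. -/
def Coind (ρ : Env p k h.carrier →ₐ[k] Module.End k V) : Submodule k (Env p k g →ₗ[k] V) where
  carrier := {f | ∀ w u, f (h.incl w * u) = ρ w (f u)}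
  add_mem' hf hf' w u := by
    rw [LinearMap.add_apply, LinearMap.add_apply, hf w u, hf' w u, map_add]
  zero_mem' w u := by simp
  smul_mem' c f hf w u := by
    rw [LinearMap.smul_apply, LinearMap.smul_apply, hf w u, map_smul]

variable (ρ : Env p k h.carrier →ₐ[k] Module.End k V)

/-- The action of `U'(g)` on `Coind(V)` by the transpose of right multiplication:
`⟨v, u · f⟩ = ⟨v u, f⟩`. -/
def coindAct : Env p k g →ₐ[k] Module.End k (Coind h ρ) :=
  AlgHom.ofLinearMap
    (LinearMap.mk₂ k
      (fun u f => ⟨(f : Env p k g →ₗ[k] V) ∘ₗ LinearMap.mulRight k u, fun w v => by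
        simp only [LinearMap.comp_apply, LinearMap.mulRight_apply, mul_assoc]
        exact f.2 w (v * u)⟩)
      (fun u u' f => Subtype.ext <| LinearMap.ext fun v => by simp [mul_add])
      (fun c u f => Subtype.ext <| LinearMap.ext fun v => by simp)
      (fun u f f' => Subtype.ext <| LinearMap.ext fun v => by simp)
      (fun c u f => Subtype.ext <| LinearMap.ext fun v => by simp))
    (by
      ext f v
      simp)
    (fun u u' => by
      ext f v
      simp [mul_assoc])

@[simp] theorem coindAct_apply (u v : Env p k g) (f : Coind h ρ) :
    (coindAct h ρ u f : Env p k g →ₗ[k] V) v = (f : Env p k g →ₗ[k] V) (v * u) := rfl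

/-- The functions of parity `i` in `Coind(V)`. -/
def coindPart [Superspace k V] (i : ZMod 2) : Submodule k (Coind h ρ) where
  carrier := {f | ∀ (j : ZMod 2), ∀ u ∈ part k (Env p k g) j,
    (f : Env p k g →ₗ[k] V) u ∈ part k V (i + j)}
  add_mem' hf hf' j u hu := Submodule.add_mem _ (hf j u hu) (hf' j u hu)
  zero_mem' _ _ _ := Submodule.zero_mem _
  smul_mem' c _ hf j u hu := Submodule.smul_mem _ c (hf j u hu)

end Coind

/-! # Products of functions -/

section Conv

open GradedTensorProduct

variable [NeZero (2 : k)] {V : Type*} [AddCommGroup V] [Module k V]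

/-- The pairing `⟨u₁ ⊗ u₂, a ⊗ f⟩ = (-1)^(|a||u₂|) ⟨u₁, a⟩ ⟨u₂, f⟩`. Note that
`a ∘ σ = (-1)^|a| a`. -/
def pairing (a : Env p k g →ₗ[k] k) (f : Env p k g →ₗ[k] V) : Env.Sq p k g →ₗ[k] V :=
  ((TensorProduct.lid k V).toLinearMap ∘ₗ TensorProduct.map a (f ∘ₗ comp k 0) +
    (TensorProduct.lid k V).toLinearMap ∘ₗ TensorProduct.map (a ∘ₗ σ k) (f ∘ₗ comp k 1)) ∘ₗ
  (GradedTensorProduct.of k (part k (Env p k g)) (part k (Env p k g))).symm.toLinearMap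

theorem pairing_tmul (a : Env p k g →ₗ[k] k) (f : Env p k g →ₗ[k] V) {j : ZMod 2}
    (u : Env p k g) {v : Env p k g} (hv : v ∈ part k (Env p k g) j) :
    pairing a f (tmul k u v) = a (σpow k j u) • f v := by
  have h0 : pairing a f (tmul k u v) =
      a u • f (comp k 0 v) + a (σ k u) • f (comp k 1 v) := rfl
  rw [h0]
  rcases zmod_two_cases j with rfl | rfl
  · rw [comp_of_mem k hv, comp_of_mem_ne k hv (by decide)]; simp
  · rw [comp_of_mem k hv, comp_of_mem_ne k hv (by decide)]; simp

/-- Induction on tensors that are homogeneous in both factors. -/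
theorem sq_induction {C : Env.Sq p k g → Prop}
    (ht : ∀ (i j : ZMod 2) (u v : Env p k g), u ∈ part k (Env p k g) i →
      v ∈ part k (Env p k g) j → C (tmul k u v))
    (ha : ∀ s t, C s → C t → C (s + t)) (h0 : C 0) (t : Env.Sq p k g) : C t := by
  induction t using TensorProduct.induction_on with
  | zero => exact h0
  | tmul u v =>
    have : (tmul k u v : Env.Sq p k g) = (tmul k (comp k 0 u) (comp k 0 v) +
        tmul k (comp k 0 u) (comp k 1 v)) + (tmul k (comp k 1 u) (comp k 0 v) +
        tmul k (comp k 1 u) (comp k 1 v)) := by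
      rw [← Env.sq_add_right, ← Env.sq_add_right, ← Env.sq_add_left, comp_add_comp, comp_add_comp]
    change C (tmul k u v)
    rw [this]
    exact ha _ _ (ha _ _ (ht _ _ _ _ (comp_mem k 0 u) (comp_mem k 0 v))
      (ht _ _ _ _ (comp_mem k 0 u) (comp_mem k 1 v)))
      (ha _ _ (ht _ _ _ _ (comp_mem k 1 u) (comp_mem k 0 v))
      (ht _ _ _ _ (comp_mem k 1 u) (comp_mem k 1 v)))
  | add s t hs ht => exact ha s t hs ht

theorem pairing_right (a : Env p k g →ₗ[k] k) (f : Env p k g →ₗ[k] V) {i : ZMod 2}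
    {x : Env p k g} (hx : x ∈ part k (Env p k g) i) (t : Env.Sq p k g) :
    pairing a f (t * (tmul k x 1 + tmul k 1 x)) =
      pairing (a ∘ₗ LinearMap.mulRight k x) f t +
        pairing (a ∘ₗ σpow k i) (f ∘ₗ LinearMap.mulRight k x) t := by
  induction t using sq_induction with
  | h0 => simp
  | ha s t hs ht => rw [add_mul, map_add, hs, ht, map_add, map_add]; abel
  | ht l j u v hu hv =>
    have h1 := one_mem_part k (A := Env p k g)
    rw [mul_add, map_add, Env.tmul_mul_tmul _ _ hv hx, Env.tmul_mul_tmul _ _ hv h1, mul_one,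
      mul_one, mul_zero, sgn_zero, one_smul, pairing_tmul _ _ _ (mul_mem_part hv hx),
      pairing_tmul _ _ _ hv, pairing_tmul _ _ _ hv, map_zsmul, pairing_tmul _ _ _ hv]
    rcases zmod_two_cases i with rfl | rfl <;> rcases zmod_two_cases j with rfl | rfl <;>
      simp [one_add_one, mem_part.1 hx]

theorem pairing_left (a : Env p k g →ₗ[k] k) (f : Env p k g →ₗ[k] V) {i : ZMod 2}
    {x : Env p k g} (hx : x ∈ part k (Env p k g) i) (ha : ∀ u, a (x * u) = 0)
    (T : Module.End k V) (hf : ∀ u, f (x * u) = T (f u)) (t : Env.Sq p k g) :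
    pairing a f ((tmul k x 1 + tmul k 1 x) * t) = T (pairing a f t) := by
  induction t using sq_induction with
  | h0 => simp
  | ha s t hs ht => rw [mul_add, map_add, hs, ht, map_add, map_add]
  | ht l j u v hu hv =>
    have h1 := one_mem_part k (A := Env p k g)
    rw [add_mul, map_add, Env.tmul_mul_tmul _ _ h1 hu, Env.tmul_mul_tmul _ _ hx hu, one_mul,
      one_mul, zero_mul, sgn_zero, one_smul, map_zsmul, pairing_tmul _ _ _ (mul_mem_part hx hv),
      pairing_tmul _ _ _ hv, pairing_tmul _ _ _ hv, hf, map_smul]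
    have hz : a (σpow k j (x * u)) = 0 := by
      rcases zmod_two_cases j with rfl | rfl
      · simpa using ha u
      · rw [σpow_one, σ_mul, mem_part.1 hx, smul_mul_assoc, map_zsmul, ha, smul_zero]
    rw [hz, zero_smul, zero_add]
    rcases zmod_two_cases i with rfl | rfl <;> rcases zmod_two_cases j with rfl | rfl <;>
      rcases zmod_two_cases l with rfl | rfl <;>
      simp [one_add_one, mem_part.1 hu]

variable [Fact p.Prime] [CharP k p]

/-- The product of functions: `⟨u, a f⟩ = ∑ (-1)^(|a||u₂|) ⟨u₁, a⟩ ⟨u₂, f⟩`, where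
`∑ u₁ ⊗ u₂` is the coproduct of `u`. -/
def conv (a : Env p k g →ₗ[k] k) (f : Env p k g →ₗ[k] V) : Env p k g →ₗ[k] V :=
  pairing a f ∘ₗ (Env.coproduct p k g).toLinearMap

theorem conv_one (a : Env p k g →ₗ[k] k) (f : Env p k g →ₗ[k] V) :
    conv a f 1 = a 1 • f 1 := by
  have : conv a f 1 = pairing a f (tmul k 1 1) := by
    simp only [conv, LinearMap.comp_apply, AlgHom.toLinearMap_apply, map_one]; rfl
  rw [this, pairing_tmul _ _ _ (one_mem_part k)]
  simp

theorem conv_mul_ι (a : Env p k g →ₗ[k] k) (f : Env p k g →ₗ[k] V) {i : ZMod 2} {x : g}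
    (hx : x ∈ part k g i) (u : Env p k g) :
    conv a f (u * Env.ι p k g x) =
      conv (a ∘ₗ LinearMap.mulRight k (Env.ι p k g x)) f u +
        conv (a ∘ₗ σpow k i) (f ∘ₗ LinearMap.mulRight k (Env.ι p k g x)) u := by
  simp only [conv, LinearMap.comp_apply, AlgHom.toLinearMap_apply, map_mul, Env.coproduct_ι]
  exact pairing_right a f (Env.ι_mem_part p hx) _

theorem conv_ι_mul (a : Env p k g →ₗ[k] k) (f : Env p k g →ₗ[k] V) {i : ZMod 2} {x : g}
    (hx : x ∈ part k g i) (ha : ∀ u, a (Env.ι p k g x * u) = 0)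
    (T : Module.End k V) (hf : ∀ u, f (Env.ι p k g x * u) = T (f u)) (u : Env p k g) :
    conv a f (Env.ι p k g x * u) = T (conv a f u) := by
  simp only [conv, LinearMap.comp_apply, AlgHom.toLinearMap_apply, map_mul, Env.coproduct_ι]
  exact pairing_left a f (Env.ι_mem_part p hx) ha T hf _

theorem conv_add_left (a b : Env p k g →ₗ[k] k) (f : Env p k g →ₗ[k] V) :
    conv (a + b) f = conv a f + conv b f := by
  simp only [conv, pairing, LinearMap.add_comp, TensorProduct.map_add_left, LinearMap.comp_add]
  abel

theorem conv_add_right (a : Env p k g →ₗ[k] k) (f f' : Env p k g →ₗ[k] V) :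
    conv a (f + f') = conv a f + conv a f' := by
  simp only [conv, pairing, LinearMap.add_comp, TensorProduct.map_add_right, LinearMap.comp_add]
  abel

theorem conv_smul_left (c : k) (a : Env p k g →ₗ[k] k) (f : Env p k g →ₗ[k] V) :
    conv (c • a) f = c • conv a f := by
  simp only [conv, pairing, LinearMap.add_comp, TensorProduct.map_smul_left, LinearMap.comp_smul,
    LinearMap.smul_comp, smul_add]

theorem conv_smul_right (c : k) (a : Env p k g →ₗ[k] k) (f : Env p k g →ₗ[k] V) :
    conv a (c • f) = c • conv a f := by
  simp only [conv, pairing, LinearMap.add_comp, TensorProduct.map_smul_right, LinearMap.comp_smul,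
    LinearMap.smul_comp, smul_add]


theorem mulRight_σ {i : ZMod 2} {x : g} (hx : x ∈ part k g i) (f : Env p k g →ₗ[k] V) :
    (f ∘ₗ σ k) ∘ₗ LinearMap.mulRight k (Env.ι p k g x) =
      sgn i • ((f ∘ₗ LinearMap.mulRight k (Env.ι p k g x)) ∘ₗ σ k) := by
  ext u
  simp only [LinearMap.comp_apply, LinearMap.mulRight_apply, LinearMap.smul_apply, σ_mul,
    Env.σ_ι, mem_part.1 hx, map_zsmul, mul_smul_comm]

theorem mulRight_parity {i l : ZMod 2} {x : g} (hx : x ∈ part k g l) {f : Env p k g →ₗ[k] V}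
    (hf : f ∘ₗ σ k = sgn i • f) :
    (f ∘ₗ LinearMap.mulRight k (Env.ι p k g x)) ∘ₗ σ k =
      sgn (i + l) • (f ∘ₗ LinearMap.mulRight k (Env.ι p k g x)) := by
  have h := mulRight_σ hx f
  rw [hf] at h
  ext u
  have hu := LinearMap.congr_fun h u
  simp only [LinearMap.comp_apply, LinearMap.mulRight_apply, LinearMap.smul_apply] at hu ⊢
  rcases zmod_two_cases i with rfl | rfl <;> rcases zmod_two_cases l with rfl | rfl
  · simpa using hu.symm
  · simpa [neg_eq_iff_eq_neg, eq_comm] using hu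
  · simpa using hu.symm
  · simpa [one_add_one] using hu.symm

theorem conv_zsmul_left (c : ℤ) (a : Env p k g →ₗ[k] k) (f : Env p k g →ₗ[k] V) :
    conv (c • a) f = c • conv a f := by
  rw [← Int.cast_smul_eq_zsmul k, ← Int.cast_smul_eq_zsmul k, conv_smul_left]

theorem conv_zsmul_right (c : ℤ) (a : Env p k g →ₗ[k] k) (f : Env p k g →ₗ[k] V) :
    conv a (c • f) = c • conv a f := by
  rw [← Int.cast_smul_eq_zsmul k, ← Int.cast_smul_eq_zsmul k, conv_smul_right]

theorem conv_σ (a : Env p k g →ₗ[k] k) (f : Env p k g →ₗ[k] V) :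
    conv a f ∘ₗ σ k = conv (a ∘ₗ σ k) (f ∘ₗ σ k) := by
  ext u
  revert a f
  refine Env.eq_top_of_right p k
    { carrier := {u | ∀ (a : Env p k g →ₗ[k] k) (f : Env p k g →ₗ[k] V),
        (conv a f ∘ₗ σ k) u = conv (a ∘ₗ σ k) (f ∘ₗ σ k) u}
      add_mem' := fun hs ht a f => by rw [map_add, map_add, hs a f, ht a f]
      zero_mem' := fun a f => by rw [map_zero, map_zero]
      smul_mem' := fun c s hs a f => by rw [map_smul, map_smul, hs a f] } ?_ ?_ u
  · intro a f
    simp [conv_one]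
  · intro u hu i x hx a f
    have e1 := hu (a ∘ₗ LinearMap.mulRight k (Env.ι p k g x)) f
    have e2 := hu (a ∘ₗ σpow k i) (f ∘ₗ LinearMap.mulRight k (Env.ι p k g x))
    rw [LinearMap.comp_apply] at e1 e2
    rw [LinearMap.comp_apply, σ_mul, Env.σ_ι, mem_part.1 hx, map_zsmul, mul_smul_comm, map_zsmul,
      conv_mul_ι _ _ hx, conv_mul_ι _ _ hx, mulRight_σ hx, mulRight_σ hx, conv_zsmul_left,
      conv_zsmul_right, e1, e2, smul_add]
    rcases zmod_two_cases i with rfl | rfl <;> rfl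

theorem conv_σpow (i : ZMod 2) (a : Env p k g →ₗ[k] k) (f : Env p k g →ₗ[k] V) :
    conv a f ∘ₗ σpow k i = conv (a ∘ₗ σpow k i) (f ∘ₗ σpow k i) := by
  rcases zmod_two_cases i with rfl | rfl
  · rfl
  · exact conv_σ a f

theorem conv_mulRight (a : Env p k g →ₗ[k] k) (f : Env p k g →ₗ[k] V) {i : ZMod 2} {x : g}
    (hx : x ∈ part k g i) :
    conv a f ∘ₗ LinearMap.mulRight k (Env.ι p k g x) =
      conv (a ∘ₗ LinearMap.mulRight k (Env.ι p k g x)) f +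
        conv (a ∘ₗ σpow k i) (f ∘ₗ LinearMap.mulRight k (Env.ι p k g x)) :=
  LinearMap.ext fun u => conv_mul_ι a f hx u

theorem conv_assoc (a b : Env p k g →ₗ[k] k) (f : Env p k g →ₗ[k] V) :
    conv (conv a b) f = conv a (conv b f) := by
  ext u
  revert a b f
  refine Env.eq_top_of_right p k
    { carrier := {u | ∀ (a b : Env p k g →ₗ[k] k) (f : Env p k g →ₗ[k] V),
        conv (conv a b) f u = conv a (conv b f) u}
      add_mem' := fun hs ht a b f => by rw [map_add, map_add, hs a b f, ht a b f]
      zero_mem' := fun a b f => by rw [map_zero, map_zero]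
      smul_mem' := fun c s hs a b f => by rw [map_smul, map_smul, hs a b f] } ?_ ?_ u
  · intro a b f
    simp [conv_one, mul_smul]
  · intro u hu i x hx a b f
    rw [conv_mul_ι _ _ hx, conv_mul_ι _ _ hx, conv_mulRight _ _ hx, conv_mulRight _ _ hx,
      conv_σpow, conv_add_left, conv_add_right, LinearMap.add_apply, LinearMap.add_apply,
      hu, hu, hu, add_assoc]

theorem conv_comm {i j : ZMod 2} {a b : Env p k g →ₗ[k] k} (ha : a ∘ₗ σ k = sgn i • a)
    (hb : b ∘ₗ σ k = sgn j • b) : conv a b = sgn (i * j) • conv b a := by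
  ext u
  revert i j a b
  refine Env.eq_top_of_right p k
    { carrier := {u | ∀ {i j : ZMod 2} {a b : Env p k g →ₗ[k] k}, a ∘ₗ σ k = sgn i • a →
        b ∘ₗ σ k = sgn j • b → conv a b u = (sgn (i * j) • conv b a) u}
      add_mem' := fun hs ht i j a b ha hb => by rw [map_add, map_add, hs ha hb, ht ha hb]
      zero_mem' := fun {i j a b} ha hb => by rw [map_zero, map_zero]
      smul_mem' := fun c s hs i j a b ha hb => by rw [map_smul, map_smul, hs ha hb] } ?_ ?_ u
  · intro i j a b ha hb
    have h1 := LinearMap.congr_fun ha 1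
    have h2 := LinearMap.congr_fun hb 1
    simp only [LinearMap.comp_apply, σ_one, LinearMap.smul_apply] at h1 h2
    rw [LinearMap.smul_apply, conv_one, conv_one, smul_eq_mul, smul_eq_mul, mul_comm]
    rcases zmod_two_cases i with rfl | rfl <;> rcases zmod_two_cases j with rfl | rfl
    · simp
    · simp
    · simp
    · have h3 : (2 : k) * a 1 = 0 := by
        simp only [sgn_one, neg_smul, one_smul] at h1
        rw [two_mul]; nth_rewrite 1 [h1]; simp
      have h4 : a 1 = 0 := (mul_eq_zero.1 h3).resolve_left (NeZero.ne _)
      simp [h4]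
  · intro u hu l x hx i j a b ha hb
    have ha' : (a ∘ₗ LinearMap.mulRight k (Env.ι p k g x)) ∘ₗ σ k =
        sgn (i + l) • (a ∘ₗ LinearMap.mulRight k (Env.ι p k g x)) := mulRight_parity hx ha
    have hb' : (b ∘ₗ LinearMap.mulRight k (Env.ι p k g x)) ∘ₗ σ k =
        sgn (j + l) • (b ∘ₗ LinearMap.mulRight k (Env.ι p k g x)) := mulRight_parity hx hb
    have hal : a ∘ₗ σpow k l = sgn (i * l) • a := by
      rcases zmod_two_cases l with rfl | rfl
      · simp only [mul_zero, sgn_zero, one_smul]; rfl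
      · rw [mul_one, ← ha]; rfl
    have hbl : b ∘ₗ σpow k l = sgn (j * l) • b := by
      rcases zmod_two_cases l with rfl | rfl
      · simp only [mul_zero, sgn_zero, one_smul]; rfl
      · rw [mul_one, ← hb]; rfl
    rw [LinearMap.smul_apply, conv_mul_ι _ _ hx, conv_mul_ι _ _ hx, hu ha' hb, hal, hbl,
      conv_zsmul_left, conv_zsmul_left, LinearMap.smul_apply, LinearMap.smul_apply, hu ha hb']
    rcases zmod_two_cases i with rfl | rfl <;> rcases zmod_two_cases j with rfl | rfl <;>
      rcases zmod_two_cases l with rfl | rfl <;> simp [one_add_one, add_comm]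

theorem counit_σ : (Env.counit p k g).toLinearMap ∘ₗ σ k = (Env.counit p k g).toLinearMap := by
  have : (Env.counit p k g).comp (σAlg k) = Env.counit p k g := by
    apply Env.hom_ext
    intro x
    change Env.counit p k g (σ k (Env.ι p k g x)) = _
    simp
  exact congrArg AlgHom.toLinearMap this

theorem counit_mulRight (x : g) :
    (Env.counit p k g).toLinearMap ∘ₗ LinearMap.mulRight k (Env.ι p k g x) = 0 := by
  ext u
  simp

theorem counit_conv (f : Env p k g →ₗ[k] V) : conv (Env.counit p k g).toLinearMap f = f := by
  ext u
  revert f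
  refine Env.eq_top_of_right p k
    { carrier := {u | ∀ (f : Env p k g →ₗ[k] V), conv (Env.counit p k g).toLinearMap f u = f u}
      add_mem' := fun hs ht f => by rw [map_add, map_add, hs f, ht f]
      zero_mem' := fun f => by rw [map_zero, map_zero]
      smul_mem' := fun c s hs f => by rw [map_smul, map_smul, hs f] } ?_ ?_ u
  · intro f
    simp [conv_one]
  · intro u hu i x hx f
    have hc : (Env.counit p k g).toLinearMap ∘ₗ σpow k i = (Env.counit p k g).toLinearMap := by
      rcases zmod_two_cases i with rfl | rfl
      · rfl
      · exact counit_σ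
    rw [conv_mul_ι _ _ hx, counit_mulRight, hc, hu, ← zero_smul k (0 : Env p k g →ₗ[k] k),
      conv_smul_left]
    simp

theorem conv_counit (a : Env p k g →ₗ[k] k) : conv a (Env.counit p k g).toLinearMap = a := by
  ext u
  revert a
  refine Env.eq_top_of_right p k
    { carrier := {u | ∀ (a : Env p k g →ₗ[k] k), conv a (Env.counit p k g).toLinearMap u = a u}
      add_mem' := fun hs ht f => by rw [map_add, map_add, hs f, ht f]
      zero_mem' := fun f => by rw [map_zero, map_zero]
      smul_mem' := fun c s hs f => by rw [map_smul, map_smul, hs f] } ?_ ?_ u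
  · intro a
    simp [conv_one]
  · intro u hu i x hx a
    rw [conv_mul_ι _ _ hx, counit_mulRight, hu, ← zero_smul k (0 : Env p k g →ₗ[k] k),
      conv_smul_right]
    simp

end Conv

/-! # The superalgebra `Coind(k)` and its action on `Coind(V)` -/

section CoindAlg

variable [NeZero (2 : k)] [Fact p.Prime] [CharP k p]

/-- The superalgebra `Coind(k)` attached to the trivial representation of `U'(h)`. -/
def CoindAlg : Type _ := Coind h (charRep (Env.counit p k h.carrier))

instance : AddCommGroup (CoindAlg h) :=
  inferInstanceAs (AddCommGroup (Coind h (charRep (Env.counit p k h.carrier))))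

instance : Module k (CoindAlg h) :=
  inferInstanceAs (Module k (Coind h (charRep (Env.counit p k h.carrier))))

namespace CoindAlg

variable {h} in
/-- The underlying function of an element of `Coind(k)`. -/
def fn : CoindAlg h →ₗ[k] (Env p k g →ₗ[k] k) := Submodule.subtype _

variable {h} in
theorem ext {a b : CoindAlg h} (hab : fn a = fn b) : a = b := Subtype.ext hab

theorem fn_incl_ι_mul (a : CoindAlg h) (x : h.carrier) (u : Env p k g) :
    fn a (Env.ι p k g (x : g) * u) = 0 := by
  have := a.2 (Env.ι p k h.carrier x) u
  rw [RestrictedSub.incl_ι] at this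
  refine this.trans ?_
  simp [charRep]

theorem conv_mem {V : Type*} [AddCommGroup V] [Module k V]
    (ρ : Env p k h.carrier →ₐ[k] Module.End k V) (a : CoindAlg h) (f : Coind h ρ) :
    conv (fn a) (f : Env p k g →ₗ[k] V) ∈ Coind h ρ := by
  intro w
  refine Env.eq_top_of_right p k
    { carrier := {w | ∀ u, conv (fn a) (f : Env p k g →ₗ[k] V) (h.incl w * u) =
        ρ w (conv (fn a) (f : Env p k g →ₗ[k] V) u)}
      add_mem' := fun hs ht u => by
        rw [map_add, add_mul, map_add, hs u, ht u, map_add, LinearMap.add_apply]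
      zero_mem' := fun u => by simp
      smul_mem' := fun c s hs u => by
        rw [map_smul, smul_mul_assoc, map_smul, hs u, map_smul, LinearMap.smul_apply] } ?_ ?_ w
  · intro u
    simp
  · intro w hw i x hx u
    rw [map_mul h.incl, mul_assoc, hw, map_mul ρ, Module.End.mul_apply, RestrictedSub.incl_ι]
    congr 1
    refine conv_ι_mul _ _ (h.coe_mem_part.2 hx) (fn_incl_ι_mul h a x) _ (fun v => ?_) u
    rw [← RestrictedSub.incl_ι]
    exact f.2 _ v

/-- The action of `Coind(k)` on `Coind(V)`. -/
def smulCoind {V : Type*} [AddCommGroup V] [Module k V]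
    (ρ : Env p k h.carrier →ₐ[k] Module.End k V) : CoindAlg h →ₗ[k] Module.End k (Coind h ρ) :=
  LinearMap.mk₂ k (fun a f => ⟨conv (fn a) (f : Env p k g →ₗ[k] V), conv_mem h ρ a f⟩)
    (fun a b f => Subtype.ext (by simp [conv_add_left]))
    (fun c a f => Subtype.ext (by simp [conv_smul_left]))
    (fun a f f' => Subtype.ext (by simp [conv_add_right]))
    (fun c a f => Subtype.ext (by simp [conv_smul_right]))

instance : Ring (CoindAlg h) where
  __ := (inferInstance : AddCommGroup (CoindAlg h))
  mul a b := ⟨conv (fn a) (fn b), conv_mem h _ a b⟩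
  one := ⟨(Env.counit p k g).toLinearMap, fun w u => by
    have : (Env.counit p k g).comp h.incl = Env.counit p k h.carrier := by
      apply Env.hom_ext
      intro x
      simp
    have hw := DFunLike.congr_fun this w
    simp only [AlgHom.comp_apply] at hw
    simp [charRep, hw]⟩
  left_distrib a b c := ext (by
    change conv (fn a) (fn (b + c)) = conv (fn a) (fn b) + conv (fn a) (fn c)
    rw [map_add, conv_add_right])
  right_distrib a b c := ext (by
    change conv (fn (a + b)) (fn c) = conv (fn a) (fn c) + conv (fn b) (fn c)
    rw [map_add, conv_add_left])
  zero_mul a := ext (by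
    change conv (fn 0) (fn a) = fn 0
    rw [map_zero, ← zero_smul k (0 : Env p k g →ₗ[k] k), conv_smul_left, zero_smul, zero_smul])
  mul_zero a := ext (by
    change conv (fn a) (fn 0) = fn 0
    rw [map_zero, ← zero_smul k (0 : Env p k g →ₗ[k] k), conv_smul_right, zero_smul, zero_smul])
  mul_assoc a b c := ext (conv_assoc (fn a) (fn b) (fn c))
  one_mul a := ext (counit_conv (fn a))
  mul_one a := ext (conv_counit (fn a))

theorem fn_mul (a b : CoindAlg h) : fn (a * b) = conv (fn a) (fn b) := rfl
theorem fn_one : fn (1 : CoindAlg h) = (Env.counit p k g).toLinearMap := rfl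

instance : Algebra k (CoindAlg h) := Algebra.ofModule
  (fun c a b => ext (by simp [fn_mul, conv_smul_left]))
  (fun c a b => ext (by simp [fn_mul, conv_smul_right]))

theorem fn_comp_σ_mem (a : CoindAlg h) :
    fn a ∘ₗ σ k ∈ Coind h (charRep (Env.counit p k h.carrier)) := by
  intro w u
  have h1 : ∀ w, σ k (h.incl w) = h.incl (σ k w) := by
    intro w
    have : (σAlg k).comp h.incl = h.incl.comp (σAlg k) := by
      apply Env.hom_ext
      intro x
      change σ k (h.incl (Env.ι p k h.carrier x)) = h.incl (σ k (Env.ι p k h.carrier x))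
      simp [RestrictedSub.coe_σ]
    exact DFunLike.congr_fun this w
  have h2 : Env.counit p k h.carrier (σ k w) = Env.counit p k h.carrier w :=
    LinearMap.congr_fun counit_σ w
  have h3 := a.2 (σ k w) (σ k u)
  rw [LinearMap.comp_apply, σ_mul, h1]
  refine h3.trans ?_
  simp only [charRep, AlgHom.comp_apply, h2]
  rfl

/-- The parity involution of `Coind(k)` is `a ↦ a ∘ σ`: even elements are the functions that vanish
on odd elements of `U'(g)`, odd elements those that vanish on even ones. -/
instance : Superalgebra k (CoindAlg h) where
  σ :=
    { toFun := fun a => ⟨fn a ∘ₗ σ k, fn_comp_σ_mem h a⟩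
      map_add' := fun a b => ext (by rfl)
      map_smul' := fun c a => ext (by rfl) }
  σ_σ a := ext (by
    change (fn a ∘ₗ σ k) ∘ₗ σ k = fn a
    ext u
    simp)
  σ_mul a b := ext (conv_σ (fn a) (fn b))

theorem fn_σ (a : CoindAlg h) : fn (σ k a) = fn a ∘ₗ σ k := rfl

instance : SuperCommutative k (CoindAlg h) where
  super_comm {i j a b} ha hb := ext (by
    have ha' := congrArg fn (mem_part.1 ha)
    have hb' := congrArg fn (mem_part.1 hb)
    rw [fn_σ, map_zsmul] at ha' hb'
    rw [map_zsmul, fn_mul, fn_mul]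
    exact conv_comm ha' hb')

/-- The action of `U'(g)` on `Coind(k)`. -/
def act : Env p k g →ₐ[k] Module.End k (CoindAlg h) :=
  coindAct h (charRep (Env.counit p k h.carrier))

theorem fn_act (u : Env p k g) (a : CoindAlg h) :
    fn (act h u a) = fn a ∘ₗ LinearMap.mulRight k u := rfl

/-- `δ_X`, the action of `X ∈ g` on `Coind(k)`. -/
def δ (x : g) : CoindAlg h →ₗ[k] CoindAlg h := act h (Env.ι p k g x)

end CoindAlg

end CoindAlg

end Sub

/-! # Superderivations, dual modules, symmetric superalgebras -/

section Modules

variable (k : Type*) [Field k] {A : Type*} [Ring A] [Algebra k A] [Superalgebra k A]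

/-- Homogeneous superderivations of parity `i`:
`D(ab) = D(a) b + (-1)^(i|a|) a D(b)`. -/
structure IsSuperDer (i : ZMod 2) (D : A →ₗ[k] A) : Prop where
  parity : ∀ a, D (σ k a) = sgn i • σ k (D a)
  leibniz : ∀ a b, D (a * b) = D a * b + σpow k i a * D b

/-- `T` is a homogeneous action on the supermodule `N`, of parity `i`, compatible with the
superderivation `D` of `A`: `T(a n) = D(a) n + (-1)^(i|a|) a T(n)`. -/
structure IsCovariant {N : Type*} [AddCommGroup N] [Module k N] [Superspace k N] [Module A N]
    (i : ZMod 2) (D : A →ₗ[k] A) (T : N →ₗ[k] N) : Prop where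
  parity : ∀ n, T (σ k n) = sgn i • σ k (T n)
  leibniz : ∀ (a : A) (n : N), T (a • n) = D a • n + σpow k i a • T n

variable {k}

theorem IsSuperDer.add {i : ZMod 2} {D E : A →ₗ[k] A} (hD : IsSuperDer k i D)
    (hE : IsSuperDer k i E) : IsSuperDer k i (D + E) where
  parity a := by simp [hD.parity, hE.parity]
  leibniz a b := by
    simp only [LinearMap.add_apply, hD.leibniz, hE.leibniz, add_mul, mul_add]
    abel

variable (k A) in
theorem IsSuperDer.zero (i : ZMod 2) : IsSuperDer k i (0 : A →ₗ[k] A) where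
  parity a := by simp
  leibniz a b := by simp

theorem IsSuperDer.one {i : ZMod 2} {D : A →ₗ[k] A} (hD : IsSuperDer k i D) : D 1 = 0 := by
  have h := hD.leibniz 1 1
  have h1 : σpow k i (1 : A) = 1 := by rcases zmod_two_cases i with rfl | rfl <;> simp
  rw [h1, mul_one, mul_one, one_mul] at h
  simpa using h

theorem IsSuperDer.mem {i j : ZMod 2} {D : A →ₗ[k] A} (hD : IsSuperDer k i D) {a : A}
    (ha : a ∈ part k A j) : D a ∈ part k A (i + j) := by
  have h := hD.parity a
  rw [mem_part.1 ha, map_zsmul] at h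
  rw [mem_part]
  rw [sgn_add, mul_smul, h, smul_smul, sgn_mul_self, one_smul]

theorem IsCovariant.mem {N : Type*} [AddCommGroup N] [Module k N] [Superspace k N] [Module A N]
    {i j : ZMod 2} {D : A →ₗ[k] A} {T : N →ₗ[k] N} (hT : IsCovariant k i D T) {n : N}
    (hn : n ∈ part k N j) : T n ∈ part k N (i + j) := by
  have h := hT.parity n
  rw [mem_part.1 hn, map_zsmul] at h
  rw [mem_part]
  rw [sgn_add, mul_smul, h, smul_smul, sgn_mul_self, one_smul]

section Parity

variable (m : ℕ) {M : Type*} [AddCommGroup M] [Module k M] [Superspace k M] [Module A M]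
  [Supermodule k A M]

/-- The `A`-module structure `a · π^m x = (-1)^(m|a|) π^m (a x)` of `Π^m M`. -/
instance : Module A (ParityShift k m M) :=
  Module.compHom M (σpowAlg k (m : ZMod 2) : A →ₐ[k] A).toRingHom

theorem ParityShift.smul_mk (a : A) (x : M) :
    a • ParityShift.mk k m M x = ParityShift.mk k m M (σpow k (m : ZMod 2) a • x) := by
  rw [← σpowAlg_apply]
  rfl

theorem ParityShift.σ_mk (x : M) :
    σ k (ParityShift.mk k m M x) = sgn m • ParityShift.mk k m M (σ k x) := rfl

instance : Supermodule k A (ParityShift k m M) where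
  smul_assoc c a x := by
    obtain ⟨x, rfl⟩ := (ParityShift.mk k m M).surjective x
    rw [ParityShift.smul_mk, ParityShift.smul_mk, map_smul (σpow k _), smul_assoc,
      map_smul (ParityShift.mk k m M)]
  σ_smul a x := by
    obtain ⟨x, rfl⟩ := (ParityShift.mk k m M).surjective x
    rw [ParityShift.smul_mk, ParityShift.σ_mk, ParityShift.σ_mk, Supermodule.σ_smul,
      smul_comm (σ k a) (sgn (m : ZMod 2)), ParityShift.smul_mk]
    rcases zmod_two_cases (m : ZMod 2) with h | h <;> rw [h] <;> rfl

/-- The action on `Π^m M` induced by a homogeneous action on `M` of parity `i`. -/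
def ParityShift.action (i : ZMod 2) (T : M →ₗ[k] M) : ParityShift k m M →ₗ[k] ParityShift k m M :=
  sgn (i * m) • ((ParityShift.mk k m M).toLinearMap ∘ₗ T ∘ₗ (ParityShift.mk k m M).symm.toLinearMap)

theorem ParityShift.action_mk (i : ZMod 2) (T : M →ₗ[k] M) (x : M) :
    ParityShift.action m i T (ParityShift.mk k m M x) =
      sgn (i * m) • ParityShift.mk k m M (T x) := rfl

theorem ParityShift.isCovariant {i : ZMod 2} {D : A →ₗ[k] A} {T : M →ₗ[k] M}
    (hD : IsSuperDer k i D) (hT : IsCovariant k i D T) :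
    IsCovariant k i D (ParityShift.action m i T) where
  parity x := by
    obtain ⟨x, rfl⟩ := (ParityShift.mk k m M).surjective x
    rw [ParityShift.σ_mk, map_zsmul, ParityShift.action_mk, ParityShift.action_mk, hT.parity,
      map_zsmul, map_zsmul, ParityShift.σ_mk]
    rw [smul_comm (sgn (m : ZMod 2)), smul_comm (sgn i), smul_comm (sgn i)]
  leibniz a x := by
    obtain ⟨x, rfl⟩ := (ParityShift.mk k m M).surjective x
    rw [ParityShift.smul_mk, ParityShift.action_mk, hT.leibniz, ParityShift.action_mk, map_add,
      smul_add, smul_comm (σpow k i a) (sgn _), ParityShift.smul_mk, ParityShift.smul_mk]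
    congr 1
    · rcases zmod_two_cases (m : ZMod 2) with h | h <;> rw [h]
      · simp
      · have := hD.parity a
        rw [σpow_one, σpow_one, this, mul_one, smul_assoc, map_zsmul, smul_smul]
        rcases zmod_two_cases i with rfl | rfl <;> simp
    · rcases zmod_two_cases (m : ZMod 2) with h | h <;> rw [h] <;>
        rcases zmod_two_cases i with rfl | rfl <;> rfl

end Parity

/-! ## The dual supermodule -/

section Dual

variable (k) (A) (M : Type*) [AddCommGroup M] [Module k M] [Superspace k M] [Module A M]
  [Supermodule k A M]

/-- The dual supermodule `M^* = Hom_A(M, A)`. The value at `m` of the function written here `φ` is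
the left pairing `⟨m, φ⟩`, for which `⟨a m, φ⟩ = a ⟨m, φ⟩`. -/
@[nolint unusedArguments]
def SDual (_k A M : Type*) [Ring A] [AddCommGroup M] [Module A M] : Type _ := M →ₗ[A] A

instance : AddCommGroup (SDual k A M) := inferInstanceAs (AddCommGroup (M →ₗ[A] A))
instance : Module k (SDual k A M) := inferInstanceAs (Module k (M →ₗ[A] A))

variable {k A M}

/-- The pairing `⟨m, φ⟩`. -/
def SDual.fn (φ : SDual k A M) : M →ₗ[A] A := φ

theorem SDual.ext {φ ψ : SDual k A M} (h : ∀ m, φ.fn m = ψ.fn m) : φ = ψ := LinearMap.ext h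

@[simp] theorem SDual.add_fn (φ ψ : SDual k A M) (m : M) :
    (φ + ψ).fn m = φ.fn m + ψ.fn m := rfl
@[simp] theorem SDual.zero_fn (m : M) : (0 : SDual k A M).fn m = 0 := rfl
@[simp] theorem SDual.smul_fn (c : k) (φ : SDual k A M) (m : M) :
    (c • φ).fn m = c • φ.fn m := rfl

theorem fn_zsmul (c : ℤ) (φ : SDual k A M) (m : M) : (c • φ).fn m = c • φ.fn m := rfl

theorem map_smul_k (φ : SDual k A M) (c : k) (m : M) : φ.fn (c • m) = c • φ.fn m := by
  rw [← algebraMap_smul A c m, map_smul, algebraMap_smul]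

/-- The parity involution: `⟨m, σ φ⟩ = σ ⟨σ m, φ⟩`. -/
instance : Superspace k (SDual k A M) where
  σ :=
    { toFun := fun φ =>
        ({ toFun := fun m => σ k (φ.fn (σ k m))
           map_add' := fun m n => by simp
           map_smul' := fun a m => by simp [Supermodule.σ_smul] } : M →ₗ[A] A)
      map_add' := fun φ ψ => SDual.ext fun m => map_add (σ k) _ _
      map_smul' := fun c φ => SDual.ext fun m => map_smul (σ k) c _ }
  σ_σ φ := SDual.ext fun m => by
    change σ k (σ k (φ.fn (σ k (σ k m)))) = _
    simp

theorem SDual.σ_fn (φ : SDual k A M) (m : M) : (σ k φ).fn m = σ k (φ.fn (σ k m)) := rfl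

variable [SuperCommutative k A]

theorem mul_comm_σpow [NeZero (2 : k)] {j : ZMod 2} {a : A} (ha : a ∈ part k A j) (b : A) :
    a * b = σpow k j b * a := by
  rw [← comp_add_comp k b, mul_add, map_add, add_mul,
    SuperCommutative.super_comm ha (comp_mem k 0 b),
    SuperCommutative.super_comm ha (comp_mem k 1 b)]
  rcases zmod_two_cases j with rfl | rfl
  · simp
  · simp [mem_part_zero.1 (comp_mem k 0 b), mem_part_one.1 (comp_mem k 1 b)]

variable [NeZero (2 : k)]

theorem comp_mul (i : ZMod 2) (a b : A) :
    comp k i (a * b) = comp k 0 a * comp k i b + comp k 1 a * comp k (i + 1) b := by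
  have h00 : comp k 0 a * comp k 0 b ∈ part k A 0 := by
    have := mul_mem_part (comp_mem k 0 a) (comp_mem k 0 b)
    rwa [add_zero] at this
  have h01 : comp k 0 a * comp k 1 b ∈ part k A 1 := by
    have := mul_mem_part (comp_mem k 0 a) (comp_mem k 1 b)
    rwa [zero_add] at this
  have h10 : comp k 1 a * comp k 0 b ∈ part k A 1 := by
    have := mul_mem_part (comp_mem k 1 a) (comp_mem k 0 b)
    rwa [add_zero] at this
  have h11 : comp k 1 a * comp k 1 b ∈ part k A 0 := by
    have := mul_mem_part (comp_mem k 1 a) (comp_mem k 1 b)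
    rwa [one_add_one] at this
  have n01 : (0 : ZMod 2) ≠ 1 := by decide
  have n10 : (1 : ZMod 2) ≠ 0 := by decide
  conv_lhs => rw [← comp_add_comp k a, ← comp_add_comp k b]
  simp only [add_mul, mul_add, map_add]
  rcases zmod_two_cases i with rfl | rfl
  · rw [comp_of_mem k h00, comp_of_mem_ne k h01 n01, comp_of_mem_ne k h10 n01, comp_of_mem k h11]
    simp
  · rw [comp_of_mem_ne k h00 n10, comp_of_mem k h01, comp_of_mem k h10, comp_of_mem_ne k h11 n10]
    simp [one_add_one, add_comm]

/-- The left `A`-module structure of the dual: `⟨m, a φ⟩ = (-1)^(|m||a|) a ⟨m, φ⟩`. -/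
instance : Module A (SDual k A M) where
  smul a φ :=
    ({ toFun := fun m => comp k 0 a * φ.fn m + comp k 1 a * φ.fn (σ k m)
       map_add' := fun m n => by simp only [map_add, mul_add]; abel
       map_smul' := fun b m => by
        simp only [Supermodule.σ_smul, map_smul, smul_eq_mul, RingHom.id_apply, mul_add,
          ← mul_assoc]
        rw [mul_comm_σpow (comp_mem k 0 a), mul_comm_σpow (comp_mem k 1 a)]
        simp } : M →ₗ[A] A)
  one_smul φ := SDual.ext fun m => by
    change comp k 0 1 * φ.fn m + comp k 1 1 * φ.fn (σ k m) = _
    rw [comp_of_mem k (one_mem_part k), comp_of_mem_ne k (one_mem_part k) (by decide)]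
    simp
  mul_smul a b φ := SDual.ext fun m => by
    change comp k 0 (a * b) * φ.fn m + comp k 1 (a * b) * φ.fn (σ k m) =
      comp k 0 a * (comp k 0 b * φ.fn m + comp k 1 b * φ.fn (σ k m)) +
      comp k 1 a * (comp k 0 b * φ.fn (σ k m) + comp k 1 b * φ.fn (σ k (σ k m)))
    rw [comp_mul, comp_mul, zero_add, one_add_one, σ_σ]
    simp only [add_mul, mul_add, mul_assoc]
    abel
  smul_zero a := SDual.ext fun m => by
    change comp k 0 a * 0 + comp k 1 a * 0 = 0
    simp
  smul_add a φ ψ := SDual.ext fun m => by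
    change comp k 0 a * (φ.fn m + ψ.fn m) + comp k 1 a * (φ.fn (σ k m) + ψ.fn (σ k m)) =
      (comp k 0 a * φ.fn m + comp k 1 a * φ.fn (σ k m)) +
      (comp k 0 a * ψ.fn m + comp k 1 a * ψ.fn (σ k m))
    simp only [mul_add]
    abel
  add_smul a b φ := SDual.ext fun m => by
    change comp k 0 (a + b) * φ.fn m + comp k 1 (a + b) * φ.fn (σ k m) =
      (comp k 0 a * φ.fn m + comp k 1 a * φ.fn (σ k m)) +
      (comp k 0 b * φ.fn m + comp k 1 b * φ.fn (σ k m))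
    simp only [map_add, add_mul]
    abel
  zero_smul φ := SDual.ext fun m => by
    change comp k 0 (0 : A) * φ.fn m + comp k 1 (0 : A) * φ.fn (σ k m) = 0
    simp

theorem SDual.smul_A_fn (a : A) (φ : SDual k A M) (m : M) :
    (a • φ).fn m = comp k 0 a * φ.fn m + comp k 1 a * φ.fn (σ k m) := rfl

theorem comp_σ (i : ZMod 2) (a : A) : comp k i (σ k a) = σ k (comp k i a) := by
  rw [comp_apply, comp_apply, map_smul, map_add, map_zsmul]

instance : Supermodule k A (SDual k A M) where
  smul_assoc c a φ := SDual.ext fun m => by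
    simp [SDual.smul_A_fn]
  σ_smul a φ := SDual.ext fun m => by
    simp [SDual.smul_A_fn, SDual.σ_fn, comp_σ]

/-- The contragredient action: `D⟨m, φ⟩ = ⟨T m, φ⟩ + (-1)^(i|m|) ⟨m, T^* φ⟩`. -/
def SDual.action {i : ZMod 2} {D : A →ₗ[k] A} {T : M →ₗ[k] M} (hD : IsSuperDer k i D)
    (hT : IsCovariant k i D T) : SDual k A M →ₗ[k] SDual k A M where
  toFun φ :=
    ({ toFun := fun m => D (φ.fn (σpow k i m)) - φ.fn (T (σpow k i m))
       map_add' := fun m n => by simp only [map_add]; abel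
       map_smul' := fun a m => by
        have h : σpow k i (a • m) = σpow k i a • σpow k i m := by
          rcases zmod_two_cases i with rfl | rfl
          · rfl
          · exact Supermodule.σ_smul a m
        have h' : σpow k i (σpow k i a) = a := by
          rcases zmod_two_cases i with rfl | rfl
          · rfl
          · exact σ_σ k a
        simp only [h, map_smul, smul_eq_mul, hD.leibniz, hT.leibniz, map_add, h',
          RingHom.id_apply, mul_sub]
        abel } : M →ₗ[A] A)
  map_add' φ ψ := SDual.ext fun m => by
    change D (φ.fn (σpow k i m) + ψ.fn (σpow k i m)) - (φ.fn (T (σpow k i m)) +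
      ψ.fn (T (σpow k i m))) = (D (φ.fn (σpow k i m)) - φ.fn (T (σpow k i m))) +
      (D (ψ.fn (σpow k i m)) - ψ.fn (T (σpow k i m)))
    rw [map_add]
    abel
  map_smul' c φ := SDual.ext fun m => by
    change D (c • φ.fn (σpow k i m)) - c • φ.fn (T (σpow k i m)) =
      c • (D (φ.fn (σpow k i m)) - φ.fn (T (σpow k i m)))
    rw [map_smul, smul_sub]

theorem SDual.action_fn {i : ZMod 2} {D : A →ₗ[k] A} {T : M →ₗ[k] M} (hD : IsSuperDer k i D)
    (hT : IsCovariant k i D T) (φ : SDual k A M) (m : M) :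
    (SDual.action hD hT φ).fn m = D (φ.fn (σpow k i m)) - φ.fn (T (σpow k i m)) := rfl

theorem comp_superDer {i : ZMod 2} {D : A →ₗ[k] A} (hD : IsSuperDer k i D) (j : ZMod 2) (a : A) :
    comp k j (D a) = D (comp k (j + i) a) := by
  have h : D (σ k a) = sgn i • σ k (D a) := hD.parity a
  rw [comp_apply, comp_apply, map_smul, map_add, map_zsmul, h]
  rcases zmod_two_cases i with rfl | rfl <;> rcases zmod_two_cases j with rfl | rfl <;>
    simp [one_add_one]

theorem SDual.isCovariant {i : ZMod 2} {D : A →ₗ[k] A} {T : M →ₗ[k] M} (hD : IsSuperDer k i D)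
    (hT : IsCovariant k i D T) : IsCovariant k i D (SDual.action hD hT) where
  parity φ := SDual.ext fun m => by
    rw [fn_zsmul, SDual.σ_fn, SDual.action_fn, SDual.action_fn, SDual.σ_fn, SDual.σ_fn, map_sub,
      hD.parity]
    rcases zmod_two_cases i with rfl | rfl
    · simp only [σpow_zero, sgn_zero, one_smul]
      have := hT.parity m
      rw [sgn_zero, one_smul] at this
      rw [this]
    · simp only [σpow_one, sgn_one, σ_σ, neg_smul, one_smul]
      have := hT.parity (σ k m)
      rw [sgn_one, σ_σ, neg_smul, one_smul] at this
      rw [this, map_neg]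
      simp [sub_eq_add_neg, add_comm]
  leibniz a φ := SDual.ext fun m => by
    rw [SDual.action_fn, SDual.add_fn, SDual.smul_A_fn, SDual.smul_A_fn, SDual.smul_A_fn,
      SDual.smul_A_fn, SDual.action_fn, SDual.action_fn]
    rw [map_add, hD.leibniz, hD.leibniz, comp_superDer hD, comp_superDer hD]
    have h0 := mem_part_zero.1 (comp_mem k 0 a)
    have h1 := mem_part_one.1 (comp_mem k 1 a)
    rcases zmod_two_cases i with rfl | rfl
    · have := hT.parity m
      rw [sgn_zero, one_smul] at this
      simp only [σpow_zero, add_zero, ← this, mul_sub]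
      abel
    · have := hT.parity (σ k m)
      rw [sgn_one, σ_σ, neg_smul, one_smul] at this
      simp only [σpow_one, σ_σ, comp_σ, h0, h1, zero_add, one_add_one, mul_sub, neg_mul]
      rw [this, map_neg]
      simp only [mul_neg]
      abel

end Dual

end Modules

/-! ## The module of superderivations -/

section Der

variable {k : Type*} [Field k] {A : Type*} [Ring A] [Algebra k A] [Superalgebra k A]

/-- The supercommutator with a superderivation `D` of parity `i`:
`[D, E] = D E - (-1)^(i|E|) E D`. -/
def superBracket (i : ZMod 2) (D : A →ₗ[k] A) : (A →ₗ[k] A) →ₗ[k] (A →ₗ[k] A) where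
  toFun E := D ∘ₗ E - (σpow k i ∘ₗ E ∘ₗ σpow k i) ∘ₗ D
  map_add' E F := by
    ext a
    simp only [LinearMap.sub_apply, LinearMap.comp_apply, LinearMap.add_apply, map_add]
    abel
  map_smul' c E := by
    ext a
    simp only [LinearMap.sub_apply, LinearMap.comp_apply, LinearMap.smul_apply, map_smul,
      smul_sub, RingHom.id_apply]

theorem superBracket_apply (i : ZMod 2) (D E : A →ₗ[k] A) (a : A) :
    superBracket i D E a = D (E a) - σpow k i (E (σpow k i (D a))) := rfl

theorem superBracket_of_parity {i j : ZMod 2} (D : A →ₗ[k] A) {E : A →ₗ[k] A}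
    (hE : ∀ a, E (σ k a) = sgn j • σ k (E a)) (a : A) :
    superBracket i D E a = D (E a) - sgn (i * j) • E (D a) := by
  rw [superBracket_apply]
  rcases zmod_two_cases i with rfl | rfl
  · simp
  · rw [σpow_one, σpow_one, hE, map_zsmul, σ_σ, one_mul]

theorem IsSuperDer.superBracket {i j : ZMod 2} {D E : A →ₗ[k] A} (hD : IsSuperDer k i D)
    (hE : IsSuperDer k j E) : IsSuperDer k (i + j) (superBracket i D E) where
  parity a := by
    rw [superBracket_of_parity D hE.parity, superBracket_of_parity D hE.parity, hD.parity,
      hE.parity, map_zsmul, map_zsmul, hD.parity, hE.parity, map_sub, map_zsmul, smul_sub]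
    rcases zmod_two_cases i with rfl | rfl <;> rcases zmod_two_cases j with rfl | rfl <;>
      simp [one_add_one]
  leibniz a b := by
    simp only [superBracket_of_parity D hE.parity, hD.leibniz, hE.leibniz, map_add]
    have h1 := hD.parity a
    have h2 := hE.parity a
    rcases zmod_two_cases i with rfl | rfl <;> rcases zmod_two_cases j with rfl | rfl <;>
      simp only [one_add_one, σpow_zero, σpow_one, sgn_zero, sgn_one, mul_zero, mul_one,
        one_smul, neg_smul, add_zero, zero_add, σ_σ, h1, h2, sub_mul, mul_sub, neg_mul,
        sub_neg_eq_add, add_mul, mul_add] <;> abel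

variable [SuperCommutative k A] [NeZero (2 : k)]

theorem IsSuperDer.smul {i j : ZMod 2} {D : A →ₗ[k] A} (hD : IsSuperDer k i D) {a : A}
    (ha : a ∈ part k A j) : IsSuperDer k (j + i) (a • D) where
  parity b := by
    rw [LinearMap.smul_apply, LinearMap.smul_apply, hD.parity, smul_eq_mul, smul_eq_mul, σ_mul,
      mem_part.1 ha, mul_smul_comm, smul_mul_assoc, smul_smul, sgn_add]
    rcases zmod_two_cases i with rfl | rfl <;> rcases zmod_two_cases j with rfl | rfl <;> simp
  leibniz b c := by
    have h := mul_comm_σpow ha (σpow k i b)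
    have h' : σpow k j (σpow k i b) = σpow k (j + i) b := by
      rcases zmod_two_cases i with rfl | rfl <;> rcases zmod_two_cases j with rfl | rfl <;>
        simp [one_add_one]
    rw [LinearMap.smul_apply, LinearMap.smul_apply, LinearMap.smul_apply, hD.leibniz,
      smul_eq_mul, smul_eq_mul, smul_eq_mul, mul_add, ← mul_assoc, ← mul_assoc, h, h', mul_assoc]
    congr 1
    exact mul_assoc _ _ _

variable (k A)

/-- `Der(A)`, the `A`-module of superderivations of `A`: the sums of an even and an odd
superderivation. -/
def Der : Submodule A (A →ₗ[k] A) where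
  carrier := {E | ∃ E₀ E₁ : A →ₗ[k] A, IsSuperDer k 0 E₀ ∧ IsSuperDer k 1 E₁ ∧ E = E₀ + E₁}
  add_mem' := by
    rintro _ _ ⟨E₀, E₁, h₀, h₁, rfl⟩ ⟨F₀, F₁, h₀', h₁', rfl⟩
    exact ⟨E₀ + F₀, E₁ + F₁, h₀.add h₀', h₁.add h₁', by abel⟩
  zero_mem' := ⟨0, 0, IsSuperDer.zero k A 0, IsSuperDer.zero k A 1, by simp⟩
  smul_mem' := by
    rintro a _ ⟨E₀, E₁, h₀, h₁, rfl⟩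
    have h00 := h₀.smul (comp_mem k 0 a)
    have h01 := h₁.smul (comp_mem k 0 a)
    have h10 := h₀.smul (comp_mem k 1 a)
    have h11 := h₁.smul (comp_mem k 1 a)
    rw [add_zero] at h00
    rw [zero_add] at h01
    rw [add_zero] at h10
    rw [one_add_one] at h11
    refine ⟨comp k 0 a • E₀ + comp k 1 a • E₁, comp k 0 a • E₁ + comp k 1 a • E₀, h00.add h11,
      h01.add h10, ?_⟩
    conv_lhs => rw [← comp_add_comp k a]
    simp only [add_smul, smul_add]
    abel

variable {k A}

theorem IsSuperDer.mem_der {i : ZMod 2} {D : A →ₗ[k] A} (hD : IsSuperDer k i D) :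
    D ∈ Der k A := by
  rcases zmod_two_cases i with rfl | rfl
  · exact ⟨D, 0, hD, IsSuperDer.zero k A 1, by simp⟩
  · exact ⟨0, D, IsSuperDer.zero k A 0, hD, by simp⟩

/-- The parity involution of `Der(A)`: `E ↦ σ ∘ E ∘ σ`. -/
instance : Superspace k (Der k A) where
  σ :=
    { toFun := fun E => ⟨σ k ∘ₗ (E : A →ₗ[k] A) ∘ₗ σ k, by
        obtain ⟨E₀, E₁, h₀, h₁, h⟩ := E.2
        refine (Der k A).sub_mem h₀.mem_der h₁.mem_der |> fun h2 => ?_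
        convert h2 using 1
        ext a
        rw [h]
        simp [h₀.parity, h₁.parity, sub_eq_add_neg]⟩
      map_add' := fun E F => Subtype.ext <| LinearMap.ext fun a => by simp
      map_smul' := fun c E => Subtype.ext <| LinearMap.ext fun a => by simp }
  σ_σ E := Subtype.ext <| LinearMap.ext fun a => by
    change σ k (σ k ((E : A →ₗ[k] A) (σ k (σ k a)))) = _
    simp

theorem Der.coe_σ (E : Der k A) (a : A) :
    ((σ k E : Der k A) : A →ₗ[k] A) a = σ k ((E : A →ₗ[k] A) (σ k a)) := rfl

instance : Supermodule k A (Der k A) where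
  σ_smul a E := Subtype.ext <| LinearMap.ext fun b => by
    simp [Der.coe_σ]

/-- The adjoint action `E ↦ [D, E]` on `Der(A)` of a superderivation `D` of parity `i`. -/
def Der.ad {i : ZMod 2} {D : A →ₗ[k] A} (hD : IsSuperDer k i D) : Der k A →ₗ[k] Der k A :=
  (superBracket i D ∘ₗ ((Der k A).subtype.restrictScalars k)).codRestrict
    ((Der k A).restrictScalars k) (by
      rintro ⟨_, E₀, E₁, h₀, h₁, rfl⟩
      change superBracket i D (E₀ + E₁) ∈ Der k A
      rw [map_add]
      exact (Der k A).add_mem (hD.superBracket h₀).mem_der (hD.superBracket h₁).mem_der)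

theorem Der.coe_ad {i : ZMod 2} {D : A →ₗ[k] A} (hD : IsSuperDer k i D) (E : Der k A) :
    (Der.ad hD E : A →ₗ[k] A) = superBracket i D (E : A →ₗ[k] A) := rfl

theorem Der.isCovariant_ad {i : ZMod 2} {D : A →ₗ[k] A} (hD : IsSuperDer k i D) :
    IsCovariant (N := Der k A) k i D (Der.ad hD) where
  parity E := Subtype.ext <| LinearMap.ext fun a => by
    rcases zmod_two_cases i with rfl | rfl
    · have h1 := fun b : A => hD.parity b
      simp only [sgn_zero, one_smul] at h1
      simp [Der.coe_ad, superBracket_apply, Der.coe_σ, h1]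
    · have h1 := fun b : A => hD.parity b
      simp only [sgn_one, neg_smul, one_smul] at h1
      simp [Der.coe_ad, superBracket_apply, Der.coe_σ, h1]
      abel
  leibniz a E := Subtype.ext <| LinearMap.ext fun b => by
    change superBracket i D (a • (E : A →ₗ[k] A)) b =
      D a * (E : A →ₗ[k] A) b + σpow k i a * superBracket i D (E : A →ₗ[k] A) b
    rw [superBracket_apply, superBracket_apply, LinearMap.smul_apply, LinearMap.smul_apply,
      smul_eq_mul, smul_eq_mul, hD.leibniz, mul_sub, ← σpowAlg_apply k i (a * _), map_mul,
      σpowAlg_apply, σpowAlg_apply]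
    abel

end Der

/-! ## Symmetric superalgebras -/

section SymAlg

variable (k A N : Type*) [Field k] [Ring A] [Algebra k A] [Superalgebra k A]
  [AddCommGroup N] [Module k N] [Superspace k N] [Module A N] [Supermodule k A N]

/-- The defining relations of the symmetric superalgebra `S_A(N)`, as a `k`-algebra generated by
`A` and `N`. -/
inductive SymRel : TensorAlgebra k (A × N) → TensorAlgebra k (A × N) → Prop
  | one : SymRel (TensorAlgebra.ι k ((1, 0) : A × N)) 1
  | mul (a b : A) : SymRel (TensorAlgebra.ι k ((a * b, 0) : A × N))
      (TensorAlgebra.ι k ((a, 0) : A × N) * TensorAlgebra.ι k ((b, 0) : A × N))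
  | smul (a : A) (n : N) : SymRel (TensorAlgebra.ι k ((0, a • n) : A × N))
      (TensorAlgebra.ι k ((a, 0) : A × N) * TensorAlgebra.ι k ((0, n) : A × N))
  | comm_left {i j : ZMod 2} {a : A} {n : N} (ha : a ∈ part k A i) (hn : n ∈ part k N j) :
      SymRel (TensorAlgebra.ι k ((0, n) : A × N) * TensorAlgebra.ι k ((a, 0) : A × N))
        (sgn (i * j) • (TensorAlgebra.ι k ((a, 0) : A × N) * TensorAlgebra.ι k ((0, n) : A × N)))
  | comm {i j : ZMod 2} {n n' : N} (hn : n ∈ part k N i) (hn' : n' ∈ part k N j) :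
      SymRel (TensorAlgebra.ι k ((0, n) : A × N) * TensorAlgebra.ι k ((0, n') : A × N))
        (sgn (i * j) • (TensorAlgebra.ι k ((0, n') : A × N) * TensorAlgebra.ι k ((0, n) : A × N)))

/-- The symmetric superalgebra `S_A(N)` of a supermodule `N` over a supercommutative
superalgebra `A`. -/
def SymAlg : Type _ := RingQuot (SymRel k A N)

instance : Ring (SymAlg k A N) := inferInstanceAs (Ring (RingQuot (SymRel k A N)))
instance : Algebra k (SymAlg k A N) := inferInstanceAs (Algebra k (RingQuot (SymRel k A N)))

namespace SymAlg

/-- The quotient map from the tensor algebra. -/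
def quot : TensorAlgebra k (A × N) →ₐ[k] SymAlg k A N := RingQuot.mkAlgHom k (SymRel k A N)

theorem quot_surjective : Function.Surjective (quot k A N) := RingQuot.mkAlgHom_surjective k _

/-- The canonical map from `A × N`. -/
def gen : A × N →ₗ[k] SymAlg k A N := (quot k A N).toLinearMap ∘ₗ TensorAlgebra.ι k

/-- The canonical map `A → S_A(N)`. -/
def ofA : A →ₗ[k] SymAlg k A N := gen k A N ∘ₗ LinearMap.inl k A N

/-- The canonical map `N → S_A(N)`. -/
def ι : N →ₗ[k] SymAlg k A N := gen k A N ∘ₗ LinearMap.inr k A N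

variable {A N}

theorem gen_eq (x : A × N) : gen k A N x = ofA k A N x.1 + ι k A N x.2 := by
  rw [ofA, ι, LinearMap.comp_apply, LinearMap.comp_apply, ← map_add]
  simp

variable (A N) in
theorem ofA_one : ofA k A N 1 = 1 := by
  have h : quot k A N _ = quot k A N _ := RingQuot.mkAlgHom_rel k SymRel.one
  rwa [map_one] at h

theorem ofA_mul (a b : A) : ofA k A N (a * b) = ofA k A N a * ofA k A N b := by
  have h : quot k A N _ = quot k A N _ := RingQuot.mkAlgHom_rel k (SymRel.mul a b)
  rwa [map_mul] at h

theorem ι_smul (a : A) (n : N) : ι k A N (a • n) = ofA k A N a * ι k A N n := by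
  have h : quot k A N _ = quot k A N _ := RingQuot.mkAlgHom_rel k (SymRel.smul a n)
  rwa [map_mul] at h

theorem ι_mul_ofA {i j : ZMod 2} {a : A} {n : N} (ha : a ∈ part k A i) (hn : n ∈ part k N j) :
    ι k A N n * ofA k A N a = sgn (i * j) • (ofA k A N a * ι k A N n) := by
  have h : quot k A N _ = quot k A N _ := RingQuot.mkAlgHom_rel k (SymRel.comm_left ha hn)
  rwa [map_zsmul, map_mul, map_mul] at h

theorem ι_mul_ι {i j : ZMod 2} {n n' : N} (hn : n ∈ part k N i) (hn' : n' ∈ part k N j) :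
    ι k A N n * ι k A N n' = sgn (i * j) • (ι k A N n' * ι k A N n) := by
  have h : quot k A N _ = quot k A N _ := RingQuot.mkAlgHom_rel k (SymRel.comm hn hn')
  rwa [map_zsmul, map_mul, map_mul] at h

variable {k}

/-- The universal property of `S_A(N)`. -/
def lift {B : Type*} [Ring B] [Algebra k B] (f : A →ₗ[k] B) (t : N →ₗ[k] B) (h1 : f 1 = 1)
    (hmul : ∀ a b, f (a * b) = f a * f b) (hsmul : ∀ (a : A) (n : N), t (a • n) = f a * t n)
    (hcl : ∀ {i j : ZMod 2} {a : A} {n : N}, a ∈ part k A i → n ∈ part k N j →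
      t n * f a = sgn (i * j) • (f a * t n))
    (hc : ∀ {i j : ZMod 2} {n n' : N}, n ∈ part k N i → n' ∈ part k N j →
      t n * t n' = sgn (i * j) • (t n' * t n)) : SymAlg k A N →ₐ[k] B :=
  RingQuot.liftAlgHom k ⟨TensorAlgebra.lift k (f.coprod t), by
    intro _ _ h
    induction h with
    | one => simp [h1]
    | mul a b => simp [hmul]
    | smul a n => simp [hsmul]
    | comm_left ha hn =>
      simp only [map_mul, map_zsmul, TensorAlgebra.lift_ι_apply, LinearMap.coprod_apply, map_zero,
        zero_add, add_zero]
      exact hcl ha hn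
    | comm hn hn' =>
      simp only [map_mul, map_zsmul, TensorAlgebra.lift_ι_apply, LinearMap.coprod_apply, map_zero,
        zero_add]
      exact hc hn hn'⟩

theorem lift_gen {B : Type*} [Ring B] [Algebra k B] (f : A →ₗ[k] B) (t : N →ₗ[k] B)
    (h1 hmul hsmul hcl hc) (x : A × N) :
    lift f t h1 hmul hsmul hcl hc (gen k A N x) = f x.1 + t x.2 := by
  unfold lift gen quot
  simp only [LinearMap.comp_apply]
  refine (RingQuot.liftAlgHom_mkAlgHom_apply k _ _ _).trans ?_
  rw [TensorAlgebra.lift_ι_apply, LinearMap.coprod_apply]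

theorem lift_ofA {B : Type*} [Ring B] [Algebra k B] (f : A →ₗ[k] B) (t : N →ₗ[k] B)
    (h1 hmul hsmul hcl hc) (a : A) :
    lift f t h1 hmul hsmul hcl hc (ofA k A N a) = f a :=
  (lift_gen f t h1 hmul hsmul hcl hc _).trans (by simp)

theorem lift_ι {B : Type*} [Ring B] [Algebra k B] (f : A →ₗ[k] B) (t : N →ₗ[k] B)
    (h1 hmul hsmul hcl hc) (n : N) :
    lift f t h1 hmul hsmul hcl hc (ι k A N n) = t n :=
  (lift_gen f t h1 hmul hsmul hcl hc _).trans (by simp)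

theorem induction {C : SymAlg k A N → Prop} (hs : ∀ c : k, C (algebraMap k _ c))
    (ha : ∀ a, C (ofA k A N a)) (hn : ∀ n, C (ι k A N n))
    (hmul : ∀ x y, C x → C y → C (x * y)) (hadd : ∀ x y, C x → C y → C (x + y))
    (x : SymAlg k A N) : C x := by
  obtain ⟨t, rfl⟩ := quot_surjective k A N x
  induction t using TensorAlgebra.induction with
  | algebraMap r => rw [AlgHom.commutes]; exact hs r
  | ι x =>
    have : quot k A N (TensorAlgebra.ι k x) = ofA k A N x.1 + ι k A N x.2 := gen_eq k x
    rw [this]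
    exact hadd _ _ (ha _) (hn _)
  | mul a b h h' => rw [map_mul]; exact hmul _ _ h h'
  | add a b h h' => rw [map_add]; exact hadd _ _ h h'

instance : Superalgebra k (SymAlg k A N) :=
  let s : SymAlg k A N →ₐ[k] SymAlg k A N := lift (ofA k A N ∘ₗ σ k) (ι k A N ∘ₗ σ k)
    (by simp [ofA_one])
    (fun a b => by simp [ofA_mul])
    (fun a n => by simp [Supermodule.σ_smul, ι_smul])
    (fun ha hn => ι_mul_ofA k (σ_mem_part ha) (σ_mem_part hn))
    (fun hn hn' => ι_mul_ι k (σ_mem_part hn) (σ_mem_part hn'))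
  { σ := s.toLinearMap
    σ_σ := by
      intro x
      change s (s x) = x
      induction x using SymAlg.induction with
      | hs c => simp
      | ha a => simp [s, lift_ofA]
      | hn n => simp [s, lift_ι]
      | hmul x y hx hy => rw [map_mul, map_mul, hx, hy]
      | hadd x y hx hy => rw [map_add, map_add, hx, hy]
    σ_mul := fun a b => map_mul s a b }

theorem σ_ofA (a : A) : σ k (ofA k A N a) = ofA k A N (σ k a) :=
  lift_ofA _ _ _ _ _ _ _ a

theorem σ_ι (n : N) : σ k (ι k A N n) = ι k A N (σ k n) :=
  lift_ι _ _ _ _ _ _ _ n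

theorem σpow_ofA (i : ZMod 2) (a : A) : σpow k i (ofA k A N a) = ofA k A N (σpow k i a) := by
  rcases zmod_two_cases i with rfl | rfl
  · rfl
  · exact σ_ofA a

theorem σpow_ι (i : ZMod 2) (n : N) : σpow k i (ι k A N n) = ι k A N (σpow k i n) := by
  rcases zmod_two_cases i with rfl | rfl
  · rfl
  · exact σ_ι n

/-! The superderivation of `S_A(N)` that extends a superderivation `D` of `A` and a compatible
action `T` on `N`. It is read off from the algebra morphism `x ↦ (σ^i x, L x; 0, x)` into
`2 × 2` matrices. -/

/-- The matrix `(σ^i x, y; 0, x)`. -/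
def upper (i : ZMod 2) {B : Type*} [AddCommGroup B] [Module k B] [Superspace k B] :
    B × B →ₗ[k] Matrix (Fin 2) (Fin 2) B where
  toFun x := !![σpow k i x.1, x.2; 0, x.1]
  map_add' x y := by ext a b; fin_cases a <;> fin_cases b <;> simp
  map_smul' c x := by ext a b; fin_cases a <;> fin_cases b <;> simp

theorem upper_mul {B : Type*} [Ring B] [Algebra k B] [Superalgebra k B] (i : ZMod 2)
    (x x' y y' : B) : upper (k := k) i (x, x') * upper (k := k) i (y, y') =
      upper (k := k) i (x * y, x' * y + σpow k i x * y') := by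
  have h : σpow k i (x * y) = σpow k i x * σpow k i y := by
    rcases zmod_two_cases i with rfl | rfl <;> simp
  ext a b
  fin_cases a <;> fin_cases b <;> simp [upper, Matrix.mul_apply, h, add_comm]

theorem upper_prod {B V : Type*} [AddCommGroup B] [Module k B] [Superspace k B] [AddCommGroup V]
    [Module k V] (i : ZMod 2) (f t : V →ₗ[k] B) (v : V) :
    (upper i ∘ₗ f.prod t) v = upper (k := k) i (f v, t v) := rfl

variable {i : ZMod 2} {D : A →ₗ[k] A} {T : N →ₗ[k] N}

theorem σpow_of_mem {V : Type*} [AddCommGroup V] [Module k V] [Superspace k V] {j : ZMod 2}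
    {v : V} (hv : v ∈ part k V j) (i : ZMod 2) : σpow k i v = sgn (i * j) • v := by
  rcases zmod_two_cases i with rfl | rfl
  · simp
  · rw [one_mul]; exact mem_part.1 hv

/-- The algebra morphism `x ↦ (σ^i x, L x; 0, x)`. -/
def actionMatrix (hD : IsSuperDer k i D) (hT : IsCovariant k i D T) :
    SymAlg k A N →ₐ[k] Matrix (Fin 2) (Fin 2) (SymAlg k A N) :=
  lift (upper i ∘ₗ (ofA k A N).prod (ofA k A N ∘ₗ D)) (upper i ∘ₗ (ι k A N).prod (ι k A N ∘ₗ T))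
    (by
      have h1 : σpow k i (1 : SymAlg k A N) = 1 := by
        rcases zmod_two_cases i with rfl | rfl <;> simp
      ext a b
      fin_cases a <;> fin_cases b <;> simp [upper, ofA_one, hD.one, h1])
    (fun a b => by
      simp only [upper_prod]
      simp only [LinearMap.comp_apply]
      rw [upper_mul, hD.leibniz, map_add, ofA_mul, ofA_mul, ofA_mul, σpow_ofA])
    (fun a n => by
      simp only [upper_prod]
      simp only [LinearMap.comp_apply]
      rw [upper_mul, hT.leibniz, map_add, ι_smul, ι_smul, ι_smul, σpow_ofA])
    (fun {j l a n} ha hn => by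
      simp only [upper_prod]
      simp only [LinearMap.comp_apply]
      rw [upper_mul, upper_mul, ← map_zsmul, Prod.smul_mk, ι_mul_ofA k ha hn, σpow_ι, σpow_ofA,
        σpow_of_mem ha, σpow_of_mem hn, map_zsmul, map_zsmul, smul_mul_assoc, smul_mul_assoc,
        ι_mul_ofA k ha (hT.mem hn), ι_mul_ofA k (hD.mem ha) hn]
      congr 2
      rcases zmod_two_cases i with rfl | rfl <;> rcases zmod_two_cases j with rfl | rfl <;>
        rcases zmod_two_cases l with rfl | rfl <;> simp [one_add_one, add_comm])
    (fun {j l n n'} hn hn' => by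
      simp only [upper_prod]
      simp only [LinearMap.comp_apply]
      rw [upper_mul, upper_mul, ← map_zsmul, Prod.smul_mk, ι_mul_ι k hn hn', σpow_ι, σpow_ι,
        σpow_of_mem hn, σpow_of_mem hn', map_zsmul, map_zsmul, smul_mul_assoc, smul_mul_assoc,
        ι_mul_ι k (hT.mem hn) hn', ι_mul_ι k hn (hT.mem hn')]
      congr 2
      rcases zmod_two_cases i with rfl | rfl <;> rcases zmod_two_cases j with rfl | rfl <;>
        rcases zmod_two_cases l with rfl | rfl <;> simp [one_add_one, add_comm])

/-- The superderivation of `S_A(N)` of parity `i` extending `D` and `T`; see `action_ofA`,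
`action_ι` and `action_mul`. -/
def action (hD : IsSuperDer k i D) (hT : IsCovariant k i D T) :
    SymAlg k A N →ₗ[k] SymAlg k A N :=
  Matrix.entryLinearMap k (SymAlg k A N) 0 1 ∘ₗ (actionMatrix hD hT).toLinearMap

theorem action_ofA (hD : IsSuperDer k i D) (hT : IsCovariant k i D T) (a : A) :
    action hD hT (ofA k A N a) = ofA k A N (D a) := by
  change actionMatrix hD hT (ofA k A N a) 0 1 = _
  rw [actionMatrix, lift_ofA]
  rfl

theorem action_ι (hD : IsSuperDer k i D) (hT : IsCovariant k i D T) (n : N) :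
    action hD hT (ι k A N n) = ι k A N (T n) := by
  change actionMatrix hD hT (ι k A N n) 0 1 = _
  rw [actionMatrix, lift_ι]
  rfl

theorem actionMatrix_eq (hD : IsSuperDer k i D) (hT : IsCovariant k i D T) (x : SymAlg k A N) :
    actionMatrix hD hT x = upper (k := k) i (x, action hD hT x) := by
  suffices h : ∃ y, actionMatrix hD hT x = upper (k := k) i (x, y) by
    obtain ⟨y, hy⟩ := h
    have : action hD hT x = y := by
      change actionMatrix hD hT x 0 1 = y
      rw [hy]
      rfl
    rw [hy, this]
  induction x using SymAlg.induction with
  | hs c =>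
    refine ⟨0, ?_⟩
    have h1 : σpow k i (algebraMap k (SymAlg k A N) c) = algebraMap k _ c := by
      rw [← σpowAlg_apply, AlgHom.commutes]
    rw [AlgHom.commutes]
    ext a b
    fin_cases a <;> fin_cases b <;> simp [upper, h1, Matrix.algebraMap_matrix_apply]
  | ha a => exact ⟨_, by rw [actionMatrix, lift_ofA]; rfl⟩
  | hn n => exact ⟨_, by rw [actionMatrix, lift_ι]; rfl⟩
  | hmul x y hx hy =>
    obtain ⟨x', hx⟩ := hx
    obtain ⟨y', hy⟩ := hy
    exact ⟨_, by rw [map_mul, hx, hy, upper_mul]⟩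
  | hadd x y hx hy =>
    obtain ⟨x', hx⟩ := hx
    obtain ⟨y', hy⟩ := hy
    exact ⟨_, by rw [map_add, hx, hy, ← map_add]; rfl⟩

theorem action_mul (hD : IsSuperDer k i D) (hT : IsCovariant k i D T) (x y : SymAlg k A N) :
    action hD hT (x * y) = action hD hT x * y + σpow k i x * action hD hT y := by
  have h := congrFun (congrFun (map_mul (actionMatrix hD hT) x y) 0) 1
  rw [actionMatrix_eq, actionMatrix_eq, actionMatrix_eq, upper_mul] at h
  exact h

end SymAlg

end SymAlg

/-! # Berezinian modules -/

section Prod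

variable {k A V W : Type*} [Field k] [Ring A] [Algebra k A] [Superalgebra k A]
  [AddCommGroup V] [Module k V] [Superspace k V] [Module A V] [Supermodule k A V]
  [AddCommGroup W] [Module k W] [Superspace k W] [Module A W] [Supermodule k A W]

instance : Supermodule k A (V × W) where
  σ_smul a x := by
    ext
    · exact Supermodule.σ_smul a x.1
    · exact Supermodule.σ_smul a x.2

theorem IsCovariant.prodMap {i : ZMod 2} {D : A →ₗ[k] A} {T : V →ₗ[k] V} {T' : W →ₗ[k] W}
    (hT : IsCovariant k i D T) (hT' : IsCovariant k i D T') :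
    IsCovariant k i D (T.prodMap T') where
  parity x := by
    ext
    · exact hT.parity x.1
    · exact hT'.parity x.2
  leibniz a x := by
    ext
    · exact hT.leibniz a x.1
    · exact hT'.leibniz a x.2

end Prod

section Ber

variable (k A M : Type*) [Field k] [Ring A] [Algebra k A] [Superalgebra k A]
  [SuperCommutative k A] [NeZero (2 : k)]
  [AddCommGroup M] [Module k M] [Superspace k M] [Module A M] [Supermodule k A M]

/-- A homogeneous basis `e_1, ..., e_n, e_{n+1}, ..., e_{n+m}` of an `A`-module, with the first `n`
vectors even and the last `m` vectors odd. -/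
structure HomBasis (n m : ℕ) where
  basis : Module.Basis (Fin n ⊕ Fin m) A M
  even : ∀ i, basis (Sum.inl i) ∈ part k M 0
  odd : ∀ s, basis (Sum.inr s) ∈ part k M 1

/-- The superalgebra `J(M) = S_A(Π M ⊕ M^*)`. -/
abbrev J : Type _ := SymAlg k A (ParityShift k 1 M × SDual k A M)

variable {M}

/-- The element `π x` of `J(M)`, for `x ∈ M`. -/
def Jπ (x : M) : J k A M := SymAlg.ι k A _ ((ParityShift.mk k 1 M x, 0) : ParityShift k 1 M × SDual k A M)

/-- The element `φ` of `J(M)`, for `φ ∈ M^*`. -/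
def Jdual (φ : SDual k A M) : J k A M := SymAlg.ι k A _ ((0, φ) : ParityShift k 1 M × SDual k A M)

variable (M) in
/-- The piece `S^r_A(Π M) ⊗_A S_A(M^*)` of degree `r` of `J(M)`. -/
def Jdeg (r : ℕ) : Submodule k (J k A M) :=
  Submodule.span k {z | ∃ (a : A) (x : Fin r → M) (φ : List (SDual k A M)),
    z = SymAlg.ofA k A _ a * (List.ofFn fun i => Jπ k A (x i)).prod * (φ.map (Jdual k A)).prod}

variable {k A}
variable {n m : ℕ} (e : HomBasis k A M n m)

/-- The dual basis: `⟨e_i, e^j⟩ = δ_{ij}`. -/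
def HomBasis.dual (i : Fin n ⊕ Fin m) : SDual k A M := e.basis.coord i

/-- The differential `d` of `J(M)`: left multiplication by
`∑ (-1)^(|e_i| + 1) π e_i ⊗ e^i`. -/
def HomBasis.d : J k A M →ₗ[k] J k A M :=
  LinearMap.mulLeft k (-(∑ i : Fin n, Jπ k A (e.basis (Sum.inl i)) * Jdual k A (e.dual (Sum.inl i))) +
    ∑ s : Fin m, Jπ k A (e.basis (Sum.inr s)) * Jdual k A (e.dual (Sum.inr s)))

/-- The cocycles of degree `n`. -/
def HomBasis.cocycles : Submodule k (J k A M) := Jdeg k A M n ⊓ LinearMap.ker e.d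

/-- The coboundaries of degree `n`: the image under `d` of the piece of degree `n - 1`, which is
zero for `n = 0`. -/
def HomBasis.coboundaries : Submodule k (J k A M) :=
  match n with
  | 0 => ⊥
  | r + 1 => (Jdeg k A M r).map e.d

/-- The Berezinian module `Ber(M) = H^n(J(M))` of a free supermodule `M` with a homogeneous basis of
`n` even and `m` odd vectors. -/
def HomBasis.Ber : Type _ := e.cocycles ⧸ e.coboundaries.comap e.cocycles.subtype

instance : AddCommGroup e.Ber :=
  inferInstanceAs (AddCommGroup (e.cocycles ⧸ e.coboundaries.comap e.cocycles.subtype))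

instance : Module k e.Ber :=
  inferInstanceAs (Module k (e.cocycles ⧸ e.coboundaries.comap e.cocycles.subtype))

/-- The class in `Ber(M)` of a cocycle. -/
def HomBasis.cls : e.cocycles →ₗ[k] e.Ber := Submodule.mkQ _

/-- The homogeneous component of parity `i` of `Ber(M)`. The cohomological degree `n` is not counted
in the parity, that is, each factor `π x` counts with the parity of `x`; so the class of
`π e_1 ⋯ π e_n e^{n+1} ⋯ e^{n+m}` has parity `m`. -/
def HomBasis.berPart (i : ZMod 2) : Submodule k e.Ber :=
  ((part k (J k A M) (i + n)).comap e.cocycles.subtype).map e.cls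

/-- The endomorphism `t` of `Ber(M)` is induced by the endomorphism `T` of `J(M)`: `T` preserves
cocycles, and `t` sends the class of `z` to the class of `T z`. -/
def HomBasis.Induces (T : J k A M →ₗ[k] J k A M) (t : Module.End k e.Ber) : Prop :=
  ∀ z : e.cocycles, ∃ hz : T z ∈ e.cocycles, t (e.cls z) = e.cls ⟨T z, hz⟩

end Ber

section LieDerivative

variable {k A : Type*} [Field k] [Ring A] [Algebra k A] [Superalgebra k A]
  [SuperCommutative k A] [NeZero (2 : k)]

variable (k A) in
/-- The dual `Der(A)^*` of the module of superderivations. -/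
abbrev DerDual : Type _ := SDual k A (Der k A)

/-- The action on `Der(A)^*` of a superderivation `D` of parity `i`, contragredient to the adjoint
action on `Der(A)`. -/
def lieDual {i : ZMod 2} {D : A →ₗ[k] A} (hD : IsSuperDer k i D) :
    DerDual k A →ₗ[k] DerDual k A := SDual.action hD (Der.isCovariant_ad hD)

theorem isCovariant_lieDual {i : ZMod 2} {D : A →ₗ[k] A} (hD : IsSuperDer k i D) :
    IsCovariant k i D (lieDual hD) := SDual.isCovariant hD (Der.isCovariant_ad hD)

/-- The Lie derivative along a superderivation `D` of parity `i`, as a superderivation of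
`J(Der(A)^*)`: it is `D` on `A`, and on `Π Der(A)^*` and `Der(A)^{**}` it is induced by the
adjoint action on `Der(A)`. -/
def lieDerivative {i : ZMod 2} {D : A →ₗ[k] A} (hD : IsSuperDer k i D) :
    J k A (DerDual k A) →ₗ[k] J k A (DerDual k A) :=
  SymAlg.action hD ((ParityShift.isCovariant 1 hD (isCovariant_lieDual hD)).prodMap
    (SDual.isCovariant hD (isCovariant_lieDual hD)))

end LieDerivative

section Action

variable {p : ℕ} {k g : Type*} [Field k] [AddCommGroup g] [Module k g]
  [LieSuperalgebra k g] [Restricted p k g] (h : RestrictedSub p k g)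
  [NeZero (2 : k)] [Fact p.Prime] [CharP k p]

/-- `δ_X` is a superderivation of `Coind(k)`. -/
theorem CoindAlg.isSuperDer_δ {i : ZMod 2} {x : g} (hx : x ∈ part k g i) :
    IsSuperDer k i (CoindAlg.δ h x) where
  parity a := CoindAlg.ext (by
    rw [map_zsmul, CoindAlg.fn_σ]
    exact mulRight_σ hx (CoindAlg.fn a))
  leibniz a b := CoindAlg.ext (by
    have h1 : CoindAlg.fn (σpow k i a) = CoindAlg.fn a ∘ₗ σpow k i := by
      rcases zmod_two_cases i with rfl | rfl <;> rfl
    rw [map_add, CoindAlg.fn_mul, CoindAlg.fn_mul, h1]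
    exact conv_mulRight (CoindAlg.fn a) (CoindAlg.fn b) hx)

end Action

end SuperLie

end

open SuperLie

noncomputable section

set_option linter.unusedSectionVars false

namespace SuperLie

/-! Think of `Coind(k)` as the algebra `𝒜` of functions on an infinitesimal homogeneous superspace
whose tangent space at the base point is `g/h`; the value of a function at the base point is `⟨1,
a⟩`. `Ber(Der(𝒜)^*)` is an equivariant line bundle on it: a free `𝒜`-module of rank one, on which
`g` acts compatibly with its action on `𝒜`. Such a module is coinduced from its fibre at the base
point, a character of `U'(h)`. The fibre has parity `m`, and the character is computed to be
`-strad`.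

Enough functions. The relations of `U'(g)` are oriented into a rewriting system on words in a
homogeneous basis of `g`. Its ambiguities are resolved by the Jacobi identity, by `[x, [x, x]] = 0`
for odd `x`, by `ad(x)^p = ad(x^[p])`, and by the commutation of `x^[p]` with `x` (`Red.confluent`).
If the letters of `h` come first, words beginning with such a letter reduce to combinations of words
of the same kind. Hence the coefficient of a one-letter normal word outside `h` is a functional that
vanishes on `h U'(g)` (`exists_functional`); these functionals are coordinates in `𝒜`. Functions are
then filtered by their order of vanishing at `1`. Leading terms of monomials in the coordinates are
dual, up to nonzero factors, to ordered products of the complementary vectors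
(`Coordinates.mon_apply_ne_zero_iff`). So every element of `Coind(V)` is a multiple of an element
whose value at `1` spans `V` (`Coordinates.exists_smulCoind_eq`), and multiplication by functions is
faithful on such an element when that value is nonzero (`eq_zero_of_smulCoind_eq_zero`). The matrix
`δ_X(x_b)` is the identity plus a nilpotent matrix, which makes `Der(𝒜)` free on the partial
derivatives.

The Berezinian. `J(M)` is a Koszul complex in pairs of an odd and an even variable. A contracting
homotopy for one pair at a time reduces every cocycle to a multiple of the product `vol` of the odd
variables (`SymAlg.exists_eq_of_kos_mul_eq_zero`), and iterated contraction gives a residue that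
kills coboundaries, so `Ber(M)` is free of rank one on the class of `vol`. The element defining the
differential is the canonical invariant of `ΠM ⊗ M^*`, so Lie derivatives supercommute with the
differential and act on `Ber`. They respect brackets and `p`-th powers, as do all the induced
actions, so that `U'(g)` acts.

Comparison. Let `λ` be the coefficient of `vol` at the base point. An element `ω` of `Ber` is sent
to the function `u ↦ λ(u ω)`; this is linear over `U'(g)` by construction, and over `𝒜` because both
sides obey the same Leibniz rule (`berFun_berMul`). The vector fields of `h` vanish at the base
point, so `h` acts on the fibre by scalars. This alone makes `U'(h)` act by a character, with no
separate check of compatibility with the `p`-operation. The fibre of `Der(𝒜)^*` at the base point is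
the dual of `g/h`, and a trace computation there identifies the character with `-strad`
(`Coordinates.lam_berLie_volCls`). The map is bijective because the class of `vol` generates `Ber`
and goes to a function with value `1` at `1`, which generates the coinduced module freely. -/

/-! # The diamond lemma -/

section Diamond

variable {k W T : Type*} [Field k] [AddCommGroup T] [Module k T] (v : Module.Basis W k T)
  {lt : W → W → Prop} (hwf : WellFounded lt) (Red : W → T → Prop)

/-- The span of the differences `w' - t`, where `w'` is reduced to `t` and `w' < w`. -/
def lowSpan (lt : W → W → Prop) (w : W) : Submodule k T :=
  Submodule.span k {z | ∃ w' t, Red w' t ∧ lt w' w ∧ z = v w' - t}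

/-- The normal form obtained by choosing a reduction of each reducible basis vector. -/
def normalForm : W → T :=
  open Classical in
  hwf.fix fun w rec => if h : ∃ t, Red w t then
    -- The recursion is available only below `w`; when reductions are decreasing, the default value
    -- `0` is never used.
    (v.repr h.choose).sum fun w' c => if hw : lt w' w then c • rec w' hw else 0
  else v w

variable {Red}

theorem span_image_induction {S : Set W} {P : T → Prop} (h0 : P 0) (hadd : ∀ x y, P x → P y → P (x + y))
    (hsmul : ∀ (c : k) x, P x → P (c • x)) (hS : ∀ w ∈ S, P (v w)) {t : T}
    (ht : t ∈ Submodule.span k (v '' S)) : P t := by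
  induction ht using Submodule.span_induction with
  | mem x h => obtain ⟨w, hw, rfl⟩ := h; exact hS w hw
  | zero => exact h0
  | add x y _ _ hx hy => exact hadd x y hx hy
  | smul c x _ hx => exact hsmul c x hx

theorem normalForm_irreducible {w : W} (h : ¬∃ t, Red w t) : normalForm v hwf Red w = v w := by
  rw [normalForm, WellFounded.fix_eq, dif_neg h]

theorem normalForm_reducible (hlt : ∀ w t, Red w t → t ∈ Submodule.span k (v '' {w' | lt w' w}))
    {w : W} (h : ∃ t, Red w t) :
    ∃ t, Red w t ∧ normalForm v hwf Red w = v.constr k (normalForm v hwf Red) t := by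
  refine ⟨h.choose, h.choose_spec, ?_⟩
  conv_lhs => rw [normalForm, WellFounded.fix_eq, dif_pos h]
  rw [Module.Basis.constr_apply]
  refine Finsupp.sum_congr fun w' hw' => ?_
  have := hlt w _ h.choose_spec
  rw [Module.Basis.mem_span_image] at this
  have h2 : lt w' w := this (by simpa using hw')
  rw [dif_pos h2]
  rfl

/-- By induction the normal form respects every reduction of smaller words, so it vanishes on
`lowSpan` at `w`. Two reductions of `w` differ by an element of that span, so the normal form does
not depend on the one that was chosen. -/
theorem normalForm_confluent
    (hlt : ∀ w t, Red w t → t ∈ Submodule.span k (v '' {w' | lt w' w}))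
    (hconf : ∀ w t t', Red w t → Red w t' → t - t' ∈ lowSpan v Red lt w) (w : W) (t : T)
    (h : Red w t) : normalForm v hwf Red w = v.constr k (normalForm v hwf Red) t := by
  revert t
  induction w using hwf.induction with
  | _ w ih =>
  intro t h
  obtain ⟨t', h', e⟩ := normalForm_reducible v hwf hlt ⟨t, h⟩
  rw [e]
  have hk : lowSpan v Red lt w ≤ LinearMap.ker (v.constr k (normalForm v hwf Red)) := by
    refine Submodule.span_le.2 ?_
    rintro _ ⟨w', s, hs, hw, rfl⟩
    rw [SetLike.mem_coe, LinearMap.mem_ker, map_sub, Module.Basis.constr_basis, ih w' hw s hs,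
      sub_self]
  have := hk (hconf w t' t h' h)
  rwa [LinearMap.mem_ker, map_sub, sub_eq_zero] at this

/-- A set of words stable under single reductions is stable under full reduction. It is used for the
words that begin with a letter of `h`. -/
theorem normalForm_mem
    (hlt : ∀ w t, Red w t → t ∈ Submodule.span k (v '' {w' | lt w' w})) {P : Set W}
    (hP : ∀ w t, w ∈ P → Red w t → t ∈ Submodule.span k (v '' P)) (w : W) (hw : w ∈ P) :
    normalForm v hwf Red w ∈ Submodule.span k (v '' P) := by
  induction w using hwf.induction with
  | _ w ih =>
  by_cases h : ∃ t, Red w t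
  · obtain ⟨t, ht, e⟩ := normalForm_reducible v hwf hlt h
    rw [e]
    have h1 := hlt w t ht
    have h2 := hP w t hw ht
    rw [Module.Basis.mem_span_image] at h1 h2
    rw [Module.Basis.constr_apply]
    exact Submodule.sum_mem _ fun w' hw' => Submodule.smul_mem _ _ (ih w' (h1 hw') (h2 hw'))
  · rw [normalForm_irreducible v hwf h]
    exact Submodule.subset_span ⟨w, hw, rfl⟩

/-- If a linear map respects the reductions, its values are spanned by those on irreducible basis
vectors. -/
theorem mem_span_irreducible (hwf : WellFounded lt) {V : Type*} [AddCommGroup V] [Module k V]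
    (htr : ∀ a b c, lt a b → lt b c → lt a c)
    (hlt : ∀ w t, Red w t → t ∈ Submodule.span k (v '' {w' | lt w' w})) (π : T →ₗ[k] V)
    (hπ : ∀ w t, Red w t → π (v w) = π t) (w : W) :
    π (v w) ∈ Submodule.span k {y | ∃ w', (¬∃ t, Red w' t) ∧ (w' = w ∨ lt w' w) ∧ y = π (v w')} := by
  induction w using hwf.induction with
  | _ w ih =>
  by_cases h : ∃ t, Red w t
  · obtain ⟨t, ht⟩ := h
    rw [hπ w t ht]
    refine span_image_induction v (P := fun t => π t ∈ _) ?_ ?_ ?_ ?_ (hlt w t ht)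
    · simp
    · intro x y hx hy; rw [map_add]; exact Submodule.add_mem _ hx hy
    · intro c x hx; rw [map_smul]; exact Submodule.smul_mem _ _ hx
    · intro w' hw'
      refine Submodule.span_mono ?_ (ih w' hw')
      rintro _ ⟨w'', h1, h2, rfl⟩
      refine ⟨w'', h1, Or.inr ?_, rfl⟩
      rcases h2 with rfl | h2
      · exact hw'
      · exact htr _ _ _ h2 hw'
  · exact Submodule.subset_span ⟨w, h, Or.inl rfl, rfl⟩

end Diamond

/-! # Jacobson's formula -/

section Jacobson

open Polynomial Finset

variable {p : ℕ} [Fact p.Prime]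

/-- Pascal's rule, with the inner binomial coefficients of `p` vanishing modulo `p`, makes
consecutive values opposite. -/
theorem neg_one_pow_eq_choose (R : Type*) [Ring R] [CharP R p] {i : ℕ} (hi : i < p) :
    (-1 : R) ^ i = ((p - 1).choose i : R) := by
  induction i with
  | zero => simp
  | succ i ih =>
    have hp : p - 1 + 1 = p := Nat.succ_pred_prime Fact.out
    have h1 : ((p - 1).choose i + (p - 1).choose (i + 1) : ℕ) = p.choose (i + 1) := by
      rw [← Nat.choose_succ_succ', hp]
    have h2 : ((p.choose (i + 1) : ℕ) : R) = 0 := by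
      rw [CharP.cast_eq_zero_iff R p]
      exact (Fact.out : p.Prime).dvd_choose_self (by omega) hi
    rw [← h1, Nat.cast_add, ← ih (by omega)] at h2
    rw [pow_succ, mul_neg_one]
    exact (eq_neg_of_add_eq_zero_right h2).symm

/-- In characteristic `p`, `ad(u)^(p-1) = ∑ L_u^i R_u^(p-1-i)`. -/
theorem Commute.sub_pow_pred {R : Type*} [Ring R] [CharP R p] {x y : R} (h : Commute x y) :
    (x - y) ^ (p - 1) = ∑ i ∈ range p, x ^ i * y ^ (p - 1 - i) := by
  have hp : p - 1 + 1 = p := Nat.succ_pred_prime Fact.out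
  have h1 : (-1 : R) ^ (p - 1) = 1 := by
    rw [neg_one_pow_eq_choose R (p := p) (by omega)]; simp
  rw [sub_eq_add_neg, (h.neg_right).add_pow, hp]
  refine sum_congr rfl fun i hi => ?_
  have hi : i < p := mem_range.1 hi
  rw [neg_pow y, ← neg_one_pow_eq_choose R hi, mul_assoc, mul_assoc]
  congr 1
  rw [((Commute.neg_one_left _).pow_left _).eq, mul_assoc, ← pow_add,
    show i + (p - 1 - i) = p - 1 by omega, h1, mul_one]

/-- Left and right multiplication by `u` commute, and their difference is the commutator with `u`;
`Commute.sub_pow_pred` is applied to them. -/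
theorem sum_pow_mul_pow_eq_ad {R : Type*} [Ring R] [CharP R p] (u a : R) :
    ∑ i ∈ range p, u ^ i * a * u ^ (p - 1 - i) = (fun z => u * z - z * u)^[p - 1] a := by
  have hc : Commute (LinearMap.mulLeft ℤ u) (LinearMap.mulRight ℤ u) := by
    ext z; simp [mul_assoc]
  have : CharP (Module.End ℤ R) p := by
    refine ⟨fun n => ?_⟩
    rw [← CharP.cast_eq_zero_iff R p]
    constructor
    · intro h
      have := LinearMap.congr_fun h (1 : R)
      simpa using this
    · intro h
      ext z
      simp [h]
  have h1 := LinearMap.congr_fun (Commute.sub_pow_pred (p := p) hc) a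
  have h2 : ∀ n, ∀ z : R, ((LinearMap.mulLeft ℤ u - LinearMap.mulRight ℤ u) ^ n) z =
      (fun z => u * z - z * u)^[n] z := by
    intro n
    induction n with
    | zero => intro z; rfl
    | succ n ih => intro z; rw [pow_succ, Function.iterate_succ_apply, Module.End.mul_apply, ih]; rfl
  rw [h2, LinearMap.sum_apply] at h1
  rw [h1]
  refine sum_congr rfl fun i _ => ?_
  rw [Module.End.mul_apply, LinearMap.pow_mulLeft, LinearMap.pow_mulRight]
  simp [mul_assoc]

theorem derivative_pow_noncomm {R : Type*} [Ring R] (u : R[X]) (n : ℕ) :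
    derivative (u ^ n) = ∑ i ∈ range n, u ^ i * derivative u * u ^ (n - 1 - i) := by
  induction n with
  | zero => simp
  | succ n ih =>
    rw [pow_succ, derivative_mul, ih, sum_range_succ, sum_mul]
    congr 1
    · refine sum_congr rfl fun i hi => ?_
      have := mem_range.1 hi
      rw [mul_assoc, ← pow_succ, show n - 1 - i + 1 = n + 1 - 1 - i by omega]
    · simp

/-- Jacobson's formula for `(x + y)^p` in an associative algebra. -/
theorem add_pow_jacobson {k R : Type*} [Field k] [CharP k p] [Ring R] [Algebra k R] (x y : R)
    (c : ℕ → ℕ → R) (h00 : c 0 0 = x) (h0 : ∀ j, c 0 (j + 1) = 0)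
    (hr0 : ∀ r, c (r + 1) 0 = y * c r 0 - c r 0 * y)
    (hr : ∀ r j, c (r + 1) (j + 1) = (x * c r j - c r j * x) +
      (y * c r (j + 1) - c r (j + 1) * y)) :
    (x + y) ^ p = x ^ p + y ^ p + ∑ j ∈ range (p - 1), ((j + 1 : ℕ) : k)⁻¹ • c (p - 1) j := by
  rcases subsingleton_or_nontrivial R with _ | _
  · exact Subsingleton.elim _ _
  have : CharP R p := charP_of_injective_algebraMap' k p
  have hp1 : 1 ≤ p := (Fact.out : p.Prime).one_le
  -- The derivative of `(x t + y)^p` is `ad(x t + y)^(p-1) x`, so `j + 1` times its coefficient at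
  -- `t^(j+1)` is `c (p - 1) j`. The extreme coefficients are `x^p` and `y^p`, and `t = 1` gives the
  -- formula.
  let u : R[X] := C x * X + C y
  have hXu : ∀ q : R[X], u * q = C x * (q * X) + C y * q := by
    intro q; simp only [u, add_mul, mul_assoc, (commute_X q).eq]
  have huX : ∀ q : R[X], q * u = (q * C x) * X + q * C y := by
    intro q; simp only [u, mul_add, mul_assoc]
  have hc : ∀ r j, ((fun z => u * z - z * u)^[r] (C x)).coeff j = c r j := by
    intro r
    induction r with
    | zero =>
      intro j
      cases j with
      | zero => simp [h00]
      | succ j => simp [h0]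
    | succ r ih =>
      intro j
      rw [Function.iterate_succ_apply']
      cases j with
      | zero => simp [hXu, huX, hr0, ← ih]
      | succ j => simp [hXu, huX, hr, ← ih]; abel
  have hd : derivative (u ^ p) = (fun z => u * z - z * u)^[p - 1] (C x) := by
    rw [derivative_pow_noncomm, ← sum_pow_mul_pow_eq_ad]
    simp [u]
  have hcoef : ∀ j, j < p - 1 → (u ^ p).coeff (j + 1) = ((j + 1 : ℕ) : k)⁻¹ • c (p - 1) j := by
    intro j hj
    have h1 := congrArg (fun q => coeff q j) hd
    simp only [coeff_derivative, hc] at h1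
    rw [← h1]
    have hne : ((j + 1 : ℕ) : k) ≠ 0 := by
      rw [Ne, CharP.cast_eq_zero_iff k p]
      intro hdvd
      have := Nat.le_of_dvd (by omega) hdvd
      omega
    rw [← Nat.cast_succ, ← (Nat.cast_commute _ _).eq, ← nsmul_eq_mul, ← Nat.cast_smul_eq_nsmul k,
      smul_smul, inv_mul_cancel₀ hne, one_smul]
  have hdeg : ∀ n, ((u ^ n).natDegree ≤ n) ∧ (u ^ n).coeff n = x ^ n ∧ (u ^ n).coeff 0 = y ^ n := by
    intro n
    induction n with
    | zero => simp
    | succ n ih =>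
      obtain ⟨h1, h2, h3⟩ := ih
      refine ⟨?_, ?_, ?_⟩
      · rw [pow_succ]
        refine natDegree_mul_le.trans ?_
        have : u.natDegree ≤ 1 := natDegree_linear_le
        omega
      · rw [pow_succ, huX, coeff_add, coeff_mul_X, coeff_mul_C, coeff_mul_C, h2,
          coeff_eq_zero_of_natDegree_lt (by omega), zero_mul, add_zero, pow_succ]
      · rw [pow_succ, huX, coeff_add, mul_coeff_zero, coeff_mul_C, h3]
        simp [pow_succ, h3]
  have heval : (x + y) ^ p = ∑ j ∈ range (p + 1), (u ^ p).coeff j := by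
    -- Evaluation at `1` is multiplicative although `R` is not commutative, because `1` is central.
    let φ : R[X] →+* R := eval₂RingHom' (RingHom.id R) 1 (fun a => Commute.one_right a)
    have h1 : φ (u ^ p) = (x + y) ^ p := by
      rw [map_pow]
      congr 1
      simp [φ, u, eval₂RingHom']
    rw [← h1]
    change eval₂ (RingHom.id R) 1 (u ^ p) = _
    rw [eval₂_eq_sum_range' _ (Nat.lt_succ_of_le (hdeg p).1)]
    simp
  rw [heval, sum_range_succ, (hdeg p).2.1, show p = p - 1 + 1 by omega, sum_range_succ',
    ← show p = p - 1 + 1 by omega, (hdeg p).2.2, sum_congr rfl fun j hj => hcoef j (mem_range.1 hj)]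
  abel

end Jacobson

/-! # Words and inversions -/

section Words

variable {B : Type*} [LinearOrder B]

/-- The number of inversions of a word. -/
def inversions : List B → ℕ
  | [] => 0
  | a :: l => l.countP (· < a) + inversions l

theorem inversions_append (u v : List B) : inversions (u ++ v) =
    inversions u + inversions v + (u.map fun a => v.countP (· < a)).sum := by
  induction u with
  | nil => simp [inversions]
  | cons a u ih => simp [inversions, ih]; omega

/-- The order of words used for the reductions: shorter words are smaller, and permuting the
letters to lower the number of inversions makes a word smaller. -/
def wordLT (w' w : List B) : Prop :=
  w'.length < w.length ∨ (w'.Perm w ∧ inversions w' < inversions w)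

theorem wordLT_wf : WellFounded (wordLT (B := B)) := by
  refine Subrelation.wf (r := InvImage (Prod.Lex (· < ·) (· < ·))
    (fun w : List B => (w.length, inversions w))) ?_ (InvImage.wf _ (WellFounded.prod_lex
      wellFounded_lt wellFounded_lt))
  intro w' w h
  rcases h with h | ⟨h, h'⟩
  · exact Prod.Lex.left _ _ h
  · have := h.length_eq
    simp only [InvImage, this]
    exact Prod.Lex.right _ h'

theorem wordLT_trans (a b c : List B) (h : wordLT a b) (h' : wordLT b c) : wordLT a c := by
  rcases h with h | ⟨h, h2⟩ <;> rcases h' with h' | ⟨h', h2'⟩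
  · exact Or.inl (h.trans h')
  · exact Or.inl (h'.length_eq ▸ h)
  · exact Or.inl (h.length_eq ▸ h')
  · exact Or.inr ⟨h.trans h', h2.trans h2'⟩

theorem wordLT.length_le {a b : List B} (h : wordLT a b) : a.length ≤ b.length := by
  rcases h with h | ⟨h, h2⟩
  · exact h.le
  · exact h.length_eq.le

/-- The inversions between the middle word and its context depend only on the multiset of letters of
the middle word, so a permutation changes the count only inside. -/
theorem wordLT.context {w' w : List B} (h : wordLT w' w) (u v : List B) :
    wordLT (u ++ w' ++ v) (u ++ w ++ v) := by
  rcases h with h | ⟨h, h2⟩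
  · left; simp only [List.length_append]; omega
  · refine Or.inr ⟨(h.append_left u).append_right v, ?_⟩
    simp only [inversions_append, List.map_append, List.sum_append, h.countP_eq]
    have := (h.map fun a => v.countP (· < a)).sum_eq
    omega

theorem inversions_replicate (n : ℕ) (x : B) : inversions (List.replicate n x) = 0 := by
  induction n with
  | zero => rfl
  | succ n ih => simp [List.replicate_succ, inversions, ih, List.countP_replicate]

theorem wordLT_replicate_right {x z : B} (h : z < x) {m : ℕ} (hm : m ≠ 0) :
    wordLT (z :: List.replicate m x) (List.replicate m x ++ [z]) := by
  refine Or.inr ⟨(List.perm_append_comm (l₁ := [z])), ?_⟩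
  simp only [inversions_append, inversions, inversions_replicate, List.countP_replicate]
  simp [h, h.not_gt, hm, Nat.pos_iff_ne_zero]

theorem wordLT_replicate_left {x z : B} (h : z < x) {m : ℕ} (hm : m ≠ 0) :
    wordLT (List.replicate m z ++ [x]) (x :: List.replicate m z) := by
  refine Or.inr ⟨(List.perm_append_comm (l₂ := [x])), ?_⟩
  simp only [inversions_append, inversions, inversions_replicate, List.countP_replicate]
  simp [h, h.not_gt, hm, Nat.pos_iff_ne_zero]

theorem wordLT_swap {x z : B} (h : z < x) : wordLT [z, x] [x, z] :=
  wordLT_replicate_right h one_ne_zero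

end Words

/-! # The reductions of the restricted enveloping superalgebra -/

section Rules

theorem br_mem_part {k g : Type*} [Field k] [AddCommGroup g] [Module k g] [LieSuperalgebra k g]
    {i j : ZMod 2} {x y : g} (hx : x ∈ part k g i) (hy : y ∈ part k g j) :
    br k x y ∈ part k g (i + j) := by
  rw [mem_part] at *
  rw [σ_br, hx, hy, sgn_add]
  simp [smul_smul, mul_comm]

variable {p : ℕ} {k g B : Type*} [Field k] [AddCommGroup g] [Module k g] [LieSuperalgebra k g]
  [Restricted p k g] [NeZero (2 : k)] [Fact p.Prime] [CharP k p] [LinearOrder B]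

/-- The word `w` as an element of the free algebra. -/
def word (k : Type*) [Field k] {B : Type*} (w : List B) : FreeAlgebra k B :=
  (w.map (FreeAlgebra.ι k)).prod

theorem word_append (u v : List B) : word k (u ++ v) = word k u * word k v := by simp [word]
@[simp] theorem word_nil : word k ([] : List B) = 1 := rfl
theorem word_singleton (x : B) : word k [x] = FreeAlgebra.ι k x := by simp [word]
theorem word_pair (x y : B) : word k [x, y] = FreeAlgebra.ι k x * FreeAlgebra.ι k y := by
  simp [word]
theorem word_replicate (n : ℕ) (x : B) : word k (List.replicate n x) = FreeAlgebra.ι k x ^ n := by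
  simp [word]

variable (k B) in
/-- The basis of the free algebra that consists of the words. -/
def wordBasis : Module.Basis (List B) k (FreeAlgebra k B) :=
  (FreeAlgebra.basisFreeMonoid k B).reindex FreeMonoid.toList

@[simp] theorem wordBasis_apply (w : List B) : wordBasis k B w = word k w := by
  rw [wordBasis, Module.Basis.reindex_apply]
  simp only [FreeAlgebra.basisFreeMonoid, Module.Basis.map_apply, Finsupp.basisSingleOne]
  change (FreeAlgebra.equivMonoidAlgebraFreeMonoid (R := k) (X := B)).symm
    (MonoidAlgebra.single (FreeMonoid.ofList w) 1) = _
  rw [AlgEquiv.symm_apply_eq]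
  simp only [word, map_list_prod, List.map_map]
  induction w with
  | nil => rfl
  | cons a w ih =>
    rw [List.map_cons, List.prod_cons, ← ih]
    simp [FreeAlgebra.equivMonoidAlgebraFreeMonoid, MonoidAlgebra.single_mul_single]

variable (k B) in
/-- The span of the words of length at most `d`. -/
def wordLE (d : ℕ) : Submodule k (FreeAlgebra k B) :=
  Submodule.span k (word k '' {w | w.length ≤ d})

theorem word_mem_wordLE (w : List B) : word k w ∈ wordLE k B w.length :=
  Submodule.subset_span ⟨w, le_refl w.length, rfl⟩

theorem one_mem_wordLE : (1 : FreeAlgebra k B) ∈ wordLE k B 0 := word_mem_wordLE []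

theorem mul_mem_wordLE {d e : ℕ} {s t : FreeAlgebra k B} (hs : s ∈ wordLE k B d)
    (ht : t ∈ wordLE k B e) : s * t ∈ wordLE k B (d + e) := by
  have : wordLE k B d * wordLE k B e ≤ wordLE k B (d + e) := by
    rw [wordLE, wordLE, Submodule.span_mul_span]
    refine Submodule.span_mono ?_
    rintro _ ⟨_, ⟨u, hu, rfl⟩, _, ⟨v, hv, rfl⟩, rfl⟩
    refine ⟨u ++ v, ?_, word_append u v⟩
    simp only [Set.mem_ofPred_eq, List.length_append] at *
    omega
  exact this (Submodule.mul_mem_mul hs ht)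

variable (b : Module.Basis B k g)

/-- The linear embedding of `g` into the free algebra on a basis. -/
def emb : g →ₗ[k] FreeAlgebra k B := b.constr k (FreeAlgebra.ι k)

@[simp] theorem emb_basis (x : B) : emb b (b x) = FreeAlgebra.ι k x := by simp [emb]

theorem emb_mem_wordLE (x : g) : emb b x ∈ wordLE k B 1 := by
  rw [emb, Module.Basis.constr_apply]
  refine Submodule.sum_mem _ fun i _ => Submodule.smul_mem _ _ ?_
  rw [← word_singleton]
  exact word_mem_wordLE [i]

/-- The relator `xy - (-1)^(|x||y|) yx - [x, y]`. -/
def rel : g →ₗ[k] g →ₗ[k] FreeAlgebra k B :=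
  -- The sign is produced by splitting `x` into parity components and applying `σ` to `y` on the odd
  -- one. This makes the relator bilinear without any homogeneity assumption.
  LinearMap.mk₂ k (fun x y => emb b x * emb b y - (emb b y * emb b (comp k 0 x) +
      emb b (σ k y) * emb b (comp k 1 x)) - emb b (br k x y))
    (fun x x' y => by simp only [map_add, LinearMap.add_apply, add_mul, mul_add]; abel)
    (fun c x y => by
      simp only [map_smul, LinearMap.smul_apply, smul_mul_assoc, mul_smul_comm, smul_sub, smul_add])
    (fun x y y' => by simp only [map_add, add_mul, mul_add]; abel)
    (fun c x y => by
      simp only [map_smul, smul_mul_assoc, mul_smul_comm, smul_sub, smul_add])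

theorem rel_apply (x y : g) : rel b x y = emb b x * emb b y - (emb b y * emb b (comp k 0 x) +
      emb b (σ k y) * emb b (comp k 1 x)) - emb b (br k x y) := rfl

theorem rel_of_mem {i j : ZMod 2} {x y : g} (hx : x ∈ part k g i) (hy : y ∈ part k g j) :
    rel b x y = emb b x * emb b y - sgn (i * j) • (emb b y * emb b x) - emb b (br k x y) := by
  rw [rel_apply]
  rcases zmod_two_cases i with rfl | rfl
  · rw [comp_of_mem k hx, comp_of_mem_ne k hx (by decide)]; simp
  · rw [comp_of_mem k hx, comp_of_mem_ne k hx (by decide), mem_part.1 hy]; simp [mul_assoc]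

theorem rel_even {x : g} (hx : x ∈ part k g 0) (y : g) :
    rel b x y = emb b x * emb b y - emb b y * emb b x - emb b (br k x y) := by
  rw [rel_apply, comp_of_mem k hx, comp_of_mem_ne k hx (by decide)]; simp

theorem rel_skew {i j : ZMod 2} {x y : g} (hx : x ∈ part k g i) (hy : y ∈ part k g j) :
    rel b x y = -(sgn (i * j) • rel b y x) := by
  have h : br k x y = -(sgn (i * j) • br k y x) := LieSuperalgebra.skew hx hy
  rw [rel_of_mem b hx hy, rel_of_mem b hy hx, h, map_neg, map_zsmul]
  rcases zmod_two_cases i with rfl | rfl <;> rcases zmod_two_cases j with rfl | rfl <;> simp <;> abel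

theorem rel_self_even {x : g} (hx : x ∈ part k g 0) : rel b x x = 0 := by
  have h := rel_skew b hx hx
  simp only [mul_zero, sgn_zero, one_smul] at h
  have h2 : (2 : k) • rel b x x = 0 := by
    rw [two_smul]; nth_rewrite 1 [h]; exact neg_add_cancel _
  exact (smul_eq_zero.1 h2).resolve_left (NeZero.ne _)

/-- The Jacobi identity for the relators. -/
theorem rel_jacobi {i j l : ZMod 2} {x y z : g} (hx : x ∈ part k g i) (hy : y ∈ part k g j)
    (hz : z ∈ part k g l) :
    rel b x y * emb b z - emb b x * rel b y z =
      -(sgn (i * j) • (emb b y * rel b x z)) - sgn (i * j) • sgn (i * l) • (rel b y z * emb b x) +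
      sgn (j * l) • (rel b x z * emb b y) + sgn (i * l) • sgn (j * l) • (emb b z * rel b x y) +
      (rel b x (br k y z) - rel b (br k x y) z - sgn (i * j) • rel b y (br k x z)) := by
  have hJ : br k x (br k y z) = br k (br k x y) z + sgn (i * j) • br k y (br k x z) :=
    LieSuperalgebra.jacobi z hx hy
  rw [rel_of_mem b hx hy, rel_of_mem b hy hz, rel_of_mem b hx hz,
    rel_of_mem b hx (br_mem_part hy hz), rel_of_mem b (br_mem_part hx hy) hz,
    rel_of_mem b hy (br_mem_part hx hz), hJ, map_add, map_zsmul]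
  rcases zmod_two_cases i with rfl | rfl <;> rcases zmod_two_cases j with rfl | rfl <;>
    rcases zmod_two_cases l with rfl | rfl <;>
    simp only [mul_zero, mul_one, add_zero, zero_add, one_add_one, sgn_zero, sgn_one,
      one_smul, neg_smul, neg_neg, sub_neg_eq_add] <;> noncomm_ring

end Rules

theorem map_mem_of_basis {k V T I : Type*} [Field k] [AddCommGroup V] [Module k V] [AddCommGroup T]
    [Module k T] (b : Module.Basis I k V) (f : V →ₗ[k] T) (S : Submodule k T)
    (h : ∀ i, f (b i) ∈ S) (x : V) : f x ∈ S := by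
  have : Submodule.span k (Set.range b) ≤ S.comap f :=
    Submodule.span_le.2 (by rintro _ ⟨i, rfl⟩; exact h i)
  rw [b.span_eq] at this
  exact this trivial

theorem smul_mem_iff_of_ne_zero (k : Type*) {T : Type*} [Field k] [AddCommGroup T] [Module k T]
    (S : Submodule k T) {c : k} (hc : c ≠ 0) {t : T} : c • t ∈ S ↔ t ∈ S :=
  ⟨fun h => by simpa [smul_smul, hc] using S.smul_mem c⁻¹ h, S.smul_mem c⟩

section Rules

variable {p : ℕ} {k g B : Type*} [Field k] [AddCommGroup g] [Module k g] [LieSuperalgebra k g]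
  [Restricted p k g] [NeZero (2 : k)] [Fact p.Prime] [CharP k p] [LinearOrder B]
  (b : Module.Basis B k g) {par : B → ZMod 2} (hb : ∀ x, b x ∈ part k g (par x))

/-- The coefficient of the relator in the reduction of `xy`. -/
def relCoeff (k : Type*) [Field k] {B : Type*} [LinearOrder B] (x y : B) : k :=
  if x = y then (2 : k)⁻¹ else 1

variable (p) in
/-- The reductions: `xy ↦ (-1)^(|x||y|) yx + [x, y]` for `x > y`, `xx ↦ [x, x] / 2` for odd `x`, and
`x^p ↦ x^[p]` for even `x`. -/
inductive Rule : List B → FreeAlgebra k B → Prop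
  | comm (x y : B) (h : y < x ∨ (x = y ∧ par x = 1)) :
      Rule [x, y] (word k [x, y] - relCoeff k x y • rel b (b x) (b y))
  | pow (x : B) (h : par x = 0) : Rule (List.replicate p x)
      (emb b (Restricted.pmap p (⟨b x, h ▸ hb x⟩ : part k g 0) : part k g 0))

variable (p) in
/-- One step reduction of words. -/
def Red (w : List B) (t : FreeAlgebra k B) : Prop :=
  ∃ u l v r, Rule p b hb l r ∧ w = u ++ l ++ v ∧ t = word k u * r * word k v

variable (k) in
/-- The span of the words smaller than `w`. -/
def below (w : List B) : Submodule k (FreeAlgebra k B) :=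
  Submodule.span k (wordBasis k B '' {w' | wordLT w' w})

theorem word_mem_below {w' w : List B} (h : wordLT w' w) : word k w' ∈ below k w :=
  Submodule.subset_span ⟨w', h, wordBasis_apply w'⟩

theorem wordLE_le_below {d : ℕ} {w : List B} (h : d < w.length) : wordLE k B d ≤ below k w := by
  refine Submodule.span_le.2 ?_
  rintro _ ⟨w', hw', rfl⟩
  exact word_mem_below (Or.inl (lt_of_le_of_lt hw' h))

theorem below_context {w : List B} {t : FreeAlgebra k B} (ht : t ∈ below k w) (u v : List B) :
    word k u * t * word k v ∈ below k (u ++ w ++ v) := by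
  refine span_image_induction (wordBasis k B)
    (P := fun t => word k u * t * word k v ∈ below k (u ++ w ++ v)) ?_ ?_ ?_ ?_ ht
  · simp
  · intro x y hx hy; rw [mul_add, add_mul]; exact Submodule.add_mem _ hx hy
  · intro c x hx; rw [mul_smul_comm, smul_mul_assoc]; exact Submodule.smul_mem _ _ hx
  · intro w' hw'
    rw [wordBasis_apply, ← word_append, ← word_append]
    exact word_mem_below (wordLT.context hw' u v)

-- For odd `x` the relator of `x` with itself is `2 xx - [x, x]`, so half of it must be subtracted
-- to replace `xx` by `[x, x] / 2`. This is the explicit form of the right side of a rule.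
include hb in
theorem relCoeff_smul_rel {x y : B} (h : y < x ∨ (x = y ∧ par x = 1)) :
    word k [x, y] - relCoeff k x y • rel b (b x) (b y) =
      if x = y then (2 : k)⁻¹ • emb b (br k (b x) (b y)) else
        sgn (par x * par y) • word k [y, x] + emb b (br k (b x) (b y)) := by
  rcases h with h | ⟨rfl, h⟩
  · rw [relCoeff, if_neg h.ne', if_neg h.ne', one_smul, rel_of_mem b (hb x) (hb y), word_pair,
      word_pair]
    simp only [emb_basis]
    abel
  · rw [relCoeff, if_pos rfl, if_pos rfl, rel_of_mem b (hb x) (hb x), word_pair, h]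
    simp only [emb_basis, mul_one, sgn_one, neg_smul, one_smul, sub_neg_eq_add, smul_sub, smul_add]
    have h2 : ∀ z : FreeAlgebra k B, (2 : k)⁻¹ • z + (2 : k)⁻¹ • z = z := fun z => by
      rw [← smul_add, ← two_smul k z, smul_smul, inv_mul_cancel₀ (NeZero.ne (2 : k)), one_smul]
    rw [h2]
    simp

theorem Rule.below {l : List B} {r : FreeAlgebra k B} (h : Rule p b hb l r) : r ∈ below k l := by
  cases h with
  | comm x y h =>
    rw [relCoeff_smul_rel b hb h]
    have h1 : ∀ z, emb b z ∈ SuperLie.below k [x, y] := fun z =>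
      wordLE_le_below (by simp) (emb_mem_wordLE b z)
    split_ifs with hxy
    · exact Submodule.smul_mem _ _ (h1 _)
    · refine Submodule.add_mem _ (Submodule.smul_of_tower_mem _ _ ?_) (h1 _)
      exact word_mem_below (wordLT_swap (h.resolve_right fun h => hxy h.1))
  | pow x h =>
    refine wordLE_le_below ?_ (emb_mem_wordLE b _)
    simpa using (Fact.out : p.Prime).one_lt

theorem Red.below {w : List B} {t : FreeAlgebra k B} (h : Red p b hb w t) :
    t ∈ Submodule.span k (wordBasis k B '' {w' | wordLT w' w}) := by
  obtain ⟨u, l, v, r, hr, rfl, rfl⟩ := h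
  exact below_context (hr.below) u v

variable (p) in
/-- The span of the `w' - t` with `w'` reducing to `t` and `w' < w`. -/
abbrev low (w : List B) : Submodule k (FreeAlgebra k B) :=
  lowSpan (wordBasis k B) (Red p b hb) wordLT w

theorem low_of_rule {u l v w : List B} {r : FreeAlgebra k B} (hr : Rule p b hb l r)
    (h : wordLT (u ++ l ++ v) w) : word k u * (word k l - r) * word k v ∈ low p b hb w := by
  refine Submodule.subset_span ⟨u ++ l ++ v, word k u * r * word k v, ⟨u, l, v, r, hr, rfl, rfl⟩, h, ?_⟩
  rw [wordBasis_apply, word_append, word_append, mul_sub, sub_mul]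

theorem low_context {w : List B} {t : FreeAlgebra k B} (ht : t ∈ low p b hb w) (u v : List B) :
    word k u * t * word k v ∈ low p b hb (u ++ w ++ v) := by
  induction ht using Submodule.span_induction with
  | mem x h =>
    obtain ⟨w', t, ⟨u', l, v', r, hr, rfl, rfl⟩, hlt, rfl⟩ := h
    have := low_of_rule b hb (u := u ++ u') (v := v' ++ v) hr (w := u ++ w ++ v)
      (by simpa using hlt.context u v)
    simp only [word_append, wordBasis_apply] at this ⊢
    convert this using 1
    noncomm_ring
  | zero => simp
  | add x y _ _ hx hy => rw [mul_add, add_mul]; exact Submodule.add_mem _ hx hy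
  | smul c x _ hx => rw [mul_smul_comm, smul_mul_assoc]; exact Submodule.smul_mem _ _ hx

/-- `u (xy - r) v` for a pair of letters `x > y`, or odd `x = y`. -/
theorem low_of_rel {x y : B} (h : y < x ∨ (x = y ∧ par x = 1)) {u v w : List B}
    (hlt : wordLT (u ++ [x, y] ++ v) w) :
    word k u * rel b (b x) (b y) * word k v ∈ low p b hb w := by
  have h1 := low_of_rule b hb (p := p) (Rule.comm x y h) hlt
  rw [sub_sub_cancel, mul_smul_comm, smul_mul_assoc] at h1
  have h2 : relCoeff k x y ≠ 0 := by
    rw [relCoeff]; split_ifs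
    · exact inv_ne_zero (NeZero.ne _)
    · exact one_ne_zero
  simpa [smul_smul, h2] using Submodule.smul_mem _ (relCoeff k x y)⁻¹ h1

/-- By bilinearity it suffices to treat pairs of letters. A pair in increasing order is turned
around by skew symmetry, and an equal even pair gives zero. In the context of shorter words no
inversions need be counted, so arbitrary `x` and `y` are allowed. -/
theorem low_of_length_words {u v w : List B} (h : u.length + v.length + 2 < w.length) (x y : g) :
    word k u * rel b x y * word k v ∈ low p b hb w := by
  have hlt : ∀ x y : B, wordLT (u ++ [x, y] ++ v) w := fun x y => Or.inl (by simp; omega)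
  have hbasis : ∀ x y : B, word k u * rel b (b x) (b y) * word k v ∈ low p b hb w := by
    intro x y
    rcases lt_trichotomy x y with h | rfl | h
    · rw [rel_skew b (hb x) (hb y), mul_neg, neg_mul, mul_smul_comm, smul_mul_assoc]
      exact Submodule.neg_mem _ (Submodule.smul_of_tower_mem _ _
        (low_of_rel b hb (Or.inl h) (hlt _ _)))
    · rcases zmod_two_cases (par x) with h0 | h1
      · rw [rel_self_even b (h0 ▸ hb x)]; simp
      · exact low_of_rel b hb (Or.inr ⟨rfl, h1⟩) (hlt _ _)
    · exact low_of_rel b hb (Or.inl h) (hlt _ _)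
  refine map_mem_of_basis b (LinearMap.mulRight k (word k v) ∘ₗ LinearMap.mulLeft k (word k u) ∘ₗ
    (rel b).flip y) _ (fun i => ?_) x
  exact map_mem_of_basis b (LinearMap.mulRight k (word k v) ∘ₗ LinearMap.mulLeft k (word k u) ∘ₗ
    rel b (b i)) _ (hbasis i) y

theorem low_of_length {d e : ℕ} {s t : FreeAlgebra k B} (hs : s ∈ wordLE k B d)
    (ht : t ∈ wordLE k B e) {w : List B} (h : d + e + 2 < w.length) (x y : g) :
    s * rel b x y * t ∈ low p b hb w := by
  induction hs using Submodule.span_induction with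
  | mem s hs =>
    obtain ⟨u, hu, rfl⟩ := hs
    have hu : u.length ≤ d := hu
    induction ht using Submodule.span_induction with
    | mem t ht =>
      obtain ⟨v, hv, rfl⟩ := ht
      have hv : v.length ≤ e := hv
      exact low_of_length_words b hb (by omega) x y
    | zero => simp
    | add x y _ _ hx hy => rw [mul_add]; exact Submodule.add_mem _ hx hy
    | smul c x _ hx => rw [mul_smul_comm]; exact Submodule.smul_mem _ _ hx
  | zero => simp
  | add x y _ _ hx hy => rw [add_mul, add_mul]; exact Submodule.add_mem _ hx hy
  | smul c x _ hx => rw [smul_mul_assoc, smul_mul_assoc]; exact Submodule.smul_mem _ _ hx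

/-! ## Resolution of the ambiguities -/

theorem low_of_rel_pair {w : List B} (h : 2 < w.length) (x y : g) :
    rel b x y ∈ low p b hb w := by
  simpa using low_of_length b hb (p := p) one_mem_wordLE one_mem_wordLE (by simpa using h) x y

theorem low_of_rel' {x y : B} (h : y < x ∨ (x = y ∧ par x = 1)) {u v w : List B}
    (hlt : wordLT (u ++ [x, y] ++ v) w) {s t : FreeAlgebra k B} (hs : s = word k u)
    (ht : t = word k v) : s * rel b (b x) (b y) * t ∈ low p b hb w := by
  subst hs ht; exact low_of_rel b hb h hlt

/-- The ambiguity `xyz` is the Jacobi identity `rel_jacobi`: it rewrites the difference of the two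
reductions by relators on strictly smaller rearrangements of `xyz` and on words of length two.
Repeated odd letters need separate cases because of the factor `1/2`. -/
theorem overlap_comm_comm {x y z : B} (h : y < x ∨ (x = y ∧ par x = 1))
    (h' : z < y ∨ (y = z ∧ par y = 1)) :
    (word k [x, y] - relCoeff k x y • rel b (b x) (b y)) * word k [z] -
      word k [x] * (word k [y, z] - relCoeff k y z • rel b (b y) (b z)) ∈
        low p b hb ([x] ++ [y] ++ [z]) := by
  have hJ := rel_jacobi b (hb x) (hb y) (hb z)
  have hL : rel b (b x) (br k (b y) (b z)) - rel b (br k (b x) (b y)) (b z) -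
      sgn (par x * par y) • rel b (b y) (br k (b x) (b z)) ∈ low p b hb [x, y, z] :=
    Submodule.sub_mem _ (Submodule.sub_mem _ (low_of_rel_pair b hb (by simp) _ _)
      (low_of_rel_pair b hb (by simp) _ _)) (Submodule.smul_of_tower_mem _ _
      (low_of_rel_pair b hb (by simp) _ _))
  generalize rel b (b x) (br k (b y) (b z)) - rel b (br k (b x) (b y)) (b z) -
      sgn (par x * par y) • rel b (b y) (br k (b x) (b z)) = L at hJ hL
  simp only [emb_basis] at hJ
  have e : (word k [x, y] - relCoeff k x y • rel b (b x) (b y)) * word k [z] -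
      word k [x] * (word k [y, z] - relCoeff k y z • rel b (b y) (b z)) =
      relCoeff k y z • (FreeAlgebra.ι k x * rel b (b y) (b z)) -
      relCoeff k x y • (rel b (b x) (b y) * FreeAlgebra.ι k z) := by
    simp only [word_pair, word_singleton, sub_mul, mul_sub, smul_mul_assoc, mul_smul_comm, mul_assoc]
    abel
  rw [e]
  change _ ∈ low p b hb [x, y, z]
  have hleft : ∀ u {x' y' : B}, (y' < x' ∨ (x' = y' ∧ par x' = 1)) →
      wordLT [u, x', y'] [x, y, z] →
      FreeAlgebra.ι k u * rel b (b x') (b y') ∈ low p b hb [x, y, z] := fun u x' y' h1 h2 => by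
    have := low_of_rel' b hb (p := p) h1 (u := [u]) (v := []) h2 rfl rfl
    rwa [word_singleton, word_nil, mul_one] at this
  have hright : ∀ u {x' y' : B}, (y' < x' ∨ (x' = y' ∧ par x' = 1)) →
      wordLT [x', y', u] [x, y, z] →
      rel b (b x') (b y') * FreeAlgebra.ι k u ∈ low p b hb [x, y, z] := fun u x' y' h1 h2 => by
    have := low_of_rel' b hb (p := p) h1 (u := []) (v := [u]) h2 rfl rfl
    rwa [word_singleton, word_nil, one_mul] at this
  have hinv : ∀ a b c : B, inversions [a, b, c] =
      (if b < a then 1 else 0) + (if c < a then 1 else 0) + (if c < b then 1 else 0) := by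
    intro a b c
    simp only [inversions, List.countP_cons, List.countP_nil, decide_eq_true_eq]
    omega
  rcases h with h | ⟨rfl, h⟩
  · rcases h' with h' | ⟨rfl, h'⟩
    · have h'' := h'.trans h
      rw [relCoeff, relCoeff, if_neg h.ne', if_neg h'.ne', one_smul, one_smul, ← neg_sub, hJ]
      refine Submodule.neg_mem _ (Submodule.add_mem _ (Submodule.add_mem _ (Submodule.add_mem _
        (Submodule.sub_mem _ (Submodule.neg_mem _ ?_) ?_) ?_) ?_) hL)
      · refine Submodule.smul_of_tower_mem _ _ (hleft _ (Or.inl h'') (Or.inr ⟨?_, ?_⟩))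
        · exact List.Perm.swap _ _ _
        · rw [hinv, hinv]; simp [h, h', h'', h.not_gt]
      · refine Submodule.smul_of_tower_mem _ _ (Submodule.smul_of_tower_mem _ _
          (hright _ (Or.inl h') (Or.inr ⟨?_, ?_⟩)))
        · exact (List.perm_append_comm (l₁ := [y, z]) (l₂ := [x]))
        · rw [hinv, hinv]; simp [h, h', h'', h.not_gt, h''.not_gt]
      · refine Submodule.smul_of_tower_mem _ _ (hright _ (Or.inl h'') (Or.inr ⟨?_, ?_⟩))
        · exact (List.Perm.swap _ _ _).cons _
        · rw [hinv, hinv]; simp [h, h', h'', h'.not_gt]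
      · refine Submodule.smul_of_tower_mem _ _ (Submodule.smul_of_tower_mem _ _
          (hleft _ (Or.inl h) (Or.inr ⟨?_, ?_⟩)))
        · exact (List.perm_append_comm (l₁ := [z]) (l₂ := [x, y]))
        · rw [hinv, hinv]; simp [h, h', h'', h'.not_gt, h''.not_gt]
    -- For odd `y = z` the rule for `yy` carries the factor `1/2`. After doubling, the Jacobi
    -- identity for `x, y, y` applies.
    · have h2 : (2 : k) * 2⁻¹ = 1 := mul_inv_cancel₀ (NeZero.ne _)
      rw [relCoeff, relCoeff, if_neg h.ne', if_pos rfl, one_smul, ← smul_mem_iff_of_ne_zero k _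
        (NeZero.ne (2 : k)), smul_sub, smul_smul, h2, one_smul]
      have h3 : FreeAlgebra.ι k x * rel b (b y) (b y) -
          (2 : k) • (rel b (b x) (b y) * FreeAlgebra.ι k y) =
          (2 : ℤ) • sgn (par x * par y) • (FreeAlgebra.ι k y * rel b (b x) (b y)) +
          rel b (b y) (b y) * FreeAlgebra.ι k x - L := by
        rw [two_smul k, two_smul ℤ]
        rw [h'] at hJ ⊢
        rcases zmod_two_cases (par x) with h0 | h0 <;> rw [h0] at hJ ⊢ <;>
          simp only [mul_one, sgn_zero, sgn_one, one_smul, neg_smul, neg_neg] at hJ ⊢ <;>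
          rw [← sub_eq_zero] at hJ ⊢ <;> rw [← neg_eq_zero, ← hJ] <;> abel
      rw [h3]
      refine Submodule.sub_mem _ (Submodule.add_mem _ (Submodule.smul_of_tower_mem _ _
        (Submodule.smul_of_tower_mem _ _ ?_)) ?_) hL
      · refine hleft _ (Or.inl h) (Or.inr ⟨List.Perm.swap _ _ _, ?_⟩)
        rw [hinv, hinv]; simp [h, h.not_gt]
      · refine hright _ (Or.inr ⟨rfl, h'⟩) (Or.inr ⟨List.perm_append_comm (l₁ := [y, y]) (l₂ := [x]), ?_⟩)
        rw [hinv, hinv]; simp [h, h.not_gt]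
  · rcases h' with h' | ⟨rfl, h'⟩
    · have h2 : (2 : k) * 2⁻¹ = 1 := mul_inv_cancel₀ (NeZero.ne _)
      rw [relCoeff, relCoeff, if_neg h'.ne', if_pos rfl, one_smul, ← smul_mem_iff_of_ne_zero k _
        (NeZero.ne (2 : k)), smul_sub, smul_smul, h2, one_smul]
      have h3 : (2 : k) • (FreeAlgebra.ι k x * rel b (b x) (b z)) -
          rel b (b x) (b x) * FreeAlgebra.ι k z =
          -((2 : ℤ) • sgn (par x * par z) • (rel b (b x) (b z) * FreeAlgebra.ι k x)) -
          FreeAlgebra.ι k z * rel b (b x) (b x) - L := by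
        rw [two_smul k, two_smul ℤ]
        rw [h] at hJ ⊢
        rcases zmod_two_cases (par z) with h0 | h0 <;> rw [h0] at hJ ⊢ <;>
          simp only [mul_one, mul_zero, sgn_zero, sgn_one, one_smul, neg_smul, neg_neg] at hJ ⊢ <;>
          rw [← sub_eq_zero] at hJ ⊢ <;> rw [← neg_eq_zero, ← hJ] <;> abel
      rw [h3]
      refine Submodule.sub_mem _ (Submodule.sub_mem _ (Submodule.neg_mem _
        (Submodule.smul_of_tower_mem _ _ (Submodule.smul_of_tower_mem _ _ ?_))) ?_) hL
      · refine hright _ (Or.inl h') (Or.inr ⟨(List.Perm.swap _ _ _).cons _, ?_⟩)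
        rw [hinv, hinv]; simp [h', h'.not_gt]
      · refine hleft _ (Or.inr ⟨rfl, h⟩) (Or.inr ⟨List.perm_append_comm (l₁ := [z]) (l₂ := [x, x]), ?_⟩)
        rw [hinv, hinv]; simp [h', h'.not_gt]
    · rw [relCoeff, if_pos rfl, ← smul_sub]
      refine Submodule.smul_mem _ _ ?_
      have hx := hb x
      rw [h] at hx
      -- For three equal odd letters the difference is the relator of `x` with `[x, x]`, and it is
      -- the identity `[x, [x, x]] = 0` that makes this so.
      have h3 : FreeAlgebra.ι k x * rel b (b x) (b x) - rel b (b x) (b x) * FreeAlgebra.ι k x =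
          -rel b (b x) (br k (b x) (b x)) := by
        have hc : br k (b x) (br k (b x) (b x)) = 0 := LieSuperalgebra.odd_cube hx
        rw [rel_of_mem b hx hx, rel_of_mem b hx (br_mem_part hx hx), hc, map_zero, emb_basis,
          one_add_one]
        simp only [mul_one, mul_zero, sgn_zero, sgn_one, one_smul, neg_smul]
        noncomm_ring
      rw [h3]
      exact Submodule.neg_mem _ (low_of_rel_pair b hb (by simp) _ _)

/-! The relators `x^p - x^[p]`. -/

/-- The span of the `s (xy - yx - [x, y]) t` of total degree at most `d`. -/
def relSpan (d : ℕ) : Submodule k (FreeAlgebra k B) :=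
  Submodule.span k {z | ∃ (d' e : ℕ) (s t : FreeAlgebra k B) (x y : g), s ∈ wordLE k B d' ∧
    t ∈ wordLE k B e ∧ d' + e + 2 ≤ d ∧ z = s * rel b x y * t}

theorem relSpan_le_low {d : ℕ} {w : List B} (h : d < w.length) : relSpan b d ≤ low p b hb w := by
  refine Submodule.span_le.2 ?_
  rintro _ ⟨d', e, s, t, x, y, hs, ht, hd, rfl⟩
  exact low_of_length b hb hs ht (by omega) x y

theorem mem_relSpan {d d' e : ℕ} {s t : FreeAlgebra k B} (hs : s ∈ wordLE k B d')
    (ht : t ∈ wordLE k B e) (h : d' + e + 2 ≤ d) (x y : g) : s * rel b x y * t ∈ relSpan b d :=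
  Submodule.subset_span ⟨d', e, s, t, x, y, hs, ht, h, rfl⟩

theorem rel_mem_relSpan {d : ℕ} (h : 2 ≤ d) (x y : g) : rel b x y ∈ relSpan b d := by
  simpa using mem_relSpan b one_mem_wordLE one_mem_wordLE (by simpa using h) x y

theorem commutator_relSpan {d : ℕ} (x : g) {z : FreeAlgebra k B} (hz : z ∈ relSpan b d) :
    emb b x * z - z * emb b x ∈ relSpan b (d + 1) := by
  induction hz using Submodule.span_induction with
  | mem z h =>
    obtain ⟨d', e, s, t, x', y', hs, ht, hd, rfl⟩ := h
    refine Submodule.sub_mem _ ?_ ?_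
    · rw [← mul_assoc, ← mul_assoc]
      exact mem_relSpan b (mul_mem_wordLE (emb_mem_wordLE b x) hs) ht (by omega) x' y'
    · rw [mul_assoc]
      exact mem_relSpan b hs (mul_mem_wordLE ht (emb_mem_wordLE b x)) (by omega) x' y'
  | zero => simp
  | add u v _ _ hu hv =>
    rw [show emb b x * (u + v) - (u + v) * emb b x =
      (emb b x * u - u * emb b x) + (emb b x * v - v * emb b x) by noncomm_ring]
    exact Submodule.add_mem _ hu hv
  | smul c u _ hu =>
    rw [mul_smul_comm, smul_mul_assoc, ← smul_sub]
    exact Submodule.smul_mem _ _ hu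

/-- Each commutator in the free algebra agrees with the Lie bracket up to one relator, and further
commutators raise the degree of the errors by one. The iterated operators `ad(x)^n` are compared in
this way. -/
theorem iterate_commutator_emb {x : g} (hx : x ∈ part k g 0) (y : g) (n : ℕ) :
    (fun z => emb b x * z - z * emb b x)^[n] (emb b y) - emb b ((br k x ^ n) y) ∈
      relSpan b (n + 1) := by
  induction n with
  | zero => simp
  | succ n ih =>
    rw [Function.iterate_succ_apply', pow_succ', Module.End.mul_apply]
    have h1 := commutator_relSpan b x ih
    have h2 := rel_even b hx ((br k x ^ n) y)
    have h3 := rel_mem_relSpan b (d := n + 1 + 1) (by omega) x ((br k x ^ n) y)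
    convert Submodule.add_mem _ h1 h3 using 1
    rw [h2]
    noncomm_ring

/-- Telescoping: `z` is moved across one factor `x` at a time. -/
theorem pow_mul_sub_mul_pow {R : Type*} [Ring R] (x z : R) (n : ℕ) :
    x ^ n * z - z * x ^ n = ∑ i ∈ Finset.range n, x ^ i * (x * z - z * x) * x ^ (n - 1 - i) := by
  induction n with
  | zero => simp
  | succ n ih =>
    have h1 : x ^ (n + 1) * z - z * x ^ (n + 1) =
        (x ^ n * z - z * x ^ n) * x + x ^ n * (x * z - z * x) := by
      rw [pow_succ]; noncomm_ring
    rw [h1, ih, Finset.sum_range_succ, Finset.sum_mul]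
    congr 1
    · refine Finset.sum_congr rfl fun i hi => ?_
      have := Finset.mem_range.1 hi
      rw [mul_assoc, ← pow_succ, show n - 1 - i + 1 = n + 1 - 1 - i by omega]
    · simp

/-- The commutator of `x^p - x^[p]` with `y`, up to relators of lower degree. -/
theorem commutator_pow_relSpan (x : part k g 0) (y : g) :
    (emb b (x : g) ^ p * emb b y - emb b y * emb b (x : g) ^ p) -
      (emb b (Restricted.pmap p x : part k g 0) * emb b y -
        emb b y * emb b (Restricted.pmap p x : part k g 0)) -
      ∑ i ∈ Finset.range p, emb b (x : g) ^ i * rel b (x : g) y * emb b (x : g) ^ (p - 1 - i) ∈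
        relSpan b p := by
  have : CharP (FreeAlgebra k B) p := charP_of_injective_algebraMap' k p
  have hp := (Fact.out : p.Prime).two_le
  -- Telescope the commutator with `x^p` and split each `xy - yx` into the relator and `[x, y]`. In
  -- characteristic `p` the terms with `[x, y]` add up to `ad(x)^(p-1) [x, y]`.
  have h1 : (emb b (x : g) ^ p * emb b y - emb b y * emb b (x : g) ^ p) =
      ∑ i ∈ Finset.range p, emb b (x : g) ^ i * rel b (x : g) y * emb b (x : g) ^ (p - 1 - i) +
      (fun z => emb b (x : g) * z - z * emb b (x : g))^[p - 1] (emb b (br k (x : g) y)) := by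
    rw [← sum_pow_mul_pow_eq_ad, pow_mul_sub_mul_pow, ← Finset.sum_add_distrib]
    refine Finset.sum_congr rfl fun i _ => ?_
    rw [rel_even b x.2]
    noncomm_ring
  -- Up to relators of degree at most `p`, this is `ad(x)^p y = [x^[p], y]`.
  have h2 := iterate_commutator_emb b x.2 (br k (x : g) y) (p - 1)
  rw [← Module.End.mul_apply, ← pow_succ, Nat.sub_add_cancel (by omega),
    ← Restricted.bracket_pmap] at h2
  have h3 := rel_even b (Restricted.pmap p x).2 y
  have h4 := rel_mem_relSpan b hp (Restricted.pmap p x : part k g 0) y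
  rw [h1]
  convert Submodule.sub_mem _ h2 h4 using 1
  rw [h3]
  abel

/-- The ambiguity `x^p z` expresses `ad(x)^p = ad(x^[p])`. By `commutator_pow_relSpan` the
difference of the two reductions is made of relators of lower degree, of the power rule applied to
`z x^p`, and of relators inside `x^i (xz) x^(p-1-i)`. -/
theorem overlap_pow_comm {x z : B} (hx : par x = 0) (h : z < x) :
    emb b (Restricted.pmap p (⟨b x, hx ▸ hb x⟩ : part k g 0) : part k g 0) * word k [z] -
      word k (List.replicate (p - 1) x) *
        (word k [x, z] - relCoeff k x z • rel b (b x) (b z)) ∈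
        low p b hb (List.replicate (p - 1) x ++ [x] ++ [z]) := by
  have hp := (Fact.out : p.Prime).two_le
  have hw : List.replicate (p - 1) x ++ [x] ++ [z] = List.replicate p x ++ [z] := by
    rw [← List.replicate_succ', Nat.sub_add_cancel (by omega)]
  have hE := relSpan_le_low b hb (p := p) (w := List.replicate p x ++ [z]) (by simp)
    (commutator_pow_relSpan b (⟨b x, hx ▸ hb x⟩ : part k g 0) (b z))
  have hZ : FreeAlgebra.ι k z * (FreeAlgebra.ι k x ^ p -
      emb b (Restricted.pmap p (⟨b x, hx ▸ hb x⟩ : part k g 0) : part k g 0)) ∈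
      low p b hb (List.replicate p x ++ [z]) := by
    have := low_of_rule b hb (p := p) (u := [z]) (v := []) (Rule.pow x hx)
      (w := List.replicate p x ++ [z]) (by simpa using wordLT_replicate_right h (by omega))
    simpa [word_singleton, word_replicate] using this
  -- Only `i < p - 1`: there the word with `z` moved to the left is smaller. The term `i = p - 1`
  -- sits on `x^p z` itself and is exactly the reduction made on the other side.
  have hS : ∑ i ∈ Finset.range (p - 1), FreeAlgebra.ι k x ^ i * rel b (b x) (b z) *
      FreeAlgebra.ι k x ^ (p - 1 - i) ∈ low p b hb (List.replicate p x ++ [z]) := by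
    refine Submodule.sum_mem _ fun i hi => ?_
    have hi := Finset.mem_range.1 hi
    refine low_of_rel' b hb (Or.inl h) (u := List.replicate i x) (v := List.replicate (p - 1 - i) x)
      ?_ (word_replicate i x).symm (word_replicate _ x).symm
    have := (wordLT_replicate_right h (m := p - 1 - i) (by omega)).context
      (List.replicate (i + 1) x) []
    rw [List.append_nil, List.append_nil, ← List.append_assoc, ← List.replicate_add,
      show i + 1 + (p - 1 - i) = p by omega, List.replicate_succ'] at this
    simpa using this
  rw [hw, relCoeff, if_neg h.ne', one_smul, word_pair, word_replicate, word_singleton]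
  obtain ⟨q, hq⟩ : ∃ q, p = q + 1 := ⟨p - 1, by omega⟩
  convert Submodule.neg_mem _ (Submodule.add_mem _ (Submodule.add_mem _ hE hZ) hS) using 1
  have hs : ∑ i ∈ Finset.range p, FreeAlgebra.ι k x ^ i * rel b (b x) (b z) *
      FreeAlgebra.ι k x ^ (p - 1 - i) =
      ∑ i ∈ Finset.range (p - 1), FreeAlgebra.ι k x ^ i * rel b (b x) (b z) *
      FreeAlgebra.ι k x ^ (p - 1 - i) + FreeAlgebra.ι k x ^ (p - 1) * rel b (b x) (b z) := by
    conv_lhs => rw [show p = p - 1 + 1 by omega, Finset.sum_range_succ]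
    simp
  have hpow : FreeAlgebra.ι k x ^ p = FreeAlgebra.ι k x ^ (p - 1) * FreeAlgebra.ι k x := by
    rw [← pow_succ, Nat.sub_add_cancel (by omega)]
  simp only [emb_basis]
  rw [hs, hpow]
  noncomm_ring

/-- The mirror image of `overlap_pow_comm`. Here the term `i = 0` of the telescoping sum is the one
that sits on the ambiguous word and cancels, hence the shift to `i + 1`. -/
theorem overlap_comm_pow {x y : B} (hy : par y = 0) (h : y < x) :
    (word k [x, y] - relCoeff k x y • rel b (b x) (b y)) * word k (List.replicate (p - 1) y) -
      word k [x] * emb b (Restricted.pmap p (⟨b y, hy ▸ hb y⟩ : part k g 0) : part k g 0) ∈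
        low p b hb ([x] ++ [y] ++ List.replicate (p - 1) y) := by
  have hp := (Fact.out : p.Prime).two_le
  have hw : [x] ++ [y] ++ List.replicate (p - 1) y = x :: List.replicate p y := by
    conv_rhs => rw [show p = p - 1 + 1 by omega, List.replicate_succ]
    simp
  have hE := relSpan_le_low b hb (p := p) (w := x :: List.replicate p y) (by simp)
    (commutator_pow_relSpan b (⟨b y, hy ▸ hb y⟩ : part k g 0) (b x))
  have hyx : rel b (b x) (b y) = - rel b (b y) (b x) := by
    rw [rel_skew b (hb x) (hb y), hy]; simp
  have hZ : (FreeAlgebra.ι k y ^ p -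
      emb b (Restricted.pmap p (⟨b y, hy ▸ hb y⟩ : part k g 0) : part k g 0)) *
      FreeAlgebra.ι k x ∈ low p b hb (x :: List.replicate p y) := by
    have := low_of_rule b hb (p := p) (u := []) (v := [x]) (Rule.pow y hy)
      (w := x :: List.replicate p y) (by simpa using wordLT_replicate_left h (by omega))
    simpa [word_singleton, word_replicate] using this
  have hS : ∑ i ∈ Finset.range (p - 1), FreeAlgebra.ι k y ^ (i + 1) * rel b (b x) (b y) *
      FreeAlgebra.ι k y ^ (p - 1 - (i + 1)) ∈ low p b hb (x :: List.replicate p y) := by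
    refine Submodule.sum_mem _ fun i hi => ?_
    have hi := Finset.mem_range.1 hi
    refine low_of_rel' b hb (Or.inl h) (u := List.replicate (i + 1) y)
      (v := List.replicate (p - 1 - (i + 1)) y)
      ?_ (word_replicate _ y).symm (word_replicate _ y).symm
    have := (wordLT_replicate_left h (m := i + 1) (by omega)).context []
      (List.replicate (p - (i + 1)) y)
    rw [List.nil_append, List.nil_append, List.cons_append, ← List.replicate_add,
      show i + 1 + (p - (i + 1)) = p by omega,
      show p - (i + 1) = p - 1 - (i + 1) + 1 by omega, List.replicate_succ (n := p - 1 - (i + 1))] at this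
    simpa only [List.append_assoc, List.cons_append, List.nil_append] using this
  rw [hw, relCoeff, if_neg h.ne', one_smul, word_pair, word_replicate, word_singleton]
  convert Submodule.sub_mem _ (Submodule.sub_mem _ hZ hE) (Submodule.neg_mem _ hS) using 1
  have hs : ∑ i ∈ Finset.range p, FreeAlgebra.ι k y ^ i * rel b (b y) (b x) *
      FreeAlgebra.ι k y ^ (p - 1 - i) =
      -∑ i ∈ Finset.range (p - 1), FreeAlgebra.ι k y ^ (i + 1) * rel b (b x) (b y) *
      FreeAlgebra.ι k y ^ (p - 1 - (i + 1)) - rel b (b x) (b y) * FreeAlgebra.ι k y ^ (p - 1) := by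
    conv_lhs => rw [show p = p - 1 + 1 by omega, Finset.sum_range_succ']
    rw [Nat.add_sub_cancel, hyx]
    simp
  have hpow : FreeAlgebra.ι k y ^ p = FreeAlgebra.ι k y * FreeAlgebra.ι k y ^ (p - 1) := by
    rw [← pow_succ', Nat.sub_add_cancel (by omega)]
  simp only [emb_basis]
  rw [hs, hpow]
  noncomm_ring

/-- Since `[x, x] = 0` for even `x`, also `[x^[p], x] = ad(x)^p x = 0`. So `x^[p]` commutes with
powers of `x` up to relators. -/
theorem overlap_pow_pow {x : B} (hx : par x = 0) {m : ℕ} {w : List B} (h : m + 1 < w.length) :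
    emb b (Restricted.pmap p (⟨b x, hx ▸ hb x⟩ : part k g 0) : part k g 0) *
      word k (List.replicate m x) - word k (List.replicate m x) *
      emb b (Restricted.pmap p (⟨b x, hx ▸ hb x⟩ : part k g 0) : part k g 0) ∈ low p b hb w := by
  have hp := (Fact.out : p.Prime).two_le
  have hx' : b x ∈ part k g 0 := hx ▸ hb x
  have h0 : br k (b x) (b x) = 0 := by
    have h1 : br k (b x) (b x) = -(sgn (0 * 0) • br k (b x) (b x)) := LieSuperalgebra.skew hx' hx'
    simp only [mul_zero, sgn_zero, one_smul] at h1
    have h2 := half_add_half k (br k (b x) (b x))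
    nth_rewrite 1 [h1] at h2
    simpa using h2.symm
  set z : part k g 0 := Restricted.pmap p (⟨b x, hx'⟩ : part k g 0) with hz
  have h1 : br k (b x) (z : g) = 0 := by
    have h3 : br k (z : g) (b x) = 0 := by
      have := LinearMap.congr_fun (Restricted.bracket_pmap (p := p) (⟨b x, hx'⟩ : part k g 0)) (b x)
      rw [hz, this, show p = p - 1 + 1 by omega, pow_succ, Module.End.mul_apply, h0, map_zero]
    have h2 : br k (b x) (z : g) = -(sgn (0 * 0) • br k (z : g) (b x)) :=
      LieSuperalgebra.skew hx' z.2
    rw [h2, h3]; simp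
  rw [word_replicate, ← neg_sub, pow_mul_sub_mul_pow]
  refine Submodule.neg_mem _ (Submodule.sum_mem _ fun i hi => ?_)
  have hi := Finset.mem_range.1 hi
  have h2 := rel_even b hx' (z : g)
  rw [h1, map_zero, sub_zero, emb_basis] at h2
  rw [← h2, ← word_replicate, ← word_replicate]
  exact low_of_length_words b hb (by simp; omega) _ _

/-! ## Confluence -/

/-- This separates the lengths of the two kinds of rules: a left side of length two never equals or
contains a `p`-th power. -/
theorem three_le (k : Type*) [Field k] [NeZero (2 : k)] [CharP k p] : 3 ≤ p := by
  have h := (Fact.out : p.Prime).two_le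
  rcases h.eq_or_lt with h | h
  · exact absurd (by exact_mod_cast (CharP.cast_eq_zero_iff k p 2).2 (h ▸ dvd_rfl)) (NeZero.ne (2 : k))
  · exact h

/-- There are no proper inclusion ambiguities: a power of an even letter contains neither a
decreasing pair nor the square of an odd letter, and the lengths exclude the rest. -/
theorem Rule.of_infix {l l' c f : List B} {r r' : FreeAlgebra k B} (h : Rule p b hb l r)
    (h' : Rule p b hb l' r') (e : l = c ++ l' ++ f) : c = [] ∧ f = [] ∧ r = r' := by
  have h3 : 3 ≤ p := three_le k
  cases h with
  | comm x y h =>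
    cases h' with
    | comm x' y' h' =>
      have hl := congrArg List.length e
      simp only [List.length_append, List.length_cons, List.length_nil] at hl
      have hc : c = [] := List.length_eq_zero_iff.1 (by omega)
      have hf : f = [] := List.length_eq_zero_iff.1 (by omega)
      subst hc hf
      simp only [List.nil_append, List.append_nil, List.cons.injEq, and_true] at e
      obtain ⟨rfl, rfl⟩ := e
      exact ⟨rfl, rfl, rfl⟩
    | pow x' h' =>
      have hl := congrArg List.length e
      simp only [List.length_append, List.length_cons, List.length_nil, List.length_replicate] at hl
      omega
  | pow x h =>
    cases h' with
    | comm x' y' h' =>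
      have e1 : x' = x := List.eq_of_mem_replicate (e ▸ (by simp) : x' ∈ List.replicate p x)
      have e2 : y' = x := List.eq_of_mem_replicate (e ▸ (by simp) : y' ∈ List.replicate p x)
      subst e1 e2
      rcases h' with h' | ⟨_, h'⟩
      · exact absurd h' (lt_irrefl _)
      · rw [h] at h'; exact absurd h' (by decide)
    | pow x' h' =>
      have e1 : x' = x := List.eq_of_mem_replicate (e ▸ (by simp; omega) : x' ∈ List.replicate p x)
      subst e1
      have hl := congrArg List.length e
      simp only [List.length_append, List.length_replicate] at hl
      have hc : c = [] := List.length_eq_zero_iff.1 (by omega)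
      have hf : f = [] := List.length_eq_zero_iff.1 (by omega)
      exact ⟨hc, hf, rfl⟩

/-- An overlap of a power rule with a square rule would require a letter to be both even and odd.
The remaining cases are those resolved above. -/
theorem overlap {c d e : List B} {r r' : FreeAlgebra k B} (hc : c ≠ []) (hd : d ≠ [])
    (he : e ≠ []) (h : Rule p b hb (c ++ d) r) (h' : Rule p b hb (d ++ e) r') :
    r * word k e - word k c * r' ∈ low p b hb (c ++ d ++ e) := by
  have h3 : 3 ≤ p := three_le k
  generalize hl : c ++ d = l at h
  generalize hl' : d ++ e = l' at h'
  have hc1 := List.length_pos_iff.2 hc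
  have hd1 := List.length_pos_iff.2 hd
  have he1 := List.length_pos_iff.2 he
  have hlen := congrArg List.length hl
  have hlen' := congrArg List.length hl'
  simp only [List.length_append] at hlen hlen'
  cases h with
  | comm x y h =>
    obtain ⟨rfl, rfl⟩ : c = [x] ∧ d = [y] := by
      obtain ⟨x', rfl⟩ := List.length_eq_one_iff.1 (show c.length = 1 by simp at hlen; omega)
      obtain ⟨y', rfl⟩ := List.length_eq_one_iff.1 (show d.length = 1 by simp at hlen; omega)
      simpa using hl
    cases h' with
    | comm y' z h' =>
      simp only [List.cons_append, List.nil_append, List.cons.injEq] at hl'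
      obtain ⟨rfl, rfl⟩ := hl'
      exact overlap_comm_comm b hb (p := p) h h'
    | pow y' hy =>
      rw [show p = p - 1 + 1 by omega, List.replicate_succ] at hl'
      simp only [List.cons_append, List.nil_append, List.cons.injEq] at hl'
      obtain ⟨rfl, rfl⟩ := hl'
      rcases h with h | ⟨rfl, h⟩
      · exact overlap_comm_pow b hb (p := p) hy h
      · rw [hy] at h; exact absurd h (by decide)
  | pow x hx =>
    have hcx : c = List.replicate c.length x := List.eq_replicate_of_mem fun z hz =>
      List.eq_of_mem_replicate (hl ▸ List.mem_append_left d hz)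
    have hdx : d = List.replicate d.length x := List.eq_replicate_of_mem fun z hz =>
      List.eq_of_mem_replicate (hl ▸ List.mem_append_right c hz)
    cases h' with
    | comm x' z h' =>
      obtain ⟨rfl, rfl⟩ : d = [x'] ∧ e = [z] := by
        obtain ⟨u, rfl⟩ := List.length_eq_one_iff.1 (show d.length = 1 by simp at hlen'; omega)
        obtain ⟨v, rfl⟩ := List.length_eq_one_iff.1 (show e.length = 1 by simp at hlen'; omega)
        simpa using hl'
      have : x' = x := by simpa using hdx
      subst this
      have hcl : c.length = p - 1 := by simp at hlen; omega
      rw [hcl] at hcx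
      subst hcx
      rcases h' with h' | ⟨rfl, h'⟩
      · have h5 := overlap_pow_comm b hb (p := p) hx h'
        rwa [hl] at h5
      · rw [hx] at h'; exact absurd h' (by decide)
    | pow x' hx' =>
      have : x' = x := by
        have h1 : x ∈ d := by rw [hdx]; simp; omega
        exact (List.eq_of_mem_replicate (hl' ▸ List.mem_append_left e h1)).symm
      subst this
      have hex : e = List.replicate e.length x' := List.eq_replicate_of_mem fun z hz =>
        List.eq_of_mem_replicate (hl' ▸ List.mem_append_right d hz)
      simp only [List.length_replicate] at hlen hlen'
      have hec : e = List.replicate c.length x' := by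
        rw [hex]; congr 1; omega
      have h4 := overlap_pow_pow b hb (p := p) hx (m := c.length) (w := List.replicate p x' ++ e)
        (by simp only [List.length_append, List.length_replicate]; omega)
      have hce : e = c := hec.trans hcx.symm
      rw [← hcx] at h4
      rw [hce] at h4 ⊢
      exact h4

/-- Two occurrences of left sides in a word are disjoint, nested or properly overlapping. Disjoint
ones resolve by performing both reductions, nested ones coincide, and overlapping ones are covered
by `overlap`. -/
theorem Red.confluent_of_le {u l v u' l' v' : List B} {r r' : FreeAlgebra k B}
    (h : Rule p b hb l r) (h' : Rule p b hb l' r') (e : u ++ l ++ v = u' ++ l' ++ v')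
    (hle : u.length ≤ u'.length) :
    word k u * r * word k v - word k u' * r' * word k v' ∈ low p b hb (u ++ l ++ v) := by
  have disjoint : ∀ d, u' = u ++ l ++ d → v = d ++ l' ++ v' →
      word k u * r * word k v - word k u' * r' * word k v' ∈ low p b hb (u ++ l ++ v) := by
    rintro d rfl rfl
    -- For disjoint factors `r d l' - l d r' = r d (l' - r') - (l - r) d r'`; both terms are low
    -- because `r` and `r'` consist of words below `l` and `l'`.
    have h1 : r * word k d * (r' - word k l') ∈ low p b hb (l ++ d ++ l') := by
      have hb1 := below_context (h.below) [] d
      rw [word_nil, one_mul, List.nil_append] at hb1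
      refine span_image_induction (wordBasis k B)
        (P := fun t => t * (r' - word k l') ∈ low p b hb (l ++ d ++ l')) ?_ ?_ ?_ ?_ hb1
      · simp
      · intro x y hx hy; rw [add_mul]; exact Submodule.add_mem _ hx hy
      · intro c x hx; rw [smul_mul_assoc]; exact Submodule.smul_mem _ _ hx
      · intro w' hw'
        rw [wordBasis_apply, ← neg_sub, mul_neg]
        refine Submodule.neg_mem _ ?_
        have := low_of_rule b hb (u := w') (v := []) h' (w := l ++ d ++ l')
          (by simpa using wordLT.context hw' [] l')
        simpa using this
    have h2 : (word k l - r) * (word k d * r') ∈ low p b hb (l ++ d ++ l') := by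
      have hb1 := below_context (h'.below) d []
      rw [word_nil, mul_one, List.append_nil] at hb1
      refine span_image_induction (wordBasis k B)
        (P := fun t => (word k l - r) * t ∈ low p b hb (l ++ d ++ l')) ?_ ?_ ?_ ?_ hb1
      · simp
      · intro x y hx hy; rw [mul_add]; exact Submodule.add_mem _ hx hy
      · intro c x hx; rw [mul_smul_comm]; exact Submodule.smul_mem _ _ hx
      · intro w' hw'
        rw [wordBasis_apply]
        have := low_of_rule b hb (u := []) (v := w') h (w := l ++ d ++ l')
          (by simpa using wordLT.context hw' l [])
        simpa using this
    have h3 := low_context b hb (Submodule.sub_mem _ (Submodule.neg_mem _ h1) h2) u v'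
    convert h3 using 1
    · simp
    · simp only [word_append]
      noncomm_ring
  obtain ⟨c, hc⟩ : ∃ c, u' = u ++ c := by
    have := congrArg (List.take u.length) e
    rw [List.append_assoc, List.append_assoc, List.take_left, List.take_append_of_le_length hle] at this
    exact ⟨u'.drop u.length, by conv_lhs => rw [← List.take_append_drop u.length u', ← this]⟩
  subst hc
  have e' : l ++ v = c ++ (l' ++ v') := by simpa using e
  rcases List.append_eq_append_iff.1 e' with ⟨d, rfl, rfl⟩ | ⟨d, rfl, h1⟩
  · exact disjoint d (by simp) (by simp)
  · rcases List.append_eq_append_iff.1 h1 with ⟨f, rfl, rfl⟩ | ⟨f, rfl, rfl⟩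
    · obtain ⟨rfl, rfl, rfl⟩ := Rule.of_infix b hb h h' (List.append_assoc _ _ _).symm
      simp
    · by_cases hd : d = []
      · subst hd
        exact disjoint [] (by simp) (by simp)
      by_cases hf : f = []
      · subst hf
        rw [List.append_nil] at h'
        obtain ⟨rfl, -, rfl⟩ := Rule.of_infix b hb (c := c) (f := []) h h' (by simp)
        simp
      by_cases hc : c = []
      · subst hc
        obtain ⟨-, rfl, rfl⟩ := Rule.of_infix b hb (c := []) (f := f) h' h (by simp)
        simp
      · have := low_context b hb (overlap b hb hc hd hf h h') u v'
        convert this using 1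
        · simp
        · simp only [word_append]
          noncomm_ring

theorem Red.confluent (w : List B) (t t' : FreeAlgebra k B) (h : Red p b hb w t)
    (h' : Red p b hb w t') : t - t' ∈ low p b hb w := by
  obtain ⟨u, l, v, r, hr, rfl, rfl⟩ := h
  obtain ⟨u', l', v', r', hr', e, rfl⟩ := h'
  rcases le_total u.length u'.length with hle | hle
  · exact Red.confluent_of_le b hb hr hr' e hle
  · rw [← neg_sub, e]
    exact Submodule.neg_mem _ (Red.confluent_of_le b hb hr' hr e.symm hle)

end Rules

/-! # The Poincaré-Birkhoff-Witt theorem -/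

/-- A linear map that respects the brackets with even elements and the `p`-operation on spanning
even elements respects the `p`-operation. -/
theorem map_pmap_of_span {p : ℕ} {k g R : Type*} [Field k] [AddCommGroup g] [Module k g]
    [LieSuperalgebra k g] [Restricted p k g] [Fact p.Prime] [CharP k p] [Ring R] [Algebra k R]
    (f : g →ₗ[k] R) (hf : ∀ x ∈ part k g 0, ∀ y, f (br k x y) = f x * f y - f y * f x)
    {S : Set g} (hS : ∀ x ∈ part k g 0, x ∈ Submodule.span k S)
    (hp : ∀ x ∈ S, ∃ hx : x ∈ part k g 0, f x ^ p =
      f (Restricted.pmap p (⟨x, hx⟩ : part k g 0) : part k g 0)) (x : part k g 0) :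
    f (x : g) ^ p = f (Restricted.pmap p x : part k g 0) := by
  obtain ⟨x, hx⟩ := x
  suffices h : ∃ hx : x ∈ part k g 0, f x ^ p =
      f (Restricted.pmap p (⟨x, hx⟩ : part k g 0) : part k g 0) from h.2
  have hsm : ∀ (c : k) (x : part k g 0), f (x : g) ^ p = f (Restricted.pmap p x : part k g 0) →
      f ((c • x : part k g 0) : g) ^ p = f (Restricted.pmap p (c • x) : part k g 0) := by
    intro c x h
    rw [Restricted.pmap_smul, Submodule.coe_smul, Submodule.coe_smul, map_smul, map_smul,
      smul_pow, h]
  have hxS := hS x hx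
  clear hx
  induction hxS using Submodule.span_induction with
  | mem x h => exact hp x h
  | zero =>
    refine ⟨Submodule.zero_mem _, ?_⟩
    have h0 : (0 : part k g 0) = (0 : k) • (0 : part k g 0) := by simp
    have hp0 := (Fact.out : p.Prime).ne_zero
    have := Restricted.pmap_smul (p := p) (0 : k) (0 : part k g 0)
    rw [← h0, zero_pow hp0, zero_smul] at this
    change f 0 ^ p = f (Restricted.pmap p (0 : part k g 0) : part k g 0)
    rw [this]
    simp [hp0]
  | add x y _ _ hx hy =>
    obtain ⟨hx0, hx⟩ := hx
    obtain ⟨hy0, hy⟩ := hy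
    refine ⟨Submodule.add_mem _ hx0 hy0, ?_⟩
    change f (x + y) ^ p = f (Restricted.pmap p ((⟨x, hx0⟩ : part k g 0) + ⟨y, hy0⟩) : part k g 0)
    rw [Restricted.pmap_add, map_add, map_add, map_add, ← hx, ← hy]
    -- Jacobson's formula holds in the associative algebra and is an axiom for the `p`-operation;
    -- the correction terms correspond because `f` respects brackets with even elements.
    rw [add_pow_jacobson (k := k) (f x) (f y) (fun r j => f (jacobsonCoeff k x y r j))]
    · congr 1
      simp [jacobsonSum]
    · rfl
    · intro j
      simp [jacobsonCoeff]
    · intro r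
      simp only [jacobsonCoeff]
      rw [hf y hy0]
    · intro r j
      simp only [jacobsonCoeff]
      rw [map_add, hf x hx0, hf y hy0]
  | smul c x _ hx =>
    obtain ⟨hx0, hx⟩ := hx
    exact ⟨Submodule.smul_mem _ c hx0, hsm c ⟨x, hx0⟩ hx⟩

section PBW

variable {p : ℕ} {k g B : Type*} [Field k] [AddCommGroup g] [Module k g] [LieSuperalgebra k g]
  [Restricted p k g] [NeZero (2 : k)] [Fact p.Prime] [CharP k p]
  [LinearOrder B]
  (b : Module.Basis B k g) {par : B → ZMod 2} (hb : ∀ x, b x ∈ part k g (par x))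

include hb in
theorem mem_span_even (x : g) (hx : x ∈ part k g 0) :
    x ∈ Submodule.span k (b '' {i | par i = 0}) := by
  rw [← comp_of_mem k hx]
  refine map_mem_of_basis b (comp k 0) _ (fun i => ?_) x
  rcases zmod_two_cases (par i) with h | h
  · rw [comp_of_mem k (h ▸ hb i)]
    exact Submodule.subset_span ⟨i, h, rfl⟩
  · rw [comp_of_mem_ne k (h ▸ hb i) (by decide)]
    exact Submodule.zero_mem _

variable (p) in
/-- The canonical map from the free algebra to the restricted enveloping superalgebra. -/
def toEnv : FreeAlgebra k B →ₐ[k] Env p k g := FreeAlgebra.lift k fun i => Env.ι p k g (b i)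

@[simp] theorem toEnv_ι (i : B) : toEnv p b (FreeAlgebra.ι k i) = Env.ι p k g (b i) := by
  simp [toEnv]

theorem toEnv_emb (x : g) : toEnv p b (emb b x) = Env.ι p k g x := by
  have : (toEnv p b).toLinearMap ∘ₗ emb b = Env.ι p k g := b.ext fun i => by
    rw [LinearMap.comp_apply, AlgHom.toLinearMap_apply, emb_basis, toEnv_ι]
  exact LinearMap.congr_fun this x

theorem toEnv_rel (x y : g) : toEnv p b (rel b x y) = 0 := by
  have h : (toEnv p b).toLinearMap ∘ₗ (rel b).flip y = 0 := by
    refine LinearMap.ext fun x => ?_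
    rw [← comp_add_comp k x, ← comp_add_comp k y]
    simp only [LinearMap.comp_apply, LinearMap.flip_apply, AlgHom.toLinearMap_apply, map_add,
      LinearMap.add_apply, LinearMap.zero_apply]
    have : ∀ i j, toEnv p b (rel b (comp k i x) (comp k j y)) = 0 := fun i j => by
      rw [rel_of_mem b (comp_mem k i x) (comp_mem k j y), map_sub, map_sub, map_zsmul, map_mul,
        map_mul, toEnv_emb, toEnv_emb, toEnv_emb, Env.ι_mul_ι p k (comp_mem k i x) (comp_mem k j y)]
      abel
    simp [this]
  exact LinearMap.congr_fun h x

theorem toEnv_surjective : Function.Surjective (toEnv (p := p) b) := by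
  intro u
  refine Env.eq_top_of_right p k (LinearMap.range (toEnv p b).toLinearMap) ⟨1, map_one (toEnv p b)⟩ ?_ u
  rintro _ ⟨t, rfl⟩ i x hx
  exact ⟨t * emb b x, by rw [AlgHom.toLinearMap_apply, map_mul, toEnv_emb]; rfl⟩

theorem toEnv_red {w : List B} {t : FreeAlgebra k B} (h : Red p b hb w t) :
    toEnv p b (word k w) = toEnv p b t := by
  obtain ⟨u, l, v, r, hr, rfl, rfl⟩ := h
  have : toEnv p b (word k l) = toEnv p b r := by
    cases hr with
    | comm x y h => rw [map_sub, map_smul, toEnv_rel, smul_zero, sub_zero]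
    | pow x h =>
      rw [word_replicate, map_pow, toEnv_ι, toEnv_emb]
      exact Env.ι_pow p k ⟨b x, h ▸ hb x⟩
  rw [word_append, word_append, map_mul, map_mul, map_mul, map_mul, this]

variable (p) in
/-- The ideal of relations, spanned by the differences of words and their reductions. -/
def relIdeal : Submodule k (FreeAlgebra k B) :=
  Submodule.span k {z | ∃ w t, Red p b hb w t ∧ z = word k w - t}

/-- A reduction may be performed inside any context, so the span of the relations is a two-sided
ideal. -/
theorem words_mul_mem_relIdeal {z : FreeAlgebra k B} (hz : z ∈ relIdeal p b hb) (u v : List B) :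
    word k u * z * word k v ∈ relIdeal p b hb := by
  induction hz using Submodule.span_induction with
  | mem z h =>
    obtain ⟨_, _, ⟨u', l, v', r, hr, rfl, rfl⟩, rfl⟩ := h
    refine Submodule.subset_span ⟨(u ++ u') ++ l ++ (v' ++ v), _, ⟨_, _, _, _, hr, rfl, rfl⟩, ?_⟩
    simp only [word_append]
    noncomm_ring
  | zero => simp
  | add x y _ _ hx hy => rw [mul_add, add_mul]; exact Submodule.add_mem _ hx hy
  | smul c x _ hx => rw [mul_smul_comm, smul_mul_assoc]; exact Submodule.smul_mem _ _ hx

theorem mul_mem_relIdeal {z : FreeAlgebra k B} (hz : z ∈ relIdeal p b hb) (s t : FreeAlgebra k B) :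
    s * z * t ∈ relIdeal p b hb := by
  refine map_mem_of_basis (wordBasis k B) (LinearMap.mulRight k t ∘ₗ LinearMap.mulRight k z) _
    (fun u => ?_) s
  refine map_mem_of_basis (wordBasis k B) (LinearMap.mulLeft k (wordBasis k B u * z)) _
    (fun v => ?_) t
  rw [LinearMap.mulLeft_apply, wordBasis_apply, wordBasis_apply]
  exact words_mul_mem_relIdeal b hb hz u v

theorem low_le_relIdeal (w : List B) : low p b hb w ≤ relIdeal p b hb := by
  refine Submodule.span_mono ?_
  rintro _ ⟨w', t, h, -, rfl⟩
  exact ⟨w', t, h, by rw [wordBasis_apply]⟩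

variable (p) in
/-- Left multiplication by `x` modulo the ideal of relations. -/
def leftMul : g →ₗ[k] Module.End k (FreeAlgebra k B ⧸ relIdeal p b hb) where
  toFun x := (relIdeal p b hb).mapQ _ (LinearMap.mulLeft k (emb b x)) fun z hz => by
    simpa using mul_mem_relIdeal b hb hz (emb b x) 1
  map_add' x y := by
    ext z
    simp [add_mul]
  map_smul' c x := by
    ext z
    simp

theorem leftMul_mk (x : g) (t : FreeAlgebra k B) :
    leftMul p b hb x (Submodule.Quotient.mk t) = Submodule.Quotient.mk (emb b x * t) := rfl

theorem rel_mul_mem_relIdeal (x y : g) (t : FreeAlgebra k B) :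
    rel b x y * t ∈ relIdeal p b hb := by
  refine map_mem_of_basis (wordBasis k B) (LinearMap.mulLeft k (rel b x y)) _ (fun v => ?_) t
  refine map_mem_of_basis b (LinearMap.mulRight k (wordBasis k B v) ∘ₗ (rel b).flip y) _
    (fun i => ?_) x
  -- The replicated word only serves as some word that is long enough; membership in the ideal does
  -- not refer to it.
  have h := low_of_length_words (p := p) b hb (u := []) (v := v)
    (w := List.replicate (v.length + 3) i) (by simp) (b i) y
  rw [word_nil, one_mul] at h
  rw [LinearMap.comp_apply, LinearMap.mulRight_apply, wordBasis_apply]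
  exact low_le_relIdeal b hb _ h

theorem leftMul_even {x : g} (hx : x ∈ part k g 0) (y : g) :
    leftMul p b hb (br k x y) = leftMul p b hb x * leftMul p b hb y -
      leftMul p b hb y * leftMul p b hb x := by
  refine LinearMap.ext fun z => ?_
  obtain ⟨t, rfl⟩ := Submodule.Quotient.mk_surjective _ z
  rw [LinearMap.sub_apply, Module.End.mul_apply, Module.End.mul_apply]
  simp only [leftMul_mk]
  rw [← Submodule.Quotient.mk_sub, eq_comm, Submodule.Quotient.eq]
  have := rel_mul_mem_relIdeal (p := p) b hb x y t
  rw [rel_even b hx] at this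
  simpa only [sub_mul, mul_assoc] using this

theorem leftMul_pow_mk (x : g) (n : ℕ) (t : FreeAlgebra k B) :
    (leftMul p b hb x ^ n) (Submodule.Quotient.mk t) =
      Submodule.Quotient.mk (emb b x ^ n * t) := by
  induction n generalizing t with
  | zero => simp
  | succ n ih => rw [pow_succ, Module.End.mul_apply, leftMul_mk, ih, pow_succ, mul_assoc]

variable (p) in
/-- The action of the restricted enveloping superalgebra on the quotient by the relations. -/
def envAct : Env p k g →ₐ[k] Module.End k (FreeAlgebra k B ⧸ relIdeal p b hb) :=
  Env.lift (leftMul p b hb)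
    (fun {i j x y} hx hy => by
      refine LinearMap.ext fun z => ?_
      obtain ⟨t, rfl⟩ := Submodule.Quotient.mk_surjective _ z
      rw [LinearMap.add_apply, LinearMap.smul_apply, Module.End.mul_apply, Module.End.mul_apply]
      simp only [leftMul_mk]
      have := rel_mul_mem_relIdeal (p := p) b hb x y t
      rw [rel_of_mem b hx hy] at this
      have e : (sgn (i * j) • Submodule.Quotient.mk (emb b y * (emb b x * t)) :
          FreeAlgebra k B ⧸ relIdeal p b hb) =
          Submodule.Quotient.mk (sgn (i * j) • (emb b y * (emb b x * t))) :=
        ((relIdeal p b hb).mkQ.map_smul_of_tower _ _).symm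
      rw [e, ← Submodule.Quotient.mk_add, Submodule.Quotient.eq]
      simpa only [sub_mul, add_mul, mul_assoc, smul_mul_assoc, sub_sub] using this)
    (map_pmap_of_span _ (fun x hx y => leftMul_even b hb hx y) (mem_span_even b hb) (by
      rintro _ ⟨x, hx, rfl⟩
      refine ⟨hx ▸ hb x, LinearMap.ext fun z => ?_⟩
      obtain ⟨t, rfl⟩ := Submodule.Quotient.mk_surjective _ z
      rw [leftMul_pow_mk, leftMul_mk, Submodule.Quotient.eq, ← sub_mul]
      have := mul_mem_relIdeal b hb (Submodule.subset_span
        ⟨_, _, ⟨[], _, [], _, Rule.pow (p := p) (b := b) (hb := hb) x hx, rfl, rfl⟩, rfl⟩) 1 t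
      simpa [word_append, word_replicate] using this))

/-- Applied to the class of `1`, this recovers `s` modulo the relations from its image in `U'(g)`.
Thus functionals on the quotient of the free algebra become functionals on `U'(g)`. -/
theorem envAct_toEnv (s t : FreeAlgebra k B) :
    envAct p b hb (toEnv p b s) (Submodule.Quotient.mk t) = Submodule.Quotient.mk (s * t) := by
  induction s using FreeAlgebra.induction generalizing t with
  | grade0 r =>
    rw [AlgHom.commutes, AlgHom.commutes, Module.algebraMap_end_apply, ← Algebra.smul_def]
    rfl
  | grade1 x =>
    rw [toEnv_ι, envAct, Env.lift_ι, leftMul_mk, emb_basis]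
  | mul a c ha hc => rw [map_mul, map_mul, Module.End.mul_apply, hc, ha, mul_assoc]
  | add a c ha hc =>
    rw [map_add, map_add, LinearMap.add_apply, ha, hc, add_mul, Submodule.Quotient.mk_add]

theorem emb_mem_of_mem_span {H : Set B} {P : Submodule k (FreeAlgebra k B)}
    (h : ∀ y ∈ H, word k [y] ∈ P) {x : g} (hx : x ∈ Submodule.span k (b '' H)) : emb b x ∈ P := by
  have : Submodule.span k (b '' H) ≤ P.comap (emb b) := by
    refine Submodule.span_le.2 ?_
    rintro _ ⟨y, hy, rfl⟩
    have := h y hy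
    rw [word_singleton] at this
    simpa using this
  exact this hx

theorem mul_mem_span_heads {H : Set B} {s : FreeAlgebra k B}
    (hs : s ∈ Submodule.span k (wordBasis k B '' {w | ∃ x ∈ H, ∃ v, w = x :: v}))
    (t : FreeAlgebra k B) :
    s * t ∈ Submodule.span k (wordBasis k B '' {w | ∃ x ∈ H, ∃ v, w = x :: v}) := by
  refine map_mem_of_basis (wordBasis k B) (LinearMap.mulLeft k s) _ (fun v => ?_) t
  rw [LinearMap.mulLeft_apply]
  induction hs using Submodule.span_induction with
  | mem _ h =>
    obtain ⟨_, ⟨x, hx, u, rfl⟩, rfl⟩ := h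
    refine Submodule.subset_span ⟨x :: (u ++ v), ⟨x, hx, _, rfl⟩, ?_⟩
    simp only [wordBasis_apply, ← word_append, List.cons_append]
  | zero => rw [zero_mul]; exact Submodule.zero_mem _
  | add x y _ _ hx hy => rw [add_mul]; exact Submodule.add_mem _ hx hy
  | smul c x _ hx => rw [smul_mul_assoc]; exact Submodule.smul_mem _ _ hx

/-- A reduction away from the first letter does not change it. A reduction at the beginning replaces
`xy` by `yx` with `y` below `x`, hence in the lower set `H`, and by brackets and `p`-th powers that
stay in the span of `H` because that span is a restricted subalgebra. -/
theorem Red.mem_span_heads {H : Set B} (hH : ∀ x ∈ H, ∀ y, y ≤ x → y ∈ H)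
    (hbr : ∀ x ∈ H, ∀ y ∈ H, br k (b x) (b y) ∈ Submodule.span k (b '' H))
    (hp : ∀ x ∈ H, ∀ h0 : b x ∈ part k g 0,
      ((Restricted.pmap p (⟨b x, h0⟩ : part k g 0) : part k g 0) : g) ∈ Submodule.span k (b '' H))
    (w : List B) (t : FreeAlgebra k B) (hw : w ∈ {w | ∃ x ∈ H, ∃ v, w = x :: v})
    (h : Red p b hb w t) :
    t ∈ Submodule.span k (wordBasis k B '' {w | ∃ x ∈ H, ∃ v, w = x :: v}) := by
  obtain ⟨x, hx, v', rfl⟩ := hw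
  obtain ⟨u, l, v, r, hr, e, rfl⟩ := h
  have hword : ∀ y ∈ H, ∀ w, word k (y :: w) ∈
      Submodule.span k (wordBasis k B '' {w | ∃ x ∈ H, ∃ v, w = x :: v}) := fun y hy w =>
    Submodule.subset_span ⟨y :: w, ⟨y, hy, w, rfl⟩, wordBasis_apply _⟩
  have hemb : ∀ y ∈ Submodule.span k (b '' H), emb b y ∈
      Submodule.span k (wordBasis k B '' {w | ∃ x ∈ H, ∃ v, w = x :: v}) := fun y hy =>
    emb_mem_of_mem_span b (fun z hz => hword z hz []) hy
  refine mul_mem_span_heads ?_ _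
  cases u with
  | cons y u =>
    obtain ⟨rfl, -⟩ := List.cons.inj (e.trans rfl)
    exact mul_mem_span_heads (hword x hx u) _
  | nil =>
    rw [word_nil, one_mul]
    cases hr with
    | comm x' y h =>
      obtain ⟨rfl, -⟩ := List.cons.inj (e.trans rfl)
      rw [relCoeff_smul_rel b hb h]
      split_ifs with hxy
      · subst hxy
        exact Submodule.smul_mem _ _ (hemb _ (hbr x hx x hx))
      · have hy : y ∈ H := hH x hx y ((h.resolve_right fun h => hxy h.1).le)
        exact Submodule.add_mem _ (Submodule.smul_of_tower_mem _ _ (hword y hy _))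
          (hemb _ (hbr x hx y hy))
    | pow x' h =>
      have : x = x' := by
        have h0 := (Fact.out : p.Prime).ne_zero
        obtain ⟨q, hq⟩ := Nat.exists_eq_succ_of_ne_zero h0
        rw [hq, List.replicate_succ] at e
        exact (List.cons.inj (e.trans rfl)).1
      subst this
      exact hemb _ (hp x hx _)

theorem not_red_of_length {w : List B} (hw : w.length ≤ 1) : ¬∃ t, Red p b hb w t := by
  rintro ⟨t, u, l, v, r, hr, rfl, -⟩
  have h3 := (Fact.out : p.Prime).two_le
  simp only [List.length_append] at hw
  cases hr with
  | comm x y h => simp at hw; omega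
  | pow x h => simp at hw; omega

include hb in
/-- For a restricted subalgebra spanned by a lower set `H` of basis vectors and a basis vector not
in `H`, the coordinate functional extends to the restricted enveloping superalgebra so that it
vanishes on the right ideal generated by `H`. -/
theorem exists_functional {H : Set B} (hH : ∀ x ∈ H, ∀ y, y ≤ x → y ∈ H)
    (hbr : ∀ x ∈ H, ∀ y ∈ H, br k (b x) (b y) ∈ Submodule.span k (b '' H))
    (hp : ∀ x ∈ H, ∀ h0 : b x ∈ part k g 0,
      ((Restricted.pmap p (⟨b x, h0⟩ : part k g 0) : part k g 0) : g) ∈ Submodule.span k (b '' H))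
    {c : B} (hc : c ∉ H) :
    ∃ ψ : Env p k g →ₗ[k] k, ψ 1 = 0 ∧ (∀ y, ψ (Env.ι p k g (b y)) = b.coord c (b y)) ∧
      ∀ x ∈ H, ∀ u, ψ (Env.ι p k g (b x) * u) = 0 := by
  classical
  -- `N` is the normal form. Confluence makes it vanish on all relations, and it fixes words of
  -- length at most one, on which no rule applies.
  let N : FreeAlgebra k B →ₗ[k] FreeAlgebra k B :=
    (wordBasis k B).constr k (normalForm (wordBasis k B) wordLT_wf (Red p b hb))
  have hNw : ∀ w, N (word k w) = normalForm (wordBasis k B) wordLT_wf (Red p b hb) w := fun w => by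
    rw [← wordBasis_apply, Module.Basis.constr_basis]
  have hN : relIdeal p b hb ≤ LinearMap.ker N := by
    refine Submodule.span_le.2 ?_
    rintro _ ⟨w, t, h, rfl⟩
    rw [SetLike.mem_coe, LinearMap.mem_ker, map_sub, hNw, normalForm_confluent _ _
      (fun w t h => h.below b hb) (fun w t t' => Red.confluent b hb w t t') w t h, sub_self]
  have hN1 : ∀ w : List B, w.length ≤ 1 → N (word k w) = word k w := fun w hw => by
    rw [hNw, normalForm_irreducible _ _ (not_red_of_length b hb hw), wordBasis_apply]
  have hNP : ∀ s ∈ Submodule.span k (wordBasis k B '' {w | ∃ x ∈ H, ∃ v, w = x :: v}),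
      N s ∈ Submodule.span k (wordBasis k B '' {w | ∃ x ∈ H, ∃ v, w = x :: v}) := by
    intro s hs
    have : Submodule.span k (wordBasis k B '' {w | ∃ x ∈ H, ∃ v, w = x :: v}) ≤
        (Submodule.span k (wordBasis k B '' {w | ∃ x ∈ H, ∃ v, w = x :: v})).comap N := by
      refine Submodule.span_le.2 ?_
      rintro _ ⟨w, hw, rfl⟩
      rw [SetLike.mem_coe, Submodule.mem_comap, wordBasis_apply, hNw]
      exact normalForm_mem _ _ (fun w t h => h.below b hb)
        (Red.mem_span_heads b hb hH hbr hp) w hw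
    exact this hs
  have hcoord : ∀ s ∈ Submodule.span k (wordBasis k B '' {w | ∃ x ∈ H, ∃ v, w = x :: v}),
      (wordBasis k B).coord [c] s = 0 := by
    intro s hs
    have : Submodule.span k (wordBasis k B '' {w | ∃ x ∈ H, ∃ v, w = x :: v}) ≤
        LinearMap.ker ((wordBasis k B).coord [c]) := by
      refine Submodule.span_le.2 ?_
      rintro _ ⟨w, ⟨x, hx, v, rfl⟩, rfl⟩
      rw [SetLike.mem_coe, LinearMap.mem_ker, Module.Basis.coord_apply, Module.Basis.repr_self,
        Finsupp.single_eq_of_ne]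
      intro e
      exact hc ((List.cons.inj e).1 ▸ hx)
    exact this hs
  let Nq : (FreeAlgebra k B ⧸ relIdeal p b hb) →ₗ[k] FreeAlgebra k B := (relIdeal p b hb).liftQ N hN
  -- The functional takes the coefficient of the one-letter word `c` in the normal form of an
  -- element of `U'(g)` acting on the class of `1`.
  let ψ : Env p k g →ₗ[k] k := (wordBasis k B).coord [c] ∘ₗ Nq ∘ₗ
    LinearMap.applyₗ (Submodule.Quotient.mk 1) ∘ₗ (envAct p b hb).toLinearMap
  have hψ : ∀ s, ψ (toEnv p b s) = (wordBasis k B).coord [c] (N s) := by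
    intro s
    change (wordBasis k B).coord [c] (Nq (envAct p b hb (toEnv p b s) (Submodule.Quotient.mk 1))) = _
    rw [envAct_toEnv, mul_one]
    rfl
  refine ⟨ψ, ?_, fun y => ?_, fun x hx u => ?_⟩
  · rw [← map_one (toEnv p b), hψ, ← word_nil, hN1 [] (by simp), ← wordBasis_apply,
      Module.Basis.coord_apply, Module.Basis.repr_self, Finsupp.single_eq_of_ne (by simp)]
  · rw [← toEnv_ι, hψ, ← word_singleton, hN1 [y] (by simp), ← wordBasis_apply,
      Module.Basis.coord_apply, Module.Basis.repr_self, Module.Basis.coord_apply,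
      Module.Basis.repr_self, Finsupp.single_apply, Finsupp.single_apply]
    simp
  · obtain ⟨s, rfl⟩ := toEnv_surjective (p := p) b u
    rw [← toEnv_ι, ← map_mul, hψ]
    refine hcoord _ (hNP _ (mul_mem_span_heads ?_ s))
    rw [← word_singleton]
    exact Submodule.subset_span ⟨[x], ⟨x, hx, [], rfl⟩, wordBasis_apply _⟩

theorem replicate_prefix_of_sorted {x : B} {w : List B} (hs : w.Pairwise (· ≤ ·))
    (hx : ∀ z ∈ w, x ≤ z) {n : ℕ} (h : n ≤ w.count x) : List.replicate n x <+: w := by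
  induction w generalizing n with
  | nil => simp_all
  | cons y w ih =>
    cases n with
    | zero => exact List.nil_prefix
    | succ n =>
      rw [List.pairwise_cons] at hs
      by_cases hxy : y = x
      · subst hxy
        rw [List.count_cons_self] at h
        rw [List.replicate_succ, List.cons_prefix_cons]
        exact ⟨rfl, ih hs.2 (fun z hz => hx z (List.mem_cons_of_mem _ hz)) (by omega)⟩
      · have h0 : 0 < (y :: w).count x := by omega
        rw [List.count_pos_iff, List.mem_cons] at h0
        rcases h0 with h0 | h0
        · exact absurd h0.symm hxy
        · exact absurd (le_antisymm (hs.1 x h0) (hx y (by simp))) hxy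

/-- Equal letters of a sorted word are adjacent. So the power rule, or the square rule for an odd
letter, applies as soon as a multiplicity is too large. -/
theorem replicate_infix_of_sorted {x : B} {w : List B} (hs : w.Pairwise (· ≤ ·)) {n : ℕ}
    (h : n ≤ w.count x) : List.replicate n x <:+: w := by
  induction w with
  | nil => simp_all
  | cons y w ih =>
    rw [List.pairwise_cons] at hs
    by_cases hxy : y = x
    · subst hxy
      exact (replicate_prefix_of_sorted (List.pairwise_cons.2 hs)
        (by simpa using hs.1) h).isInfix
    · rw [List.count_cons_of_ne hxy] at h
      exact (ih hs.2 h).trans (List.suffix_cons y w).isInfix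

/-- The words that are not reducible. -/
def IsNormal (p : ℕ) (par : B → ZMod 2) (w : List B) : Prop :=
  w.Pairwise (· ≤ ·) ∧ ∀ x, w.count x < if par x = 0 then p else 2

theorem isNormal_of_not_red {w : List B} (h : ¬∃ t, Red p b hb w t) : IsNormal p par w := by
  have key : ∀ l r, Rule p b hb l r → ¬ l <:+: w := by
    rintro l r hr ⟨u, v, rfl⟩
    exact h ⟨_, u, l, v, r, hr, rfl, rfl⟩
  have hs : w.Pairwise (· ≤ ·) := by
    rw [← List.isChain_iff_pairwise, List.isChain_iff_forall_rel_of_append_cons_cons]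
    intro x y u v e
    by_contra hxy
    exact key _ _ (Rule.comm x y (Or.inl (not_le.1 hxy))) ⟨u, v, by simp [e]⟩
  refine ⟨hs, fun x => ?_⟩
  by_contra hcount
  rw [not_lt] at hcount
  split_ifs at hcount with hx
  · exact key _ _ (Rule.pow x hx) (replicate_infix_of_sorted hs hcount)
  · have hx1 : par x = 1 := (zmod_two_cases _).resolve_left hx
    exact key _ _ (Rule.comm x x (Or.inr ⟨rfl, hx1⟩)) (replicate_infix_of_sorted hs hcount)

-- Irreducible words are normal, and reductions never lengthen a word. The control of the length is
-- needed for the filtration by order of vanishing.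
include hb in
theorem toEnv_word_mem_span (w : List B) : toEnv p b (word k w) ∈
    Submodule.span k ((fun v => toEnv p b (word k v)) ''
      {v | IsNormal p par v ∧ v.length ≤ w.length}) := by
  have := mem_span_irreducible (wordBasis k B) wordLT_wf wordLT_trans
    (fun w t (h : Red p b hb w t) => h.below b hb) (toEnv p b).toLinearMap
    (fun w t h => by rw [wordBasis_apply]; exact toEnv_red b hb h) w
  rw [wordBasis_apply] at this
  refine Submodule.span_mono ?_ this
  rintro _ ⟨v, hv, hlt, rfl⟩
  refine ⟨v, ⟨isNormal_of_not_red b hb hv, ?_⟩, ?_⟩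
  · rcases hlt with rfl | h
    · exact le_rfl
    · exact h.length_le
  · rw [wordBasis_apply]
    rfl

end PBW

/-! # Coordinates on the coinduced algebra -/

section SuperBasis

/-- The parity of the elements of a homogeneous basis. -/
def parity {I J : Type*} : I ⊕ J → ZMod 2 := Sum.elim (fun _ => 0) (fun _ => 1)

@[simp] theorem parity_inl {I J : Type*} (i : I) : parity (Sum.inl i : I ⊕ J) = 0 := rfl
@[simp] theorem parity_inr {I J : Type*} (j : J) : parity (Sum.inr j : I ⊕ J) = 1 := rfl

variable {k V I J : Type*} [Field k] [NeZero (2 : k)] [AddCommGroup V] [Module k V] [Superspace k V]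

/-- The homogeneous basis of a superspace formed by bases of its components. -/
def superBasis (b₀ : Module.Basis I k (part k V 0)) (b₁ : Module.Basis J k (part k V 1)) :
    Module.Basis (I ⊕ J) k V :=
  (b₀.prod b₁).map (Submodule.prodEquivOfIsCompl _ _ (isCompl_part k V))

theorem superBasis_mem (b₀ : Module.Basis I k (part k V 0)) (b₁ : Module.Basis J k (part k V 1))
    (i : I ⊕ J) : superBasis b₀ b₁ i ∈ part k V (parity i) := by
  rcases i with i | j
  · simp [superBasis]
  · simp [superBasis]

theorem comp_map {W : Type*} [AddCommGroup W] [Module k W] [Superspace k W] (f : V →ₗ[k] W)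
    (hf : ∀ v, f (σ k v) = σ k (f v)) (i : ZMod 2) (v : V) : f (comp k i v) = comp k i (f v) := by
  rw [comp_apply, comp_apply, map_smul, map_add, map_zsmul, hf]

end SuperBasis

section Coordinates

variable {p : ℕ} {k g : Type*} [Field k] [AddCommGroup g] [Module k g] [LieSuperalgebra k g]
  [Restricted p k g] [NeZero (2 : k)] [Fact p.Prime] [CharP k p]

variable (p k) in
/-- The product in the restricted enveloping superalgebra of a list of elements of `g`. -/
def prodι (L : List g) : Env p k g := (L.map (Env.ι p k g)).prod

theorem prodι_cons (x : g) (L : List g) : prodι p k (x :: L) = Env.ι p k g x * prodι p k L := rfl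

variable (h : RestrictedSub p k g)

/-- Homogeneous vectors of `g` that form a basis modulo `h`, together with homogeneous elements of
`Coind(k)` dual to them. -/
structure Coordinates {J : Type*} [LinearOrder J] (par : J → ZMod 2) where
  vec : J → g
  vec_mem : ∀ b, vec b ∈ part k g (par b)
  basis : Module.Basis (J) k (g ⧸ h.carrier)
  basis_apply : ∀ b, basis b = h.carrier.mkQ (vec b)
  x : J → CoindAlg h
  x_mem : ∀ b, x b ∈ part k (CoindAlg h) (par b)
  x_one : ∀ b, CoindAlg.fn (x b) 1 = 0
  x_vec : ∀ b c, CoindAlg.fn (x b) (Env.ι p k g (vec c)) = if b = c then 1 else 0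
  -- The spanning half of the Poincaré-Birkhoff-Witt theorem relative to `h`, with lengths. In the
  -- part that lies in `h U'(g)` the second factor is strictly shorter, so that equivariant
  -- functions can be treated by induction on length.
  span : ∀ L : List g, prodι p k L ∈
    Submodule.span k {u | ∃ w, IsNormal p par w ∧ w.length ≤ L.length ∧
      u = prodι p k (w.map vec)} ⊔
    Submodule.span k {u | ∃ H ∈ h.carrier, ∃ L' : List g, L'.length < L.length ∧
      u = Env.ι p k g H * prodι p k L'}

variable {h}

/-- A functional that vanishes on the right ideal generated by `h` lies in `Coind(k)`. -/
theorem mem_coind_counit (ψ : Env p k g →ₗ[k] k)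
    (hψ : ∀ H ∈ h.carrier, ∀ u, ψ (Env.ι p k g H * u) = 0) :
    ψ ∈ Coind h (charRep (Env.counit p k h.carrier)) := by
  intro w
  refine Env.eq_top_of_right p k
    { carrier := {w | ∀ u, ψ (h.incl w * u) = charRep (Env.counit p k h.carrier) w (ψ u)}
      add_mem' := fun hs ht u => by
        rw [map_add, add_mul, map_add, hs u, ht u, map_add, LinearMap.add_apply]
      zero_mem' := fun u => by simp
      smul_mem' := fun c s hs u => by
        rw [map_smul, smul_mul_assoc, map_smul, hs u, map_smul, LinearMap.smul_apply] } ?_ ?_ w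
  · intro u
    simp
  · intro w hw i x hx u
    rw [map_mul h.incl, mul_assoc, hw, RestrictedSub.incl_ι, hψ x x.2]
    simp [charRep]

section Extend

variable {I J : Type*} (bh : Module.Basis I k h.carrier) (bq : Module.Basis J k (g ⧸ h.carrier))
  (X : J → g) (hX : ∀ j, h.carrier.mkQ (X j) = bq j)

include hX in
theorem bijective_coprod_lift :
    Function.Bijective (h.carrier.subtype.coprod (bq.constr k X)) := by
  have hs : ∀ q, h.carrier.mkQ (bq.constr k X q) = q := by
    intro q
    have : h.carrier.mkQ ∘ₗ bq.constr k X = LinearMap.id := bq.ext fun j => by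
      rw [LinearMap.comp_apply, Module.Basis.constr_basis, hX, LinearMap.id_apply]
    exact LinearMap.congr_fun this q
  constructor
  · rw [← LinearMap.ker_eq_bot, LinearMap.ker_eq_bot']
    rintro ⟨y, q⟩ e
    rw [LinearMap.coprod_apply] at e
    have e2 := congrArg h.carrier.mkQ e
    rw [map_add, hs, map_zero] at e2
    have e3 : q = 0 := by
      have : h.carrier.mkQ (h.carrier.subtype y) = 0 :=
        (Submodule.Quotient.mk_eq_zero _).2 y.2
      simpa only [this, zero_add] using e2
    subst e3
    simpa using e
  · intro y
    refine ⟨(⟨y - bq.constr k X (h.carrier.mkQ y), ?_⟩, h.carrier.mkQ y), by simp⟩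
    rw [← Submodule.Quotient.mk_eq_zero, ← Submodule.mkQ_apply, map_sub, hs, sub_self]

/-- The basis of `g` that consists of a basis of a subspace and of lifts of a basis of the
quotient. -/
def extendBasis : Module.Basis (I ⊕ J) k g :=
  (bh.prod bq).map (LinearEquiv.ofBijective _ (bijective_coprod_lift bq X hX))

theorem extendBasis_inl (i : I) : extendBasis bh bq X hX (Sum.inl i) = bh i := by
  rw [extendBasis, Module.Basis.map_apply, LinearEquiv.ofBijective_apply]
  simp

theorem extendBasis_inr (j : J) : extendBasis bh bq X hX (Sum.inr j) = X j := by
  rw [extendBasis, Module.Basis.map_apply, LinearEquiv.ofBijective_apply]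
  simp

end Extend

theorem toEnv_word {B : Type*} [LinearOrder B] (b : Module.Basis B k g) (w : List B) :
    toEnv p b (word k w) = prodι p k (w.map b) := by
  induction w with
  | nil => rw [word_nil, map_one]; rfl
  | cons i w ih =>
    rw [← List.singleton_append, word_append, map_mul, ih, word_singleton, toEnv_ι]
    rfl

theorem prodι_mem_span {B : Type*} [LinearOrder B] (b : Module.Basis B k g) {par : B → ZMod 2}
    (hb : ∀ x, b x ∈ part k g (par x)) (L : List g) : prodι p k L ∈
    Submodule.span k {u | ∃ w, IsNormal p par w ∧ w.length ≤ L.length ∧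
      u = prodι p k (w.map b)} := by
  have h1 : (L.map (emb b)).prod ∈ wordLE k B L.length := by
    induction L with
    | nil => exact one_mem_wordLE
    | cons x L ih =>
      rw [List.map_cons, List.prod_cons, List.length_cons, add_comm]
      exact mul_mem_wordLE (emb_mem_wordLE b x) ih
  have h2 : toEnv p b (L.map (emb b)).prod = prodι p k L := by
    rw [map_list_prod, List.map_map]
    congr 1
    exact List.map_congr_left fun x _ => toEnv_emb b x
  rw [← h2]
  have : wordLE k B L.length ≤ (Submodule.span k {u | ∃ w, IsNormal p par w ∧
      w.length ≤ L.length ∧ u = prodι p k (w.map b)}).comap (toEnv p b).toLinearMap := by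
    refine Submodule.span_le.2 ?_
    rintro _ ⟨w, hw, rfl⟩
    refine Submodule.span_mono ?_ (toEnv_word_mem_span b hb w)
    rintro _ ⟨v, ⟨hv, hl⟩, rfl⟩
    exact ⟨v, hv, hl.trans hw, toEnv_word b v⟩
  exact this h1

theorem exists_homogeneous_lift {J : Type*} (bq : Module.Basis J k (g ⧸ h.carrier))
    {par : J → ZMod 2} (hbq : ∀ j, bq j ∈ part k (g ⧸ h.carrier) (par j)) :
    ∃ X : J → g, (∀ j, X j ∈ part k g (par j)) ∧ ∀ j, h.carrier.mkQ (X j) = bq j := by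
  refine ⟨fun j => comp k (par j) (h.carrier.mkQ_surjective (bq j)).choose,
    fun j => comp_mem k _ _, fun j => ?_⟩
  rw [comp_map h.carrier.mkQ (fun _ => rfl), (h.carrier.mkQ_surjective (bq j)).choose_spec,
    comp_of_mem k (hbq j)]

theorem exists_basis_quotient [FiniteDimensional k (g ⧸ h.carrier)] :
    ∃ bq : Module.Basis (Fin h.evenDim ⊕ Fin h.oddDim) k (g ⧸ h.carrier),
      ∀ b, bq b ∈ part k (g ⧸ h.carrier) (parity b) :=
  ⟨superBasis (Module.finBasis k _) (Module.finBasis k _), superBasis_mem _ _⟩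

theorem count_map_of_injective {I J : Type*} [LinearOrder I] [LinearOrder J] {f : J → I}
    (hf : Function.Injective f) (v : List J) (x : J) : (v.map f).count (f x) = v.count x :=
  List.count_map_of_injective _ _ hf x

section Lex

variable {I J : Type*} [LinearOrder I] [LinearOrder J] (bh : Module.Basis I k h.carrier)
  {parI : I → ZMod 2} (hbh : ∀ i, bh i ∈ part k h.carrier (parI i))
  (bq : Module.Basis J k (g ⧸ h.carrier)) (X : J → g) {par : J → ZMod 2}
  (hXm : ∀ j, X j ∈ part k g (par j)) (hX : ∀ j, h.carrier.mkQ (X j) = bq j)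

/-- The basis of `g` that extends a basis of `h`, with the vectors of `h` first. -/
def lexBasis : Module.Basis (I ⊕ₗ J) k g := (extendBasis bh bq X hX).reindex toLex

theorem lexBasis_inl (i : I) : lexBasis bh bq X hX (Sum.inlₗ i) = bh i := by
  rw [lexBasis, Module.Basis.reindex_apply]
  exact extendBasis_inl bh bq X hX i

theorem lexBasis_inr (j : J) : lexBasis bh bq X hX (Sum.inrₗ j) = X j := by
  rw [lexBasis, Module.Basis.reindex_apply]
  exact extendBasis_inr bh bq X hX j

theorem not_inrₗ_le_inlₗ (i : I) (j : J) : ¬ (Sum.inrₗ j : I ⊕ₗ J) ≤ Sum.inlₗ i :=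
  Sum.Lex.not_inr_le_inl

theorem inrₗ_injective : Function.Injective (Sum.inrₗ : J → I ⊕ₗ J) :=
  toLex.injective.comp Sum.inr_injective

theorem lex_cases (i : I ⊕ₗ J) : (∃ j, i = Sum.inlₗ j) ∨ ∃ j, i = Sum.inrₗ j := by
  rcases e : ofLex i with j | j
  · exact Or.inl ⟨j, e⟩
  · exact Or.inr ⟨j, e⟩

include hbh hXm in
theorem lexBasis_mem (i : I ⊕ₗ J) :
    lexBasis bh bq X hX i ∈ part k g (Sum.elim parI par (ofLex i)) := by
  rcases lex_cases i with ⟨i, rfl⟩ | ⟨j, rfl⟩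
  · rw [lexBasis_inl]
    exact h.coe_mem_part.2 (hbh i)
  · rw [lexBasis_inr]
    exact hXm j

theorem span_lexBasis_inl :
    Submodule.span k (lexBasis bh bq X hX '' Set.range Sum.inlₗ) = h.carrier := by
  have h1 : lexBasis bh bq X hX '' Set.range Sum.inlₗ = h.carrier.subtype '' Set.range bh := by
    rw [← Set.range_comp, ← Set.range_comp]
    congr 1
    funext i
    exact lexBasis_inl bh bq X hX i
  rw [h1, Submodule.span_image, Module.Basis.span_eq, Submodule.map_top,
    Submodule.range_subtype]

-- With the vectors of `h` first, they form a lower set spanning a restricted subalgebra, and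
-- `exists_functional` gives a functional vanishing on `h U'(g)`, that is, an element of `Coind(k)`.
include hbh bq hXm hX in
theorem exists_coordinate (j : J) : ∃ ψ : CoindAlg h, CoindAlg.fn ψ 1 = 0 ∧
    ∀ l, CoindAlg.fn ψ (Env.ι p k g (X l)) = if j = l then 1 else 0 := by
  classical
  have hspan := span_lexBasis_inl bh bq X hX
  have hH : ∀ x ∈ Set.range (Sum.inlₗ : I → I ⊕ₗ J), ∀ y, y ≤ x → y ∈ Set.range Sum.inlₗ := by
    rintro _ ⟨i, rfl⟩ y hy
    rcases lex_cases y with ⟨y, rfl⟩ | ⟨y, rfl⟩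
    · exact ⟨y, rfl⟩
    · exact absurd hy (not_inrₗ_le_inlₗ i y)
  have hHmem : ∀ x ∈ Set.range (Sum.inlₗ : I → I ⊕ₗ J), lexBasis bh bq X hX x ∈ h.carrier := by
    rintro _ ⟨i, rfl⟩
    rw [lexBasis_inl]
    exact (bh i).2
  obtain ⟨ψ, h1, h2, h3⟩ := exists_functional (p := p) (lexBasis bh bq X hX)
    (lexBasis_mem bh hbh bq X hXm hX) hH
    (fun x hx y hy => hspan ▸ h.br_mem _ (hHmem x hx) _ (hHmem y hy))
    (fun x hx h0 => hspan ▸ h.pmap_mem _ (hHmem x hx)) (c := Sum.inrₗ j)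
    (by rintro ⟨i, e⟩; exact absurd e.symm.le (not_inrₗ_le_inlₗ i j))
  have h4 : ∀ y ∈ h.carrier, ∀ u, ψ (Env.ι p k g y * u) = 0 := by
    intro y hy u
    rw [← hspan] at hy
    induction hy using Submodule.span_induction with
    | mem _ hy => obtain ⟨x, hx, rfl⟩ := hy; exact h3 x hx u
    | zero => simp
    | add x y _ _ hx hy => rw [map_add, add_mul, map_add, hx, hy, add_zero]
    | smul c x _ hx => rw [map_smul, smul_mul_assoc, map_smul, hx, smul_zero]
  refine ⟨⟨ψ, mem_coind_counit ψ h4⟩, h1, fun l => ?_⟩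
  have h5 := h2 (Sum.inrₗ l)
  rw [lexBasis_inr, Module.Basis.coord_apply, ← lexBasis_inr bh bq X hX, Module.Basis.repr_self,
    Finsupp.single_apply] at h5
  rw [lexBasis_inr] at h5
  refine h5.trans (if_congr ⟨fun e => (inrₗ_injective e).symm, fun e => by rw [e]⟩ rfl rfl)

-- In a sorted word the letters of `h` come first. So a normal word either starts with a letter of
-- `h` or involves only the complementary vectors.
include hbh bq hXm hX in
theorem prodι_mem_span_sup (L : List g) : prodι p k L ∈
    Submodule.span k {u | ∃ w, IsNormal p par w ∧ w.length ≤ L.length ∧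
      u = prodι p k (w.map X)} ⊔
    Submodule.span k {u | ∃ H ∈ h.carrier, ∃ L' : List g, L'.length < L.length ∧
      u = Env.ι p k g H * prodι p k L'} := by
  refine Submodule.span_le.2 ?_ (prodι_mem_span (lexBasis bh bq X hX)
    (lexBasis_mem bh hbh bq X hXm hX) L)
  rintro _ ⟨w, hw, hl, rfl⟩
  by_cases hin : ∃ i : I, Sum.inlₗ i ∈ w
  · refine Submodule.mem_sup_right (Submodule.subset_span ?_)
    obtain ⟨i, hi⟩ := hin
    cases w with
    | nil => simp at hi
    | cons y w =>
      obtain ⟨y, rfl⟩ : ∃ j, y = Sum.inlₗ j := by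
        rcases lex_cases y with hy | ⟨j, rfl⟩
        · exact hy
        · rcases List.mem_cons.1 hi with e | e
          · exact ⟨i, e.symm⟩
          · exact absurd ((List.pairwise_cons.1 hw.1).1 _ e) (not_inrₗ_le_inlₗ i j)
      refine ⟨bh y, (bh y).2, w.map (lexBasis bh bq X hX), by simpa using hl, ?_⟩
      rw [List.map_cons, lexBasis_inl, prodι_cons]
  · refine Submodule.mem_sup_left (Submodule.subset_span ?_)
    obtain ⟨v, rfl⟩ : ∃ v : List J, w = v.map Sum.inrₗ := by
      clear hl hw
      induction w with
      | nil => exact ⟨[], rfl⟩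
      | cons y w ih =>
        obtain ⟨v, rfl⟩ := ih fun ⟨i, hi⟩ => hin ⟨i, List.mem_cons_of_mem _ hi⟩
        rcases lex_cases y with ⟨y, rfl⟩ | ⟨y, rfl⟩
        · exact absurd ⟨y, List.mem_cons_self⟩ hin
        · exact ⟨y :: v, rfl⟩
    refine ⟨v, ⟨?_, fun x => ?_⟩, by simpa using hl, ?_⟩
    · have := hw.1
      rw [List.pairwise_map] at this
      exact this.imp fun hxy => Sum.Lex.inr_le_inr_iff.1 hxy
    · have := hw.2 (Sum.inrₗ x)
      rwa [count_map_of_injective inrₗ_injective] at this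
    · rw [List.map_map]
      congr 1
      exact List.map_congr_left fun j _ => lexBasis_inr bh bq X hX j

end Lex

variable (h) in
theorem nonempty_coordinates [FiniteDimensional k (g ⧸ h.carrier)] :
    ∃ _ : LinearOrder (Fin h.evenDim ⊕ Fin h.oddDim),
      Nonempty (Coordinates h (parity : Fin h.evenDim ⊕ Fin h.oddDim → ZMod 2)) := by
  obtain ⟨bq, hbq⟩ := exists_basis_quotient (h := h)
  obtain ⟨X, hXm, hX⟩ := exists_homogeneous_lift bq hbq
  obtain ⟨I, parI, bh, hbh⟩ : ∃ (I : Type _) (parI : I → ZMod 2)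
      (bh : Module.Basis I k h.carrier), ∀ i, bh i ∈ part k h.carrier (parI i) :=
    ⟨_, parity, superBasis (Module.Basis.ofVectorSpace k (part k h.carrier 0))
      (Module.Basis.ofVectorSpace k (part k h.carrier 1)), superBasis_mem _ _⟩
  classical
  let _ : LinearOrder I := linearOrderOfSTO WellOrderingRel
  let oJ : LinearOrder (Fin h.evenDim ⊕ Fin h.oddDim) := linearOrderOfSTO WellOrderingRel
  choose ψ h1 h2 using fun j => exists_coordinate bh hbh bq X hXm hX j
  -- The parity component of `ψ j` still pairs to `1` with `X j`, which has the same parity;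
  -- pairings that were zero stay zero.
  refine ⟨oJ, ⟨X, hXm, bq, fun b => (hX b).symm, fun j => comp k (parity j) (ψ j),
    fun j => comp_mem k _ _, fun j => ?_, fun j l => ?_, fun L => ?_⟩⟩
  · rw [comp_apply, map_smul, map_add, map_zsmul, CoindAlg.fn_σ, LinearMap.smul_apply,
      LinearMap.add_apply, LinearMap.smul_apply, LinearMap.comp_apply, σ_one, h1]
    simp
  · rw [comp_apply, map_smul, map_add, map_zsmul, CoindAlg.fn_σ, LinearMap.smul_apply,
      LinearMap.add_apply, LinearMap.smul_apply, LinearMap.comp_apply, Env.σ_ι,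
      mem_part.1 (hXm l), map_zsmul, map_zsmul, h2]
    split_ifs with e
    · rw [e, smul_smul, sgn_mul_self, one_smul]
      exact half_add_half k 1
    · simp
  · exact prodι_mem_span_sup bh hbh bq X hXm hX L

end Coordinates

/-! # The order of vanishing of functions on the restricted enveloping superalgebra -/

section Order

variable {p : ℕ} {k g : Type*} [Field k] [AddCommGroup g] [Module k g] [LieSuperalgebra k g]
  [Restricted p k g] [NeZero (2 : k)] [Fact p.Prime] [CharP k p]
  {V : Type*} [AddCommGroup V] [Module k V]

variable (p k g V) in
/-- The functions that vanish on the products of fewer than `r` elements of `g`. -/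
def ord (r : ℕ) : Submodule k (Env p k g →ₗ[k] V) where
  carrier := {f | ∀ L : List g, L.length < r → f (prodι p k L) = 0}
  add_mem' hf hf' L hL := by rw [LinearMap.add_apply, hf L hL, hf' L hL, add_zero]
  zero_mem' L hL := rfl
  smul_mem' c f hf L hL := by rw [LinearMap.smul_apply, hf L hL, smul_zero]

theorem prodι_concat (L : List g) (x : g) :
    prodι p k (L ++ [x]) = prodι p k L * Env.ι p k g x := by simp [prodι]

theorem mem_ord_zero (f : Env p k g →ₗ[k] V) : f ∈ ord p k g V 0 := fun _ hL => absurd hL (by simp)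

theorem ord_anti {r s : ℕ} (h : r ≤ s) : ord p k g V s ≤ ord p k g V r :=
  fun _ hf L hL => hf L (hL.trans_le h)

theorem mem_ord_one {f : Env p k g →ₗ[k] V} : f ∈ ord p k g V 1 ↔ f 1 = 0 := by
  refine ⟨fun hf => hf [] (by simp), fun hf L hL => ?_⟩
  rw [Nat.lt_one_iff, List.length_eq_zero_iff] at hL
  rw [hL]
  exact hf

theorem apply_one_of_mem_ord {f : Env p k g →ₗ[k] V} {r : ℕ} (hf : f ∈ ord p k g V (r + 1)) :
    f 1 = 0 := hf [] (by simp)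

theorem mulRight_mem_ord {f : Env p k g →ₗ[k] V} {r : ℕ} (hf : f ∈ ord p k g V (r + 1)) (x : g) :
    f ∘ₗ LinearMap.mulRight k (Env.ι p k g x) ∈ ord p k g V r := fun L hL => by
  rw [LinearMap.comp_apply, LinearMap.mulRight_apply, ← prodι_concat]
  exact hf _ (by simpa using hL)

/-- This recursive description by derivatives turns statements about orders into inductions with the
Leibniz rule `conv_mulRight`. -/
theorem mem_ord_succ {f : Env p k g →ₗ[k] V} {r : ℕ} (h1 : f 1 = 0)
    (hx : ∀ (i : ZMod 2) (x : g), x ∈ part k g i →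
      f ∘ₗ LinearMap.mulRight k (Env.ι p k g x) ∈ ord p k g V r) : f ∈ ord p k g V (r + 1) := by
  intro L hL
  induction L using List.reverseRecOn with
  | nil => exact h1
  | append_singleton L x _ =>
    have hL' : L.length < r := by simpa using hL
    rw [prodι_concat, ← comp_add_comp k x, map_add, mul_add, map_add]
    have e0 := hx 0 _ (comp_mem k 0 x) L hL'
    have e1 := hx 1 _ (comp_mem k 1 x) L hL'
    rw [LinearMap.comp_apply, LinearMap.mulRight_apply] at e0 e1
    rw [e0, e1, add_zero]

theorem eq_zero_of_mem_ord {f : Env p k g →ₗ[k] V} (hf : ∀ r, f ∈ ord p k g V r) : f = 0 := by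
  ext u
  revert f
  refine Env.eq_top_of_right p k
    { carrier := {u | ∀ {f : Env p k g →ₗ[k] V}, (∀ r, f ∈ ord p k g V r) → f u = 0}
      add_mem' := fun hs ht f hf => by rw [map_add, hs hf, ht hf, add_zero]
      zero_mem' := fun {f} _ => map_zero f
      smul_mem' := fun c s hs f hf => by rw [map_smul, hs hf, smul_zero] } ?_ ?_ u
  · exact fun hf => hf 1 [] (by simp)
  · intro u hu i x _ f hf
    exact hu fun r => mulRight_mem_ord (hf (r + 1)) x

theorem σpow_mem_ord {f : Env p k g →ₗ[k] V} {r : ℕ} (hf : f ∈ ord p k g V r) (i : ZMod 2) :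
    f ∘ₗ σpow k i ∈ ord p k g V r := by
  rcases zmod_two_cases i with rfl | rfl
  · exact hf
  · induction r generalizing f with
    | zero => exact mem_ord_zero _
    | succ r ih =>
      refine mem_ord_succ ?_ fun i x hx => ?_
      · rw [LinearMap.comp_apply, σpow_one, σ_one]
        exact apply_one_of_mem_ord hf
      · have : f ∘ₗ σpow k 1 = f ∘ₗ σ k := rfl
        rw [this, mulRight_σ hx]
        exact Submodule.smul_of_tower_mem _ _ (ih (mulRight_mem_ord hf x))

/-- By the Leibniz rule a derivative of the product is a sum of products in which one factor has
lost at most one order; the induction is on the total order. -/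
theorem conv_mem_ord {a : Env p k g →ₗ[k] k} {f : Env p k g →ₗ[k] V} {r s : ℕ}
    (ha : a ∈ ord p k g k r) (hf : f ∈ ord p k g V s) : conv a f ∈ ord p k g V (r + s) := by
  obtain ⟨t, ht⟩ : ∃ t, t = r + s := ⟨_, rfl⟩
  rw [← ht]
  induction t generalizing r s a f with
  | zero => exact mem_ord_zero _
  | succ t ih =>
    have hr : r = 0 ∨ ∃ r', r = r' + 1 := by cases r <;> simp
    have hs : s = 0 ∨ ∃ s', s = s' + 1 := by cases s <;> simp
    refine mem_ord_succ ?_ fun i x hx => ?_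
    · rw [conv_one]
      rcases hr with rfl | ⟨r, rfl⟩
      · rcases hs with rfl | ⟨s, rfl⟩
        · omega
        · rw [apply_one_of_mem_ord hf, smul_zero]
      · rw [apply_one_of_mem_ord ha, zero_smul]
    · rw [conv_mulRight _ _ hx]
      refine Submodule.add_mem _ ?_ ?_
      · rcases hr with rfl | ⟨r, rfl⟩
        -- A factor of order `0` has no order to lose; the order of the other factor already
        -- suffices.
        · exact ord_anti (by omega) (ih (mem_ord_zero _) (ord_anti (by omega : t ≤ s) hf)
            (by omega))
        · exact ih (mulRight_mem_ord ha x) hf (by omega)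
      · rcases hs with rfl | ⟨s, rfl⟩
        · exact ih (σpow_mem_ord (ord_anti (by omega : t ≤ r) ha) i) (mem_ord_zero _) (by omega)
        · exact ih (σpow_mem_ord ha i) (mulRight_mem_ord hf x) (by omega)

/-- The leading term of `a f` is that of `a` times the value of `f` at `1`. Differentiating `f`
instead of `a` loses no order of `a`, so such terms count as errors. -/
theorem conv_sub_mem_ord {a : Env p k g →ₗ[k] k} (f : Env p k g →ₗ[k] V) {r : ℕ}
    (ha : a ∈ ord p k g k r) : conv a f - a.smulRight (f 1) ∈ ord p k g V (r + 1) := by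
  induction r generalizing a f with
  | zero =>
    rw [zero_add, mem_ord_one, LinearMap.sub_apply, conv_one, LinearMap.smulRight_apply, sub_self]
  | succ r ih =>
    refine mem_ord_succ ?_ fun i x hx => ?_
    · rw [LinearMap.sub_apply, conv_one, LinearMap.smulRight_apply, sub_self]
    · rw [LinearMap.sub_comp, conv_mulRight _ _ hx, add_sub_right_comm]
      refine Submodule.add_mem _ (ih f (mulRight_mem_ord ha x)) ?_
      exact conv_mem_ord (s := 0) (σpow_mem_ord ha i) (mem_ord_zero _)

end Order

/-! ### Monomials in the coordinates and their leading terms. -/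

section Triangular

variable {p : ℕ} {k g : Type*} [Field k] [AddCommGroup g] [Module k g] [LieSuperalgebra k g]
  [Restricted p k g] [NeZero (2 : k)] [Fact p.Prime] [CharP k p]
  {h : RestrictedSub p k g}

variable (h) in
/-- The functions in `Coind(k)` that vanish on the products of fewer than `r` elements of `g`. -/
def ordA (r : ℕ) : Submodule k (CoindAlg h) := (ord p k g k r).comap CoindAlg.fn

theorem mem_ordA {r : ℕ} {a : CoindAlg h} : a ∈ ordA h r ↔ CoindAlg.fn a ∈ ord p k g k r := Iff.rfl

theorem mul_mem_ordA {r s : ℕ} {a b : CoindAlg h} (ha : a ∈ ordA h r) (hb : b ∈ ordA h s) :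
    a * b ∈ ordA h (r + s) := conv_mem_ord ha hb

theorem mem_ordA_one {a : CoindAlg h} : a ∈ ordA h 1 ↔ CoindAlg.fn a 1 = 0 := mem_ord_one

theorem mem_ordA_zero (a : CoindAlg h) : a ∈ ordA h 0 := mem_ord_zero _

theorem eq_zero_of_mem_ordA {a : CoindAlg h} (ha : ∀ r, a ∈ ordA h r) : a = 0 :=
  CoindAlg.ext ((eq_zero_of_mem_ord ha).trans (map_zero _).symm)

/-- Multiplication by functions separates them on elements that do not vanish at `1`. -/
theorem eq_zero_of_smulCoind_eq_zero {V : Type*} [AddCommGroup V] [Module k V]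
    {ρ : Env p k h.carrier →ₐ[k] Module.End k V} {f : Coind h ρ}
    (hf : (f : Env p k g →ₗ[k] V) 1 ≠ 0) {a : CoindAlg h}
    (ha : CoindAlg.smulCoind h ρ a f = 0) : a = 0 := by
  refine eq_zero_of_mem_ordA fun r => ?_
  induction r with
  | zero => exact mem_ordA_zero a
  | succ r ih =>
    intro L hL
    have h1 := conv_sub_mem_ord (f : Env p k g →ₗ[k] V) (mem_ordA.1 ih) L hL
    have h2 : conv (CoindAlg.fn a) (f : Env p k g →ₗ[k] V) = 0 := congrArg Subtype.val ha
    rw [LinearMap.sub_apply, h2, LinearMap.zero_apply, zero_sub, neg_eq_zero,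
      LinearMap.smulRight_apply] at h1
    exact (smul_eq_zero.1 h1).resolve_right hf

theorem fn_δ (x : g) (a : CoindAlg h) (u : Env p k g) :
    CoindAlg.fn (CoindAlg.δ h x a) u = CoindAlg.fn a (u * Env.ι p k g x) := rfl

variable {J : Type*} [LinearOrder J] {par : J → ZMod 2} (C : Coordinates h par)

namespace Coordinates

/-- The monomial in the coordinates attached to a word. -/
def mon (w : List (J)) : CoindAlg h := (w.map C.x).prod

theorem mon_cons (b : J) (w) : C.mon (b :: w) = C.x b * C.mon w := rfl

theorem mon_mem_ordA (w) : C.mon w ∈ ordA h w.length := by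
  induction w with
  | nil => exact mem_ordA_zero _
  | cons b w ih =>
    rw [mon_cons, List.length_cons, add_comm]
    exact mul_mem_ordA (mem_ordA_one.2 (C.x_one b)) ih

theorem x_mul_mon_erase {y : J} (hy : par y = 0) {w}
    (hw : y ∈ w) : C.x y * C.mon (w.erase y) = C.mon w := by
  induction w with
  | nil => simp at hw
  | cons z w ih =>
    by_cases e : z = y
    · rw [e, List.erase_cons_head, mon_cons]
    · rw [List.erase_cons_tail (by simpa using e), mon_cons, mon_cons,
        ← ih ((List.mem_cons.1 hw).resolve_left (Ne.symm e)), ← mul_assoc, ← mul_assoc,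
        SuperCommutative.super_comm (C.x_mem y) (C.x_mem z), hy, zero_mul, sgn_zero, one_smul]

variable (k) in
/-- The coefficient of the monomial with `y` removed in the derivative of a monomial. -/
def coeff (par : J → ZMod 2) (y : J) : List (J) → k
  | [] => 0
  | z :: w => (if y = z then 1 else 0) + sgn (par y * par z) • coeff par y w

theorem coeff_of_notMem {y : J} {w} (hy : y ∉ w) :
    coeff k par y w = 0 := by
  induction w with
  | nil => rfl
  | cons z w ih =>
    rw [List.mem_cons, not_or] at hy
    rw [coeff, if_neg hy.1, ih hy.2, smul_zero, add_zero]

theorem coeff_even {y : J} (hy : par y = 0) (w) :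
    coeff k par y w = w.count y := by
  induction w with
  | nil => simp [coeff]
  | cons z w ih =>
    rw [coeff, ih, hy, zero_mul, sgn_zero, one_smul, List.count_cons]
    by_cases e : y = z
    · simp [e, add_comm]
    · simp [e, Ne.symm e]

/-- For even `y` the coefficient is the multiplicity, which is positive and less than `p`. For odd
`y`, which occurs once, it is a sign. -/
theorem coeff_ne_zero {y : J} {w} (hy : y ∈ w)
    (hc : w.count y < if par y = 0 then p else 2) : coeff k par y w ≠ 0 := by
  have h0 := List.count_pos_iff.2 hy
  rcases zmod_two_cases (par y) with hp | hp
  · rw [if_pos hp] at hc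
    rw [coeff_even hp, Ne, CharP.cast_eq_zero_iff k p]
    exact Nat.not_dvd_of_pos_of_lt h0 hc
  · rw [hp, if_neg (by decide)] at hc
    clear h0
    induction w with
    | nil => simp at hy
    | cons z w ih =>
      rw [coeff]
      by_cases e : y = z
      · have : y ∉ w := fun h1 => by
          have := List.count_pos_iff.2 h1
          rw [← e, List.count_cons_self] at hc
          omega
        rw [coeff_of_notMem this, if_pos e]
        simp
      · rw [if_neg e, zero_add]
        have h1 := ih ((List.mem_cons.1 hy).resolve_left e)
          (by rwa [List.count_cons_of_ne (Ne.symm e)] at hc)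
        rcases zmod_two_cases (par z) with hz | hz <;> rw [hz, hp] <;> simpa using h1

/-- Since `δ_X(x_b)` takes the dual values at `1`, the vector dual to `x_y` acts on leading terms as
the partial derivative along `x_y`. An odd `y` is assumed to occur at most once, so that removing
the first occurrence gives the derivative. -/
theorem δ_mon_sub_mem {y : J} {w}
    (hc : par y = 1 → w.count y < 2) :
    CoindAlg.δ h (C.vec y) (C.mon w) - coeff k par y w • C.mon (w.erase y) ∈ ordA h w.length := by
  induction w with
  | nil => exact mem_ordA_zero _
  | cons z w ih =>
    have hc' : par y = 1 → w.count y < 2 := fun h1 =>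
      lt_of_le_of_lt (List.count_le_count_cons) (hc h1)
    have h1 : CoindAlg.δ h (C.vec y) (C.x z) - (if y = z then (1 : k) else 0) • (1 : CoindAlg h) ∈
        ordA h 1 := by
      rw [mem_ordA_one, map_sub, LinearMap.sub_apply, map_smul, LinearMap.smul_apply,
        CoindAlg.fn_one, AlgHom.toLinearMap_apply, fn_δ, one_mul, C.x_vec, map_one]
      simp [eq_comm]
    have h2 := mul_mem_ordA h1 (C.mon_mem_ordA w)
    have h3 := mul_mem_ordA (mem_ordA_one.2 (C.x_one z)) (ih hc')
    have h4 := Submodule.add_mem _ h2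
      (Submodule.smul_of_tower_mem _ (sgn (par y * par z)) h3)
    rw [List.length_cons, add_comm]
    convert h4 using 1
    rw [mon_cons, (CoindAlg.isSuperDer_δ h (C.vec_mem y)).leibniz,
      SymAlg.σpow_of_mem (C.x_mem z), coeff, add_smul, sub_mul, mul_sub, smul_sub, smul_mul_assoc,
      smul_mul_assoc, one_mul]
    have h5 : (sgn (par y * par z) • coeff k par y w) • C.mon ((z :: w).erase y) =
        sgn (par y * par z) • (C.x z * coeff k par y w • C.mon (w.erase y)) := by
      rw [mul_smul_comm, smul_assoc]
      congr 1
      by_cases e : y = z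
      · subst e
        rw [List.erase_cons_head]
        by_cases hy : y ∈ w
        · rcases zmod_two_cases (par y) with hp | hp
          · rw [C.x_mul_mon_erase hp hy]
          · have h6 := hc hp
            have := List.count_pos_iff.2 hy
            rw [List.count_cons_self] at h6
            omega
        · rw [coeff_of_notMem hy, zero_smul, zero_smul]
      · rw [List.erase_cons_tail (by simpa using Ne.symm e), mon_cons]
    have h7 : (if y = z then (1 : k) else 0) • C.mon ((z :: w).erase y) =
        (if y = z then (1 : k) else 0) • C.mon w := by
      split_ifs with e
      · rw [e, List.erase_cons_head]
      · simp
    rw [h5, h7]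
    abel

/-- Evaluation on a product of vectors differentiates by its factors one after the other, and to
leading order each derivative strips one letter with a nonzero coefficient. So the pairing between
normal monomials and normal products of equal length is diagonal and nondegenerate. -/
theorem mon_apply_ne_zero_iff {w w' : List (J)}
    (hw : ∀ x, w.count x < if par x = 0 then p else 2) (hl : w.length = w'.length) :
    CoindAlg.fn (C.mon w) (prodι p k (w'.map C.vec)) ≠ 0 ↔ w.Perm w' := by
  induction w' using List.reverseRecOn generalizing w with
  | nil =>
    rw [List.length_nil, List.length_eq_zero_iff] at hl
    subst hl
    simp only [List.map_nil, List.Perm.refl, iff_true]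
    change Env.counit p k g 1 ≠ 0
    simp
  | append_singleton v y ih =>
    rw [List.length_append, List.length_singleton] at hl
    have h1 := C.δ_mon_sub_mem (y := y) (w := w) (fun hp => by
      have := hw y
      rwa [hp, if_neg (by decide)] at this) (v.map C.vec) (by simp; omega)
    rw [map_sub, LinearMap.sub_apply, map_smul, LinearMap.smul_apply, sub_eq_zero] at h1
    have h2 : CoindAlg.fn (C.mon w) (prodι p k ((v ++ [y]).map C.vec)) =
        CoindAlg.fn (CoindAlg.δ h (C.vec y) (C.mon w)) (prodι p k (v.map C.vec)) := by
      rw [List.map_append, List.map_singleton, prodι_concat]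
      rfl
    rw [h2, h1]
    by_cases hy : y ∈ w
    · rw [smul_eq_mul, mul_ne_zero_iff, and_iff_right (coeff_ne_zero hy (hw y)), ih]
      · have e1 := List.perm_cons_erase hy
        have e2 := List.perm_append_comm (l₁ := v) (l₂ := [y])
        refine ⟨fun e => e1.trans ((e.cons y).trans e2.symm), fun e => ?_⟩
        exact (e1.symm.trans (e.trans e2)).cons_inv
      · exact fun x => lt_of_le_of_lt (List.erase_sublist.count_le x) (hw x)
      · rw [List.length_erase_of_mem hy]; omega
    · rw [coeff_of_notMem hy, zero_smul]
      simp only [ne_eq, not_true_eq_false, false_iff]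
      exact fun e => hy (e.mem_iff.2 (by simp))

variable [Fintype J] {V : Type*} [AddCommGroup V] [Module k V]
  {ρ : Env p k h.carrier →ₐ[k] Module.End k V}

/-- Products of `r` factors are combinations of normal products and of elements of `h U'(g)` with
shorter second factor. On the latter equivariance reduces `f` to shorter products, where it vanishes
already. -/
theorem mem_ord_succ_of_normal (f : Coind h ρ) {r : ℕ}
    (hf : (f : Env p k g →ₗ[k] V) ∈ ord p k g V r)
    (hw : ∀ w, IsNormal p par w → w.length = r →
      (f : Env p k g →ₗ[k] V) (prodι p k (w.map C.vec)) = 0) :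
    (f : Env p k g →ₗ[k] V) ∈ ord p k g V (r + 1) := by
  intro L hL
  have h1 := C.span L
  have h2 : (Submodule.span k {u | ∃ w, IsNormal p par w ∧ w.length ≤ L.length ∧
      u = prodι p k (w.map C.vec)} ⊔
    Submodule.span k {u | ∃ H ∈ h.carrier, ∃ L' : List g, L'.length < L.length ∧
      u = Env.ι p k g H * prodι p k L'}) ≤ LinearMap.ker (f : Env p k g →ₗ[k] V) := by
    refine sup_le (Submodule.span_le.2 ?_) (Submodule.span_le.2 ?_)
    · rintro _ ⟨w, hn, hl, rfl⟩
      rw [SetLike.mem_coe, LinearMap.mem_ker]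
      rcases (show w.length ≤ r by omega).lt_or_eq with h3 | h3
      · exact hf _ (by simpa using h3)
      · exact hw w hn h3
    · rintro _ ⟨H, hH, L', hl, rfl⟩
      rw [SetLike.mem_coe, LinearMap.mem_ker]
      have := f.2 (Env.ι p k h.carrier ⟨H, hH⟩) (prodι p k L')
      rw [RestrictedSub.incl_ι] at this
      rw [this, hf L' (by omega), map_zero]
  exact h2 h1

theorem _root_.SuperLie.IsNormal.length_le {B : Type*} [LinearOrder B] [Fintype B]
    {par : B → ZMod 2} {w : List B} (hw : IsNormal p par w) :
    w.length ≤ Fintype.card B * p := by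
  classical
  have h1 := Multiset.toFinset_sum_count_eq (w : Multiset B)
  rw [Multiset.coe_card] at h1
  rw [← h1]
  calc _ ≤ ∑ a ∈ (w : Multiset B).toFinset, p := Finset.sum_le_sum fun a _ => by
        have := hw.2 a
        have h2 := (Fact.out : p.Prime).two_le
        rw [Multiset.coe_count]
        split_ifs at this
        · convert this.le
        · exact le_trans (by convert this.le) h2
    _ ≤ _ := by
      rw [Finset.sum_const, smul_eq_mul]
      exact Nat.mul_le_mul_right p (Finset.card_le_univ _)

-- No normal word has length greater than `Fintype.card J * p`. Beyond this order there is nothing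
-- left to test, so `f` vanishes to every order.
include C in
theorem eq_zero_of_mem_ord (f : Coind h ρ)
    (hf : (f : Env p k g →ₗ[k] V) ∈ ord p k g V
      (Fintype.card (J) * p + 1)) : f = 0 := by
  refine Subtype.ext (SuperLie.eq_zero_of_mem_ord fun r => ?_)
  rcases le_total r (Fintype.card (J) * p + 1) with hr | hr
  · exact ord_anti hr hf
  · induction r, hr using Nat.le_induction with
    | base => exact hf
    | succ r hr ih =>
      refine C.mem_ord_succ_of_normal f ih fun w hw hl => ?_
      have := hw.length_le
      omega

/-- Every coinduced function is the product of a polynomial in the coordinates and a given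
coinduced function, if the value of the latter at `1` spans. -/
theorem exists_smulCoind_eq {f₀ : Coind h ρ}
    (h₀ : ∀ v : V, ∃ c : k, v = c • (f₀ : Env p k g →ₗ[k] V) 1) (f : Coind h ρ) :
    ∃ a ∈ Algebra.adjoin k (Set.range C.x), f = CoindAlg.smulCoind h ρ a f₀ := by
  -- Descending induction on the order `r` of `f`: the number `d` bounds its distance to the order
  -- from which on functions are zero.
  suffices H : ∀ d r, Fintype.card (J) * p + 1 ≤ r + d →
      ∀ f : Coind h ρ, (f : Env p k g →ₗ[k] V) ∈ ord p k g V r →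
      ∃ a ∈ Algebra.adjoin k (Set.range C.x), f = CoindAlg.smulCoind h ρ a f₀ from
    H _ 0 (by rw [zero_add]) f (mem_ord_zero _)
  intro d
  induction d with
  | zero =>
    intro r hr f hf
    exact ⟨0, Subalgebra.zero_mem _, by
      rw [C.eq_zero_of_mem_ord f (ord_anti hr hf), map_zero, LinearMap.zero_apply]⟩
  | succ d ih =>
    intro r hr f hf
    choose γ hγ using fun w : List (J) =>
      h₀ ((f : Env p k g →ₗ[k] V) (prodι p k (w.map C.vec)))
    have hfin : {w : List (J) |
        IsNormal p par w ∧ w.length = r}.Finite :=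
      (List.finite_length_eq _ r).subset fun w hw => hw.2
    -- The polynomial `c` of order `r` is chosen so that `c f₀` has the same values as `f` on normal
    -- products of length `r`; subtracting it raises the order. The division is by the diagonal
    -- entries of the pairing.
    let c : CoindAlg h := ∑ w ∈ hfin.toFinset,
      (γ w / CoindAlg.fn (C.mon w) (prodι p k (w.map C.vec))) • C.mon w
    have hc : c ∈ Algebra.adjoin k (Set.range C.x) := by
      refine Subalgebra.sum_mem _ fun w _ => Subalgebra.smul_mem _ ?_ _
      refine Subalgebra.list_prod_mem _ fun a ha => ?_
      obtain ⟨b, -, rfl⟩ := List.mem_map.1 ha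
      exact Algebra.subset_adjoin ⟨b, rfl⟩
    have hco : c ∈ ordA h r := by
      refine Submodule.sum_mem _ fun w hw => Submodule.smul_mem _ _ ?_
      rw [Set.Finite.mem_toFinset] at hw
      exact hw.2 ▸ C.mon_mem_ordA w
    have hsub : ((f - CoindAlg.smulCoind h ρ c f₀ : Coind h ρ) : Env p k g →ₗ[k] V) ∈
        ord p k g V (r + 1) := by
      refine C.mem_ord_succ_of_normal _ (Submodule.sub_mem _ hf
        (conv_mem_ord (s := 0) hco (mem_ord_zero _))) fun w hw hl => ?_
      change (f : Env p k g →ₗ[k] V) (prodι p k (w.map C.vec)) -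
        conv (CoindAlg.fn c) (f₀ : Env p k g →ₗ[k] V) (prodι p k (w.map C.vec)) = 0
      have h1 := conv_sub_mem_ord (f₀ : Env p k g →ₗ[k] V) (mem_ordA.1 hco) (w.map C.vec)
        (by simp [hl])
      rw [LinearMap.sub_apply, sub_eq_zero, LinearMap.smulRight_apply] at h1
      rw [h1, hγ, ← sub_smul]
      have h2 : CoindAlg.fn c (prodι p k (w.map C.vec)) = γ w := by
        rw [map_sum, LinearMap.sum_apply, Finset.sum_eq_single w]
        · rw [map_smul, LinearMap.smul_apply, smul_eq_mul, div_mul_cancel₀]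
          exact (C.mon_apply_ne_zero_iff (fun x => by convert hw.2 x) rfl).2 (List.Perm.refl _)
        · intro v hv hne
          rw [Set.Finite.mem_toFinset] at hv
          rw [map_smul, LinearMap.smul_apply]
          by_contra h3
          have h4 : CoindAlg.fn (C.mon v) (prodι p k (w.map C.vec)) ≠ 0 := fun h4 =>
            h3 (by rw [h4, smul_zero])
          rw [C.mon_apply_ne_zero_iff (fun x => by convert hv.1.2 x) (hv.2.trans hl.symm)] at h4
          exact hne (h4.eq_of_pairwise (fun a b _ _ => le_antisymm) hv.1.1 hw.1)
        · intro hn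
          exact absurd ((Set.Finite.mem_toFinset hfin).2 ⟨hw, hl⟩) hn
      rw [h2, sub_self, zero_smul]
    obtain ⟨a, ha, e⟩ := ih (r + 1) (by omega) _ hsub
    refine ⟨a + c, Subalgebra.add_mem _ ha hc, ?_⟩
    rw [map_add, LinearMap.add_apply, ← e, sub_add_cancel]

end Coordinates

end Triangular

/-! # Superderivations of the coinduced algebra -/

section DerBasis

variable {p : ℕ} {k g : Type*} [Field k] [AddCommGroup g] [Module k g] [LieSuperalgebra k g]
  [Restricted p k g] [NeZero (2 : k)] [Fact p.Prime] [CharP k p]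
  {h : RestrictedSub p k g} {J : Type*} [LinearOrder J] [Fintype J] {par : J → ZMod 2}
  (C : Coordinates h par)

namespace Coordinates

/-- The unit of `Coind(k)` has value `1` at `1`, so `exists_smulCoind_eq` with `f₀ = 1` shows that
the coordinates generate the algebra. -/
theorem mem_adjoin (a : CoindAlg h) : a ∈ Algebra.adjoin k (Set.range C.x) := by
  obtain ⟨c, hc, e⟩ := C.exists_smulCoind_eq (ρ := charRep (Env.counit p k h.carrier))
    (f₀ := (1 : CoindAlg h)) (fun v => ⟨v, by
      change v = v • Env.counit p k g 1
      rw [map_one, smul_eq_mul, mul_one]⟩) a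
  have : a = c := e.trans (mul_one c)
  exact this ▸ hc

theorem eq_zero_of_superDer {i : ZMod 2} {D : CoindAlg h →ₗ[k] CoindAlg h} (hD : IsSuperDer k i D)
    (h0 : ∀ b, D (C.x b) = 0) : D = 0 := by
  ext a
  have ha := C.mem_adjoin a
  rw [LinearMap.zero_apply]
  induction ha using Algebra.adjoin_induction with
  | mem _ h => obtain ⟨b, rfl⟩ := h; exact h0 b
  | algebraMap r => rw [Algebra.algebraMap_eq_smul_one, map_smul, hD.one, smul_zero]
  | add a b _ _ ha hb => rw [map_add, ha, hb, add_zero]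
  | mul a b _ _ ha hb => rw [hD.leibniz, ha, hb, zero_mul, mul_zero, add_zero]

/-- The values of a superderivation on the coordinates. -/
def ev : Der k (CoindAlg h) →ₗ[CoindAlg h] (J → CoindAlg h) where
  toFun E b := (E : CoindAlg h →ₗ[k] CoindAlg h) (C.x b)
  map_add' _ _ := rfl
  map_smul' _ _ := rfl

theorem ev_apply (E : Der k (CoindAlg h)) (b : J) :
    C.ev E b = (E : CoindAlg h →ₗ[k] CoindAlg h) (C.x b) := rfl

/-- The even and the odd part of a superderivation take values of different parity on each
coordinate, so each of them vanishes on the coordinates, which generate the algebra. -/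
theorem ev_injective : Function.Injective C.ev := by
  rw [← LinearMap.ker_eq_bot, LinearMap.ker_eq_bot']
  rintro ⟨_, E₀, E₁, h₀, h₁, rfl⟩ h
  have key : ∀ b, E₀ (C.x b) = 0 ∧ E₁ (C.x b) = 0 := by
    intro b
    have e : E₀ (C.x b) + E₁ (C.x b) = 0 := congrFun h b
    have e0 := h₀.mem (C.x_mem b)
    have e1 := h₁.mem (C.x_mem b)
    rw [zero_add] at e0
    have h2 := congrArg (comp k (par b)) e
    rw [map_add, comp_of_mem k e0, comp_of_mem_ne k e1 (by
      rcases zmod_two_cases (par b) with h | h <;> rw [h] <;> decide), add_zero, map_zero] at h2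
    refine ⟨h2, ?_⟩
    rwa [h2, zero_add] at e
  apply Subtype.ext
  change E₀ + E₁ = 0
  rw [C.eq_zero_of_superDer h₀ fun b => (key b).1, C.eq_zero_of_superDer h₁ fun b => (key b).2,
    add_zero]

/-- The values on the coordinates of the action of the vectors dual to them. -/
def jacobian : Matrix J J (CoindAlg h) := Matrix.of fun c b => CoindAlg.δ h (C.vec c) (C.x b)

include C in
theorem ordA_eq_zero {a : CoindAlg h} (ha : a ∈ ordA h (Fintype.card J * p + 1)) : a = 0 :=
  C.eq_zero_of_mem_ord (ρ := charRep (Env.counit p k h.carrier)) a ha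

/-- At `1` the matrix takes the values of the identity, so the difference has entries of positive
order. Its powers have entries of growing order, which is eventually zero, so the difference is
nilpotent. -/
theorem isUnit_jacobian : IsUnit C.jacobian := by
  have h1 : ∀ r c b, ((C.jacobian - 1) ^ r) c b ∈ ordA h r := by
    intro r
    induction r with
    | zero => exact fun c b => mem_ordA_zero _
    | succ r ih =>
      intro c b
      rw [pow_succ, Matrix.mul_apply]
      refine Submodule.sum_mem _ fun l _ => mul_mem_ordA (ih c l) (mem_ordA_one.2 ?_)
      rw [Matrix.sub_apply, map_sub, LinearMap.sub_apply, jacobian, Matrix.of_apply, fn_δ, one_mul,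
        C.x_vec, Matrix.one_apply]
      by_cases e : l = b
      · subst e
        rw [if_pos rfl, if_pos rfl, CoindAlg.fn_one, AlgHom.toLinearMap_apply, map_one, sub_self]
      · rw [if_neg (Ne.symm e), if_neg e, map_zero, LinearMap.zero_apply, sub_zero]
  have h2 : IsNilpotent (C.jacobian - 1) := ⟨_, by
    ext c b
    exact C.ordA_eq_zero (h1 _ c b)⟩
  have := h2.isUnit_one_add
  rwa [add_sub_cancel] at this

/-- The superderivations of `Coind(k)` given by the vectors dual to the coordinates. -/
def δvec (b : J) : Der k (CoindAlg h) :=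
  ⟨CoindAlg.δ h (C.vec b), (CoindAlg.isSuperDer_δ h (C.vec_mem b)).mem_der⟩

/-- The rows of the inverse matrix combine the superderivations `δ_X` into partial derivatives. No
presentation of the algebra by generators and relations is needed. -/
theorem ev_surjective : Function.Surjective C.ev := by
  obtain ⟨S, hS⟩ := C.isUnit_jacobian.exists_left_inv
  have h1 : ∀ b c, C.ev (∑ l, S b l • C.δvec l) c = if b = c then 1 else 0 := by
    intro b c
    have := congrFun (congrFun hS b) c
    rw [Matrix.mul_apply, Matrix.one_apply] at this
    rw [map_sum, Finset.sum_apply, ← this]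
    exact Finset.sum_congr rfl fun l _ => by rw [map_smul]; rfl
  intro v
  refine ⟨∑ b, v b • ∑ l, S b l • C.δvec l, ?_⟩
  funext c
  rw [map_sum, Finset.sum_apply]
  simp only [map_smul, Pi.smul_apply, h1]
  simp

/-- The basis of `Der(Coind(k))` dual to the coordinates. -/
def pd : Module.Basis J (CoindAlg h) (Der k (CoindAlg h)) :=
  Module.Basis.ofEquivFun (LinearEquiv.ofBijective C.ev ⟨C.ev_injective, C.ev_surjective⟩)

theorem ev_pd (b : J) : C.ev (C.pd b) = Pi.single b 1 := by
  rw [pd, Module.Basis.coe_ofEquivFun]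
  exact (LinearEquiv.ofBijective C.ev ⟨C.ev_injective, C.ev_surjective⟩).apply_symm_apply _

theorem pd_x (b c : J) : (C.pd b : CoindAlg h →ₗ[k] CoindAlg h) (C.x c) =
    if c = b then 1 else 0 := by
  rw [← ev_apply, ev_pd, Pi.single_apply]

theorem pd_repr (E : Der k (CoindAlg h)) (b : J) :
    C.pd.repr E b = (E : CoindAlg h →ₗ[k] CoindAlg h) (C.x b) := rfl

theorem pd_mem (b : J) : C.pd b ∈ part k (Der k (CoindAlg h)) (par b) := by
  rw [mem_part]
  apply C.ev_injective
  funext c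
  rw [ev_apply, map_zsmul, Pi.smul_apply, ev_apply, Der.coe_σ, mem_part.1 (C.x_mem c), map_zsmul,
    pd_x, map_zsmul]
  split_ifs with e
  · rw [e, σ_one]
  · simp

end Coordinates

end DerBasis

theorem σpow_mul {k A : Type*} [Field k] [Ring A] [Algebra k A] [Superalgebra k A] (i : ZMod 2)
    (a b : A) : σpow k i (a * b) = σpow k i a * σpow k i b := by
  rw [← σpowAlg_apply, map_mul, σpowAlg_apply, σpowAlg_apply]

/-! ### Bases of dual supermodules. -/

section DualBasis

variable {k A M J : Type*} [Field k] [Ring A] [Algebra k A] [Superalgebra k A]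
  [SuperCommutative k A] [NeZero (2 : k)]
  [AddCommGroup M] [Module k M] [Superspace k M] [Module A M] [Supermodule k A M]
  [Fintype J] [DecidableEq J] (e : Module.Basis J A M) {par : J → ZMod 2}
  (he : ∀ b, e b ∈ part k M (par b))

theorem SDual.smul_A_fn_of_mem (a : A) (φ : SDual k A M) {i : ZMod 2} {m : M}
    (hm : m ∈ part k M i) : (a • φ).fn m = σpow k i a * φ.fn m := by
  rw [SDual.smul_A_fn, mem_part.1 hm]
  conv_rhs => rw [← comp_add_comp k a, map_add, SymAlg.σpow_of_mem (comp_mem k 0 a),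
    SymAlg.σpow_of_mem (comp_mem k 1 a), mul_zero, mul_one, sgn_zero, one_smul, add_mul]
  rw [map_zsmul, smul_mul_assoc, mul_smul_comm]

theorem σpow_σpow {V : Type*} [AddCommGroup V] [Module k V] [Superspace k V] (i : ZMod 2) (v : V) :
    σpow k i (σpow k i v) = v := by
  rcases zmod_two_cases i with rfl | rfl
  · rfl
  · exact σ_σ k v

/-- The coordinates of elements of the dual supermodule. -/
def dualEquiv : SDual k A M ≃ₗ[A] (J → A) where
  -- As `⟨m, a φ⟩ = (-1)^(|m||a|) a ⟨m, φ⟩`, evaluation at an odd vector is linear only up to `σ`;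
  -- the twist restores linearity over `A`.
  toFun φ b := σpow k (par b) (φ.fn (e b))
  map_add' φ ψ := funext fun b => by rw [SDual.add_fn, map_add]; rfl
  map_smul' a φ := funext fun b => by
    rw [SDual.smul_A_fn_of_mem a φ (he b), σpow_mul, σpow_σpow]
    rfl
  invFun v := (e.constr ℤ fun b => σpow k (par b) (v b) : M →ₗ[A] A)
  left_inv φ := e.ext fun b => by
    rw [Module.Basis.constr_basis, σpow_σpow]
    rfl
  right_inv v := funext fun b => by
    change σpow k (par b) ((e.constr ℤ fun b => σpow k (par b) (v b) : M →ₗ[A] A) (e b)) = _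
    rw [Module.Basis.constr_basis, σpow_σpow]

/-- The basis of the dual supermodule given by the coordinates. -/
def dualBasis : Module.Basis J A (SDual k A M) := Module.Basis.ofEquivFun (dualEquiv e he)

theorem dualBasis_fn (b c : J) :
    (dualBasis e he b).fn (e c) = if b = c then 1 else 0 := by
  have h1 : dualEquiv e he (dualBasis e he b) = Pi.single b 1 := by
    rw [dualBasis, Module.Basis.coe_ofEquivFun, LinearEquiv.apply_symm_apply]
  have h2 : σpow k (par c) ((dualBasis e he b).fn (e c)) = _ := congrFun h1 c
  rw [← σpow_σpow (k := k) (par c) ((dualBasis e he b).fn (e c)), h2, Pi.single_apply]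
  have h3 : σpow k (par c) (1 : A) = 1 := by rw [← σpowAlg_apply, map_one (σpowAlg k (par c))]
  split_ifs with e1 e2 e2
  · exact h3
  · exact absurd e1.symm e2
  · exact absurd e2.symm e1
  · exact map_zero _

theorem SDual.ext_basis {φ ψ : SDual k A M} (h : ∀ b, φ.fn (e b) = ψ.fn (e b)) : φ = ψ :=
  e.ext h

theorem dualBasis_mem (b : J) : dualBasis e he b ∈ part k (SDual k A M) (par b) := by
  rw [mem_part]
  refine SDual.ext_basis e fun c => ?_
  rw [SDual.σ_fn, mem_part.1 (he c), map_zsmul, map_zsmul, fn_zsmul, dualBasis_fn]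
  split_ifs with e
  · rw [e, σ_one]
  · simp

/-- The homogeneous basis of the dual supermodule. -/
def HomBasis.ofDual {n m : ℕ} (e : Module.Basis (Fin n ⊕ Fin m) A M)
    (he : ∀ b, e b ∈ part k M (parity b)) : HomBasis k A (SDual k A M) n m where
  basis := dualBasis e he
  even i := dualBasis_mem e he (Sum.inl i)
  odd s := dualBasis_mem e he (Sum.inr s)

end DualBasis

/-! # Koszul complexes in symmetric superalgebras -/

namespace SymAlg

section Twist

variable {k A N : Type*} [Field k] [Ring A] [Algebra k A] [Superalgebra k A]
  [AddCommGroup N] [Module k N] [Superspace k N] [Module A N] [Supermodule k A N]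

theorem hom_ext {B : Type*} [Ring B] [Algebra k B] {f f' : SymAlg k A N →ₐ[k] B}
    (ha : ∀ a, f (ofA k A N a) = f' (ofA k A N a)) (hn : ∀ n, f (ι k A N n) = f' (ι k A N n)) :
    f = f' := by
  ext x
  induction x using SymAlg.induction with
  | hs c => rw [AlgHom.commutes, AlgHom.commutes]
  | ha a => exact ha a
  | hn n => exact hn n
  | hmul x y hx hy => rw [map_mul, map_mul, hx, hy]
  | hadd x y hx hy => rw [map_add, map_add, hx, hy]

/-- The sign rule in a form where only `n` has to be homogeneous. -/
theorem ι_mul_σpow [NeZero (2 : k)] {j : ZMod 2} {n : N} (hn : n ∈ part k N j)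
    (y : SymAlg k A N) : ι k A N n * y = σpow k j y * ι k A N n := by
  induction y using SymAlg.induction with
  | hs c =>
    rw [← σpowAlg_apply, AlgHom.commutes, Algebra.commutes]
  | ha a =>
    rw [← comp_add_comp k a, map_add, mul_add, map_add, add_mul]
    congr 1
    · rw [ι_mul_ofA k (comp_mem k 0 a) hn, σpow_ofA, σpow_of_mem (comp_mem k 0 a)]
      simp
    · rw [ι_mul_ofA k (comp_mem k 1 a) hn, σpow_ofA, σpow_of_mem (comp_mem k 1 a), one_mul, mul_one,
        map_zsmul, smul_mul_assoc]
  | hn n' =>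
    rw [← comp_add_comp k n', map_add, mul_add, map_add, add_mul]
    congr 1
    · rw [ι_mul_ι k hn (comp_mem k 0 n'), σpow_ι, σpow_of_mem (comp_mem k 0 n'), map_zsmul,
        smul_mul_assoc]
    · rw [ι_mul_ι k hn (comp_mem k 1 n'), σpow_ι, σpow_of_mem (comp_mem k 1 n'), map_zsmul,
        smul_mul_assoc]
  | hmul x y hx hy => rw [← mul_assoc, hx, mul_assoc, hy, ← mul_assoc, σpow_mul]
  | hadd x y hx hy => rw [mul_add, hx, hy, map_add, add_mul]

theorem ofA_mul_σpow [NeZero (2 : k)] [SuperCommutative k A] {j : ZMod 2} {a : A}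
    (ha : a ∈ part k A j) (y : SymAlg k A N) : ofA k A N a * y = σpow k j y * ofA k A N a := by
  induction y using SymAlg.induction with
  | hs c =>
    rw [← σpowAlg_apply, AlgHom.commutes, Algebra.commutes]
  | ha b => rw [σpow_ofA, ← ofA_mul, ← ofA_mul, mul_comm_σpow ha]
  | hn n =>
    rw [← comp_add_comp k n, map_add, mul_add, map_add, add_mul]
    congr 1
    · rw [σpow_ι, σpow_of_mem (comp_mem k 0 n), mul_zero, sgn_zero, one_smul,
        ι_mul_ofA k ha (comp_mem k 0 n), mul_zero, sgn_zero, one_smul]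
    · rw [σpow_ι, σpow_of_mem (comp_mem k 1 n), mul_one, map_zsmul, smul_mul_assoc,
        ι_mul_ofA k ha (comp_mem k 1 n), smul_smul, mul_one, sgn_mul_self, one_smul]
  | hmul x y hx hy => rw [← mul_assoc, hx, mul_assoc, hy, ← mul_assoc, σpow_mul]
  | hadd x y hx hy => rw [mul_add, hx, hy, map_add, add_mul]

/-- The matrix `(S x, y; 0, x)`. -/
def upperHom {B : Type*} [Ring B] [Algebra k B] (S : B →ₐ[k] B) :
    B × B →ₗ[k] Matrix (Fin 2) (Fin 2) B where
  toFun x := !![S x.1, x.2; 0, x.1]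
  map_add' x y := by ext a b; fin_cases a <;> fin_cases b <;> simp
  map_smul' c x := by ext a b; fin_cases a <;> fin_cases b <;> simp

theorem upperHom_mul {B : Type*} [Ring B] [Algebra k B] (S : B →ₐ[k] B) (x x' y y' : B) :
    upperHom S (x, x') * upperHom S (y, y') = upperHom S (x * y, x' * y + S x * y') := by
  ext a b
  fin_cases a <;> fin_cases b <;> simp [upperHom, Matrix.mul_apply, add_comm]

section

variable (S : SymAlg k A N →ₐ[k] SymAlg k A N) (T : N →ₗ[k] SymAlg k A N)
  (hsmul : ∀ (a : A) (n : N), T (a • n) = S (ofA k A N a) * T n)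
  (hcl : ∀ {i j : ZMod 2} {a : A} {n : N}, a ∈ part k A i → n ∈ part k N j →
    T n * ofA k A N a = sgn (i * j) • (S (ofA k A N a) * T n))
  (hc : ∀ {i j : ZMod 2} {n n' : N}, n ∈ part k N i → n' ∈ part k N j →
    T n * ι k A N n' + S (ι k A N n) * T n' =
      sgn (i * j) • (T n' * ι k A N n + S (ι k A N n') * T n))

/-- The algebra morphism `x ↦ (S x, Δ x; 0, x)`. -/
def twistMatrix : SymAlg k A N →ₐ[k] Matrix (Fin 2) (Fin 2) (SymAlg k A N) :=
  lift (upperHom S ∘ₗ (ofA k A N).prod 0) (upperHom S ∘ₗ (ι k A N).prod T)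
    (by
      ext a b
      fin_cases a <;> fin_cases b <;> simp [upperHom, ofA_one])
    (fun a b => by
      simp only [LinearMap.comp_apply, LinearMap.prod_apply, Function.prod_apply]
      simp only [LinearMap.zero_apply]
      rw [upperHom_mul, ofA_mul, zero_mul, mul_zero, add_zero])
    (fun a n => by
      simp only [LinearMap.comp_apply, LinearMap.prod_apply, Function.prod_apply]
      simp only [LinearMap.zero_apply]
      rw [upperHom_mul, ι_smul, hsmul, zero_mul, zero_add])
    (fun {j l a n} ha hn => by
      simp only [LinearMap.comp_apply, LinearMap.prod_apply, Function.prod_apply]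
      simp only [LinearMap.zero_apply]
      rw [upperHom_mul, upperHom_mul, ← map_zsmul, Prod.smul_mk, ι_mul_ofA k ha hn, hcl ha hn,
        mul_zero, add_zero, zero_mul, zero_add])
    (fun {j l n n'} hn hn' => by
      simp only [LinearMap.comp_apply, LinearMap.prod_apply, Function.prod_apply]
      rw [upperHom_mul, upperHom_mul, ← map_zsmul, Prod.smul_mk, ι_mul_ι k hn hn', hc hn hn'])

/-- The map `Δ` with `Δ(x y) = Δ(x) y + S(x) Δ(y)` that vanishes on `A` and extends `T`. -/
def twist : SymAlg k A N →ₗ[k] SymAlg k A N :=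
  Matrix.entryLinearMap k (SymAlg k A N) 0 1 ∘ₗ (twistMatrix S T hsmul hcl hc).toLinearMap

theorem twist_ofA (a : A) : twist S T hsmul hcl hc (ofA k A N a) = 0 := by
  change twistMatrix S T hsmul hcl hc (ofA k A N a) 0 1 = _
  rw [twistMatrix, lift_ofA]
  rfl

theorem twist_ι (n : N) : twist S T hsmul hcl hc (ι k A N n) = T n := by
  change twistMatrix S T hsmul hcl hc (ι k A N n) 0 1 = _
  rw [twistMatrix, lift_ι]
  rfl

theorem twistMatrix_eq (x : SymAlg k A N) :
    twistMatrix S T hsmul hcl hc x = upperHom S (x, twist S T hsmul hcl hc x) := by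
  suffices h : ∃ y, twistMatrix S T hsmul hcl hc x = upperHom S (x, y) by
    obtain ⟨y, hy⟩ := h
    have : twist S T hsmul hcl hc x = y := by
      change twistMatrix S T hsmul hcl hc x 0 1 = y
      rw [hy]
      rfl
    rw [hy, this]
  induction x using SymAlg.induction with
  | hs c =>
    refine ⟨0, ?_⟩
    rw [AlgHom.commutes]
    ext a b
    fin_cases a <;> fin_cases b <;> simp [upperHom, Matrix.algebraMap_matrix_apply]
  | ha a => exact ⟨_, by rw [twistMatrix, lift_ofA]; rfl⟩
  | hn n => exact ⟨_, by rw [twistMatrix, lift_ι]; rfl⟩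
  | hmul x y hx hy =>
    obtain ⟨x', hx⟩ := hx
    obtain ⟨y', hy⟩ := hy
    exact ⟨_, by rw [map_mul, hx, hy, upperHom_mul]⟩
  | hadd x y hx hy =>
    obtain ⟨x', hx⟩ := hx
    obtain ⟨y', hy⟩ := hy
    exact ⟨_, by rw [map_add, hx, hy, ← map_add]; rfl⟩

/-- The upper right entry of a product of triangular matrices. The choice of the parity involution
for `S` gives contractions with odd variables, and that of the morphism killing an even variable
gives divided differences. -/
theorem twist_mul (x y : SymAlg k A N) : twist S T hsmul hcl hc (x * y) =
    twist S T hsmul hcl hc x * y + S x * twist S T hsmul hcl hc y := by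
  have h := congrFun (congrFun (map_mul (twistMatrix S T hsmul hcl hc) x y) 0) 1
  rw [twistMatrix_eq, twistMatrix_eq, twistMatrix_eq, upperHom_mul] at h
  exact h

end

variable (k A N) in
/-- The projection `S_A(N) → A`. -/
def aug : SymAlg k A N →ₐ[k] A :=
  lift LinearMap.id 0 rfl (fun _ _ => rfl) (by simp) (by simp) (by simp)

@[simp] theorem aug_ofA (a : A) : aug k A N (ofA k A N a) = a := lift_ofA _ _ _ _ _ _ _ a

@[simp] theorem aug_ι (n : N) : aug k A N (ι k A N n) = 0 := lift_ι _ _ _ _ _ _ _ n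

theorem aug_σ (x : SymAlg k A N) : aug k A N (σ k x) = σ k (aug k A N x) := by
  have : (aug k A N).comp (σAlg k) = (σAlg k).comp (aug k A N) := by
    refine hom_ext (fun a => ?_) fun n => ?_
    · change aug k A N (σ k (ofA k A N a)) = σ k (aug k A N (ofA k A N a))
      rw [σ_ofA, aug_ofA, aug_ofA]
    · change aug k A N (σ k (ι k A N n)) = σ k (aug k A N (ι k A N n))
      rw [σ_ι, aug_ι, aug_ι, map_zero]
  exact DFunLike.congr_fun this x

end Twist

section Koszul

variable {k A N J : Type*} [Field k] [Ring A] [Algebra k A] [Superalgebra k A]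
  [SuperCommutative k A] [NeZero (2 : k)]
  [AddCommGroup N] [Module k N] [Superspace k N] [Module A N] [Supermodule k A N]
  [Fintype J] [DecidableEq J] (β : Module.Basis (J ⊕ J) A N)
  (hβ : ∀ b, β b ∈ part k N (parity b + 1))

include hβ in
theorem σ_coord (b : J ⊕ J) (n : N) :
    σ k (β.coord b n) = sgn (parity b + 1) • β.coord b (σ k n) := by
  conv_rhs => rw [← β.sum_repr n, map_sum, map_sum]
  rw [Finset.sum_eq_single b]
  · rw [Supermodule.σ_smul, map_smul, mem_part.1 (hβ b), map_zsmul, Module.Basis.coord_apply,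
      Module.Basis.coord_apply, Module.Basis.repr_self, Finsupp.single_eq_same, smul_eq_mul,
      mul_smul_comm, smul_smul, sgn_mul_self, mul_one, one_smul]
  · intro c _ hc
    rw [Supermodule.σ_smul, map_smul, mem_part.1 (hβ c), map_zsmul, Module.Basis.coord_apply,
      Module.Basis.repr_self, Finsupp.single_eq_of_ne hc.symm, smul_zero, smul_zero]
  · simp

include hβ in
theorem coord_mem (b : J ⊕ J) {j : ZMod 2} {n : N} (hn : n ∈ part k N j) :
    β.coord b n ∈ part k A (parity b + 1 + j) := by
  rw [mem_part, σ_coord β hβ, mem_part.1 hn, map_zsmul, sgn_add _ j, mul_smul]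

/-- The odd variable. -/
def ξ (b : J) : SymAlg k A N := ι k A N (β (Sum.inl b))

/-- The even variable. -/
def ev (b : J) : SymAlg k A N := ι k A N (β (Sum.inr b))

include hβ in
theorem ξ_mul (b : J) (y : SymAlg k A N) : ξ (k := k) β b * y = σ k y * ξ β b :=
  ι_mul_σpow (hβ (Sum.inl b)) y

include hβ in
theorem ev_mul (b : J) (y : SymAlg k A N) : ev (k := k) β b * y = y * ev β b :=
  ι_mul_σpow (hβ (Sum.inr b)) y

include hβ in
theorem σ_ξ (b : J) : σ k (ξ (k := k) β b) = -ξ β b := by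
  rw [ξ, σ_ι, mem_part_one.1 (hβ (Sum.inl b)), map_neg]

include hβ in
theorem σ_ev (b : J) : σ k (ev (k := k) β b) = ev β b := by
  rw [ev, σ_ι, mem_part_zero.1 (hβ (Sum.inr b))]

include hβ in
theorem ξ_mul_self (b : J) : ξ (k := k) β b * ξ β b = 0 := by
  have h := ξ_mul β hβ b (ξ (k := k) β b)
  rw [σ_ξ β hβ, neg_mul] at h
  have h2 : (2 : k) • (ξ (k := k) β b * ξ β b) = 0 := by
    rw [two_smul]; nth_rewrite 1 [h]; exact neg_add_cancel _
  exact (smul_eq_zero.1 h2).resolve_left (NeZero.ne _)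

/-- The coefficient of the odd variable `ξ b`. -/
def oddCoeff (b : J) : N →ₗ[k] A := σ k ∘ₗ (β.coord (Sum.inl b)).restrictScalars k

/-- The coefficient of the even variable `ev b`. -/
def evenCoeff (b : J) : N →ₗ[k] A := (β.coord (Sum.inr b)).restrictScalars k

theorem oddCoeff_apply (b : J) (n : N) :
    oddCoeff (k := k) β b n = σ k (β.coord (Sum.inl b) n) := rfl

theorem evenCoeff_apply (b : J) (n : N) :
    evenCoeff (k := k) β b n = β.coord (Sum.inr b) n := rfl

include hβ in
theorem oddCoeff_mem (b : J) {j : ZMod 2} {n : N} (hn : n ∈ part k N j) :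
    oddCoeff (k := k) β b n ∈ part k A (j + 1) := by
  have := σ_mem_part (coord_mem β hβ (Sum.inl b) hn)
  rwa [parity_inl, zero_add, add_comm] at this

include hβ in
theorem evenCoeff_mem (b : J) {j : ZMod 2} {n : N} (hn : n ∈ part k N j) :
    evenCoeff (k := k) β b n ∈ part k A j := by
  have := coord_mem β hβ (Sum.inr b) hn
  rwa [parity_inr, one_add_one, zero_add] at this

theorem sum_coeff (n : N) : n = ∑ b, σ k (oddCoeff (k := k) β b n) • β (Sum.inl b) +
    ∑ b, evenCoeff (k := k) β b n • β (Sum.inr b) := by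
  conv_lhs => rw [← β.sum_repr n, Fintype.sum_sum_type]
  simp only [oddCoeff_apply, σ_σ]
  rfl

theorem ι_eq_sum (n : N) : ι k A N n =
    ∑ b, ofA k A N (σ k (oddCoeff (k := k) β b n)) * ξ β b +
    ∑ b, ofA k A N (evenCoeff (k := k) β b n) * ev β b := by
  conv_lhs => rw [sum_coeff (k := k) β n]
  simp only [map_add, map_sum, ι_smul]
  rfl

/-- This and the next two facts are the compatibilities required for a twisted derivation with `S =
σ`. The coefficient is taken with `σ` because contraction has to pass over a scalar written to the
left. -/
theorem oddCoeff_smul (b : J) (a : A) (n : N) :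
    (ofA k A N ∘ₗ oddCoeff (k := k) β b) (a • n) =
      σAlg k (ofA k A N a) * (ofA k A N ∘ₗ oddCoeff (k := k) β b) n := by
  change ofA k A N (σ k (β.coord (Sum.inl b) (a • n))) = σ k (ofA k A N a) * _
  rw [map_smul, smul_eq_mul, σ_mul, ofA_mul, σ_ofA]
  rfl

include hβ in
theorem oddCoeff_comm_left (b : J) {i j : ZMod 2} {a : A} {n : N} (ha : a ∈ part k A i)
    (hn : n ∈ part k N j) : (ofA k A N ∘ₗ oddCoeff (k := k) β b) n * ofA k A N a =
      sgn (i * j) • (σAlg k (ofA k A N a) * (ofA k A N ∘ₗ oddCoeff (k := k) β b) n) := by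
  have h := oddCoeff_mem β hβ b hn
  change ofA k A N (oddCoeff (k := k) β b n) * ofA k A N a =
    sgn (i * j) • (σ k (ofA k A N a) * ofA k A N (oddCoeff (k := k) β b n))
  rw [σ_ofA, mem_part.1 ha, map_zsmul, ← ofA_mul, smul_mul_assoc, ← ofA_mul,
    SuperCommutative.super_comm h ha, map_zsmul, smul_smul, ← sgn_add]
  congr 2
  ring

include hβ in
theorem oddCoeff_comm (b : J) {i j : ZMod 2} {n n' : N} (hn : n ∈ part k N i)
    (hn' : n' ∈ part k N j) : (ofA k A N ∘ₗ oddCoeff (k := k) β b) n * ι k A N n' +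
        σAlg k (ι k A N n) * (ofA k A N ∘ₗ oddCoeff (k := k) β b) n' =
      sgn (i * j) • ((ofA k A N ∘ₗ oddCoeff (k := k) β b) n' * ι k A N n +
        σAlg k (ι k A N n') * (ofA k A N ∘ₗ oddCoeff (k := k) β b) n) := by
  have h := oddCoeff_mem β hβ b hn
  have h' := oddCoeff_mem β hβ b hn'
  change ofA k A N (oddCoeff (k := k) β b n) * ι k A N n' +
      σ k (ι k A N n) * ofA k A N (oddCoeff (k := k) β b n') =
    sgn (i * j) • (ofA k A N (oddCoeff (k := k) β b n') * ι k A N n +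
      σ k (ι k A N n') * ofA k A N (oddCoeff (k := k) β b n))
  rw [σ_ι, σ_ι, mem_part.1 hn, mem_part.1 hn', map_zsmul, map_zsmul, smul_mul_assoc,
    smul_mul_assoc, ι_mul_ofA k h' hn, ι_mul_ofA k h hn']
  rcases zmod_two_cases i with rfl | rfl <;> rcases zmod_two_cases j with rfl | rfl <;>
    simp [one_add_one, add_comm]

/-- The odd superderivation `∂/∂ξ_b`. -/
def contract (b : J) : SymAlg k A N →ₗ[k] SymAlg k A N :=
  twist (σAlg k) (ofA k A N ∘ₗ oddCoeff (k := k) β b) (oddCoeff_smul β b)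
    (oddCoeff_comm_left β hβ b) (oddCoeff_comm β hβ b)

theorem contract_ofA (b : J) (a : A) : contract (k := k) β hβ b (ofA k A N a) = 0 :=
  twist_ofA _ _ (oddCoeff_smul β b) (oddCoeff_comm_left β hβ b) (oddCoeff_comm β hβ b) a

theorem contract_ι (b : J) (n : N) :
    contract (k := k) β hβ b (ι k A N n) = ofA k A N (oddCoeff (k := k) β b n) :=
  twist_ι _ _ (oddCoeff_smul β b) (oddCoeff_comm_left β hβ b) (oddCoeff_comm β hβ b) n

theorem contract_mul (b : J) (x y : SymAlg k A N) : contract β hβ b (x * y) =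
    contract β hβ b x * y + σ k x * contract β hβ b y :=
  twist_mul _ _ (oddCoeff_smul β b) (oddCoeff_comm_left β hβ b) (oddCoeff_comm β hβ b) x y

theorem contract_ξ (b c : J) :
    contract (k := k) β hβ b (ξ β c) = if c = b then 1 else 0 := by
  rw [ξ, contract_ι, oddCoeff_apply, Module.Basis.coord_apply, Module.Basis.repr_self,
    Finsupp.single_apply]
  by_cases h : c = b
  · rw [if_pos (by rw [h]), if_pos h, σ_one, ofA_one]
  · rw [if_neg (by simpa using h), if_neg h, map_zero, map_zero]

theorem contract_ev (b c : J) : contract (k := k) β hβ b (ev β c) = 0 := by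
  rw [ev, contract_ι, oddCoeff_apply, Module.Basis.coord_apply, Module.Basis.repr_self,
    Finsupp.single_eq_of_ne (by simp), map_zero, map_zero]

theorem contract_ξ_mul (b c : J) (y : SymAlg k A N) : contract (k := k) β hβ b (ξ β c * y) =
    (if c = b then y else 0) - ξ β c * contract β hβ b y := by
  rw [contract_mul, contract_ξ, σ_ξ β hβ, neg_mul, ← sub_eq_add_neg, ite_mul, one_mul, zero_mul]

theorem contract_ev_mul (b c : J) (y : SymAlg k A N) : contract (k := k) β hβ b (ev β c * y) =
    ev β c * contract β hβ b y := by
  rw [contract_mul, contract_ev, σ_ev β hβ, zero_mul, zero_add]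

/-- The projection of `N` along the even basis vector `b`. -/
def project (b : J) : N →ₗ[k] N :=
  LinearMap.id - ((β.coord (Sum.inr b)).smulRight (β (Sum.inr b))).restrictScalars k

theorem project_apply (b : J) (n : N) :
    project (k := k) β b n = n - evenCoeff (k := k) β b n • β (Sum.inr b) := rfl

include hβ in
theorem project_mem (b : J) {j : ZMod 2} {n : N} (hn : n ∈ part k N j) :
    project (k := k) β b n ∈ part k N j := by
  refine Submodule.sub_mem _ hn ?_
  have := evenCoeff_mem β hβ b hn
  rw [mem_part]
  change σ k (evenCoeff (k := k) β b n • β (Sum.inr b)) = _ • evenCoeff (k := k) β b n • _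
  rw [Supermodule.σ_smul, mem_part.1 this, mem_part_zero.1 (hβ (Sum.inr b)), smul_assoc]

theorem project_smul (b : J) (a : A) (n : N) : (ι k A N ∘ₗ project (k := k) β b) (a • n) =
    ofA k A N a * (ι k A N ∘ₗ project (k := k) β b) n := by
  rw [LinearMap.comp_apply, LinearMap.comp_apply, ← ι_smul, project_apply, project_apply,
    evenCoeff_apply, evenCoeff_apply, map_smul, smul_sub, smul_eq_mul, mul_smul]

/-- The endomorphism that sends the even variable `ev b` to `0`. -/
def kill (b : J) : SymAlg k A N →ₐ[k] SymAlg k A N :=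
  lift (ofA k A N) (ι k A N ∘ₗ project (k := k) β b) (ofA_one k A N) (ofA_mul k)
    (project_smul β b) (fun ha hn => ι_mul_ofA k ha (project_mem β hβ b hn))
    (fun hn hn' => ι_mul_ι k (project_mem β hβ b hn) (project_mem β hβ b hn'))

theorem kill_ofA (b : J) (a : A) : kill (k := k) β hβ b (ofA k A N a) = ofA k A N a :=
  lift_ofA _ _ _ _ _ _ _ a

theorem kill_ι (b : J) (n : N) : kill (k := k) β hβ b (ι k A N n) =
    ι k A N n - ofA k A N (evenCoeff (k := k) β b n) * ev β b := by
  refine (lift_ι _ _ _ _ _ _ _ n).trans ?_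
  rw [LinearMap.comp_apply, project_apply, map_sub, ev, ← ι_smul]

theorem evenCoeff_inl (b c : J) : evenCoeff (k := k) β b (β (Sum.inl c)) = 0 := by
  rw [evenCoeff_apply, Module.Basis.coord_apply, Module.Basis.repr_self,
    Finsupp.single_eq_of_ne (by simp)]

theorem evenCoeff_inr (b c : J) :
    evenCoeff (k := k) β b (β (Sum.inr c)) = if c = b then 1 else 0 := by
  rw [evenCoeff_apply, Module.Basis.coord_apply, Module.Basis.repr_self, Finsupp.single_apply]
  exact if_congr (by simp) rfl rfl

theorem kill_ξ (b c : J) : kill (k := k) β hβ b (ξ β c) = ξ β c := by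
  rw [ξ, kill_ι, evenCoeff_inl, map_zero, zero_mul, sub_zero]

theorem kill_ev (b c : J) : kill (k := k) β hβ b (ev β c) = if c = b then 0 else ev β c := by
  conv_lhs => rw [ev, kill_ι, evenCoeff_inr]
  split_ifs with h
  · rw [ofA_one, one_mul, h, ev, sub_self]
  · rw [map_zero, zero_mul, sub_zero, ev]

theorem evenCoeff_smul (b : J) (a : A) (n : N) :
    (ofA k A N ∘ₗ evenCoeff (k := k) β b) (a • n) =
      kill (k := k) β hβ b (ofA k A N a) * (ofA k A N ∘ₗ evenCoeff (k := k) β b) n := by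
  rw [kill_ofA, LinearMap.comp_apply, LinearMap.comp_apply, ← ofA_mul, evenCoeff_apply, map_smul]
  rfl

theorem evenCoeff_comm_left (b : J) {i j : ZMod 2} {a : A} {n : N} (ha : a ∈ part k A i)
    (hn : n ∈ part k N j) : (ofA k A N ∘ₗ evenCoeff (k := k) β b) n * ofA k A N a =
      sgn (i * j) • (kill (k := k) β hβ b (ofA k A N a) *
        (ofA k A N ∘ₗ evenCoeff (k := k) β b) n) := by
  have h := evenCoeff_mem β hβ b hn
  rw [kill_ofA, LinearMap.comp_apply, ← ofA_mul, ← ofA_mul, ← map_zsmul,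
    SuperCommutative.super_comm h ha, mul_comm j i]

theorem evenCoeff_comm (b : J) {i j : ZMod 2} {n n' : N} (hn : n ∈ part k N i)
    (hn' : n' ∈ part k N j) : (ofA k A N ∘ₗ evenCoeff (k := k) β b) n * ι k A N n' +
        kill (k := k) β hβ b (ι k A N n) * (ofA k A N ∘ₗ evenCoeff (k := k) β b) n' =
      sgn (i * j) • ((ofA k A N ∘ₗ evenCoeff (k := k) β b) n' * ι k A N n +
        kill (k := k) β hβ b (ι k A N n') * (ofA k A N ∘ₗ evenCoeff (k := k) β b) n) := by
  have h := evenCoeff_mem β hβ b hn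
  have h' := evenCoeff_mem β hβ b hn'
  have e : ∀ a : A, ev β b * ofA k A N a = ofA k A N a * ev β b := fun a => ev_mul β hβ b _
  rw [kill_ι, kill_ι, LinearMap.comp_apply, LinearMap.comp_apply, sub_mul, sub_mul,
    ι_mul_ofA k h' hn, ι_mul_ofA k h hn', mul_assoc, mul_assoc, e, e, ← mul_assoc,
    ← mul_assoc, ← ofA_mul, ← ofA_mul, SuperCommutative.super_comm h h', map_zsmul,
    smul_mul_assoc, mul_comm j i]
  rcases zmod_two_cases i with rfl | rfl <;> rcases zmod_two_cases j with rfl | rfl <;>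
    simp <;> abel

/-- The divided difference `(f - kill b f) / ev b`. -/
def divide (b : J) : SymAlg k A N →ₗ[k] SymAlg k A N :=
  twist (kill (k := k) β hβ b) (ofA k A N ∘ₗ evenCoeff (k := k) β b) (evenCoeff_smul β hβ b)
    (evenCoeff_comm_left β hβ b) (evenCoeff_comm β hβ b)

theorem divide_ofA (b : J) (a : A) : divide (k := k) β hβ b (ofA k A N a) = 0 :=
  twist_ofA _ _ (evenCoeff_smul β hβ b) (evenCoeff_comm_left β hβ b) (evenCoeff_comm β hβ b) a

theorem divide_ι (b : J) (n : N) :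
    divide (k := k) β hβ b (ι k A N n) = ofA k A N (evenCoeff (k := k) β b n) :=
  twist_ι _ _ (evenCoeff_smul β hβ b) (evenCoeff_comm_left β hβ b) (evenCoeff_comm β hβ b) n

theorem divide_mul (b : J) (x y : SymAlg k A N) : divide β hβ b (x * y) =
    divide β hβ b x * y + kill β hβ b x * divide β hβ b y :=
  twist_mul _ _ (evenCoeff_smul β hβ b) (evenCoeff_comm_left β hβ b) (evenCoeff_comm β hβ b) x y

theorem divide_ξ_mul (b c : J) (y : SymAlg k A N) :
    divide (k := k) β hβ b (ξ β c * y) = ξ β c * divide β hβ b y := by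
  rw [divide_mul, kill_ξ, ξ, divide_ι, evenCoeff_inl, map_zero, zero_mul, zero_add]

theorem divide_ev_mul (b c : J) (y : SymAlg k A N) : divide (k := k) β hβ b (ev β c * y) =
    if c = b then y else ev β c * divide β hβ b y := by
  rw [divide_mul, kill_ev, ev, divide_ι, evenCoeff_inr]
  split_ifs with h
  · rw [ofA_one, one_mul, zero_mul, add_zero]
  · rw [map_zero, zero_mul, zero_add]

/-- Both sides satisfy the same twisted Leibniz rule, with the killing morphism as twist, and agree
on generators. -/
theorem ev_mul_divide (b : J) (y : SymAlg k A N) :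
    ev β b * divide (k := k) β hβ b y = y - kill β hβ b y := by
  induction y using SymAlg.induction with
  | hs c =>
    rw [AlgHom.commutes, sub_self, Algebra.algebraMap_eq_smul_one, map_smul, ← ofA_one,
      divide_ofA, smul_zero, mul_zero]
  | ha a => rw [divide_ofA, kill_ofA, mul_zero, sub_self]
  | hn n => rw [divide_ι, kill_ι, sub_sub_cancel, ev_mul β hβ]
  | hmul x y hx hy =>
    rw [divide_mul, mul_add, ← mul_assoc, hx, ← mul_assoc, ev_mul β hβ, mul_assoc, hy, map_mul]
    noncomm_ring
  | hadd x y hx hy => rw [map_add, mul_add, hx, hy, map_add]; abel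

variable (ε : J → k)

/-- The element whose left multiplication is the Koszul differential. -/
def kos : SymAlg k A N := ∑ b, ε b • (ξ β b * ev β b)

include hβ in
theorem kos_mul (y : SymAlg k A N) : kos β ε * y = σ k y * kos β ε := by
  rw [kos, Finset.sum_mul, Finset.mul_sum]
  refine Finset.sum_congr rfl fun b _ => ?_
  rw [smul_mul_assoc, mul_smul_comm, mul_assoc, ev_mul β hβ, ← mul_assoc, ξ_mul β hβ, mul_assoc]

theorem contract_kos_mul (b : J) (y : SymAlg k A N) : contract β hβ b (kos β ε * y) =
    ε b • (ev β b * y) - kos β ε * contract β hβ b y := by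
  rw [kos, Finset.sum_mul, map_sum, Finset.sum_mul]
  simp only [smul_mul_assoc, map_smul, mul_assoc, contract_ξ_mul, contract_ev_mul, smul_sub,
    Finset.sum_sub_distrib]
  congr 1
  rw [Finset.sum_eq_single b (fun c _ hc => by rw [if_neg hc, smul_zero]) (by simp), if_pos rfl]

variable {ε} (hε : ∀ b, ε b * ε b = 1)

-- Contract with `ξ b` and divide by `ev b`. Summands of the differential for other variables
-- anticommute with contraction and commute with division, while the summand for `b` leaves the
-- identity minus the projection onto multiples of `ξ b` without `ev b`.
include hε in
theorem kos_homotopy (b : J) (y : SymAlg k A N) :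
    kos β ε * (ε b • divide β hβ b (contract β hβ b y)) +
      ε b • divide β hβ b (contract β hβ b (kos β ε * y)) =
    y - ξ β b * kill β hβ b (contract β hβ b y) := by
  have h1 : divide β hβ b (kos β ε * contract β hβ b y) =
      kos β ε * divide β hβ b (contract β hβ b y) +
        ε b • (ξ β b * (contract β hβ b y - ev β b * divide β hβ b (contract β hβ b y))) := by
    rw [kos, Finset.sum_mul, map_sum, Finset.sum_mul,
      ← Finset.add_sum_erase _ _ (Finset.mem_univ b),
      ← Finset.add_sum_erase _ (fun c => ε c • (ξ β c * ev β c) *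
        divide β hβ b (contract β hβ b y)) (Finset.mem_univ b)]
    have h2 : ∀ c ∈ Finset.univ.erase b,
        divide β hβ b (ε c • (ξ β c * ev β c) * contract β hβ b y) =
        ε c • (ξ β c * ev β c) * divide β hβ b (contract β hβ b y) := fun c hc => by
      rw [smul_mul_assoc, mul_assoc, map_smul, divide_ξ_mul, divide_ev_mul,
        if_neg (Finset.ne_of_mem_erase hc), smul_mul_assoc, mul_assoc]
    rw [Finset.sum_congr rfl h2, smul_mul_assoc, mul_assoc, map_smul, divide_ξ_mul, divide_ev_mul,
      if_pos rfl, smul_mul_assoc, mul_assoc, mul_sub, smul_sub]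
    abel
  rw [contract_kos_mul, map_sub, h1, map_smul, divide_ev_mul, if_pos rfl, smul_sub, smul_smul,
    hε, one_smul, smul_add, smul_smul, hε, one_smul, ev_mul_divide, mul_smul_comm, sub_sub_cancel]
  abel

/-- The product of the odd variables in a list. -/
def ξprod (l : List J) : SymAlg k A N := (l.map (ξ β)).prod

theorem ξprod_cons (b : J) (l : List J) : ξprod (k := k) β (b :: l) = ξ β b * ξprod β l := rfl

include hβ in
theorem ξ_mul_ξprod {b : J} {l : List J} (hb : b ∈ l) : ξ (k := k) β b * ξprod β l = 0 := by
  induction l with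
  | nil => simp at hb
  | cons c l ih =>
    rw [ξprod_cons]
    rcases List.mem_cons.1 hb with rfl | hb
    · rw [← mul_assoc, ξ_mul_self β hβ, zero_mul]
    · rw [← mul_assoc, ξ_mul β hβ, σ_ξ β hβ, neg_mul, neg_mul, mul_assoc, ih hb, mul_zero, neg_zero]

include hβ in
theorem kos_mul_ξprod {l : List J} (hl : ∀ b, b ∈ l) : kos β ε * ξprod (k := k) β l = 0 := by
  rw [kos, Finset.sum_mul]
  refine Finset.sum_eq_zero fun b _ => ?_
  rw [smul_mul_assoc, mul_assoc, ev_mul β hβ, ← mul_assoc, ξ_mul_ξprod β hβ (hl b), zero_mul,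
    smul_zero]

include hβ in
theorem ξprod_mul_ξ {b : J} {l : List J} (hb : b ∈ l) : ξprod (k := k) β l * ξ β b = 0 := by
  have h := ξ_mul β hβ b (σ k (ξprod (k := k) β l))
  rw [σ_σ] at h
  have h2 := congrArg (σ k) (ξ_mul_ξprod β hβ hb)
  rw [σ_mul, σ_ξ β hβ, neg_mul, map_zero, neg_eq_zero] at h2
  rw [← h, h2]

include hβ in
theorem ξprod_mem (l : List J) :
    ξprod (k := k) β l ∈ part k (SymAlg k A N) (l.length : ZMod 2) := by
  induction l with
  | nil => exact one_mem_part k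
  | cons b l ih =>
    rw [ξprod_cons, List.length_cons, Nat.cast_succ, add_comm]
    exact mul_mem_part (by rw [mem_part_one, σ_ξ β hβ]) ih

-- The element is odd, so it anticommutes with itself, and `2` is invertible.
include hβ in
theorem kos_mul_kos : kos β ε * kos (k := k) β ε = 0 := by
  have h := kos_mul β hβ ε (kos (k := k) β ε)
  have h1 : σ k (kos (k := k) β ε) = -kos β ε := by
    rw [kos, map_sum, ← Finset.sum_neg_distrib]
    refine Finset.sum_congr rfl fun b _ => ?_
    rw [map_smul, σ_mul, σ_ξ β hβ, σ_ev β hβ, neg_mul, smul_neg]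
  rw [h1, neg_mul] at h
  have h2 : (2 : k) • (kos β ε * kos (k := k) β ε) = 0 := by
    rw [two_smul]; nth_rewrite 1 [h]; exact neg_add_cancel _
  exact (smul_eq_zero.1 h2).resolve_left (NeZero.ne _)

theorem contract_ξprod_mul {b : J} {l : List J} (hb : b ∉ l) (y : SymAlg k A N) :
    ∃ y', contract (k := k) β hβ b (ξprod β l * y) = ξprod β l * y' := by
  induction l with
  | nil => exact ⟨contract β hβ b y, by simp [ξprod]⟩
  | cons c l ih =>
    obtain ⟨y', hy⟩ := ih (List.not_mem_of_not_mem_cons hb)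
    refine ⟨-y', ?_⟩
    rw [ξprod_cons, mul_assoc, contract_ξ_mul, if_neg (fun h => hb (by simp [h])), hy, zero_sub,
      mul_assoc, mul_neg, mul_neg]

theorem contract_ξprod {b : J} {l : List J} (hb : b ∉ l) :
    contract (k := k) β hβ b (ξprod β l) = 0 := by
  induction l with
  | nil =>
    change contract β hβ b 1 = 0
    rw [← ofA_one, contract_ofA]
  | cons c l ih =>
    rw [ξprod_cons, contract_ξ_mul, if_neg (fun h => hb (by simp [h])),
      ih (List.not_mem_of_not_mem_cons hb), mul_zero, sub_zero]

theorem kill_ξprod (b : J) (l : List J) :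
    kill (k := k) β hβ b (ξprod β l) = ξprod β l := by
  induction l with
  | nil => exact map_one _
  | cons c l ih => rw [ξprod_cons, map_mul, kill_ξ, ih]

-- One homotopy after the other extracts the odd variables. Contraction with a new variable and
-- killing its partner preserve divisibility by the product extracted before.
include hβ hε in
theorem exists_ξprod_mul {l : List J} (hl : l.Nodup) {z : SymAlg k A N}
    (hz : kos β ε * z = 0) : ∃ y w, z = ξprod β l * y + kos β ε * w := by
  induction l with
  | nil => exact ⟨z, 0, by simp [ξprod]⟩
  | cons b l ih =>
    obtain ⟨hb, hl⟩ := List.nodup_cons.1 hl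
    obtain ⟨y, w, rfl⟩ := ih hl
    rw [mul_add, ← mul_assoc (kos β ε) (kos β ε), kos_mul_kos β hβ, zero_mul, add_zero] at hz
    obtain ⟨y', hy⟩ := contract_ξprod_mul β hβ hb y
    have h := kos_homotopy β hβ hε b (ξprod β l * y)
    rw [hz, map_zero, map_zero, smul_zero, add_zero, eq_sub_iff_add_eq] at h
    refine ⟨kill β hβ b y', w + ε b • divide β hβ b (contract β hβ b (ξprod β l * y)), ?_⟩
    nth_rewrite 1 [← h]
    rw [hy, map_mul (kill β hβ b), kill_ξprod, ξprod_cons, mul_add, mul_assoc]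
    abel

-- After multiplication by all odd variables a further odd variable gives zero. An even variable
-- gives a coboundary, because the anticommutator of the differential with contraction by `ξ b` is
-- multiplication by `ε b • ev b`.
include hβ hε in
theorem ξprod_mul_ofA_mul_ι {l : List J} (hl : ∀ b, b ∈ l) (a : A) (n : N) :
    ∃ w, ξprod β l * (ofA k A N a * ι k A N n) = kos β ε * w := by
  have hodd : ∀ (c : A) (b : J), ξprod β l * (ofA k A N c * ξ β b) = 0 := fun c b => by
    have h := ξ_mul β hβ b (σ k (ofA k A N c))
    rw [σ_σ] at h
    rw [← h, ← mul_assoc, ξprod_mul_ξ β hβ (hl b), zero_mul]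
  have heven : ∀ (c : A) (b : J), ξprod β l * (ofA k A N c * ev β b) =
      kos β ε * (ε b • (contract β hβ b (ξprod β l) * ofA k A N c)) := fun c b => by
    have h := contract_kos_mul β hβ ε b (ξprod (k := k) β l)
    rw [kos_mul_ξprod β hβ hl, map_zero, eq_comm, sub_eq_zero] at h
    rw [mul_smul_comm, ← mul_assoc (kos β ε), ← h, smul_mul_assoc, smul_smul, hε, one_smul,
      ev_mul β hβ, mul_assoc, ev_mul β hβ]
  refine ⟨∑ b, ε b • (contract β hβ b (ξprod β l) *
    ofA k A N (a * evenCoeff (k := k) β b n)), ?_⟩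
  rw [ι_eq_sum (k := k) β n, mul_add, mul_add, Finset.mul_sum, Finset.mul_sum, Finset.mul_sum,
    Finset.mul_sum, Finset.mul_sum]
  simp only [← mul_assoc (ofA k A N a), ← ofA_mul, hodd, Finset.sum_const_zero, zero_add, heven]

-- By `ξprod_mul_ofA_mul_ι` every generator from `N` contributes a coboundary, so only the part of
-- `y` in `A` survives. The extra factor from `A` lets the induction on products run.
include hβ hε in
theorem ξprod_mul_eq {l : List J} (hl : ∀ b, b ∈ l) (y : SymAlg k A N) :
    ∃ a w, ξprod β l * y = ξprod β l * ofA k A N a + kos β ε * w := by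
  suffices h : ∀ a, ∃ a' w, ξprod β l * (ofA k A N a * y) =
      ξprod β l * ofA k A N a' + kos β ε * w by
    have := h 1
    rwa [ofA_one, one_mul] at this
  induction y using SymAlg.induction with
  | hs c =>
    exact fun a => ⟨c • a, 0, by
      rw [Algebra.algebraMap_eq_smul_one, mul_smul_comm, mul_one, map_smul, mul_zero, add_zero]⟩
  | ha a' => exact fun a => ⟨a * a', 0, by rw [ofA_mul, mul_zero, add_zero]⟩
  | hn n =>
    intro a
    obtain ⟨w, hw⟩ := ξprod_mul_ofA_mul_ι β hβ hε hl a n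
    exact ⟨0, w, by rw [hw, map_zero, mul_zero, zero_add]⟩
  | hmul x y hx hy =>
    intro a
    obtain ⟨a', w, h⟩ := hx a
    obtain ⟨a'', w', h'⟩ := hy a'
    refine ⟨a'', w' + w * y, ?_⟩
    rw [← mul_assoc (ofA k A N a), ← mul_assoc, h, add_mul, mul_assoc, h', mul_add, mul_assoc,
      add_assoc]
  | hadd x y hx hy =>
    intro a
    obtain ⟨a', w, h⟩ := hx a
    obtain ⟨a'', w', h'⟩ := hy a
    refine ⟨a' + a'', w + w', ?_⟩
    rw [mul_add, mul_add, h, h', map_add, mul_add, mul_add]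
    abel

include hβ hε in
/-- A cocycle is cohomologous to a multiple of the product of all odd variables. -/
theorem exists_eq_of_kos_mul_eq_zero {l : List J} (hl : l.Nodup) (hl' : ∀ b, b ∈ l)
    {z : SymAlg k A N} (hz : kos β ε * z = 0) :
    ∃ a w, z = ξprod β l * ofA k A N a + kos β ε * w := by
  obtain ⟨y, w, rfl⟩ := exists_ξprod_mul β hβ hε hl hz
  obtain ⟨a, w', h⟩ := ξprod_mul_eq β hβ hε hl' y
  exact ⟨a, w' + w, by rw [h, mul_add, add_assoc]⟩

/-- The coefficient of the product of the odd variables in a list. -/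
def residue : List J → SymAlg k A N →ₗ[k] A
  | [] => (aug k A N).toLinearMap
  | b :: l => residue l ∘ₗ contract β hβ b

theorem residue_cons (b : J) (l : List J) (y : SymAlg k A N) :
    residue β hβ (b :: l) y = residue β hβ l (contract β hβ b y) := rfl

theorem residue_ev_mul (l : List J) (c : J) (y : SymAlg k A N) :
    residue β hβ l (ev β c * y) = 0 := by
  induction l generalizing y with
  | nil =>
    change aug k A N _ = 0
    rw [map_mul, ev, aug_ι, zero_mul]
  | cons b l ih => rw [residue_cons, contract_ev_mul, ih]

/-- Contraction anticommutes with the Koszul element up to a multiple of an even variable. Even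
variables pass through all contractions and die under the augmentation. -/
theorem residue_kos_mul (ε : J → k) (l : List J) (y : SymAlg k A N) :
    residue β hβ l (kos β ε * y) = 0 := by
  induction l generalizing y with
  | nil =>
    change aug k A N _ = 0
    rw [kos, Finset.sum_mul, map_sum]
    refine Finset.sum_eq_zero fun b _ => ?_
    rw [smul_mul_assoc, map_smul, map_mul, map_mul, ev, aug_ι, mul_zero, zero_mul, smul_zero]
  | cons b l ih =>
    rw [residue_cons, contract_kos_mul, map_sub, map_smul, residue_ev_mul, ih, smul_zero, sub_zero]

theorem residue_ξ_mul_of_notMem {l : List J} {b : J} (hb : b ∉ l) (y : SymAlg k A N) :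
    residue β hβ l (ξ β b * y) = 0 := by
  induction l generalizing y with
  | nil =>
    change aug k A N _ = 0
    rw [map_mul, ξ, aug_ι, zero_mul]
  | cons c l ih =>
    rw [residue_cons, contract_ξ_mul, if_neg (fun h => hb (by simp [h])), zero_sub, map_neg,
      ih (List.not_mem_of_not_mem_cons hb), neg_zero]

theorem residue_cons_ξ_mul {l : List J} {b : J} (hb : b ∉ l) (y : SymAlg k A N) :
    residue β hβ (b :: l) (ξ β b * y) = residue β hβ l y := by
  rw [residue_cons, contract_ξ_mul, if_pos rfl, map_sub, residue_ξ_mul_of_notMem β hβ hb, sub_zero]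

theorem residue_ξprod_mul {l : List J} (hl : l.Nodup) (y : SymAlg k A N) :
    residue β hβ l (ξprod β l * y) = aug k A N y := by
  induction l with
  | nil => rw [ξprod, List.map_nil, List.prod_nil, one_mul]; rfl
  | cons b l ih =>
    obtain ⟨hb, hl⟩ := List.nodup_cons.1 hl
    rw [ξprod_cons, mul_assoc, residue_cons_ξ_mul β hβ hb, ih hl]

/-- Each of the odd contractions applies `σ` once to a scalar it passes. -/
theorem residue_ofA_mul (l : List J) (a : A) (y : SymAlg k A N) :
    residue β hβ l (ofA k A N a * y) = σpow k (l.length : ZMod 2) a * residue β hβ l y := by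
  induction l generalizing y a with
  | nil =>
    change aug k A N _ = σpow k ((0 : ℕ) : ZMod 2) a * aug k A N y
    rw [map_mul, aug_ofA, Nat.cast_zero, σpow_zero]
  | cons b l ih =>
    rw [residue_cons, contract_mul, contract_ofA, zero_mul, zero_add, σ_ofA, ih, residue_cons,
      List.length_cons, Nat.cast_succ]
    congr 1
    rcases zmod_two_cases (l.length : ZMod 2) with h | h <;> rw [h]
    · rfl
    · exact σ_σ k a

theorem contract_σ (b : J) (y : SymAlg k A N) :
    contract β hβ b (σ k y) = -σ k (contract β hβ b y) := by
  induction y using SymAlg.induction with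
  | hs c =>
    rw [Algebra.algebraMap_eq_smul_one, map_smul, σ_one, map_smul, ← ofA_one, contract_ofA,
      smul_zero, map_zero, neg_zero]
  | ha a => rw [σ_ofA, contract_ofA, contract_ofA, map_zero, neg_zero]
  | hn n =>
    have h := σ_coord β hβ (Sum.inl b) (σ k n)
    rw [parity_inl, zero_add, sgn_one, neg_one_zsmul, σ_σ] at h
    rw [σ_ι, contract_ι, contract_ι, σ_ofA, oddCoeff_apply, oddCoeff_apply, σ_σ, h, map_neg]
  | hmul x y hx hy =>
    rw [σ_mul, contract_mul, contract_mul, hx, hy, map_add, σ_mul, σ_mul, neg_add, neg_mul,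
      mul_neg]
  | hadd x y hx hy => rw [map_add, map_add, hx, hy, map_add, map_add, neg_add]

theorem residue_σ (l : List J) (y : SymAlg k A N) :
    residue β hβ l (σ k y) = sgn (l.length : ZMod 2) • σ k (residue β hβ l y) := by
  induction l generalizing y with
  | nil =>
    change aug k A N _ = sgn ((0 : ℕ) : ZMod 2) • σ k (aug k A N y)
    rw [aug_σ, Nat.cast_zero, sgn_zero, one_smul]
  | cons b l ih =>
    rw [residue_cons, contract_σ, map_neg, ih, residue_cons, List.length_cons, Nat.cast_succ,
      sgn_add, sgn_one, mul_neg_one, neg_smul]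

/-- The coefficient of `∏ ξ` in the image of `∏ ξ` under an even derivation is a trace. -/
theorem residue_derivation_ξprod {L : SymAlg k A N →ₗ[k] SymAlg k A N} {T : N →ₗ[k] N}
    (hL : ∀ x y, L (x * y) = L x * y + x * L y) (hT : ∀ n, L (ι k A N n) = ι k A N (T n))
    {θ : A →ₗ[k] k} (hθ : ∀ a, θ (σ k a) = θ a) {l : List J} (hl : l.Nodup) :
    θ (residue β hβ l (L (ξprod β l))) =
      (l.map fun b => θ (oddCoeff (k := k) β b (T (β (Sum.inl b))))).sum := by
  have hθ' : ∀ (i : ZMod 2) (a : A), θ (σpow k i a) = θ a := fun i a => by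
    rcases zmod_two_cases i with rfl | rfl
    · rfl
    · exact hθ a
  induction l with
  | nil =>
    have h1 : L 1 = 0 := by
      have := hL 1 1
      rwa [mul_one, mul_one, one_mul, left_eq_add] at this
    change θ (residue β hβ [] (L 1)) = 0
    rw [h1, map_zero, map_zero]
  | cons b l ih =>
    obtain ⟨hb, hl⟩ := List.nodup_cons.1 hl
    rw [ξprod_cons, hL, map_add, map_add, residue_cons_ξ_mul β hβ hb, ih hl, ξ, hT, residue_cons,
      contract_mul, contract_ξprod β hβ hb, mul_zero, add_zero, contract_ι, residue_ofA_mul,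
      List.map_cons, List.sum_cons]
    have h := residue_ξprod_mul β hβ hl (1 : SymAlg k A N)
    rw [mul_one, map_one] at h
    rw [h, mul_one, hθ']

end Koszul

end SymAlg

/-! # The structure of Berezinian modules -/

section ShiftBasis

variable {k A M J : Type*} [Field k] [Ring A] [Algebra k A] [Superalgebra k A]
  [AddCommGroup M] [Module k M] [Superspace k M] [Module A M] [Supermodule k A M]
  [Fintype J] (e : Module.Basis J A M)

/-- The coordinates of elements of `Π M`. -/
def shiftEquiv : ParityShift k 1 M ≃ₗ[A] (J → A) where
  -- Since `a • π x = π (σ a • x)`, the coordinates of `π x` are those of `x` with `σ` applied.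
  toFun x b := σ k (e.repr ((ParityShift.mk k 1 M).symm x) b)
  map_add' x y := funext fun b => by
    rw [map_add, map_add, Finsupp.add_apply, map_add]; rfl
  map_smul' a x := funext fun b => by
    obtain ⟨x, rfl⟩ := (ParityShift.mk k 1 M).surjective x
    rw [ParityShift.smul_mk, LinearEquiv.symm_apply_apply, LinearEquiv.symm_apply_apply, map_smul,
      Finsupp.smul_apply, smul_eq_mul, σ_mul, Nat.cast_one, σpow_one, σ_σ]
    rfl
  invFun v := ParityShift.mk k 1 M (e.equivFun.symm fun b => σ k (v b))
  left_inv x := by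
    obtain ⟨x, rfl⟩ := (ParityShift.mk k 1 M).surjective x
    simp only [LinearEquiv.symm_apply_apply, σ_σ]
    congr 1
    exact e.equivFun.symm_apply_apply x
  right_inv v := funext fun b => by
    have h := congrFun (e.equivFun.apply_symm_apply fun b => σ k (v b)) b
    exact (congrArg (σ k) h).trans (σ_σ k _)

/-- The basis of `Π M` given by a basis of `M`. -/
def shiftBasis : Module.Basis J A (ParityShift k 1 M) := Module.Basis.ofEquivFun (shiftEquiv e)

theorem shiftBasis_apply [DecidableEq J] (b : J) :
    shiftBasis (k := k) e b = ParityShift.mk k 1 M (e b) := by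
  apply (shiftEquiv (k := k) e).injective
  rw [shiftBasis, Module.Basis.coe_ofEquivFun, LinearEquiv.apply_symm_apply]
  funext c
  change _ = σ k (e.repr ((ParityShift.mk k 1 M).symm (ParityShift.mk k 1 M (e b))) c)
  rw [LinearEquiv.symm_apply_apply, Module.Basis.repr_self, Finsupp.single_apply, Pi.single_apply]
  simp only [eq_comm (a := c)]
  split_ifs <;> simp

end ShiftBasis

section Ber

variable {k A M : Type*} [Field k] [Ring A] [Algebra k A] [Superalgebra k A]
  [SuperCommutative k A] [NeZero (2 : k)]
  [AddCommGroup M] [Module k M] [Superspace k M] [Module A M] [Supermodule k A M]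

/-! ## The grading -/

theorem mem_Jdeg_of_list {r : ℕ} (a : A) {l : List M} (hl : l.length = r)
    (φ : List (SDual k A M)) : SymAlg.ofA k A _ a * (l.map (Jπ k A)).prod *
      (φ.map (Jdual k A)).prod ∈ Jdeg k A M r := by
  subst hl
  refine Submodule.subset_span ⟨a, l.get, φ, ?_⟩
  congr 3
  rw [← List.ofFn_get (l.map (Jπ k A))]
  rw [List.ofFn_congr (List.length_map (Jπ k A))]
  congr 1
  funext i
  simp

theorem Jdeg_induction {r : ℕ} {C : J k A M → Prop}
    (hg : ∀ (a : A) (l : List M) (φ : List (SDual k A M)), l.length = r →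
      C (SymAlg.ofA k A _ a * (l.map (Jπ k A)).prod * (φ.map (Jdual k A)).prod))
    (h0 : C 0) (hadd : ∀ x y, C x → C y → C (x + y)) (hsmul : ∀ (c : k) x, C x → C (c • x))
    {z : J k A M} (hz : z ∈ Jdeg k A M r) : C z := by
  induction hz using Submodule.span_induction with
  | mem z hz =>
    obtain ⟨a, x, φ, rfl⟩ := hz
    have := hg a (List.ofFn x) φ (List.length_ofFn)
    rwa [List.map_ofFn] at this
  | zero => exact h0
  | add x y _ _ hx hy => exact hadd x y hx hy
  | smul c x _ hx => exact hsmul c x hx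

theorem σ_Jπ (x : M) : σ k (Jπ k A x) = Jπ k A (-σ k x) := by
  rw [Jπ, SymAlg.σ_ι, σ_prod, ParityShift.σ_mk, Nat.cast_one, sgn_one, neg_one_zsmul, map_zero,
    ← map_neg]
  rfl

theorem σ_Jdual (φ : SDual k A M) : σ k (Jdual k A φ) = Jdual k A (σ k φ) := by
  rw [Jdual, SymAlg.σ_ι, σ_prod, map_zero]
  rfl

theorem Jπ_add (x y : M) : Jπ k A (x + y) = Jπ k A x + Jπ k A y := by
  rw [Jπ, Jπ, Jπ, ← map_add, Prod.mk_add_mk, add_zero, map_add]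

theorem Jdual_add (x y : SDual k A M) : Jdual k A (x + y) = Jdual k A x + Jdual k A y := by
  rw [Jdual, Jdual, Jdual, ← map_add, Prod.mk_add_mk, add_zero]

theorem σ_list_Jπ (l : List M) :
    σ k (l.map (Jπ k A)).prod = ((l.map fun x => -σ k x).map (Jπ k A)).prod := by
  induction l with
  | nil => exact σ_one k
  | cons x l ih => rw [List.map_cons, List.prod_cons, σ_mul, ih, σ_Jπ]; rfl

theorem σ_list_Jdual (l : List (SDual k A M)) :
    σ k (l.map (Jdual k A)).prod = ((l.map fun x => σ k x).map (Jdual k A)).prod := by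
  induction l with
  | nil => exact σ_one k
  | cons x l ih => rw [List.map_cons, List.prod_cons, σ_mul, ih, σ_Jdual]; rfl

theorem σ_mem_Jdeg {r : ℕ} {z : J k A M} (hz : z ∈ Jdeg k A M r) : σ k z ∈ Jdeg k A M r := by
  refine Jdeg_induction (C := fun z => σ k z ∈ Jdeg k A M r) (fun a l φ hl => ?_) ?_
    (fun x y hx hy => ?_) (fun c x hx => ?_) hz
  · rw [σ_mul, σ_mul, SymAlg.σ_ofA, σ_list_Jπ, σ_list_Jdual]
    exact mem_Jdeg_of_list _ (by rw [List.length_map, hl]) _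
  · rw [map_zero]; exact zero_mem _
  · rw [map_add]; exact add_mem hx hy
  · rw [map_smul]; exact Submodule.smul_mem _ c hx

theorem σpow_mem_Jdeg (i : ZMod 2) {r : ℕ} {z : J k A M} (hz : z ∈ Jdeg k A M r) :
    σpow k i z ∈ Jdeg k A M r := by
  rcases zmod_two_cases i with rfl | rfl
  · exact hz
  · exact σ_mem_Jdeg hz

theorem ofA_mul_mem_Jdeg (b : A) {r : ℕ} {z : J k A M} (hz : z ∈ Jdeg k A M r) :
    SymAlg.ofA k A _ b * z ∈ Jdeg k A M r := by
  refine Jdeg_induction (C := fun z => SymAlg.ofA k A _ b * z ∈ Jdeg k A M r)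
    (fun a l φ hl => ?_) ?_ (fun x y hx hy => ?_) (fun c x hx => ?_) hz
  · rw [← mul_assoc, ← mul_assoc, ← SymAlg.ofA_mul]
    exact mem_Jdeg_of_list _ hl _
  · rw [mul_zero]; exact zero_mem _
  · rw [mul_add]; exact add_mem hx hy
  · rw [mul_smul_comm]; exact Submodule.smul_mem _ c hx

theorem Jπ_mem {i : ZMod 2} {x : M} (hx : x ∈ part k M i) :
    ((ParityShift.mk k 1 M x, 0) : ParityShift k 1 M × SDual k A M) ∈ part k _ (1 + i) := by
  rw [mem_part, σ_prod, ParityShift.σ_mk, mem_part.1 hx, map_zero, Prod.smul_mk, smul_zero,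
    sgn_add, mul_smul, Nat.cast_one, map_zsmul]

theorem Jdual_mem {i : ZMod 2} {φ : SDual k A M} (hx : φ ∈ part k (SDual k A M) i) :
    ((0, φ) : ParityShift k 1 M × SDual k A M) ∈ part k _ i := by
  rw [mem_part, σ_prod, mem_part.1 hx, map_zero, Prod.smul_mk, smul_zero]

theorem Jπ_mul_mem_Jdeg (x : M) {r : ℕ} {z : J k A M} (hz : z ∈ Jdeg k A M r) :
    Jπ k A x * z ∈ Jdeg k A M (r + 1) := by
  suffices h : ∀ (i : ZMod 2) (x : M), x ∈ part k M i → Jπ k A x * z ∈ Jdeg k A M (r + 1) by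
    rw [← comp_add_comp k x, Jπ_add, add_mul]
    exact add_mem (h 0 _ (comp_mem k 0 x)) (h 1 _ (comp_mem k 1 x))
  intro i x hx
  refine Jdeg_induction (C := fun z => Jπ k A x * z ∈ Jdeg k A M (r + 1))
    (fun a l φ hl => ?_) ?_ (fun x y hx hy => ?_) (fun c x hx => ?_) hz
  · rw [← mul_assoc, ← mul_assoc, Jπ, SymAlg.ι_mul_σpow (Jπ_mem hx), SymAlg.σpow_ofA, mul_assoc _ _
      (l.map (Jπ k A)).prod]
    exact mem_Jdeg_of_list _ (l := x :: l) (by rw [List.length_cons, hl]) φ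
  · rw [mul_zero]; exact zero_mem _
  · rw [mul_add]; exact add_mem hx hy
  · rw [mul_smul_comm]; exact Submodule.smul_mem _ c hx

theorem Jdual_mul_mem_Jdeg (ψ : SDual k A M) {r : ℕ} {z : J k A M} (hz : z ∈ Jdeg k A M r) :
    Jdual k A ψ * z ∈ Jdeg k A M r := by
  suffices h : ∀ (i : ZMod 2) (x : SDual k A M), x ∈ part k _ i →
      Jdual k A x * z ∈ Jdeg k A M r by
    rw [← comp_add_comp k ψ, Jdual_add, add_mul]
    exact add_mem (h 0 _ (comp_mem k 0 ψ)) (h 1 _ (comp_mem k 1 ψ))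
  intro i ψ hψ
  refine Jdeg_induction (C := fun z => Jdual k A ψ * z ∈ Jdeg k A M r)
    (fun a l φ hl => ?_) ?_ (fun x y hx hy => ?_) (fun c x hx => ?_) hz
  · rw [← mul_assoc, Jdual, SymAlg.ι_mul_σpow (Jdual_mem hψ), mul_assoc]
    have h : ∃ (a' : A) (l' : List M), l'.length = r ∧
        σpow k i (SymAlg.ofA k A _ a * (l.map (Jπ k A)).prod) =
          SymAlg.ofA k A _ a' * (l'.map (Jπ k A)).prod := by
      rcases zmod_two_cases i with rfl | rfl
      · exact ⟨a, l, hl, rfl⟩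
      · exact ⟨σ k a, l.map fun x => -σ k x, by rw [List.length_map, hl], by
          rw [σpow_one, σ_mul, SymAlg.σ_ofA, σ_list_Jπ]⟩
    obtain ⟨a', l', hl', e⟩ := h
    rw [e]
    exact mem_Jdeg_of_list a' hl' (ψ :: φ)
  · rw [mul_zero]; exact zero_mem _
  · rw [mul_add]; exact add_mem hx hy
  · rw [mul_smul_comm]; exact Submodule.smul_mem _ c hx

theorem mul_mem_Jdeg {r s : ℕ} {y z : J k A M} (hy : y ∈ Jdeg k A M r) (hz : z ∈ Jdeg k A M s) :
    y * z ∈ Jdeg k A M (r + s) := by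
  refine Jdeg_induction (C := fun y => y * z ∈ Jdeg k A M (r + s))
    (fun a l φ hl => ?_) ?_ (fun x y hx hy => ?_) (fun c x hx => ?_) hy
  · rw [mul_assoc, mul_assoc]
    apply ofA_mul_mem_Jdeg
    have h1 : (φ.map (Jdual k A)).prod * z ∈ Jdeg k A M s := by
      induction φ with
      | nil => rwa [List.map_nil, List.prod_nil, one_mul]
      | cons ψ φ ih =>
        rw [List.map_cons, List.prod_cons, mul_assoc]
        exact Jdual_mul_mem_Jdeg _ ih
    subst hl
    clear hy
    induction l with
    | nil => rwa [List.map_nil, List.prod_nil, one_mul, List.length_nil, zero_add]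
    | cons x l ih =>
      rw [List.map_cons, List.prod_cons, mul_assoc, List.length_cons, add_right_comm]
      exact Jπ_mul_mem_Jdeg _ ih
  · rw [zero_mul]; exact zero_mem _
  · rw [add_mul]; exact add_mem hx hy
  · rw [smul_mul_assoc]; exact Submodule.smul_mem _ c hx

theorem ofA_mem_Jdeg (a : A) : SymAlg.ofA k A _ a ∈ Jdeg k A M 0 := by
  have := mem_Jdeg_of_list (k := k) a (l := ([] : List M)) rfl []
  rwa [List.map_nil, List.map_nil, List.prod_nil, mul_one, mul_one] at this

theorem mul_ofA_mem_Jdeg (a : A) {r : ℕ} {y : J k A M} (hy : y ∈ Jdeg k A M r) :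
    y * SymAlg.ofA k A _ a ∈ Jdeg k A M r := by
  have := mul_mem_Jdeg hy (ofA_mem_Jdeg a)
  rwa [add_zero] at this

theorem one_mem_Jdeg : (1 : J k A M) ∈ Jdeg k A M 0 := by
  rw [← SymAlg.ofA_one]; exact ofA_mem_Jdeg 1

theorem Jπ_mem_Jdeg (x : M) : Jπ k A x ∈ Jdeg k A M 1 := by
  have := Jπ_mul_mem_Jdeg (k := k) (A := A) x one_mem_Jdeg
  rwa [mul_one] at this

theorem Jdual_mem_Jdeg (φ : SDual k A M) : Jdual k A φ ∈ Jdeg k A M 0 := by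
  have := Jdual_mul_mem_Jdeg φ one_mem_Jdeg
  rwa [mul_one] at this

theorem ι_eq_Jπ_add_Jdual (n : ParityShift k 1 M × SDual k A M) :
    SymAlg.ι k A _ n = Jπ k A ((ParityShift.mk k 1 M).symm n.1) + Jdual k A n.2 := by
  rw [Jπ, Jdual, ← map_add, LinearEquiv.apply_symm_apply, Prod.mk_add_mk, add_zero, zero_add]

open Polynomial

variable (k A M) in
/-- The linear map `π x + φ ↦ π x t + φ`. -/
def Jgen : ParityShift k 1 M × SDual k A M →ₗ[k] (J k A M)[X] where
  toFun n := C (SymAlg.ι k A _ ((n.1, 0) : ParityShift k 1 M × SDual k A M)) * X +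
    C (SymAlg.ι k A _ ((0, n.2) : ParityShift k 1 M × SDual k A M))
  map_add' x y := by
    have h1 : (((x + y).1, 0) : ParityShift k 1 M × SDual k A M) = (x.1, 0) + (y.1, 0) := by simp
    have h2 : ((0, (x + y).2) : ParityShift k 1 M × SDual k A M) = (0, x.2) + (0, y.2) := by simp
    rw [h1, h2, map_add, map_add, map_add, map_add, add_mul]
    abel
  map_smul' c x := by
    have h1 : (((c • x).1, 0) : ParityShift k 1 M × SDual k A M) = c • (x.1, 0) := by simp
    have h2 : ((0, (c • x).2) : ParityShift k 1 M × SDual k A M) = c • (0, x.2) := by simp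
    rw [h1, h2, map_smul (SymAlg.ι k A _), map_smul (SymAlg.ι k A _), ← smul_C, ← smul_C,
      smul_mul_assoc, ← smul_add]
    rfl

theorem Jgen_apply (n : ParityShift k 1 M × SDual k A M) : Jgen k A M n =
    C (SymAlg.ι k A _ ((n.1, 0) : ParityShift k 1 M × SDual k A M)) * X +
      C (SymAlg.ι k A _ ((0, n.2) : ParityShift k 1 M × SDual k A M)) := rfl

theorem Jgen_smul (a : A) (n : ParityShift k 1 M × SDual k A M) :
    Jgen k A M (a • n) =
      ((CAlgHom : J k A M →ₐ[k] (J k A M)[X]).toLinearMap ∘ₗ SymAlg.ofA k A _) a *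
        Jgen k A M n := by
  have h1 : (((a • n).1, 0) : ParityShift k 1 M × SDual k A M) = a • (n.1, 0) := by simp
  have h2 : ((0, (a • n).2) : ParityShift k 1 M × SDual k A M) = a • (0, n.2) := by simp
  rw [Jgen_apply, Jgen_apply, h1, h2, SymAlg.ι_smul, SymAlg.ι_smul, C_mul, C_mul, mul_assoc,
    ← mul_add]
  rfl

theorem fst_mem {j : ZMod 2} {n : ParityShift k 1 M × SDual k A M} (hn : n ∈ part k _ j) :
    ((n.1, 0) : ParityShift k 1 M × SDual k A M) ∈ part k _ j := by
  have := congrArg Prod.fst (mem_part.1 hn)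
  rw [mem_part, σ_prod, map_zero, Prod.smul_mk, smul_zero]
  exact Prod.ext this rfl

theorem snd_mem {j : ZMod 2} {n : ParityShift k 1 M × SDual k A M} (hn : n ∈ part k _ j) :
    ((0, n.2) : ParityShift k 1 M × SDual k A M) ∈ part k _ j := by
  have := congrArg Prod.snd (mem_part.1 hn)
  rw [mem_part, σ_prod, map_zero, Prod.smul_mk, smul_zero]
  exact Prod.ext rfl this

theorem Jgen_comm_left {i j : ZMod 2} {a : A} {n : ParityShift k 1 M × SDual k A M}
    (ha : a ∈ part k A i) (hn : n ∈ part k _ j) : Jgen k A M n *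
        ((CAlgHom : J k A M →ₐ[k] (J k A M)[X]).toLinearMap ∘ₗ SymAlg.ofA k A _) a =
      sgn (i * j) • (((CAlgHom : J k A M →ₐ[k] (J k A M)[X]).toLinearMap ∘ₗ SymAlg.ofA k A _) a *
        Jgen k A M n) := by
  change Jgen k A M n * C (SymAlg.ofA k A _ a) = _ • (C (SymAlg.ofA k A _ a) * _)
  rw [Jgen_apply, add_mul, mul_add, mul_assoc, X_mul_C, ← mul_assoc, ← C_mul, ← C_mul,
    SymAlg.ι_mul_ofA k ha (fst_mem hn), SymAlg.ι_mul_ofA k ha (snd_mem hn), map_zsmul, map_zsmul,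
    C_mul, C_mul, smul_mul_assoc, mul_assoc, smul_add]

theorem Jgen_comm {i j : ZMod 2} {n n' : ParityShift k 1 M × SDual k A M}
    (hn : n ∈ part k _ i) (hn' : n' ∈ part k _ j) :
    Jgen k A M n * Jgen k A M n' = sgn (i * j) • (Jgen k A M n' * Jgen k A M n) := by
  have key : ∀ a b a' b' : J k A M, (C a * X + C b) * (C a' * X + C b') =
      C (a * a') * X * X + C (a * b') * X + C (b * a') * X + C (b * b') := fun a b a' b' => by
    simp only [C_mul, mul_add, add_mul, mul_assoc, X_mul_C]
    simp only [← mul_assoc, X_mul_C]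
    abel
  rw [Jgen_apply, Jgen_apply, key, key, SymAlg.ι_mul_ι k (fst_mem hn) (fst_mem hn'),
    SymAlg.ι_mul_ι k (fst_mem hn) (snd_mem hn'), SymAlg.ι_mul_ι k (snd_mem hn) (fst_mem hn'),
    SymAlg.ι_mul_ι k (snd_mem hn) (snd_mem hn')]
  simp only [map_zsmul, smul_mul_assoc, smul_add]
  abel

variable (k A M) in
/-- The algebra morphism `J(M) → J(M)[t]` that is `z ↦ z t^r` in degree `r`. -/
def Jgrade : J k A M →ₐ[k] (J k A M)[X] :=
  SymAlg.lift ((CAlgHom : J k A M →ₐ[k] (J k A M)[X]).toLinearMap ∘ₗ SymAlg.ofA k A _)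
    (Jgen k A M)
    ((congrArg C (SymAlg.ofA_one k A _)).trans C_1)
    (fun a b => (congrArg C (SymAlg.ofA_mul k a b)).trans C_mul)
    Jgen_smul Jgen_comm_left Jgen_comm

theorem Jgrade_ofA (a : A) : Jgrade k A M (SymAlg.ofA k A _ a) = C (SymAlg.ofA k A _ a) :=
  SymAlg.lift_ofA _ _ _ _ _ _ _ a

theorem Jgrade_Jπ (x : M) : Jgrade k A M (Jπ k A x) = C (Jπ k A x) * X := by
  refine (SymAlg.lift_ι _ _ _ _ _ _ _ _).trans ?_
  rw [Jgen_apply]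
  change _ + C (SymAlg.ι k A _ 0) = _
  rw [map_zero, C_0, add_zero]
  rfl

theorem Jgrade_Jdual (φ : SDual k A M) : Jgrade k A M (Jdual k A φ) = C (Jdual k A φ) := by
  refine (SymAlg.lift_ι _ _ _ _ _ _ _ _).trans ?_
  rw [Jgen_apply]
  change C (SymAlg.ι k A _ 0) * X + _ = _
  rw [map_zero, C_0, zero_mul, zero_add]
  rfl

theorem Jgrade_of_mem {r : ℕ} {z : J k A M} (hz : z ∈ Jdeg k A M r) :
    Jgrade k A M z = C z * X ^ r := by
  refine Jdeg_induction (C := fun z => Jgrade k A M z = C z * X ^ r)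
    (fun a l φ hl => ?_) ?_ (fun x y hx hy => ?_) (fun c x hx => ?_) hz
  · have h1 : Jgrade k A M (l.map (Jπ k A)).prod = C (l.map (Jπ k A)).prod * X ^ l.length := by
      clear hl
      induction l with
      | nil => simp
      | cons x l ih =>
        rw [List.map_cons, List.prod_cons, map_mul, ih, Jgrade_Jπ, C_mul, List.length_cons,
          pow_succ', mul_assoc, mul_assoc, ← mul_assoc X, X_mul_C, mul_assoc]
    have h2 : Jgrade k A M (φ.map (Jdual k A)).prod = C (φ.map (Jdual k A)).prod := by
      induction φ with
      | nil => simp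
      | cons x l ih => rw [List.map_cons, List.prod_cons, map_mul, ih, Jgrade_Jdual, C_mul]
    rw [map_mul, map_mul, h1, h2, Jgrade_ofA, hl, C_mul, C_mul]
    simp only [mul_assoc]
    rw [X_pow_mul_C]
  · rw [map_zero, C_0, zero_mul]
  · rw [map_add, hx, hy, C_add, add_mul]
  · rw [map_smul, hx, ← smul_C, smul_mul_assoc]

/-- The projection of `J(M)` onto its piece of degree `r`. -/
def Jproj (r : ℕ) (z : J k A M) : J k A M := (Jgrade k A M z).coeff r

theorem Jproj_of_mem {r : ℕ} {z : J k A M} (hz : z ∈ Jdeg k A M r) : Jproj r z = z := by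
  rw [Jproj, Jgrade_of_mem hz, coeff_C_mul, coeff_X_pow_self, mul_one]

theorem Jproj_mem (r : ℕ) (z : J k A M) : Jproj r z ∈ Jdeg k A M r := by
  unfold Jproj
  induction z using SymAlg.induction generalizing r with
  | hs c =>
    rw [AlgHom.commutes, Polynomial.algebraMap_apply, coeff_C]
    split_ifs with h
    · rw [h, Algebra.algebraMap_eq_smul_one]
      exact Submodule.smul_mem _ c one_mem_Jdeg
    · exact zero_mem _
  | ha a =>
    rw [Jgrade_ofA, coeff_C]
    split_ifs with h
    · rw [h]; exact ofA_mem_Jdeg a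
    · exact zero_mem _
  | hn n =>
    rw [ι_eq_Jπ_add_Jdual, map_add, Jgrade_Jπ, Jgrade_Jdual, coeff_add, coeff_C_mul_X, coeff_C]
    refine add_mem ?_ ?_
    · split_ifs with h
      · rw [h]; exact Jπ_mem_Jdeg _
      · exact zero_mem _
    · split_ifs with h
      · rw [h]; exact Jdual_mem_Jdeg _
      · exact zero_mem _
  | hmul x y hx hy =>
    rw [map_mul, coeff_mul]
    refine Submodule.sum_mem _ fun rs hrs => ?_
    rw [← Finset.HasAntidiagonal.mem_antidiagonal.1 hrs]
    exact mul_mem_Jdeg (hx _) (hy _)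
  | hadd x y hx hy => rw [map_add, coeff_add]; exact add_mem (hx r) (hy r)

theorem Jproj_add (r : ℕ) (y z : J k A M) : Jproj r (y + z) = Jproj r y + Jproj r z := by
  rw [Jproj, map_add, coeff_add]; rfl

theorem Jproj_zero_mul {y : J k A M} (hy : y ∈ Jdeg k A M 1) (z : J k A M) :
    Jproj 0 (y * z) = 0 := by
  rw [Jproj, map_mul, Jgrade_of_mem hy, pow_one, mul_assoc, coeff_C_mul, coeff_X_mul_zero, mul_zero]

/-- This allows a primitive of a homogeneous cocycle to be replaced by its component of the right
degree. -/
theorem Jproj_succ_mul (r : ℕ) {y : J k A M} (hy : y ∈ Jdeg k A M 1) (z : J k A M) :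
    Jproj (r + 1) (y * z) = y * Jproj r z := by
  rw [Jproj, map_mul, Jgrade_of_mem hy, pow_one, mul_assoc, coeff_C_mul, coeff_X_mul]
  rfl

/-! ## The Koszul variables -/

variable {n m : ℕ} (e : HomBasis k A M n m)

namespace HomBasis

theorem mem (b : Fin n ⊕ Fin m) : e.basis b ∈ part k M (parity b) := by
  rcases b with i | s
  · exact e.even i
  · exact e.odd s

theorem dual_eq (b : Fin n ⊕ Fin m) : e.dual b = dualBasis e.basis e.mem b := by
  refine SDual.ext_basis e.basis fun c => ?_
  rw [dualBasis_fn]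
  change e.basis.coord b (e.basis c) = _
  rw [Module.Basis.coord_apply, Module.Basis.repr_self, Finsupp.single_apply]
  simp only [eq_comm]

variable (n m) in
/-- The exchange of the two variables `π e_b` and `e^b` for odd `e_b`. -/
def swapOdd : ((Fin n ⊕ Fin m) ⊕ (Fin n ⊕ Fin m)) → ((Fin n ⊕ Fin m) ⊕ (Fin n ⊕ Fin m))
  | Sum.inl (Sum.inl i) => Sum.inl (Sum.inl i)
  | Sum.inl (Sum.inr s) => Sum.inr (Sum.inr s)
  | Sum.inr (Sum.inl i) => Sum.inr (Sum.inl i)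
  | Sum.inr (Sum.inr s) => Sum.inl (Sum.inr s)

variable (n m) in
theorem swapOdd_involutive : Function.Involutive (swapOdd n m) := by
  rintro ((i | s) | (i | s)) <;> rfl

/-- The basis of `Π M ⊕ M^*`, consisting of odd and of even variables. -/
def vars : Module.Basis ((Fin n ⊕ Fin m) ⊕ (Fin n ⊕ Fin m)) A
    (ParityShift k 1 M × SDual k A M) :=
  ((shiftBasis e.basis).prod (dualBasis e.basis e.mem)).reindex (swapOdd_involutive n m).toPerm

theorem vars_apply (b : (Fin n ⊕ Fin m) ⊕ (Fin n ⊕ Fin m)) : e.vars b =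
    Sum.elim (fun c => (ParityShift.mk k 1 M (e.basis c), 0)) (fun c => (0, e.dual c))
      (swapOdd n m b) := by
  rw [vars, Module.Basis.reindex_apply, Module.Basis.prod_apply]
  have : (swapOdd_involutive n m).toPerm.symm b = swapOdd n m b := rfl
  rw [this]
  rcases swapOdd n m b with c | c
  · change ((shiftBasis (k := k) e.basis c, 0) : ParityShift k 1 M × SDual k A M) = _
    rw [shiftBasis_apply]
    rfl
  · rw [Sum.elim_inr, Sum.elim_inr, dual_eq]
    rfl

theorem vars_mem (b : (Fin n ⊕ Fin m) ⊕ (Fin n ⊕ Fin m)) :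
    e.vars b ∈ part k (ParityShift k 1 M × SDual k A M) (parity b + 1) := by
  have hd : ∀ c, e.dual c ∈ part k (SDual k A M) (parity c) := fun c => by
    rw [dual_eq]; exact dualBasis_mem e.basis e.mem c
  rw [vars_apply]
  rcases b with (i | s) | (i | s)
  · have := Jπ_mem (k := k) (A := A) (e.even i)
    rwa [add_comm] at this
  · exact Jdual_mem (hd (Sum.inr s))
  · exact Jdual_mem (hd (Sum.inl i))
  · have := Jπ_mem (k := k) (A := A) (e.odd s)
    rwa [add_comm] at this

/-- The signs in the differential. -/
def dsgn : Fin n ⊕ Fin m → k := Sum.elim (fun _ => -1) (fun _ => 1)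

theorem dsgn_mul_self (b : Fin n ⊕ Fin m) : dsgn (k := k) b * dsgn b = 1 := by
  rcases b with i | s <;> simp [dsgn]

/-- The element `∑ (-1)^(|e_i| + 1) π e_i ⊗ e^i`. -/
def κ : J k A M := SymAlg.kos e.vars dsgn

theorem κ_eq : e.κ = ∑ b, (sgn (parity b + 1)) • (Jπ k A (e.basis b) * Jdual k A (e.dual b)) := by
  rw [κ, SymAlg.kos]
  refine Finset.sum_congr rfl fun b _ => ?_
  rcases b with i | s
  · rw [SymAlg.ξ, SymAlg.ev, vars_apply, vars_apply, parity_inl, zero_add, sgn_one]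
    exact (neg_one_smul _ _).trans (neg_one_zsmul _).symm
  -- For odd `e_b` the even variable is `π e_b`; it commutes with everything, so exchanging it with
  -- `e^b` costs no sign.
  · rw [← SymAlg.ev_mul e.vars e.vars_mem, SymAlg.ξ, SymAlg.ev, vars_apply, vars_apply,
      parity_inr, one_add_one, sgn_zero, one_smul]
    exact one_smul _ _

theorem d_apply (z : J k A M) : e.d z = e.κ * z := by
  rw [d, LinearMap.mulLeft_apply, κ_eq, Fintype.sum_sum_type]
  congr 1
  simp only [parity_inl, parity_inr, zero_add, one_add_one, sgn_zero, sgn_one, neg_one_zsmul,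
    one_smul, Finset.sum_neg_distrib]

theorem κ_mem_Jdeg : e.κ ∈ Jdeg k A M 1 := by
  rw [κ_eq]
  refine Submodule.sum_mem _ fun b _ => zsmul_mem ?_ _
  have := mul_mem_Jdeg (Jπ_mem_Jdeg (k := k) (A := A) (e.basis b)) (Jdual_mem_Jdeg (e.dual b))
  rwa [add_zero] at this

theorem κ_mul (z : J k A M) : e.κ * z = σ k z * e.κ := SymAlg.kos_mul e.vars e.vars_mem dsgn z

variable (n m) in
/-- The indices of the basis. -/
def indices : List (Fin n ⊕ Fin m) := Finset.univ.toList

theorem nodup_indices : (indices n m).Nodup := Finset.nodup_toList _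
theorem mem_indices (b : Fin n ⊕ Fin m) : b ∈ indices n m := Finset.mem_toList.2 (Finset.mem_univ b)
theorem length_indices : (indices n m).length = n + m := by
  rw [indices, Finset.length_toList, Finset.card_univ, Fintype.card_sum, Fintype.card_fin,
    Fintype.card_fin]

/-- The product of the odd variables. -/
def vol : J k A M := SymAlg.ξprod e.vars (indices n m)

theorem ξprod_mem_Jdeg (l : List (Fin n ⊕ Fin m)) : SymAlg.ξprod e.vars l ∈
    Jdeg k A M (l.map (Sum.elim (fun _ => 1) (fun _ => 0))).sum := by
  induction l with
  | nil => exact one_mem_Jdeg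
  | cons b l ih =>
    rw [SymAlg.ξprod_cons, List.map_cons, List.sum_cons]
    refine mul_mem_Jdeg ?_ ih
    rw [SymAlg.ξ, vars_apply]
    rcases b with i | s
    · exact Jπ_mem_Jdeg _
    · exact Jdual_mem_Jdeg _

theorem vol_mem_Jdeg : e.vol ∈ Jdeg k A M n := by
  have h := e.ξprod_mem_Jdeg (indices n m)
  have h2 : ((indices n m).map (Sum.elim (fun _ => 1) (fun _ => 0))).sum = n := by
    rw [indices, Finset.sum_map_toList, Fintype.sum_sum_type]
    simp
  rwa [h2] at h

theorem vol_mem : e.vol ∈ part k (J k A M) ((n : ZMod 2) + m) := by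
  have := SymAlg.ξprod_mem e.vars e.vars_mem (indices n m)
  rwa [length_indices, Nat.cast_add] at this

theorem κ_mul_vol : e.κ * e.vol = 0 := SymAlg.kos_mul_ξprod e.vars e.vars_mem mem_indices

theorem mem_cocycles {z : J k A M} : z ∈ e.cocycles ↔ z ∈ Jdeg k A M n ∧ e.κ * z = 0 := by
  rw [cocycles, Submodule.mem_inf, LinearMap.mem_ker, d_apply]

theorem exists_of_mem_coboundaries {z : J k A M} (hz : z ∈ e.coboundaries) :
    ∃ w, z = e.κ * w := by
  cases n with
  | zero =>
    rw [(Submodule.mem_bot k).1 hz]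
    exact ⟨0, (mul_zero _).symm⟩
  | succ r =>
    obtain ⟨w, -, rfl⟩ := hz
    exact ⟨w, e.d_apply w⟩

theorem coboundaries_induction {C : J k A M → Prop} (h0 : C 0)
    (hC : ∀ r w, w ∈ Jdeg k A M r → r + 1 = n → C (e.κ * w)) {z : J k A M}
    (hz : z ∈ e.coboundaries) : C z := by
  cases n with
  | zero => rwa [(Submodule.mem_bot k).1 hz]
  | succ r =>
    obtain ⟨w, hw, rfl⟩ := hz
    rw [d_apply]
    exact hC r w hw rfl

theorem κ_mul_mem_coboundaries {r : ℕ} {w : J k A M} (hw : w ∈ Jdeg k A M r) (hr : r + 1 = n) :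
    e.κ * w ∈ e.coboundaries := by
  subst hr
  exact ⟨w, hw, e.d_apply w⟩

theorem vol_mul_mem (a : A) : e.vol * SymAlg.ofA k A _ a ∈ e.cocycles := by
  refine e.mem_cocycles.2 ⟨mul_ofA_mem_Jdeg a e.vol_mem_Jdeg, ?_⟩
  rw [← mul_assoc, κ_mul_vol, zero_mul]

/-- The class of `ω a`, where `ω` is the product of the odd variables. -/
def volCls (a : A) : e.Ber := e.cls ⟨_, e.vol_mul_mem a⟩

/-- The Koszul lemma gives a primitive with no control of the degree; projecting onto degree `n`
makes it one of degree `n - 1`. -/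
theorem exists_eq_volCls (ω : e.Ber) : ∃ a, ω = e.volCls a := by
  obtain ⟨⟨z, hz⟩, rfl⟩ := Submodule.mkQ_surjective _ ω
  obtain ⟨hz1, hz2⟩ := e.mem_cocycles.1 hz
  obtain ⟨a, w, h⟩ := SymAlg.exists_eq_of_kos_mul_eq_zero e.vars e.vars_mem dsgn_mul_self
    nodup_indices mem_indices hz2
  refine ⟨a, (Submodule.Quotient.eq _).2 ?_⟩
  change z - e.vol * SymAlg.ofA k A _ a ∈ e.coboundaries
  have h' : z = Jproj n (e.vol * SymAlg.ofA k A _ a) + Jproj n (e.κ * w) := by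
    rw [← Jproj_add, ← Jproj_of_mem hz1]
    exact congrArg _ h
  rw [Jproj_of_mem (mul_ofA_mem_Jdeg a e.vol_mem_Jdeg : _ ∈ Jdeg k A M n)] at h'
  rw [h', add_sub_cancel_left]
  -- In degree `0` there are no coboundaries, and the projection of `κ w` vanishes because `κ` has
  -- degree one.
  rcases Nat.eq_zero_or_pos n with hn | hn
  · have h0 : Jproj n (e.κ * w) = 0 :=
      (congrArg (fun r => Jproj r (e.κ * w)) hn).trans (Jproj_zero_mul e.κ_mem_Jdeg w)
    rw [h0]; exact zero_mem _
  · obtain ⟨r, hr⟩ := Nat.exists_eq_add_of_lt hn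
    have hr' : r + 1 = n := by omega
    have h1 : Jproj n (e.κ * w) = e.κ * Jproj r w :=
      (congrArg (fun r => Jproj r (e.κ * w)) hr'.symm).trans (Jproj_succ_mul r e.κ_mem_Jdeg w)
    rw [h1]
    exact e.κ_mul_mem_coboundaries (Jproj_mem r w) hr'

/-- The coefficient of the product of the odd variables. -/
def Jres : J k A M →ₗ[k] A := SymAlg.residue e.vars e.vars_mem (indices n m)

theorem Jres_κ_mul (w : J k A M) : e.Jres (e.κ * w) = 0 :=
  SymAlg.residue_kos_mul e.vars e.vars_mem dsgn _ w

theorem Jres_vol_mul (a : A) : e.Jres (e.vol * SymAlg.ofA k A _ a) = a :=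
  (SymAlg.residue_ξprod_mul e.vars e.vars_mem nodup_indices _).trans (SymAlg.aug_ofA a)

/-- The coordinate of elements of the Berezinian module. -/
def res : e.Ber →ₗ[k] A :=
  Submodule.liftQ _ (e.Jres ∘ₗ e.cocycles.subtype) fun z hz => by
    obtain ⟨w, hw⟩ := e.exists_of_mem_coboundaries hz
    rw [LinearMap.mem_ker, LinearMap.comp_apply, hw, Jres_κ_mul]

theorem res_volCls (a : A) : e.res (e.volCls a) = a := e.Jres_vol_mul a

/-- The product of the odd variables has parity `n + m` in `J(M)`. The summand `n` is the one that
the parity of `Ber(M)` does not count. -/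
theorem volCls_mem {i : ZMod 2} {a : A} (ha : a ∈ part k A (i + m)) :
    e.volCls a ∈ e.berPart i := by
  refine ⟨⟨_, e.vol_mul_mem a⟩, ?_, rfl⟩
  have h : SymAlg.ofA k A (ParityShift k 1 M × SDual k A M) a ∈ part k _ (i + m) := by
    rw [mem_part, SymAlg.σ_ofA, mem_part.1 ha, map_zsmul]
  have := mul_mem_part e.vol_mem h
  rw [show (n : ZMod 2) + m + (i + m) = i + n + (m + m) by ring, CharTwo.add_self_eq_zero,
    add_zero] at this
  exact this

theorem volCls_add (a b : A) : e.volCls (a + b) = e.volCls a + e.volCls b := by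
  rw [volCls, volCls, volCls, ← map_add]
  congr 1
  exact Subtype.ext (by simp [mul_add])

end HomBasis

end Ber

/-! # Brackets and `p`-th powers of induced actions -/

section Frobenius

theorem sub_pow_of_commute {p : ℕ} (k : Type*) {R : Type*} [Field k] [Fact p.Prime] [CharP k p]
    [Ring R] [Algebra k R] {a b : R} (h : Commute a b) : (a - b) ^ p = a ^ p - b ^ p := by
  cases subsingleton_or_nontrivial R
  · exact Subsingleton.elim _ _
  · have : CharP R p := charP_of_injective_algebraMap (algebraMap k R).injective p
    exact sub_pow_char_of_commute p h

theorem add_pow_of_commute {p : ℕ} (k : Type*) {R : Type*} [Field k] [Fact p.Prime] [CharP k p]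
    [Ring R] [Algebra k R] {a b : R} (h : Commute a b) : (a + b) ^ p = a ^ p + b ^ p := by
  cases subsingleton_or_nontrivial R
  · exact Subsingleton.elim _ _
  · have : CharP R p := charP_of_injective_algebraMap (algebraMap k R).injective p
    exact add_pow_char_of_commute p h

/-- The `p`-th power of a derivation is a derivation. -/
theorem derivation_pow {p : ℕ} {k R : Type*} [Field k] [Fact p.Prime] [CharP k p]
    [Ring R] [Algebra k R] {L : Module.End k R} (hL : ∀ x y, L (x * y) = L x * y + x * L y)
    (x y : R) : (L ^ p) (x * y) = (L ^ p) x * y + x * (L ^ p) y := by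
  -- The Leibniz rule says that multiplication intertwines `L` with `L ⊗ 1 + 1 ⊗ L`. The two
  -- summands commute, so in characteristic `p` the `p`-th power of their sum is the sum of their
  -- `p`-th powers.
  let T₁ : Module.End k (R ⊗[k] R) := LinearMap.rTensor R L
  let T₂ : Module.End k (R ⊗[k] R) := LinearMap.lTensor R L
  have h12 : Commute T₁ T₂ := TensorProduct.ext' fun a b => rfl
  have h : ∀ (r : ℕ) (t : R ⊗[k] R),
      (L ^ r) (LinearMap.mul' k R t) = LinearMap.mul' k R (((T₁ + T₂) ^ r) t) := by
    intro r
    induction r with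
    | zero => intro t; rfl
    | succ r ih =>
      intro t
      rw [pow_succ, pow_succ, Module.End.mul_apply, Module.End.mul_apply, ← ih]
      congr 1
      induction t using TensorProduct.induction_on with
      | zero => simp
      | tmul a b => exact hL a b
      | add s t hs ht => rw [map_add, map_add, map_add, map_add, hs, ht]
  have h1 := h p (x ⊗ₜ y)
  rw [add_pow_of_commute k h12] at h1
  have p1 : ∀ r : ℕ, (T₁ ^ r) (x ⊗ₜ y) = (L ^ r) x ⊗ₜ y := fun r => by
    induction r with
    | zero => rfl
    | succ r ih => rw [pow_succ', pow_succ', Module.End.mul_apply, ih]; rfl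
  have p2 : ∀ r : ℕ, (T₂ ^ r) (x ⊗ₜ y) = x ⊗ₜ (L ^ r) y := fun r => by
    induction r with
    | zero => rfl
    | succ r ih => rw [pow_succ', pow_succ', Module.End.mul_apply, ih]; rfl
  rw [LinearMap.add_apply, p1, p2, map_add] at h1
  exact h1

end Frobenius

section Induced

variable {k A : Type*} [Field k] [Ring A] [Algebra k A] [Superalgebra k A]
  {M : Type*} [AddCommGroup M] [Module k M] [Superspace k M] [Module A M] [Supermodule k A M]

namespace ParityShift

theorem action_comb {i : ZMod 2} {S T F : Module.End k M} {c c' : k} (h : F = c • S + c' • T) :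
    action 1 i F = c • action 1 i S + c' • action 1 i T := by
  ext x
  obtain ⟨x, rfl⟩ := (mk k 1 M).surjective x
  rw [LinearMap.add_apply, LinearMap.smul_apply, LinearMap.smul_apply, action_mk, action_mk,
    action_mk, h, LinearMap.add_apply, map_add, smul_add]
  rw [LinearMap.smul_apply, LinearMap.smul_apply, map_smul, map_smul, smul_comm c, smul_comm c']

theorem action_bracket {i j : ZMod 2} {S T F : Module.End k M}
    (h : F = S * T - sgn (i * j) • (T * S)) : action 1 (i + j) F =
      action 1 i S * action 1 j T - sgn (i * j) • (action 1 j T * action 1 i S) := by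
  ext x
  obtain ⟨x, rfl⟩ := (mk k 1 M).surjective x
  rw [LinearMap.sub_apply, LinearMap.smul_apply, Module.End.mul_apply, Module.End.mul_apply,
    action_mk, action_mk, action_mk, map_zsmul, map_zsmul, action_mk, action_mk, h,
    LinearMap.sub_apply, LinearMap.smul_apply, map_sub, map_zsmul, Nat.cast_one]
  rcases zmod_two_cases i with rfl | rfl <;> rcases zmod_two_cases j with rfl | rfl <;>
    simp [one_add_one] <;> abel

theorem action_pow {T : Module.End k M} (r : ℕ) : action 1 0 (T ^ r) = action 1 0 T ^ r := by
  have h : ∀ (T : Module.End k M) x, action 1 0 T (mk k 1 M x) = mk k 1 M (T x) := fun T x => by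
    rw [action_mk, zero_mul, sgn_zero, one_smul]
  induction r with
  | zero =>
    ext x
    obtain ⟨x, rfl⟩ := (mk k 1 M).surjective x
    exact h _ x
  | succ r ih =>
    ext x
    obtain ⟨x, rfl⟩ := (mk k 1 M).surjective x
    rw [pow_succ, pow_succ, h, Module.End.mul_apply, Module.End.mul_apply, h, ← ih, h]

end ParityShift

variable [SuperCommutative k A] [NeZero (2 : k)]

theorem IsSuperDer.σpow_comm {i j : ZMod 2} {D : A →ₗ[k] A} (hD : IsSuperDer k i D) (a : A) :
    D (σpow k j a) = sgn (i * j) • σpow k j (D a) := by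
  rcases zmod_two_cases j with rfl | rfl
  · simp
  · rw [mul_one]; exact hD.parity a

theorem σpow_add {V : Type*} [AddCommGroup V] [Module k V] [Superspace k V] (i j : ZMod 2) (v : V) :
    σpow k (i + j) v = σpow k i (σpow k j v) := by
  rcases zmod_two_cases i with rfl | rfl <;> rcases zmod_two_cases j with rfl | rfl <;>
    simp [one_add_one]

namespace SDual

variable {i j : ZMod 2} {D E F : Module.End k A} {S T U : Module.End k M}

theorem action_comb (hD : IsSuperDer k i D) (hS : IsCovariant k i D S) (hE : IsSuperDer k i E)
    (hT : IsCovariant k i E T) (hF : IsSuperDer k i F) (hU : IsCovariant k i F U) {c c' : k}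
    (h : F = c • D + c' • E) (h' : U = c • S + c' • T) :
    action hF hU = c • action hD hS + c' • action hE hT := by
  refine LinearMap.ext fun φ => SDual.ext fun m => ?_
  rw [LinearMap.add_apply, LinearMap.smul_apply, LinearMap.smul_apply, add_fn, smul_fn, smul_fn,
    action_fn, action_fn, action_fn, h, h']
  simp only [LinearMap.add_apply, LinearMap.smul_apply, map_add, map_smul_k, smul_sub]
  abel

theorem action_bracket (hD : IsSuperDer k i D) (hS : IsCovariant k i D S) (hE : IsSuperDer k j E)
    (hT : IsCovariant k j E T) (hF : IsSuperDer k (i + j) F) (hU : IsCovariant k (i + j) F U)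
    (h : F = D * E - sgn (i * j) • (E * D)) (h' : ∀ m, U m = S (T m) - sgn (i * j) • T (S m)) :
    action hF hU = action hD hS * action hE hT -
      sgn (i * j) • (action hE hT * action hD hS) := by
  refine LinearMap.ext fun φ => SDual.ext fun m => ?_
  have hsub : ∀ φ ψ : SDual k A M, ∀ m, (φ - ψ).fn m = φ.fn m - ψ.fn m := fun _ _ _ => rfl
  rw [LinearMap.sub_apply, LinearMap.smul_apply, Module.End.mul_apply, Module.End.mul_apply, hsub,
    fn_zsmul]
  simp only [action_fn, h, h', LinearMap.sub_apply, LinearMap.smul_apply, Module.End.mul_apply,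
    map_sub, map_zsmul]
  have h1 := hS.parity
  have h2 := hT.parity
  rcases zmod_two_cases i with rfl | rfl <;> rcases zmod_two_cases j with rfl | rfl <;>
    simp only [one_add_one, σpow_zero, σpow_one, sgn_zero, sgn_one, mul_zero, mul_one,
      one_smul, neg_smul, add_zero, zero_add, σ_σ, h1, h2, map_neg] <;> abel

/-- On linear maps the contragredient action is the difference of composition with `D` and with `S`
on the two sides. These operators commute, so the `p`-th power is taken termwise. -/
theorem action_pow {p : ℕ} [Fact p.Prime] [CharP k p] (hD : IsSuperDer k 0 D)
    (hS : IsCovariant k 0 D S) (hF : IsSuperDer k 0 F) (hU : IsCovariant k 0 F U)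
    (h : F = D ^ p) (h' : U = S ^ p) : action hF hU = action hD hS ^ p := by
  let T₁ : Module.End k (M →ₗ[k] A) := LinearMap.llcomp k M A A D
  let T₂ : Module.End k (M →ₗ[k] A) := LinearMap.lcomp k A S
  have hc : Commute T₁ T₂ := by
    ext f m
    rfl
  have p1 : ∀ (r : ℕ) (f : M →ₗ[k] A) m, (T₁ ^ r) f m = (D ^ r) (f m) := fun r => by
    induction r with
    | zero => exact fun f m => rfl
    | succ r ih =>
      intro f m
      rw [pow_succ', pow_succ', Module.End.mul_apply, Module.End.mul_apply, ← ih]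
      rfl
  have p2 : ∀ (r : ℕ) (f : M →ₗ[k] A) m, (T₂ ^ r) f m = f ((S ^ r) m) := fun r => by
    induction r with
    | zero => exact fun f m => rfl
    | succ r ih =>
      intro f m
      rw [pow_succ, pow_succ', Module.End.mul_apply, Module.End.mul_apply, ih]
      rfl
  have key : ∀ (r : ℕ) (φ : SDual k A M),
      (((action hD hS) ^ r) φ).fn.restrictScalars k = ((T₁ - T₂) ^ r) (φ.fn.restrictScalars k) := by
    intro r
    induction r with
    | zero => exact fun φ => rfl
    | succ r ih =>
      intro φ
      rw [pow_succ', pow_succ', Module.End.mul_apply, Module.End.mul_apply, ← ih]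
      rfl
  refine LinearMap.ext fun φ => SDual.ext fun m => ?_
  have := LinearMap.congr_fun (key p φ) m
  have e0 : (T₁ - T₂) ^ p = T₁ ^ p - T₂ ^ p :=
    sub_pow_of_commute k (R := Module.End k (M →ₗ[k] A)) hc
  have e := LinearMap.congr_fun (LinearMap.congr_fun e0 (φ.fn.restrictScalars k)) m
  rw [LinearMap.sub_apply, LinearMap.sub_apply, p1, p2] at e
  rw [action_fn, h, h']
  exact e.symm.trans this.symm

end SDual

namespace Der

variable {i j : ZMod 2} {D E F : Module.End k A}

theorem ad_comb (hD : IsSuperDer k i D) (hE : IsSuperDer k i E) (hF : IsSuperDer k i F) {c c' : k}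
    (h : F = c • D + c' • E) : ad hF = c • ad hD + c' • ad hE := by
  refine LinearMap.ext fun X => Subtype.ext <| LinearMap.ext fun a => ?_
  change superBracket i F (X : A →ₗ[k] A) a = c • superBracket i D (X : A →ₗ[k] A) a +
    c' • superBracket i E (X : A →ₗ[k] A) a
  simp only [superBracket_apply, h, LinearMap.add_apply, LinearMap.smul_apply, map_add, map_smul,
    smul_sub]
  abel

/-- The Jacobi identity for the supercommutator, with `X` not assumed homogeneous. -/
theorem ad_bracket (hD : IsSuperDer k i D) (hE : IsSuperDer k j E) (hF : IsSuperDer k (i + j) F)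
    (h : F = D * E - sgn (i * j) • (E * D)) (X : Der k A) :
    ad hF X = ad hD (ad hE X) - sgn (i * j) • ad hE (ad hD X) := by
  refine Subtype.ext <| LinearMap.ext fun a => ?_
  change superBracket (i + j) F (X : A →ₗ[k] A) a =
    superBracket i D (superBracket j E (X : A →ₗ[k] A)) a -
    sgn (i * j) • superBracket j E (superBracket i D (X : A →ₗ[k] A)) a
  have hc : ∀ a : A, σpow k j (σpow k i a) = σpow k i (σpow k j a) := fun a => by
    rw [← σpow_add, ← σpow_add, add_comm]
  simp only [superBracket_apply, h, LinearMap.sub_apply, LinearMap.smul_apply,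
    Module.End.mul_apply, map_sub, map_zsmul, hD.σpow_comm, hE.σpow_comm, σpow_add, smul_sub,
    smul_smul, mul_comm j i, sgn_mul_self, one_smul, hc]
  abel

/-- For even `D` the adjoint action is left minus right multiplication by `D`. These commute, so the
Frobenius identity applies. -/
theorem ad_pow {p : ℕ} [Fact p.Prime] [CharP k p] (hD : IsSuperDer k 0 D)
    (hF : IsSuperDer k 0 F) (h : F = D ^ p) :
    (ad hF : Module.End k (Der k A)) = ad hD ^ p := by
  have hc : Commute (LinearMap.mulLeft k D) (LinearMap.mulRight k D) :=
    LinearMap.commute_mulLeft_right D D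
  have key : ∀ (r : ℕ) (X : Der k A), ((((ad hD : Module.End k (Der k A)) ^ r) X : Der k A) : Module.End k A) =
      ((LinearMap.mulLeft k D - LinearMap.mulRight k D) ^ r) (X : Module.End k A) := by
    intro r
    induction r with
    | zero => exact fun X => rfl
    | succ r ih =>
      intro X
      rw [pow_succ', pow_succ', Module.End.mul_apply, Module.End.mul_apply, ← ih]
      rfl
  refine LinearMap.ext fun X => Subtype.ext ?_
  have e0 : (LinearMap.mulLeft k D - LinearMap.mulRight k D) ^ p =
      LinearMap.mulLeft k D ^ p - LinearMap.mulRight k D ^ p :=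
    sub_pow_of_commute k (R := Module.End k (Module.End k A)) hc
  have e := LinearMap.congr_fun e0 (X : Module.End k A)
  rw [LinearMap.pow_mulLeft, LinearMap.pow_mulRight, ← h] at e
  exact e.symm.trans (key p X).symm

end Der

namespace SymAlg

variable {N : Type*} [AddCommGroup N] [Module k N] [Superspace k N] [Module A N]
  [Supermodule k A N] {i j : ZMod 2} {D E F : Module.End k A} {S T U : Module.End k N}

theorem eq_of_leibniz {L L' : SymAlg k A N →ₗ[k] SymAlg k A N}
    (hL : ∀ x y, L (x * y) = L x * y + σpow k i x * L y)
    (hL' : ∀ x y, L' (x * y) = L' x * y + σpow k i x * L' y)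
    (ha : ∀ a, L (ofA k A N a) = L' (ofA k A N a)) (hn : ∀ n, L (ι k A N n) = L' (ι k A N n)) :
    L = L' := by
  ext x
  induction x using SymAlg.induction with
  | hs c =>
    rw [Algebra.algebraMap_eq_smul_one, map_smul, map_smul, ← ofA_one, ha]
  | ha a => exact ha a
  | hn n => exact hn n
  | hmul x y hx hy => rw [hL, hL', hx, hy]
  | hadd x y hx hy => rw [map_add, map_add, hx, hy]

theorem action_σ (hD : IsSuperDer k i D) (hS : IsCovariant k i D S) (x : SymAlg k A N) :
    action hD hS (σ k x) = sgn i • σ k (action hD hS x) := by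
  induction x using SymAlg.induction with
  | hs c =>
    rw [Algebra.algebraMap_eq_smul_one, map_smul, σ_one, map_smul, ← ofA_one, action_ofA, hD.one,
      map_zero, smul_zero, map_zero, smul_zero]
  | ha a => rw [σ_ofA, action_ofA, action_ofA, hD.parity, map_zsmul, σ_ofA]
  | hn n => rw [σ_ι, action_ι, action_ι, hS.parity, map_zsmul, σ_ι]
  | hmul x y hx hy =>
    rw [σ_mul, action_mul, action_mul, hx, hy, map_add, σ_mul, σ_mul, smul_add, smul_mul_assoc,
      mul_smul_comm]
    rcases zmod_two_cases i with rfl | rfl <;> rfl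
  | hadd x y hx hy => rw [map_add, map_add, hx, hy, map_add, map_add, smul_add]

theorem action_σpow (hD : IsSuperDer k i D) (hS : IsCovariant k i D S) (x : SymAlg k A N) :
    action hD hS (σpow k j x) = sgn (i * j) • σpow k j (action hD hS x) := by
  rcases zmod_two_cases j with rfl | rfl
  · simp
  · rw [mul_one]; exact action_σ hD hS x

theorem action_comb (hD : IsSuperDer k i D) (hS : IsCovariant k i D S) (hE : IsSuperDer k i E)
    (hT : IsCovariant k i E T) (hF : IsSuperDer k i F) (hU : IsCovariant k i F U) {c c' : k}
    (h : F = c • D + c' • E) (h' : U = c • S + c' • T) :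
    action hF hU = c • action hD hS + c' • action hE hT := by
  refine eq_of_leibniz (i := i) (action_mul hF hU) (fun x y => ?_) (fun a => ?_) fun n => ?_
  · simp only [LinearMap.add_apply, LinearMap.smul_apply, action_mul, smul_add, add_mul, mul_add,
      smul_mul_assoc, mul_smul_comm]
    abel
  · simp only [LinearMap.add_apply, LinearMap.smul_apply, action_ofA, h, map_add, map_smul]
  · simp only [LinearMap.add_apply, LinearMap.smul_apply, action_ι, h', map_add, map_smul]

/-- The supercommutator of two superderivations satisfies the Leibniz rule of parity `i + j`, so it
is enough to compare on generators. -/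
theorem action_bracket (hD : IsSuperDer k i D) (hS : IsCovariant k i D S) (hE : IsSuperDer k j E)
    (hT : IsCovariant k j E T) (hF : IsSuperDer k (i + j) F) (hU : IsCovariant k (i + j) F U)
    (h : F = D * E - sgn (i * j) • (E * D)) (h' : U = S * T - sgn (i * j) • (T * S)) :
    action hF hU = action hD hS * action hE hT -
      sgn (i * j) • (action hE hT * action hD hS) := by
  refine eq_of_leibniz (i := i + j) (action_mul hF hU) (fun x y => ?_) (fun a => ?_) fun n => ?_
  · have hc : ∀ a : SymAlg k A N, σpow k j (σpow k i a) = σpow k i (σpow k j a) := fun a => by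
      rw [← σpow_add, ← σpow_add, add_comm]
    simp only [LinearMap.sub_apply, LinearMap.smul_apply, Module.End.mul_apply, action_mul,
      map_add, action_σpow, σpow_add, smul_add, sub_mul, mul_sub, smul_mul_assoc, mul_smul_comm,
      hc, smul_smul, mul_comm j i, sgn_mul_self, one_smul]
    abel
  · simp only [LinearMap.sub_apply, LinearMap.smul_apply, Module.End.mul_apply, action_ofA, h,
      map_sub, map_zsmul]
  · simp only [LinearMap.sub_apply, LinearMap.smul_apply, Module.End.mul_apply, action_ι, h',
      map_sub, map_zsmul]

/-- By `derivation_pow` both sides are derivations; they agree on generators. -/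
theorem action_pow {p : ℕ} [Fact p.Prime] [CharP k p] (hD : IsSuperDer k 0 D)
    (hS : IsCovariant k 0 D S) (hF : IsSuperDer k 0 F) (hU : IsCovariant k 0 F U)
    (h : F = D ^ p) (h' : U = S ^ p) : action hF hU = action hD hS ^ p := by
  have hL : ∀ x y, action hD hS (x * y) = action hD hS x * y + x * action hD hS y := fun x y =>
    action_mul hD hS x y
  have ha : ∀ (r : ℕ) a, ((action hD hS) ^ r) (ofA k A N a) = ofA k A N ((D ^ r) a) := fun r => by
    induction r with
    | zero => exact fun a => rfl
    | succ r ih => intro a; rw [pow_succ, Module.End.mul_apply, action_ofA, ih, pow_succ]; rfl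
  have hn : ∀ (r : ℕ) n, ((action hD hS) ^ r) (ι k A N n) = ι k A N ((S ^ r) n) := fun r => by
    induction r with
    | zero => exact fun a => rfl
    | succ r ih => intro a; rw [pow_succ, Module.End.mul_apply, action_ι, ih, pow_succ]; rfl
  refine eq_of_leibniz (i := 0) (action_mul hF hU) (derivation_pow hL) (fun a => ?_) fun n => ?_
  · rw [action_ofA, ha, h]
  · rw [action_ι, hn, h']

end SymAlg

end Induced

/-! # The Lie derivatives -/

section LieDerivative

variable {k A : Type*} [Field k] [Ring A] [Algebra k A] [Superalgebra k A]
  [SuperCommutative k A] [NeZero (2 : k)] {i j : ZMod 2} {D E F : Module.End k A}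

theorem prodMap_pow {V W : Type*} [AddCommGroup V] [Module k V] [AddCommGroup W] [Module k W]
    (S : Module.End k V) (T : Module.End k W) (r : ℕ) :
    (S ^ r).prodMap (T ^ r) = (S.prodMap T : Module.End k (V × W)) ^ r := by
  induction r with
  | zero => rfl
  | succ r ih => rw [pow_succ, pow_succ, pow_succ, ← ih]; rfl

theorem lieDerivative_comb (hD : IsSuperDer k i D) (hE : IsSuperDer k i E)
    (hF : IsSuperDer k i F) {c c' : k} (h : F = c • D + c' • E) :
    lieDerivative hF = c • lieDerivative hD + c' • lieDerivative hE := by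
  have h1 : lieDual hF = c • lieDual hD + c' • lieDual hE :=
    SDual.action_comb _ _ _ _ _ _ h (Der.ad_comb hD hE hF h)
  refine SymAlg.action_comb _ _ _ _ _ _ h ?_
  rw [ParityShift.action_comb h1, SDual.action_comb hD (isCovariant_lieDual hD) hE
    (isCovariant_lieDual hE) hF (isCovariant_lieDual hF) h h1]
  rfl

/-- The bracket is carried along each construction in turn: from `Der(A)` to its dual, to the parity
shift and the double dual, and to the symmetric superalgebra. -/
theorem lieDerivative_bracket (hD : IsSuperDer k i D) (hE : IsSuperDer k j E)
    (hF : IsSuperDer k (i + j) F) (h : F = D * E - sgn (i * j) • (E * D)) :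
    lieDerivative hF = lieDerivative hD * lieDerivative hE -
      sgn (i * j) • (lieDerivative hE * lieDerivative hD) := by
  have h1 : lieDual hF = lieDual hD * lieDual hE - sgn (i * j) • (lieDual hE * lieDual hD) :=
    SDual.action_bracket _ _ _ _ _ _ h (Der.ad_bracket hD hE hF h)
  refine SymAlg.action_bracket _ _ _ _ _ _ h ?_
  rw [ParityShift.action_bracket h1, SDual.action_bracket hD (isCovariant_lieDual hD) hE
    (isCovariant_lieDual hE) hF (isCovariant_lieDual hF) h (LinearMap.congr_fun h1)]
  rfl

theorem lieDerivative_pow {p : ℕ} [Fact p.Prime] [CharP k p] (hD : IsSuperDer k 0 D)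
    (hF : IsSuperDer k 0 F) (h : F = D ^ p) : lieDerivative hF = lieDerivative hD ^ p := by
  have h1 : lieDual hF = lieDual hD ^ p :=
    SDual.action_pow _ _ _ _ h (Der.ad_pow hD hF h)
  refine SymAlg.action_pow _ _ _ _ h ?_
  rw [SDual.action_pow hD (isCovariant_lieDual hD) hF (isCovariant_lieDual hF) h h1, h1,
    ParityShift.action_pow]
  exact prodMap_pow _ _ p

end LieDerivative

/-! # The action on Berezinian modules -/

section Ber

variable {k A M : Type*} [Field k] [Ring A] [Algebra k A] [Superalgebra k A]
  [SuperCommutative k A] [NeZero (2 : k)]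
  [AddCommGroup M] [Module k M] [Superspace k M] [Module A M] [Supermodule k A M]
  {i : ZMod 2} {D : A →ₗ[k] A} {T : M →ₗ[k] M}

/-- The superderivation of `J(M)` induced by a superderivation of `A` and a compatible action on
`M`. -/
def Jaction (hD : IsSuperDer k i D) (hT : IsCovariant k i D T) : J k A M →ₗ[k] J k A M :=
  SymAlg.action hD ((ParityShift.isCovariant 1 hD hT).prodMap (SDual.isCovariant hD hT))

variable (hD : IsSuperDer k i D) (hT : IsCovariant k i D T)

theorem Jaction_mul (x y : J k A M) :
    Jaction hD hT (x * y) = Jaction hD hT x * y + σpow k i x * Jaction hD hT y :=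
  SymAlg.action_mul _ _ x y

theorem Jaction_ofA (a : A) : Jaction hD hT (SymAlg.ofA k A _ a) = SymAlg.ofA k A _ (D a) :=
  SymAlg.action_ofA _ _ a

theorem Jaction_Jπ (x : M) : Jaction hD hT (Jπ k A x) = sgn i • Jπ k A (T x) := by
  refine (SymAlg.action_ι _ _ _).trans ?_
  rw [Jπ, ← map_zsmul]
  congr 1
  refine Prod.ext ?_ ((map_zero (SDual.action hD hT)).trans (smul_zero (sgn i)).symm)
  change ParityShift.action 1 i T (ParityShift.mk k 1 M x) = _
  rw [ParityShift.action_mk, Nat.cast_one, mul_one]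
  rfl

theorem Jaction_Jdual (φ : SDual k A M) :
    Jaction hD hT (Jdual k A φ) = Jdual k A (SDual.action hD hT φ) := by
  refine (SymAlg.action_ι _ _ _).trans ?_
  rw [Jdual]
  congr 1
  exact Prod.ext (map_zero (ParityShift.action (k := k) 1 i T)) rfl

theorem Jaction_mem_Jdeg {r : ℕ} {z : J k A M} (hz : z ∈ Jdeg k A M r) :
    Jaction hD hT z ∈ Jdeg k A M r := by
  have hmul : ∀ {r s : ℕ} {x y : J k A M}, x ∈ Jdeg k A M r → Jaction hD hT x ∈ Jdeg k A M r →
      y ∈ Jdeg k A M s → Jaction hD hT y ∈ Jdeg k A M s →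
      x * y ∈ Jdeg k A M (r + s) ∧ Jaction hD hT (x * y) ∈ Jdeg k A M (r + s) :=
    fun {r s x y} hx hx' hy hy' => ⟨mul_mem_Jdeg hx hy, by
      rw [Jaction_mul]
      exact add_mem (mul_mem_Jdeg hx' hy) (mul_mem_Jdeg (σpow_mem_Jdeg i hx) hy')⟩
  have h1 : (1 : J k A M) ∈ Jdeg k A M 0 ∧ Jaction hD hT 1 ∈ Jdeg k A M 0 := by
    refine ⟨one_mem_Jdeg, ?_⟩
    rw [← SymAlg.ofA_one, Jaction_ofA]
    exact ofA_mem_Jdeg _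
  refine Jdeg_induction (C := fun z => Jaction hD hT z ∈ Jdeg k A M r) (fun a l φ hl => ?_) ?_
    (fun x y hx hy => ?_) (fun c x hx => ?_) hz
  · have hφ : (φ.map (Jdual k A)).prod ∈ Jdeg k A M 0 ∧
        Jaction hD hT (φ.map (Jdual k A)).prod ∈ Jdeg k A M 0 := by
      induction φ with
      | nil => exact h1
      | cons ψ φ ih =>
        have := hmul (Jdual_mem_Jdeg ψ) (by rw [Jaction_Jdual]; exact Jdual_mem_Jdeg _) ih.1 ih.2
        rwa [add_zero] at this
    have hl' : (l.map (Jπ k A)).prod ∈ Jdeg k A M l.length ∧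
        Jaction hD hT (l.map (Jπ k A)).prod ∈ Jdeg k A M l.length := by
      clear hl
      induction l with
      | nil => exact h1
      | cons x l ih =>
        have := hmul (Jπ_mem_Jdeg x) (by
          rw [Jaction_Jπ]; exact zsmul_mem (Jπ_mem_Jdeg _) _) ih.1 ih.2
        rwa [add_comm] at this
    have h2 := hmul (ofA_mem_Jdeg a) (by rw [Jaction_ofA]; exact ofA_mem_Jdeg _) hl'.1 hl'.2
    have h3 := (hmul h2.1 h2.2 hφ.1 hφ.2).2
    rwa [zero_add, add_zero, hl] at h3
  · rw [map_zero]; exact zero_mem _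
  · rw [map_add]; exact add_mem hx hy
  · rw [map_smul]; exact Submodule.smul_mem _ c hx

theorem SDual.fn_mem {j l : ZMod 2} {φ : SDual k A M} (hφ : φ ∈ part k (SDual k A M) j) {m : M}
    (hm : m ∈ part k M l) : φ.fn m ∈ part k A (j + l) := by
  have h : (σ k φ).fn m = σ k (φ.fn (σ k m)) := rfl
  rw [mem_part.1 hφ, mem_part.1 hm, map_zsmul, map_zsmul, fn_zsmul] at h
  rw [mem_part, sgn_add, mul_smul, smul_comm, h, smul_smul, sgn_mul_self, one_smul]

theorem Jπ_smul (a : A) (x : M) :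
    Jπ k A (a • x) = SymAlg.ofA k A _ (σ k a) * Jπ k A x := by
  rw [Jπ, Jπ, ← SymAlg.ι_smul]
  congr 1
  refine Prod.ext ?_ (smul_zero (σ k a)).symm
  change _ = σ k a • ParityShift.mk k 1 M x
  rw [ParityShift.smul_mk, Nat.cast_one, σpow_one, σ_σ]

theorem Jdual_smul (a : A) (φ : SDual k A M) :
    Jdual k A (a • φ) = SymAlg.ofA k A _ a * Jdual k A φ := by
  rw [Jdual, Jdual, ← SymAlg.ι_smul]
  congr 1
  exact Prod.ext (smul_zero a).symm rfl

theorem Jπ_sum {ι : Type*} (s : Finset ι) (f : ι → M) :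
    Jπ k A (∑ b ∈ s, f b) = ∑ b ∈ s, Jπ k A (f b) :=
  map_sum (SymAlg.ι k A (ParityShift k 1 M × SDual k A M) ∘ₗ LinearMap.inl k _ _ ∘ₗ
    (ParityShift.mk k 1 M).toLinearMap) f s

theorem Jdual_sum {ι : Type*} (s : Finset ι) (f : ι → SDual k A M) :
    Jdual k A (∑ b ∈ s, f b) = ∑ b ∈ s, Jdual k A (f b) :=
  map_sum (SymAlg.ι k A (ParityShift k 1 M × SDual k A M) ∘ₗ LinearMap.inr k _ _) f s

theorem Jdual_zsmul (c : ℤ) (φ : SDual k A M) : Jdual k A (c • φ) = c • Jdual k A φ :=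
  map_zsmul (SymAlg.ι k A (ParityShift k 1 M × SDual k A M) ∘ₗ LinearMap.inr k _ _) c φ

namespace HomBasis

variable {n m : ℕ} (e : HomBasis k A M n m)

theorem dual_mem (b : Fin n ⊕ Fin m) : e.dual b ∈ part k (SDual k A M) (parity b) := by
  rw [dual_eq]; exact dualBasis_mem e.basis e.mem b

theorem dual_fn_basis (b c : Fin n ⊕ Fin m) :
    (e.dual b).fn (e.basis c) = if b = c then 1 else 0 := by
  rw [dual_eq]; exact dualBasis_fn e.basis e.mem b c

/-- The matrix coefficients of an endomorphism. -/
def coeff (T : M →ₗ[k] M) (b c : Fin n ⊕ Fin m) : A := e.basis.repr (T (e.basis b)) c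

include hT in
theorem coeff_mem (b c : Fin n ⊕ Fin m) :
    e.coeff T b c ∈ part k A (i + parity b + parity c) := by
  have := SDual.fn_mem (e.dual_mem c) (hT.mem (e.mem b))
  rw [add_comm] at this
  exact this

theorem apply_basis (T : M →ₗ[k] M) (b : Fin n ⊕ Fin m) :
    T (e.basis b) = ∑ c, e.coeff T b c • e.basis c := (e.basis.sum_repr _).symm

/-- `D` kills the constants `⟨e_d, e^b⟩`, so the contragredient action has the negative
supertranspose as its matrix. -/
theorem sdual_action_dual (b : Fin n ⊕ Fin m) : SDual.action hD hT (e.dual b) =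
    -∑ c, sgn (parity c * parity b + parity c) • (e.coeff T c b • e.dual c) := by
  refine SDual.ext_basis e.basis fun d => ?_
  have hneg : ∀ (φ : SDual k A M) x, (-φ).fn x = -φ.fn x := fun _ _ => rfl
  have hsum : ∀ (f : Fin n ⊕ Fin m → SDual k A M) x, (∑ c, f c).fn x = ∑ c, (f c).fn x :=
    fun f x => LinearMap.sum_apply (σ₁₂ := RingHom.id A) Finset.univ (fun c => (f c).fn) x
  rw [SDual.action_fn, SymAlg.σpow_of_mem (e.mem d), map_zsmul, map_zsmul, map_zsmul, map_zsmul,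
    dual_fn_basis, hneg, hsum, Finset.sum_eq_single d]
  · rw [fn_zsmul, SDual.smul_A_fn_of_mem _ _ (e.mem d), dual_fn_basis, if_pos rfl, mul_one,
      SymAlg.σpow_of_mem (e.coeff_mem hT d b), smul_smul, ← sgn_add]
    have h0 : D (if b = d then 1 else 0) = 0 := by
      split_ifs
      · exact hD.one
      · exact map_zero D
    rw [h0, smul_zero, zero_sub]
    congr 2
    congr 1
    have key : ∀ i x y : ZMod 2, i * x = x * y + x + x * (i + x + y) := by decide
    exact key i _ _
  · intro c _ hc
    rw [fn_zsmul, SDual.smul_A_fn_of_mem _ _ (e.mem d), dual_fn_basis, if_neg hc, mul_zero,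
      smul_zero]
  · simp

/-- The element `κ` is the canonical element of `ΠM ⊗ M^*`, which corresponds to the identity of
`M`. The action on the vectors and the contragredient action on the dual basis cancel after
exchanging the two summations. -/
theorem Jaction_κ : Jaction hD hT e.κ = 0 := by
  have h : ∀ b, Jaction hD hT (sgn (parity b + 1) • (Jπ k A (e.basis b) * Jdual k A (e.dual b))) =
      ∑ c, sgn (parity c + 1) • (SymAlg.ofA k A _ (e.coeff T b c) *
        (Jπ k A (e.basis c) * Jdual k A (e.dual b))) -
      ∑ c, sgn (parity b + 1) • (SymAlg.ofA k A _ (e.coeff T c b) *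
        (Jπ k A (e.basis b) * Jdual k A (e.dual c))) := by
    intro b
    rw [map_zsmul, Jaction_mul, Jaction_Jπ, Jaction_Jdual, e.apply_basis T b,
      e.sdual_action_dual hD hT b, smul_add, sub_eq_add_neg]
    have hneg : ∀ φ : SDual k A M, Jdual k A (-φ) = -Jdual k A φ := fun φ => by
      have := Jdual_zsmul (-1) φ
      rwa [neg_one_zsmul, neg_one_zsmul] at this
    congr 1
    · rw [Jπ_sum, Finset.smul_sum, Finset.sum_mul, Finset.smul_sum]
      refine Finset.sum_congr rfl fun c _ => ?_
      rw [Jπ_smul, mem_part.1 (e.coeff_mem hT b c), map_zsmul, smul_mul_assoc, smul_mul_assoc,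
        smul_mul_assoc, smul_smul, smul_smul, ← sgn_add, ← sgn_add, mul_assoc]
      congr 2
      have key : ∀ i x y : ZMod 2, y + 1 + i + (i + y + x) = x + 1 := by decide
      exact key i _ _
    · rw [hneg, mul_neg, smul_neg, Jdual_sum, Finset.mul_sum, Finset.smul_sum]
      congr 1
      refine Finset.sum_congr rfl fun c _ => ?_
      have hb : Jπ k A (e.basis b) ∈ part k (J k A M) (1 + parity b) := by
        rw [mem_part, Jπ, SymAlg.σ_ι, mem_part.1 (Jπ_mem (e.mem b)), map_zsmul]
      have hcomm : Jπ k A (e.basis b) * SymAlg.ofA k A _ (e.coeff T c b) = _ :=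
        SymAlg.ι_mul_ofA k (e.coeff_mem hT c b) (Jπ_mem (e.mem b))
      rw [Jdual_zsmul, Jdual_smul, SymAlg.σpow_of_mem hb, mul_smul_comm, smul_mul_assoc,
        ← mul_assoc, hcomm, smul_mul_assoc, smul_smul, smul_smul, smul_smul, ← sgn_add, ← sgn_add,
        ← sgn_add, mul_assoc]
      congr 2
      have key : ∀ i x y : ZMod 2,
          y + 1 + (x * y + x) + i * (1 + y) + (i + x + y) * (1 + y) = y + 1 := by decide
      exact key i _ _
  rw [κ_eq, map_sum, Finset.sum_congr rfl fun b _ => h b, Finset.sum_sub_distrib, sub_eq_zero]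
  exact Finset.sum_comm

theorem κ_mem : e.κ ∈ part k (J k A M) 1 := by
  rw [κ_eq]
  refine Submodule.sum_mem _ fun b _ => zsmul_mem ?_ _
  have h1 : Jπ k A (e.basis b) ∈ part k (J k A M) (1 + parity b) := by
    rw [mem_part, Jπ, SymAlg.σ_ι, mem_part.1 (Jπ_mem (e.mem b)), map_zsmul]
  have h2 : Jdual k A (e.dual b) ∈ part k (J k A M) (parity b) := by
    rw [mem_part, Jdual, SymAlg.σ_ι, mem_part.1 (Jdual_mem (e.dual_mem b)), map_zsmul]
  have := mul_mem_part h1 h2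
  rwa [add_assoc, CharTwo.add_self_eq_zero, add_zero] at this

theorem Jaction_κ_mul (z : J k A M) :
    Jaction hD hT (e.κ * z) = sgn i • (e.κ * Jaction hD hT z) := by
  rw [Jaction_mul, Jaction_κ, zero_mul, zero_add, SymAlg.σpow_of_mem e.κ_mem, mul_one, smul_mul_assoc]

/-! ## Induced endomorphisms -/

/-- The endomorphisms of `J(M)` that preserve cocycles and coboundaries. -/
def stable : Subalgebra k (Module.End k (J k A M)) where
  carrier := {T | (∀ z ∈ e.cocycles, T z ∈ e.cocycles) ∧ ∀ z ∈ e.coboundaries, T z ∈ e.coboundaries}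
  mul_mem' hS hT := ⟨fun z hz => hS.1 _ (hT.1 z hz), fun z hz => hS.2 _ (hT.2 z hz)⟩
  add_mem' hS hT := ⟨fun z hz => add_mem (hS.1 z hz) (hT.1 z hz),
    fun z hz => add_mem (hS.2 z hz) (hT.2 z hz)⟩
  algebraMap_mem' c := ⟨fun _ hz => Submodule.smul_mem _ c hz,
    fun _ hz => Submodule.smul_mem _ c hz⟩

/-- The endomorphism induced on the Berezinian module. -/
def induce (T : e.stable) : Module.End k e.Ber :=
  Submodule.mapQ _ _ ((T : Module.End k (J k A M)).restrict T.2.1) fun z hz => T.2.2 z hz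

theorem induce_cls (T : e.stable) (z : e.cocycles) : e.induce T (e.cls z) =
    e.cls ⟨(T : Module.End k (J k A M)) z, T.2.1 z z.2⟩ := rfl

theorem induces (T : e.stable) : e.Induces (T : Module.End k (J k A M)) (e.induce T) :=
  fun z => ⟨T.2.1 z z.2, rfl⟩

theorem end_ext {S T : Module.End k e.Ber} (h : ∀ z, S (e.cls z) = T (e.cls z)) : S = T := by
  ext ω
  obtain ⟨z, rfl⟩ := Submodule.mkQ_surjective _ ω
  exact h z

/-- The action on the Berezinian module of endomorphisms of `J(M)`. -/
def induceHom : e.stable →ₐ[k] Module.End k e.Ber :=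
  AlgHom.ofLinearMap
    { toFun := e.induce
      map_add' := fun _ _ => e.end_ext fun _ => rfl
      map_smul' := fun _ _ => e.end_ext fun _ => rfl }
    (e.end_ext fun _ => rfl) (fun _ _ => e.end_ext fun _ => rfl)

/-- Invariance of `κ` makes the action supercommute with the differential, and the action preserves
the degree. -/
theorem Jaction_mem_stable : Jaction hD hT ∈ e.stable := by
  constructor
  · intro z hz
    obtain ⟨h1, h2⟩ := e.mem_cocycles.1 hz
    refine e.mem_cocycles.2 ⟨Jaction_mem_Jdeg hD hT h1, ?_⟩
    have h := e.Jaction_κ_mul hD hT z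
    rw [h2, map_zero] at h
    have := congrArg (fun x => sgn i • x) h
    simpa only [smul_zero, smul_smul, sgn_mul_self, one_smul, eq_comm] using this
  · intro z hz
    refine e.coboundaries_induction (C := fun z => Jaction hD hT z ∈ e.coboundaries) ?_
      (fun r w hw hr => ?_) hz
    · rw [map_zero]; exact zero_mem _
    · rw [Jaction_κ_mul]
      exact zsmul_mem (e.κ_mul_mem_coboundaries (Jaction_mem_Jdeg hD hT hw) hr) _

theorem mulLeft_mem_stable (a : A) : LinearMap.mulLeft k (SymAlg.ofA k A _ a) ∈ e.stable := by
  have hκ : ∀ z, SymAlg.ofA k A _ a * (e.κ * z) = e.κ * (SymAlg.ofA k A _ (σ k a) * z) :=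
    fun z => by
      rw [← mul_assoc, ← mul_assoc, κ_mul, SymAlg.σ_ofA, σ_σ]
  constructor
  · intro z hz
    obtain ⟨h1, h2⟩ := e.mem_cocycles.1 hz
    refine e.mem_cocycles.2 ⟨ofA_mul_mem_Jdeg a h1, ?_⟩
    have := hκ z
    rw [LinearMap.mulLeft_apply, ← mul_assoc, κ_mul, SymAlg.σ_ofA, mul_assoc, h2, mul_zero]
  · intro z hz
    refine e.coboundaries_induction
      (C := fun z => LinearMap.mulLeft k (SymAlg.ofA k A _ a) z ∈ e.coboundaries) ?_
      (fun r w hw hr => ?_) hz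
    · rw [map_zero]; exact zero_mem _
    · rw [LinearMap.mulLeft_apply, hκ]
      exact e.κ_mul_mem_coboundaries (ofA_mul_mem_Jdeg _ hw) hr

variable (k A M) in
/-- The action of `A` on `J(M)`. -/
def mulHom : A →ₐ[k] Module.End k (J k A M) :=
  (Algebra.lmul k (J k A M)).comp (AlgHom.ofLinearMap (SymAlg.ofA k A _) (SymAlg.ofA_one k A _)
    (SymAlg.ofA_mul k))

/-- The action of `A` on the Berezinian module. -/
def berMul : A →ₐ[k] Module.End k e.Ber :=
  e.induceHom.comp ((mulHom k A M).codRestrict e.stable e.mulLeft_mem_stable)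

theorem berMul_induces (a : A) :
    e.Induces (LinearMap.mulLeft k (SymAlg.ofA k A _ a)) (e.berMul a) :=
  e.induces ⟨_, e.mulLeft_mem_stable a⟩

/-- A Leibniz rule between operators on `J(M)` is an identity in the algebra of stable operators, so
it passes to the quotient. -/
theorem induce_berMul (T : e.stable) {a b c : A}
    (h : ∀ z, (T : Module.End k (J k A M)) (SymAlg.ofA k A _ a * z) =
      SymAlg.ofA k A _ b * z + SymAlg.ofA k A _ c * (T : Module.End k (J k A M)) z) (ω : e.Ber) :
    e.induce T (e.berMul a ω) = e.berMul b ω + e.berMul c (e.induce T ω) := by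
  have h1 : T * (mulHom k A M).codRestrict e.stable e.mulLeft_mem_stable a =
      (mulHom k A M).codRestrict e.stable e.mulLeft_mem_stable b +
        (mulHom k A M).codRestrict e.stable e.mulLeft_mem_stable c * T :=
    Subtype.ext (LinearMap.ext h)
  have h2 := congrArg e.induceHom h1
  rw [map_mul, map_add, map_mul] at h2
  exact LinearMap.congr_fun h2 ω

end HomBasis

end Ber

/-! ### Algebra morphisms on `U'(g)` prescribed on homogeneous elements. -/

section EnvHom

variable {p : ℕ} {k g B : Type*} [Field k] [AddCommGroup g] [Module k g]
  [LieSuperalgebra k g] [Restricted p k g] [NeZero (2 : k)]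

/-- The linear map given by its restrictions to the homogeneous components. -/
def ofParts {W : Type*} [AddCommGroup W] [Module k W] (f : ∀ i, part k g i →ₗ[k] W) : g →ₗ[k] W :=
  f 0 ∘ₗ compTo k 0 + f 1 ∘ₗ compTo k 1

theorem ofParts_of_mem {W : Type*} [AddCommGroup W] [Module k W] (f : ∀ i, part k g i →ₗ[k] W)
    {i : ZMod 2} {x : g} (hx : x ∈ part k g i) : ofParts f x = f i ⟨x, hx⟩ := by
  change f 0 (compTo k 0 x) + f 1 (compTo k 1 x) = f i ⟨x, hx⟩
  rcases zmod_two_cases i with rfl | rfl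
  · have h1 : compTo k 0 x = ⟨x, hx⟩ := Subtype.ext (comp_of_mem k hx)
    have h2 : compTo k 1 x = 0 := Subtype.ext (comp_of_mem_ne k hx (by decide))
    rw [h1, h2, map_zero, add_zero]
  · have h1 : compTo k 1 x = ⟨x, hx⟩ := Subtype.ext (comp_of_mem k hx)
    have h2 : compTo k 0 x = 0 := Subtype.ext (comp_of_mem_ne k hx (by decide))
    rw [h1, h2, map_zero, zero_add]

variable [Ring B] [Algebra k B] (f : ∀ i, part k g i →ₗ[k] B)
  (hf : ∀ {i j : ZMod 2} (x : part k g i) (y : part k g j),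
    f (i + j) ⟨br k (x : g) y, br_mem_part x.2 y.2⟩ = f i x * f j y - sgn (i * j) • (f j y * f i x))
  (hp : ∀ x : part k g 0, f 0 (Restricted.pmap p x) = f 0 x ^ p)

/-- The algebra morphism on `U'(g)` given on homogeneous elements of `g`. -/
def Env.liftParts : Env p k g →ₐ[k] B :=
  Env.lift (ofParts f)
    (fun {i j x y} hx hy => by
      have := hf ⟨x, hx⟩ ⟨y, hy⟩
      rw [ofParts_of_mem f hx, ofParts_of_mem f hy, ofParts_of_mem f (br_mem_part hx hy), this]
      abel)
    (fun x => by
      rw [ofParts_of_mem f x.2, ofParts_of_mem f (Restricted.pmap p x).2]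
      exact (hp x).symm)

theorem Env.liftParts_ι {i : ZMod 2} {x : g} (hx : x ∈ part k g i) :
    Env.liftParts f hf hp (Env.ι p k g x) = f i ⟨x, hx⟩ :=
  (Env.lift_ι p k _ _ _ x).trans (ofParts_of_mem f hx)

theorem Env.map_mem {φ : Env p k g →ₐ[k] B} {S : Subalgebra k B}
    (hS : ∀ (i : ZMod 2) (x : g), x ∈ part k g i → φ (Env.ι p k g x) ∈ S) (u : Env p k g) :
    φ u ∈ S := by
  obtain ⟨t, rfl⟩ := Env.quot_surjective p k g u
  induction t using TensorAlgebra.induction with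
  | algebraMap r => rw [AlgHom.commutes, AlgHom.commutes]; exact S.algebraMap_mem r
  | ι x =>
    change φ (Env.ι p k g x) ∈ S
    rw [← comp_add_comp k x, map_add, map_add]
    exact add_mem (hS 0 _ (comp_mem k 0 x)) (hS 1 _ (comp_mem k 1 x))
  | mul a b ha hb => rw [map_mul, map_mul]; exact mul_mem ha hb
  | add a b ha hb => rw [map_add, map_add]; exact add_mem ha hb

end EnvHom

/-! ### The action of `U'(g)` by Lie derivatives. -/

section LieAction

variable {p : ℕ} {k g A : Type*} [Field k] [AddCommGroup g] [Module k g]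
  [LieSuperalgebra k g] [Restricted p k g] [NeZero (2 : k)] [Fact p.Prime] [CharP k p]
  [Ring A] [Algebra k A] [Superalgebra k A] [SuperCommutative k A]
  (act : Env p k g →ₐ[k] Module.End k A)
  (hact : ∀ {i : ZMod 2} {x : g}, x ∈ part k g i → IsSuperDer k i (act (Env.ι p k g x)))

theorem lieDerivative_add {i : ZMod 2} {D E F : Module.End k A} (hD : IsSuperDer k i D)
    (hE : IsSuperDer k i E) (hF : IsSuperDer k i F) (h : F = D + E) :
    lieDerivative hF = lieDerivative hD + lieDerivative hE := by
  have := lieDerivative_comb hD hE hF (c := 1) (c' := 1) (by rw [h, one_smul, one_smul])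
  exact this.trans (congrArg₂ (· + ·) (one_smul k _) (one_smul k _))

theorem lieDerivative_smul {i : ZMod 2} {D F : Module.End k A} (hD : IsSuperDer k i D)
    (hF : IsSuperDer k i F) {c : k} (h : F = c • D) :
    lieDerivative hF = c • lieDerivative hD := by
  have := lieDerivative_comb hD hD hF (c := c) (c' := 0) (by rw [h, zero_smul, add_zero])
  exact this.trans ((congrArg (c • lieDerivative hD + ·) (zero_smul k _)).trans (add_zero _))

/-- The Lie derivatives along homogeneous elements of parity `i`. -/
def lieAlong (i : ZMod 2) : part k g i →ₗ[k] Module.End k (J k A (DerDual k A)) where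
  toFun x := lieDerivative (hact x.2)
  map_add' x y := lieDerivative_add (hact x.2) (hact y.2) (hact (x + y).2) (by
    rw [Submodule.coe_add, map_add, map_add])
  map_smul' c x := lieDerivative_smul (hact x.2) (hact (c • x).2) (by
    rw [Submodule.coe_smul, map_smul, map_smul, RingHom.id_apply])

theorem lieAlong_bracket {i j : ZMod 2} (x : part k g i) (y : part k g j) :
    lieAlong act hact (i + j) ⟨br k (x : g) y, br_mem_part x.2 y.2⟩ =
      lieAlong act hact i x * lieAlong act hact j y -
        sgn (i * j) • (lieAlong act hact j y * lieAlong act hact i x) := by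
  have hδ : act (Env.ι p k g (br k (x : g) y)) =
      act (Env.ι p k g (x : g)) * act (Env.ι p k g (y : g)) -
        sgn (i * j) • (act (Env.ι p k g (y : g)) * act (Env.ι p k g (x : g))) := by
    have := congrArg act (Env.ι_mul_ι p k x.2 y.2)
    rw [map_mul, map_add, map_zsmul, map_mul] at this
    rw [this, add_sub_cancel_left]
  exact lieDerivative_bracket (hact x.2) (hact y.2) (hact (br_mem_part x.2 y.2)) hδ

theorem lieAlong_pow (x : part k g 0) :
    lieAlong act hact 0 (Restricted.pmap p x) = lieAlong act hact 0 x ^ p :=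
  lieDerivative_pow (hact x.2) (hact (Restricted.pmap p x : part k g 0).2)
    (by rw [← map_pow, Env.ι_pow])

/-- The action of `U'(g)` on `J(Der(A)^*)` by Lie derivatives. -/
def lieHom : Env p k g →ₐ[k] Module.End k (J k A (DerDual k A)) :=
  Env.liftParts (lieAlong act hact) (lieAlong_bracket act hact) (lieAlong_pow act hact)

theorem lieHom_ι {i : ZMod 2} {x : g} (hx : x ∈ part k g i) :
    lieHom act hact (Env.ι p k g x) = lieDerivative (hact hx) :=
  Env.liftParts_ι (lieAlong act hact) (lieAlong_bracket act hact) (lieAlong_pow act hact) hx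

variable {n m : ℕ} (e : HomBasis k A (DerDual k A) n m)

theorem lieDerivative_mem_stable {i : ZMod 2} {D : A →ₗ[k] A} (hD : IsSuperDer k i D) :
    lieDerivative hD ∈ e.stable :=
  e.Jaction_mem_stable hD (isCovariant_lieDual hD)

theorem lieHom_mem_stable (u : Env p k g) : lieHom act hact u ∈ e.stable :=
  Env.map_mem (fun i x hx => by
    rw [lieHom_ι act hact hx]
    exact lieDerivative_mem_stable e (hact hx)) u

/-- The action of `U'(g)` on the Berezinian module. -/
def berLie : Env p k g →ₐ[k] Module.End k e.Ber :=
  e.induceHom.comp ((lieHom act hact).codRestrict e.stable (lieHom_mem_stable act hact e))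

theorem berLie_ι {i : ZMod 2} {x : g} (hx : x ∈ part k g i) :
    berLie act hact e (Env.ι p k g x) = e.induce ⟨_, lieDerivative_mem_stable e (hact hx)⟩ :=
  congrArg e.induce (Subtype.ext (lieHom_ι act hact hx))

theorem berLie_induces {i : ZMod 2} {x : g} (hx : x ∈ part k g i) :
    e.Induces (lieDerivative (hact hx)) (berLie act hact e (Env.ι p k g x)) := by
  rw [berLie_ι act hact e hx]
  exact e.induces ⟨_, lieDerivative_mem_stable e (hact hx)⟩

theorem lieDerivative_ofA_mul {i : ZMod 2} {D : A →ₗ[k] A} (hD : IsSuperDer k i D) (a : A)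
    (z : J k A (DerDual k A)) : lieDerivative hD (SymAlg.ofA k A _ a * z) =
      SymAlg.ofA k A _ (D a) * z + SymAlg.ofA k A _ (σpow k i a) * lieDerivative hD z := by
  have h := Jaction_mul hD (isCovariant_lieDual hD) (SymAlg.ofA k A _ a) z
  rw [Jaction_ofA, SymAlg.σpow_ofA] at h
  exact h

theorem induce_lieDerivative_berMul {i : ZMod 2} {D : A →ₗ[k] A} (hD : IsSuperDer k i D) (a : A)
    (ω : e.Ber) :
    e.induce ⟨lieDerivative hD, lieDerivative_mem_stable e hD⟩ (e.berMul a ω) =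
      e.berMul (D a) ω +
        e.berMul (σpow k i a) (e.induce ⟨lieDerivative hD, lieDerivative_mem_stable e hD⟩ ω) :=
  e.induce_berMul ⟨lieDerivative hD, lieDerivative_mem_stable e hD⟩
    (lieDerivative_ofA_mul hD a) ω

/-- This has the same shape as the Leibniz rule `conv_mul_ι` for products of functions; the
linearity over functions of the comparison map rests on that. -/
theorem berLie_berMul {i : ZMod 2} {x : g} (hx : x ∈ part k g i) (a : A) (ω : e.Ber) :
    berLie act hact e (Env.ι p k g x) (e.berMul a ω) = e.berMul (act (Env.ι p k g x) a) ω +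
      e.berMul (σpow k i a) (berLie act hact e (Env.ι p k g x) ω) := by
  rw [berLie_ι act hact e hx]
  exact induce_lieDerivative_berMul e (hact hx) a ω

end LieAction

/-! # The supertrace -/

theorem SymAlg.mul_ofA_of_mem {k A N : Type*} [Field k] [Ring A] [Algebra k A] [Superalgebra k A]
    [SuperCommutative k A] [NeZero (2 : k)] [AddCommGroup N] [Module k N] [Superspace k N]
    [Module A N] [Supermodule k A N] {j : ZMod 2} {y : SymAlg k A N} (hy : y ∈ part k _ j) (a : A) :
    y * ofA k A N a = σpow k j (ofA k A N a) * y := by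
  have key : ∀ {i : ZMod 2} {a : A}, a ∈ part k A i →
      y * ofA k A N a = σpow k j (ofA k A N a) * y := fun {i a} ha => by
    have h : ofA k A N a ∈ part k _ i := by rw [mem_part, σ_ofA, mem_part.1 ha, map_zsmul]
    rw [σpow_of_mem h, smul_mul_assoc, ofA_mul_σpow ha, σpow_of_mem hy, smul_mul_assoc, smul_smul,
      mul_comm i j, sgn_mul_self, one_smul]
  rw [← comp_add_comp k a, map_add, mul_add, key (comp_mem k 0 a), key (comp_mem k 1 a), ← add_mul,
    map_add]

section Residue

variable {k A M : Type*} [Field k] [Ring A] [Algebra k A] [Superalgebra k A]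
  [SuperCommutative k A] [NeZero (2 : k)]
  [AddCommGroup M] [Module k M] [Superspace k M] [Module A M] [Supermodule k A M]
  {i : ZMod 2} {D : A →ₗ[k] A} {T : M →ₗ[k] M}

namespace HomBasis

variable {n m : ℕ} (e : HomBasis k A M n m)

theorem vars_coord_inl (i : Fin n) (x : M) (φ : SDual k A M) :
    e.vars.coord (Sum.inl (Sum.inl i)) (ParityShift.mk k 1 M x, φ) =
      σ k (e.basis.repr x (Sum.inl i)) := by
  rw [Module.Basis.coord_apply, vars, Module.Basis.repr_reindex_apply]
  change ((shiftBasis (k := k) e.basis).prod (dualBasis e.basis e.mem)).repr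
    (ParityShift.mk k 1 M x, φ) (Sum.inl (Sum.inl i)) = _
  rw [Module.Basis.prod_repr_inl]
  rfl

theorem vars_coord_inr (s : Fin m) (x : ParityShift k 1 M) (φ : SDual k A M) :
    e.vars.coord (Sum.inl (Sum.inr s)) (x, φ) = σ k (φ.fn (e.basis (Sum.inr s))) := by
  rw [Module.Basis.coord_apply, vars, Module.Basis.repr_reindex_apply]
  change ((shiftBasis (k := k) e.basis).prod (dualBasis e.basis e.mem)).repr
    (x, φ) (Sum.inr (Sum.inr s)) = _
  rw [Module.Basis.prod_repr_inr]
  rfl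

/-- The action of an even superderivation on the product of the odd variables, at the level of
coefficients, is a supertrace. -/
theorem Jres_Jaction_vol (hD : IsSuperDer k 0 D) (hT : IsCovariant k 0 D T) {θ : A →ₗ[k] k}
    (hθ : ∀ a, θ (σ k a) = θ a) :
    θ (e.Jres (Jaction hD hT e.vol)) = ∑ b, sgn (parity b) • θ (e.coeff T b b) := by
  refine (SymAlg.residue_derivation_ξprod e.vars e.vars_mem (L := Jaction hD hT)
    (T := (ParityShift.action 1 0 T).prodMap (SDual.action hD hT)) (Jaction_mul hD hT)
    (SymAlg.action_ι _ _) hθ nodup_indices).trans ?_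
  rw [indices, Finset.sum_map_toList]
  refine Finset.sum_congr rfl fun b _ => ?_
  rw [SymAlg.oddCoeff_apply, hθ, vars_apply]
  rcases b with i | s
  · have h : (ParityShift.action 1 0 T).prodMap (SDual.action hD hT)
        (ParityShift.mk k 1 M (e.basis (Sum.inl i)), 0) =
        (ParityShift.mk k 1 M (T (e.basis (Sum.inl i))), 0) := by
      refine Prod.ext ?_ (map_zero (SDual.action hD hT))
      refine (ParityShift.action_mk 1 0 T _).trans ?_
      rw [zero_mul, sgn_zero, one_smul]
      rfl
    refine (congrArg (fun x => θ (e.vars.coord (Sum.inl (Sum.inl i)) x)) h).trans ?_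
    rw [vars_coord_inl, hθ, parity_inl, sgn_zero, one_smul]
    rfl
  -- For an odd basis vector the odd variable is the dual vector. The contragredient action brings
  -- the minus sign that turns the trace into a supertrace.
  · refine (congrArg θ (e.vars_coord_inr s _ (SDual.action hD hT (e.dual (Sum.inr s))))).trans ?_
    rw [hθ, SDual.action_fn, σpow_zero, dual_fn_basis, if_pos rfl, hD.one, zero_sub, map_neg,
      parity_inr, sgn_one, neg_one_zsmul]
    rfl

/-! ## The functional on the Berezinian module given by an augmentation -/

theorem σ_mem_stable : (σ k : J k A M →ₗ[k] J k A M) ∈ e.stable := by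
  have hκ : ∀ z : J k A M, e.κ * σ k z = -σ k (e.κ * z) := fun z => by
    rw [σ_mul, mem_part_one.1 e.κ_mem, neg_mul, neg_neg]
  constructor
  · intro z hz
    obtain ⟨h1, h2⟩ := e.mem_cocycles.1 hz
    exact e.mem_cocycles.2 ⟨σ_mem_Jdeg h1, by rw [hκ, h2, map_zero, neg_zero]⟩
  · intro z hz
    refine e.coboundaries_induction (C := fun z => σ k z ∈ e.coboundaries) ?_
      (fun r w hw hr => ?_) hz
    · rw [map_zero]; exact zero_mem _
    · have := neg_mem (e.κ_mul_mem_coboundaries (σ_mem_Jdeg hw) hr)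
      rwa [hκ, neg_neg] at this

/-- The parity involution of `J(M)` on the Berezinian module. -/
def berσ : Module.End k e.Ber := e.induce ⟨_, e.σ_mem_stable⟩

theorem berσ_of_mem {i : ZMod 2} {ω : e.Ber} (hω : ω ∈ e.berPart i) :
    e.berσ ω = sgn (i + n) • ω := by
  obtain ⟨z, hz, rfl⟩ := hω
  have h : (σ k (z : J k A M)) = sgn (i + n) • (z : J k A M) := hz
  rw [← map_zsmul]
  refine (e.induce_cls ⟨_, e.σ_mem_stable⟩ z).trans ?_
  exact congrArg e.cls (Subtype.ext h)

theorem induce_Jaction_berσ (hD : IsSuperDer k i D) (hT : IsCovariant k i D T) (ω : e.Ber) :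
    e.induce ⟨_, e.Jaction_mem_stable hD hT⟩ (e.berσ ω) =
      sgn i • e.berσ (e.induce ⟨_, e.Jaction_mem_stable hD hT⟩ ω) := by
  obtain ⟨z, rfl⟩ := Submodule.mkQ_surjective _ ω
  have h : ((⟨_, e.Jaction_mem_stable hD hT⟩ * ⟨_, e.σ_mem_stable⟩ : e.stable) :
      Module.End k (J k A M)) z = σ k (sgn i • Jaction hD hT z) :=
    (SymAlg.action_σ _ _ (z : J k A M)).trans (map_zsmul (σ k) _ _).symm
  have h2 : e.induce (⟨_, e.Jaction_mem_stable hD hT⟩ * ⟨_, e.σ_mem_stable⟩) (e.cls z) =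
      e.berσ (sgn i • e.induce ⟨_, e.Jaction_mem_stable hD hT⟩ (e.cls z)) := by
    rw [induce_cls, induce_cls, ← map_zsmul]
    exact congrArg e.cls (Subtype.ext h)
  rw [map_zsmul] at h2
  exact h2

theorem berσ_berσ (ω : e.Ber) : e.berσ (e.berσ ω) = ω := by
  obtain ⟨z, rfl⟩ := Submodule.mkQ_surjective _ ω
  exact congrArg e.cls (Subtype.ext (σ_σ k (z : J k A M)))

variable (ε : A →ₐ[k] k)

/-- The composition of the coordinate with an augmentation of `A`. -/
def lam : e.Ber →ₗ[k] k := ε.toLinearMap ∘ₗ e.res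

theorem lam_volCls (a : A) : e.lam ε (e.volCls a) = ε a := congrArg ε (e.res_volCls a)

variable {ε} (hε : ∀ a, ε (σ k a) = ε a)

include hε in
theorem aug_σpow (i : ZMod 2) (a : A) : ε (σpow k i a) = ε a := by
  rcases zmod_two_cases i with rfl | rfl
  · rfl
  · exact hε a

include hε in
theorem aug_eq_zero {a : A} (ha : a ∈ part k A 1) : ε a = 0 := by
  have h := hε a
  rw [mem_part_one.1 ha, map_neg, neg_eq_iff_add_eq_zero, ← two_mul] at h
  exact (mul_eq_zero.1 h).resolve_left (NeZero.ne _)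

-- The coordinate is linear only up to a power of `σ`, which disappears under a `σ`-invariant
-- augmentation.
include hε in
theorem lam_berMul (a : A) (ω : e.Ber) : e.lam ε (e.berMul a ω) = ε a * e.lam ε ω := by
  obtain ⟨z, rfl⟩ := Submodule.mkQ_surjective _ ω
  have h : e.res (e.berMul a (e.cls z)) = _ :=
    SymAlg.residue_ofA_mul e.vars e.vars_mem (indices n m) a (z : J k A M)
  refine (congrArg ε h).trans ?_
  rw [map_mul, aug_σpow hε]
  rfl

include hε in
theorem lam_berσ (ω : e.Ber) : e.lam ε (e.berσ ω) = sgn (n + m) • e.lam ε ω := by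
  obtain ⟨z, rfl⟩ := Submodule.mkQ_surjective _ ω
  have h : e.res (e.berσ (e.cls z)) = _ :=
    SymAlg.residue_σ e.vars e.vars_mem (indices n m) (z : J k A M)
  refine (congrArg ε h).trans ?_
  rw [map_zsmul, hε, length_indices, Nat.cast_add]
  rfl

include hε in
theorem lam_induce_Jaction_volCls (hD : IsSuperDer k 0 D) (hT : IsCovariant k 0 D T) :
    e.lam ε (e.induce ⟨_, e.Jaction_mem_stable hD hT⟩ (e.volCls 1)) =
      ∑ b, sgn (parity b) • ε (e.coeff T b b) := by
  have h : e.vol * SymAlg.ofA k A _ 1 = e.vol := by rw [SymAlg.ofA_one, mul_one]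
  refine Eq.trans ?_ (e.Jres_Jaction_vol hD hT (θ := ε.toLinearMap) hε)
  exact congrArg (fun z => ε (e.Jres (Jaction hD hT z))) h

/-- A scalar moves from the right of the volume element to its left at the cost of `σ^(n+m)`, since
that element has parity `n + m`. So its class generates for the left action. -/
theorem exists_eq_berMul (ω : e.Ber) : ∃ a, ω = e.berMul a (e.volCls 1) := by
  obtain ⟨a, rfl⟩ := e.exists_eq_volCls ω
  refine ⟨σpow k (n + m) a, ?_⟩
  refine congrArg e.cls (Subtype.ext ?_)
  change e.vol * SymAlg.ofA k A _ a =
    SymAlg.ofA k A _ (σpow k (n + m) a) * (e.vol * SymAlg.ofA k A _ 1)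
  rw [SymAlg.ofA_one, mul_one, ← SymAlg.σpow_ofA]
  exact SymAlg.mul_ofA_of_mem e.vol_mem a

end HomBasis

end Residue

/-! # From the Berezinian module to functions on `U'(g)` -/

section BerFun

variable {p : ℕ} {k g A : Type*} [Field k] [AddCommGroup g] [Module k g]
  [LieSuperalgebra k g] [Restricted p k g] [NeZero (2 : k)] [Fact p.Prime] [CharP k p]
  [Ring A] [Algebra k A] [Superalgebra k A] [SuperCommutative k A]
  (act : Env p k g →ₐ[k] Module.End k A)
  (hact : ∀ {i : ZMod 2} {x : g}, x ∈ part k g i → IsSuperDer k i (act (Env.ι p k g x)))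
  {n m : ℕ} (e : HomBasis k A (DerDual k A) n m)

theorem berLie_ι_berσ {i : ZMod 2} {x : g} (hx : x ∈ part k g i) (ω : e.Ber) :
    berLie act hact e (Env.ι p k g x) (e.berσ ω) =
      sgn i • e.berσ (berLie act hact e (Env.ι p k g x) ω) := by
  rw [berLie_ι act hact e hx]
  exact e.induce_Jaction_berσ (hact hx) (isCovariant_lieDual (hact hx)) ω

theorem berLie_σ (u : Env p k g) (ω : e.Ber) :
    berLie act hact e (σ k u) ω = e.berσ (berLie act hact e u (e.berσ ω)) := by
  revert ω
  refine Env.eq_top_of_right p k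
    { carrier := {u | ∀ ω, berLie act hact e (σ k u) ω = e.berσ (berLie act hact e u (e.berσ ω))}
      add_mem' := fun hs ht ω => by
        simp only [map_add, LinearMap.add_apply, hs ω, ht ω]
      zero_mem' := fun ω => by simp only [map_zero, LinearMap.zero_apply]
      smul_mem' := fun c s hs ω => by
        simp only [map_smul, LinearMap.smul_apply, hs ω] } ?_ ?_ u
  · intro ω
    rw [σ_one, map_one, Module.End.one_apply, Module.End.one_apply, e.berσ_berσ]
  · intro u hu i x hx ω
    rw [σ_mul, Env.σ_ι, mem_part.1 hx, map_zsmul, mul_smul_comm, map_zsmul, LinearMap.smul_apply,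
      map_mul, Module.End.mul_apply, hu, map_mul, Module.End.mul_apply,
      berLie_ι_berσ act hact e hx, map_zsmul, map_zsmul]

variable (ε : A →ₐ[k] k)

/-- The function `u ↦ ε(u a)` on `U'(g)`. -/
def augFun (a : A) : Env p k g →ₗ[k] k := ε.toLinearMap ∘ₗ (LinearMap.applyₗ a) ∘ₗ act.toLinearMap

theorem augFun_apply (a : A) (u : Env p k g) : augFun act ε a u = ε (act u a) := rfl

/-- The function on `U'(g)` attached to an element of the Berezinian module. -/
def berFun : e.Ber →ₗ[k] Env p k g →ₗ[k] k :=
  LinearMap.mk₂ k (fun ω u => e.lam ε (berLie act hact e u ω))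
    (fun _ _ _ => by rw [map_add, map_add]) (fun _ _ _ => by rw [map_smul, map_smul])
    (fun _ _ _ => by rw [map_add, LinearMap.add_apply, map_add])
    (fun _ _ _ => by rw [map_smul, LinearMap.smul_apply, map_smul])

theorem berFun_apply (ω : e.Ber) (u : Env p k g) :
    berFun act hact e ε ω u = e.lam ε (berLie act hact e u ω) := rfl

theorem berFun_berLie (u v : Env p k g) (ω : e.Ber) :
    berFun act hact e ε (berLie act hact e u ω) v = berFun act hact e ε ω (v * u) := by
  rw [berFun_apply, berFun_apply, map_mul, Module.End.mul_apply]

variable {ε} (hε : ∀ a, ε (σ k a) = ε a)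

include hact in
theorem act_σ (u : Env p k g) (a : A) : act (σ k u) a = σ k (act u (σ k a)) := by
  revert a
  refine Env.eq_top_of_right p k
    { carrier := {u | ∀ a, act (σ k u) a = σ k (act u (σ k a))}
      add_mem' := fun hs ht a => by
        simp only [map_add, LinearMap.add_apply, hs a, ht a]
      zero_mem' := fun a => by simp only [map_zero, LinearMap.zero_apply]
      smul_mem' := fun c s hs a => by
        simp only [map_smul, LinearMap.smul_apply, hs a] } ?_ ?_ u
  · intro a
    rw [σ_one, map_one, Module.End.one_apply, Module.End.one_apply, σ_σ]
  · intro u hu i x hx a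
    rw [σ_mul, Env.σ_ι, mem_part.1 hx, map_zsmul, mul_smul_comm, map_zsmul, LinearMap.smul_apply,
      map_mul, Module.End.mul_apply, hu, map_mul, Module.End.mul_apply, (hact hx).parity,
      map_zsmul, map_zsmul]

include hact hε in
theorem augFun_σpow (i : ZMod 2) (a : A) :
    augFun act ε a ∘ₗ σpow k i = augFun act ε (σpow k i a) := by
  rcases zmod_two_cases i with rfl | rfl
  · rfl
  · ext u
    change ε (act (σ k u) a) = ε (act u (σ k a))
    rw [act_σ act hact, hε]

-- Induction on `u` by right multiplication: both sides obey the same Leibniz rule, and at `1` both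
-- are the product of the values.
include hε in
theorem berFun_berMul (a : A) (ω : e.Ber) :
    berFun act hact e ε (e.berMul a ω) = conv (augFun act ε a) (berFun act hact e ε ω) := by
  ext u
  revert a ω
  refine Env.eq_top_of_right p k
    { carrier := {u | ∀ a ω, berFun act hact e ε (e.berMul a ω) u =
        conv (augFun act ε a) (berFun act hact e ε ω) u}
      add_mem' := fun hs ht a ω => by rw [map_add, map_add, hs a ω, ht a ω]
      zero_mem' := fun a ω => by rw [map_zero, map_zero]
      smul_mem' := fun c s hs a ω => by rw [map_smul, map_smul, hs a ω] } ?_ ?_ u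
  · intro a ω
    rw [conv_one, berFun_apply, berFun_apply, augFun_apply, map_one, map_one,
      Module.End.one_apply, Module.End.one_apply, Module.End.one_apply, e.lam_berMul hε,
      smul_eq_mul]
  · intro u hu i x hx a ω
    have h1 : augFun act ε a ∘ₗ LinearMap.mulRight k (Env.ι p k g x) =
        augFun act ε (act (Env.ι p k g x) a) := LinearMap.ext fun v => by
      rw [LinearMap.comp_apply, LinearMap.mulRight_apply, augFun_apply, augFun_apply, map_mul,
        Module.End.mul_apply]
    have h2 : berFun act hact e ε ω ∘ₗ LinearMap.mulRight k (Env.ι p k g x) =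
        berFun act hact e ε (berLie act hact e (Env.ι p k g x) ω) := LinearMap.ext fun v =>
      (berFun_berLie act hact e ε _ v ω).symm
    rw [conv_mul_ι _ _ hx, h1, h2, augFun_σpow act hact hε, ← hu, ← hu]
    exact (berFun_berLie act hact e ε _ u (e.berMul a ω)).symm.trans
      ((congrArg (fun ω' => berFun act hact e ε ω' u) (berLie_berMul act hact e hx a ω)).trans
        (LinearMap.map_add₂ (berFun act hact e ε) _ _ u))

-- The value must vanish unless `i + j = m`, which is what it means for the function to have parity
-- `i` with values in `Π^m k`. The reason is that `λ` has parity `m` and the action commutes with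
-- the parity involutions.
include hε in
theorem berFun_mem {i j : ZMod 2} {ω : e.Ber} (hω : ω ∈ e.berPart i) {u : Env p k g}
    (hu : u ∈ part k _ j) :
    sgn m • berFun act hact e ε ω u = sgn (i + j) • berFun act hact e ε ω u := by
  have h := congrArg (e.lam ε) (berLie_σ act hact e u ω)
  rw [mem_part.1 hu, map_zsmul, LinearMap.smul_apply, map_zsmul, e.lam_berσ hε, e.berσ_of_mem hω,
    map_zsmul, map_zsmul, smul_smul] at h
  have h2 := congrArg (fun x => (sgn m * sgn j) • x) h
  simp only [smul_smul] at h2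
  have e1 : sgn m * sgn j * sgn j = sgn m := by rw [mul_assoc, sgn_mul_self, mul_one]
  have e2 : sgn m * sgn j * (sgn (n + m) * sgn (i + n)) = sgn (i + j) := by
    rw [← sgn_add, ← sgn_add, ← sgn_add]
    congr 1
    have key : ∀ i j n m : ZMod 2, m + j + (n + m + (i + n)) = i + j := by decide
    exact key _ _ _ _
  rwa [e1, e2] at h2

include hε in
theorem lam_berLie_volCls_of_even {x : g} (hx : x ∈ part k g 0) :
    e.lam ε (berLie act hact e (Env.ι p k g x) (e.volCls 1)) =
      ∑ b, sgn (parity b) • ε (e.coeff (lieDual (hact hx)) b b) := by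
  rw [berLie_ι act hact e hx]
  exact e.lam_induce_Jaction_volCls hε (hact hx) (isCovariant_lieDual (hact hx))

-- The functional `λ` has parity `m` and the volume class has parity `m`, so its transform by an odd
-- element is annihilated.
include hε in
theorem lam_berLie_volCls_of_odd {x : g} (hx : x ∈ part k g 1) :
    e.lam ε (berLie act hact e (Env.ι p k g x) (e.volCls 1)) = 0 := by
  have h1 : (1 : A) ∈ part k A (m + m) := by
    rw [CharTwo.add_self_eq_zero]; exact one_mem_part k
  have h := berFun_mem act hact e hε (e.volCls_mem h1) (Env.ι_mem_part p hx)
  rw [sgn_add, sgn_one, mul_neg_one, neg_smul, berFun_apply, eq_neg_iff_add_eq_zero, ← two_mul] at h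
  have h2 := (mul_eq_zero.1 h).resolve_left (NeZero.ne _)
  have h3 := congrArg (fun c => sgn (m : ZMod 2) • c) h2
  rwa [smul_smul, sgn_mul_self, one_smul, smul_zero] at h3

/-! ## The character -/

variable (h : RestrictedSub p k g) {s : h.carrier → k}
  (hh : ∀ (x : h.carrier) (a : A), ε (act (Env.ι p k g (x : g)) a) = 0)
  (hs : ∀ x : h.carrier,
    e.lam ε (berLie act hact e (Env.ι p k g (x : g)) (e.volCls 1)) = s x)

-- The vector field of `x ∈ h` vanishes at the base point, so in the Leibniz rule for `a • vol` only
-- the term with `vol` differentiated survives. Thus `x` acts on the fibre by the scalar `s x`.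
include hε hh hs in
theorem lam_berLie_ι {i : ZMod 2} {x : h.carrier} (hx : (x : g) ∈ part k g i) (ω : e.Ber) :
    e.lam ε (berLie act hact e (Env.ι p k g (x : g)) ω) = s x * e.lam ε ω := by
  obtain ⟨a, rfl⟩ := e.exists_eq_berMul ω
  rw [berLie_berMul act hact e hx, map_add, e.lam_berMul hε, e.lam_berMul hε, e.lam_berMul hε, hh,
    HomBasis.aug_σpow hε, hs, e.lam_volCls, map_one, zero_mul, zero_add, mul_one, mul_comm]

-- Elements of `h` act on the fibre by scalars, and hence all of `U'(h)` does; multiplicativity of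
-- the resulting character follows formally.
include hε hh hs in
theorem lam_berLie_incl (w : Env p k h.carrier) (ω : e.Ber) :
    e.lam ε (berLie act hact e (h.incl w) ω) =
      e.lam ε (berLie act hact e (h.incl w) (e.volCls 1)) * e.lam ε ω := by
  revert ω
  refine Env.eq_top_of_right p k
    { carrier := {w | ∀ ω, e.lam ε (berLie act hact e (h.incl w) ω) =
        e.lam ε (berLie act hact e (h.incl w) (e.volCls 1)) * e.lam ε ω}
      add_mem' := fun hs ht ω => by
        simp only [map_add, LinearMap.add_apply, add_mul, hs ω, ht ω]
      zero_mem' := fun ω => by simp only [map_zero, LinearMap.zero_apply, zero_mul]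
      smul_mem' := fun c s hs ω => by
        simp only [map_smul, LinearMap.smul_apply, smul_mul_assoc, hs ω] } ?_ ?_ w
  · intro ω
    rw [map_one, map_one, Module.End.one_apply, Module.End.one_apply, e.lam_volCls, map_one,
      one_mul]
  · intro w hw i x hx ω
    have hx' := h.coe_mem_part.2 hx
    rw [map_mul, map_mul, RestrictedSub.incl_ι, Module.End.mul_apply, Module.End.mul_apply, hw,
      hw (berLie act hact e (Env.ι p k g (x : g)) (e.volCls 1)),
      lam_berLie_ι act hact e hε h hh hs hx', lam_berLie_ι act hact e hε h hh hs hx',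
      e.lam_volCls, map_one, mul_one, mul_assoc]

/-- The character of `U'(h)` by which it acts on the Berezinian module modulo the augmentation
ideal. -/
def berChar : Env p k h.carrier →ₐ[k] k :=
  AlgHom.ofLinearMap (berFun act hact e ε (e.volCls 1) ∘ₗ h.incl.toLinearMap)
    (by
      change e.lam ε (berLie act hact e (h.incl 1) (e.volCls 1)) = 1
      rw [map_one, map_one, Module.End.one_apply, e.lam_volCls, map_one])
    (fun w w' => by
      change e.lam ε (berLie act hact e (h.incl (w * w')) (e.volCls 1)) = _
      rw [map_mul, map_mul, Module.End.mul_apply, lam_berLie_incl act hact e hε h hh hs]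
      rfl)

theorem berChar_ι (x : h.carrier) :
    berChar act hact e hε h hh hs (Env.ι p k h.carrier x) = s x := by
  change e.lam ε (berLie act hact e (h.incl (Env.ι p k h.carrier x)) (e.volCls 1)) = _
  rw [RestrictedSub.incl_ι, hs]

theorem berFun_incl_mul (w : Env p k h.carrier) (u : Env p k g) (ω : e.Ber) :
    berFun act hact e ε ω (h.incl w * u) =
      berChar act hact e hε h hh hs w * berFun act hact e ε ω u := by
  rw [berFun_apply, map_mul, Module.End.mul_apply, lam_berLie_incl act hact e hε h hh hs]
  rfl

end BerFun

/-! # The action of `h` on the volume form -/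

/-- A spanning family of the right size is a basis of the dual space, and the trace is computed
there as that of the transpose. -/
theorem trace_mul_of_dual {k V ι : Type*} [Field k] [AddCommGroup V] [Module k V] [Fintype ι]
    [FiniteDimensional k V] {f : ι → Module.Dual k V} (hf : ⊤ ≤ Submodule.span k (Set.range f))
    (hcard : Fintype.card ι = Module.finrank k V) {S T : Module.End k V} {s : ι → ℤ}
    (hS : ∀ b, f b ∘ₗ S = s b • f b) {t : ι → ι → k} (hT : ∀ b, f b ∘ₗ T = ∑ c, t b c • f c) :
    LinearMap.trace k V (S * T) = ∑ b, s b • t b b := by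
  classical
  have hb : Fintype.card ι = Module.finrank k (Module.Dual k V) := by
    rw [hcard, Subspace.dual_finrank_eq]
  let B := basisOfTopLeSpanOfCardEqFinrank f hf hb
  have hB : ∀ b, B b = f b := fun b => by rw [coe_basisOfTopLeSpanOfCardEqFinrank]
  rw [← LinearMap.trace_transpose', LinearMap.trace_eq_matrix_trace k B, Matrix.trace]
  refine Finset.sum_congr rfl fun b _ => ?_
  rw [Matrix.diag_apply, LinearMap.toMatrix_apply, hB]
  have h : Module.Dual.transpose (R := k) (S * T) (f b) = ∑ c, (s b • t b c) • B c := by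
    change (f b ∘ₗ S) ∘ₗ T = _
    rw [hS, LinearMap.smul_comp, hT, Finset.smul_sum]
    exact Finset.sum_congr rfl fun c _ => by rw [hB, smul_assoc]
  rw [h, B.repr_sum_self]

section Symbol

variable {p : ℕ} {k g : Type*} [Field k] [AddCommGroup g] [Module k g]
  [LieSuperalgebra k g] [Restricted p k g] (h : RestrictedSub p k g)

theorem RestrictedSub.mkQ_σ (x : g) : σ k (h.carrier.mkQ x) = h.carrier.mkQ (σ k x) := rfl

theorem RestrictedSub.adQuot_mkQ (x : h.carrier) (y : g) :
    h.adQuot x (h.carrier.mkQ y) = h.carrier.mkQ (br k (x : g) y) := rfl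

theorem RestrictedSub.strad_add (x y : h.carrier) : h.strad (x + y) = h.strad x + h.strad y := by
  have : h.adQuot (x + y) = h.adQuot x + h.adQuot y := by
    ext v
    change h.carrier.mkQ (br k (((x + y : h.carrier)) : g) v) =
      h.carrier.mkQ (br k (x : g) v) + h.carrier.mkQ (br k (y : g) v)
    rw [Submodule.coe_add, map_add, LinearMap.add_apply, map_add]
  rw [strad, this, map_add]
  rfl

variable [NeZero (2 : k)]

/-- For odd `x` the operator `ad x` anticommutes with `σ`, while the trace of a product does not
depend on the order; `2` is invertible. -/
theorem RestrictedSub.strad_eq_zero {x : h.carrier} (hx : (x : g) ∈ part k g 1) :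
    h.strad x = 0 := by
  have h1 : h.adQuot x * (σ k : Module.End k (g ⧸ h.carrier)) = -(σ k * h.adQuot x) := by
    ext v
    change h.carrier.mkQ (br k (x : g) (σ k v)) = -h.carrier.mkQ (σ k (br k (x : g) v))
    rw [σ_br, mem_part_one.1 hx, map_neg, LinearMap.neg_apply, map_neg, neg_neg]
  have h2 := LinearMap.trace_mul_comm k (h.adQuot x) (σ k : Module.End k (g ⧸ h.carrier))
  rw [h1, map_neg, neg_eq_iff_add_eq_zero, ← two_mul] at h2
  exact (mul_eq_zero.1 h2).resolve_left (NeZero.ne _)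

variable [Fact p.Prime] [CharP k p]

/-- The augmentation of `Coind(k)`. -/
def CoindAlg.aug : CoindAlg h →ₐ[k] k :=
  AlgHom.ofLinearMap ((LinearMap.applyₗ 1) ∘ₗ CoindAlg.fn)
    (by
      change CoindAlg.fn (1 : CoindAlg h) 1 = 1
      rw [CoindAlg.fn_one, AlgHom.toLinearMap_apply, map_one])
    (fun a b => by
      change CoindAlg.fn (a * b) 1 = CoindAlg.fn a 1 * CoindAlg.fn b 1
      rw [CoindAlg.fn_mul, conv_one, smul_eq_mul])

theorem CoindAlg.aug_apply (a : CoindAlg h) : CoindAlg.aug h a = CoindAlg.fn a 1 := rfl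

theorem CoindAlg.aug_σ (a : CoindAlg h) : CoindAlg.aug h (σ k a) = CoindAlg.aug h a := by
  rw [aug_apply, aug_apply, fn_σ, LinearMap.comp_apply, σ_one]

theorem CoindAlg.aug_δ (x : g) (a : CoindAlg h) :
    CoindAlg.aug h (CoindAlg.δ h x a) = CoindAlg.fn a (Env.ι p k g x) := by
  rw [aug_apply, fn_δ, one_mul]

theorem CoindAlg.aug_δ_coe (x : h.carrier) (a : CoindAlg h) :
    CoindAlg.aug h (CoindAlg.δ h (x : g) a) = 0 := by
  have := CoindAlg.fn_incl_ι_mul h a x 1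
  rwa [mul_one, ← aug_δ] at this

theorem CoindAlg.augFun_act (a : CoindAlg h) :
    augFun (CoindAlg.act h) (CoindAlg.aug h) a = CoindAlg.fn a := by
  ext u
  rw [augFun_apply, aug_apply, fn_act, LinearMap.comp_apply, LinearMap.mulRight_apply, one_mul]

/-- The map `X ↦ δ_X` into superderivations. -/
def CoindAlg.δDer : g →ₗ[k] Der k (CoindAlg h) where
  toFun x := ⟨CoindAlg.δ h x, by
    rw [← comp_add_comp k x, δ, map_add, map_add]
    exact add_mem (isSuperDer_δ h (comp_mem k 0 x)).mem_der
      (isSuperDer_δ h (comp_mem k 1 x)).mem_der⟩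
  map_add' x y := Subtype.ext (by
    change act h (Env.ι p k g (x + y)) = act h (Env.ι p k g x) + act h (Env.ι p k g y)
    rw [map_add, map_add])
  map_smul' c x := Subtype.ext (by
    change act h (Env.ι p k g (c • x)) = c • act h (Env.ι p k g x)
    rw [map_smul, map_smul])

theorem CoindAlg.coe_δDer (x : g) :
    (CoindAlg.δDer h x : CoindAlg h →ₗ[k] CoindAlg h) = CoindAlg.δ h x := rfl

theorem CoindAlg.σ_δDer (x : g) : σ k (CoindAlg.δDer h x) = CoindAlg.δDer h (σ k x) := by
  have key : ∀ {i : ZMod 2} {x : g}, x ∈ part k g i →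
      σ k (CoindAlg.δDer h x) = CoindAlg.δDer h (σ k x) := fun {i x} hx => by
    rw [mem_part.1 hx, map_zsmul]
    refine Subtype.ext (LinearMap.ext fun a => ?_)
    rw [Der.coe_σ, coe_δDer, (isSuperDer_δ h hx).parity, map_zsmul, σ_σ]
    rfl
  rw [← comp_add_comp k x, map_add, map_add, key (comp_mem k 0 x), key (comp_mem k 1 x), map_add,
    map_add]

/-- The action of `U'(g)` on `Coind(k)` is a representation, so the commutator of the vector fields
is the vector field of the bracket. -/
theorem CoindAlg.ad_δDer {x : g} (hx : x ∈ part k g 0) (y : g) :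
    Der.ad (CoindAlg.isSuperDer_δ h hx) (CoindAlg.δDer h y) = CoindAlg.δDer h (br k x y) := by
  have key : ∀ {i : ZMod 2} {y : g}, y ∈ part k g i → Der.ad (CoindAlg.isSuperDer_δ h hx)
      (CoindAlg.δDer h y) = CoindAlg.δDer h (br k x y) := fun {i y} hy => by
    refine Subtype.ext (LinearMap.ext fun a => ?_)
    rw [Der.coe_ad, coe_δDer, coe_δDer, superBracket_apply, σpow_zero, σpow_zero]
    have := LinearMap.congr_fun (congrArg (act h) (Env.ι_mul_ι p k hx hy)) a
    rw [zero_mul, sgn_zero, one_smul, map_add, map_mul, map_mul] at this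
    exact sub_eq_of_eq_add' this
  rw [← comp_add_comp k y, map_add, map_add, map_add, map_add, key (comp_mem k 0 y),
    key (comp_mem k 1 y)]

variable {h} {J : Type*} [LinearOrder J] [Fintype J] {par : J → ZMod 2} (C : Coordinates h par)

-- The coefficients of `δ_x` in the basis of partial derivatives are its values on the coordinates,
-- which vanish at `1` for `x ∈ h`. So `φ ↦ ⟨δ_X, φ⟩(1)` depends on `X` only modulo `h`.
include C in
theorem CoindAlg.aug_fn_δDer_coe (φ : DerDual k (CoindAlg h)) (x : h.carrier) :
    CoindAlg.aug h (φ.fn (CoindAlg.δDer h (x : g))) = 0 := by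
  rw [← C.pd.sum_repr (CoindAlg.δDer h (x : g)), map_sum, map_sum]
  refine Finset.sum_eq_zero fun b _ => ?_
  rw [map_smul, smul_eq_mul, map_mul, C.pd_repr, coe_δDer, aug_δ_coe, zero_mul]

/-- The functional on `g/h` given by an element of `Der(Coind(k))^*`. -/
def Coordinates.symbol (φ : DerDual k (CoindAlg h)) : Module.Dual k (g ⧸ h.carrier) :=
  h.carrier.liftQ
    { toFun := fun x => CoindAlg.aug h (φ.fn (CoindAlg.δDer h x))
      map_add' := fun x y => by rw [map_add, map_add, map_add]
      map_smul' := fun c x => by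
        rw [map_smul (CoindAlg.δDer h), map_smul_k φ, map_smul]; rfl }
    (fun x hx => CoindAlg.aug_fn_δDer_coe C φ ⟨x, hx⟩)

theorem Coordinates.symbol_mkQ (φ : DerDual k (CoindAlg h)) (x : g) :
    C.symbol φ (h.carrier.mkQ x) = CoindAlg.aug h (φ.fn (CoindAlg.δDer h x)) := rfl

end Symbol

section Symbol

variable {p : ℕ} {k g : Type*} [Field k] [AddCommGroup g] [Module k g]
  [LieSuperalgebra k g] [Restricted p k g] {h : RestrictedSub p k g}
  [NeZero (2 : k)] [Fact p.Prime] [CharP k p]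
  {J : Type*} [LinearOrder J] [Fintype J] {par : J → ZMod 2} (C : Coordinates h par)

namespace Coordinates

theorem dual_ext {f f' : Module.Dual k (g ⧸ h.carrier)}
    (hf : ∀ x, f (h.carrier.mkQ x) = f' (h.carrier.mkQ x)) : f = f' := by
  ext v
  exact hf v

theorem symbol_add (φ ψ : DerDual k (CoindAlg h)) :
    C.symbol (φ + ψ) = C.symbol φ + C.symbol ψ := dual_ext fun x => by
  rw [LinearMap.add_apply, symbol_mkQ, symbol_mkQ, symbol_mkQ, SDual.add_fn, map_add]

theorem symbol_smul (a : CoindAlg h) (φ : DerDual k (CoindAlg h)) :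
    C.symbol (a • φ) = CoindAlg.aug h a • C.symbol φ := dual_ext fun x => by
  have h1 : CoindAlg.aug h (comp k 1 a) = 0 :=
    HomBasis.aug_eq_zero (CoindAlg.aug_σ h) (comp_mem k 1 a)
  have h0 : CoindAlg.aug h (comp k 0 a) = CoindAlg.aug h a := by
    conv_rhs => rw [← comp_add_comp k a, map_add, h1, add_zero]
  rw [LinearMap.smul_apply, symbol_mkQ, symbol_mkQ, SDual.smul_A_fn, map_add, map_mul, map_mul, h0,
    h1, zero_mul, add_zero, smul_eq_mul]

theorem symbol_zsmul (c : ℤ) (φ : DerDual k (CoindAlg h)) :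
    C.symbol (c • φ) = c • C.symbol φ := dual_ext fun x => by
  rw [LinearMap.smul_apply, symbol_mkQ, symbol_mkQ, fn_zsmul, map_zsmul]

theorem symbol_sum {ι : Type*} (s : Finset ι) (f : ι → DerDual k (CoindAlg h)) :
    C.symbol (∑ b ∈ s, f b) = ∑ b ∈ s, C.symbol (f b) :=
  map_sum (AddMonoidHom.mk' C.symbol C.symbol_add) f s

theorem symbol_σ (φ : DerDual k (CoindAlg h)) : C.symbol φ ∘ₗ σ k = C.symbol (σ k φ) :=
  dual_ext fun x => by
    rw [LinearMap.comp_apply, h.mkQ_σ, symbol_mkQ, symbol_mkQ, SDual.σ_fn, CoindAlg.aug_σ,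
      CoindAlg.σ_δDer]

/-- In the contragredient formula the term `δ_x ⟨·, φ⟩` vanishes at the base point because `x ∈ h`.
What remains is the negative transpose of `ad x` on `g/h`. -/
theorem symbol_lieDual {x : h.carrier} (hx : (x : g) ∈ part k g 0)
    (φ : DerDual k (CoindAlg h)) :
    C.symbol φ ∘ₗ h.adQuot x = -C.symbol (lieDual (CoindAlg.isSuperDer_δ h hx) φ) :=
  dual_ext fun y => by
    rw [LinearMap.comp_apply, h.adQuot_mkQ, LinearMap.neg_apply, symbol_mkQ, symbol_mkQ, lieDual,
      SDual.action_fn, σpow_zero, map_sub, CoindAlg.aug_δ_coe, zero_sub, neg_neg,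
      CoindAlg.ad_δDer h hx]

theorem symbol_dualBasis (b c : J) :
    C.symbol (dualBasis C.pd C.pd_mem b) (C.basis c) = if b = c then 1 else 0 := by
  rw [C.basis_apply, symbol_mkQ, ← C.pd.sum_repr (CoindAlg.δDer h (C.vec c)), map_sum, map_sum,
    Finset.sum_eq_single b]
  · rw [map_smul, dualBasis_fn, if_pos rfl, smul_eq_mul, mul_one, C.pd_repr, CoindAlg.coe_δDer,
      CoindAlg.aug_δ, C.x_vec]
  · intro l _ hl
    rw [map_smul, dualBasis_fn, if_neg (Ne.symm hl), smul_zero, map_zero]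
  · simp

/-- The symbol map is linear over the augmentation, and it already hits the basis of the dual of
`g/h` that is dual to the classes of the coordinate vectors. So any basis of the module over
functions restricts to a spanning family at the base point, which allows an arbitrary homogeneous
basis in the theorem. -/
theorem span_symbol {ι : Type*} [Fintype ι]
    (B : Module.Basis ι (CoindAlg h) (DerDual k (CoindAlg h))) :
    ⊤ ≤ Submodule.span k (Set.range fun b => C.symbol (B b)) := by
  have h1 : ∀ φ, C.symbol φ ∈ Submodule.span k (Set.range fun b => C.symbol (B b)) := by
    intro φ
    rw [← B.sum_repr φ, symbol_sum]
    refine Submodule.sum_mem _ fun b _ => ?_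
    rw [symbol_smul]
    exact Submodule.smul_mem _ _ (Submodule.subset_span ⟨b, rfl⟩)
  intro f _
  have h2 : f = ∑ b, f (C.basis b) • C.symbol (dualBasis C.pd C.pd_mem b) := by
    refine C.basis.ext fun c => ?_
    rw [LinearMap.sum_apply, Finset.sum_eq_single c]
    · rw [LinearMap.smul_apply, symbol_dualBasis, if_pos rfl, smul_eq_mul, mul_one]
    · intro b _ hb
      rw [LinearMap.smul_apply, symbol_dualBasis, if_neg hb, smul_zero]
    · simp
  rw [h2]
  exact Submodule.sum_mem _ fun b _ => Submodule.smul_mem _ _ (h1 _)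

variable [FiniteDimensional k (g ⧸ h.carrier)] {n m : ℕ}
  (e : HomBasis k (CoindAlg h) (DerDual k (CoindAlg h)) n m)

-- The symbols of the basis form a basis of the dual of `g/h`, in which `σ` is diagonal and `ad x`
-- has the negative of the coefficients of the Lie derivative at the base point.
include C in
theorem strad_eq (hcard : n + m = Module.finrank k (g ⧸ h.carrier)) {x : h.carrier}
    (hx : (x : g) ∈ part k g 0) : h.strad x = -∑ b, sgn (parity b) •
      CoindAlg.aug h (e.coeff (lieDual (CoindAlg.isSuperDer_δ h hx)) b b) := by
  have h1 := trace_mul_of_dual (C.span_symbol e.basis)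
    (by rw [Fintype.card_sum, Fintype.card_fin, Fintype.card_fin, hcard])
    (S := σ k) (T := h.adQuot x) (s := fun b => sgn (parity b))
    (fun b => by rw [symbol_σ, mem_part.1 (e.mem b), symbol_zsmul])
    (t := fun b c => -CoindAlg.aug h (e.coeff (lieDual (CoindAlg.isSuperDer_δ h hx)) b c))
    (fun b => by
      rw [symbol_lieDual C hx, e.apply_basis, symbol_sum, ← Finset.sum_neg_distrib]
      exact Finset.sum_congr rfl fun c _ => by
        rw [symbol_smul]; exact (neg_smul _ _).symm)
  refine h1.trans ?_
  rw [← Finset.sum_neg_distrib]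
  exact Finset.sum_congr rfl fun b _ => smul_neg _ _

include C in
/-- The action of `h` on the volume form modulo the augmentation ideal. -/
theorem lam_berLie_volCls (hcard : n + m = Module.finrank k (g ⧸ h.carrier)) (x : h.carrier) :
    e.lam (CoindAlg.aug h) (berLie (CoindAlg.act h) (CoindAlg.isSuperDer_δ h) e
      (Env.ι p k g (x : g)) (e.volCls 1)) = -h.strad x := by
  have key : ∀ (i : ZMod 2) (x : h.carrier), (x : g) ∈ part k g i →
      e.lam (CoindAlg.aug h) (berLie (CoindAlg.act h) (CoindAlg.isSuperDer_δ h) e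
        (Env.ι p k g (x : g)) (e.volCls 1)) = -h.strad x := by
    intro i x hx
    rcases zmod_two_cases i with rfl | rfl
    · rw [C.strad_eq e hcard hx, neg_neg]
      exact lam_berLie_volCls_of_even (CoindAlg.act h) (CoindAlg.isSuperDer_δ h) e
        (CoindAlg.aug_σ h) hx
    · rw [h.strad_eq_zero hx, neg_zero]
      exact lam_berLie_volCls_of_odd (CoindAlg.act h) (CoindAlg.isSuperDer_δ h) e
        (CoindAlg.aug_σ h) hx
  have hx : (x : g) = (comp k 0 x : h.carrier) + (comp k 1 x : h.carrier) := by
    rw [← Submodule.coe_add, comp_add_comp]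
  have h0 := key 0 _ (h.coe_mem_part.2 (comp_mem k 0 x))
  have h1 := key 1 _ (h.coe_mem_part.2 (comp_mem k 1 x))
  have h2 : h.strad x = h.strad (comp k 0 x) + h.strad (comp k 1 x) := by
    rw [← h.strad_add, comp_add_comp]
  rw [hx, map_add, map_add, LinearMap.add_apply, map_add, h0, h1, h2, neg_add]

end Coordinates

end Symbol

/-! # The isomorphism with the coinduced module -/

section Iso

variable {p : ℕ} {k g : Type*} [Field k] [AddCommGroup g] [Module k g]
  [LieSuperalgebra k g] [Restricted p k g] [NeZero (2 : k)]
  {h : RestrictedSub p k g} {χ : Env p k h.carrier →ₐ[k] k}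

/-- The twist by `σ^m` in the shifted representation is invisible for a `σ`-invariant character. -/
theorem ParityShift.rep_charRep (hχ : ∀ w, χ (σ k w) = χ w) (m : ℕ) (w : Env p k h.carrier)
    (v : k) : ParityShift.rep m (charRep χ) w (ParityShift.mk k m k v) =
      ParityShift.mk k m k (χ w * v) := by
  have h1 : χ (σpowAlg k (m : ZMod 2) w) = χ w := by
    rw [σpowAlg_apply]
    rcases zmod_two_cases (m : ZMod 2) with h | h <;> rw [h]
    · rfl
    · exact hχ w
  rw [← h1]
  rfl

/-- The supertrace vanishes on odd elements, so the character and its composition with `σ` agree on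
generators. -/
theorem char_σ_of_strad (hχ : ∀ x, χ (Env.ι p k h.carrier x) = -h.strad x)
    (w : Env p k h.carrier) : χ (σ k w) = χ w := by
  have h1 : ∀ x : h.carrier, h.strad (σ k x) = h.strad x := fun x => by
    have h0 := mem_part_zero.1 (comp_mem k 0 x)
    have h2 := h.coe_mem_part.2 (comp_mem k 1 x)
    have h3 := h.coe_mem_part.2 (σ_mem_part (comp_mem k 1 x))
    rw [← comp_add_comp k x, map_add, h.strad_add, h.strad_add, h0, h.strad_eq_zero h2,
      h.strad_eq_zero h3]
  have h2 : χ.comp (σAlg k) = χ := by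
    refine Env.hom_ext p k fun x => ?_
    change χ (σ k (Env.ι p k h.carrier x)) = _
    rw [Env.σ_ι, hχ, hχ, h1]
  exact DFunLike.congr_fun h2 w

variable [Fact p.Prime] [CharP k p]

theorem conv_comp {V W : Type*} [AddCommGroup V] [Module k V] [AddCommGroup W] [Module k W]
    (T : V →ₗ[k] W) (a : Env p k g →ₗ[k] k) (f : Env p k g →ₗ[k] V) :
    conv a (T ∘ₗ f) = T ∘ₗ conv a f := by
  ext u
  revert a f
  refine Env.eq_top_of_right p k
    { carrier := {u | ∀ (a : Env p k g →ₗ[k] k) (f : Env p k g →ₗ[k] V),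
        conv a (T ∘ₗ f) u = (T ∘ₗ conv a f) u}
      add_mem' := fun hs ht a f => by rw [map_add, map_add, hs a f, ht a f]
      zero_mem' := fun a f => by rw [map_zero, map_zero]
      smul_mem' := fun c s hs a f => by rw [map_smul, map_smul, hs a f] } ?_ ?_ u
  · intro a f
    rw [LinearMap.comp_apply, conv_one, conv_one, map_smul]
    rfl
  · intro u hu i x hx a f
    rw [LinearMap.comp_apply, conv_mul_ι _ _ hx, conv_mul_ι _ _ hx, map_add, hu,
      LinearMap.comp_assoc, hu]
    rfl

theorem mk_mem_part {m : ℕ} {l : ZMod 2} {c : k} (hc : sgn m • c = sgn l • c) :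
    ParityShift.mk k m k c ∈ part k (ParityShift k m k) l := by
  rw [mem_part, ParityShift.σ_mk, ← map_zsmul, ← map_zsmul]
  exact congrArg _ hc

section Generic

variable {A : Type*} [Ring A] [Algebra k A] [Superalgebra k A] [SuperCommutative k A]
  (act : Env p k g →ₐ[k] Module.End k A)
  (hact : ∀ {i : ZMod 2} {x : g}, x ∈ part k g i → IsSuperDer k i (act (Env.ι p k g x)))
  {n m : ℕ} (e : HomBasis k A (DerDual k A) n m)
  {ε : A →ₐ[k] k} (hε : ∀ a, ε (σ k a) = ε a)
  (hh : ∀ (x : h.carrier) (a : A), ε (act (Env.ι p k g (x : g)) a) = 0)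
  (hs : ∀ x : h.carrier,
    e.lam ε (berLie act hact e (Env.ι p k g (x : g)) (e.volCls 1)) = -h.strad x)
  (hχ : ∀ x, χ (Env.ι p k h.carrier x) = -h.strad x)

-- Equivariance under `U'(h)` is the action by scalars on the fibre; the character found there
-- equals `χ` because both have the same values on `h`.
include hε hh hs hχ in
theorem berFun_mem_coind (ω : e.Ber) :
    (ParityShift.mk k m k).toLinearMap ∘ₗ berFun act hact e ε ω ∈
      Coind h (ParityShift.rep m (charRep χ)) := fun w u => by
  have h1 : berChar act hact e hε h hh hs = χ := Env.hom_ext p k fun x => by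
    rw [berChar_ι, hχ]
  have h2 := berFun_incl_mul act hact e hε h hh hs w u ω
  rw [h1] at h2
  exact (congrArg (ParityShift.mk k m k) h2).trans
    (ParityShift.rep_charRep (char_σ_of_strad hχ) m w _).symm

/-- The map from the Berezinian module to the coinduced module. -/
def berCoind : e.Ber →ₗ[k] Coind h (ParityShift.rep m (charRep χ)) :=
  LinearMap.codRestrict _
    (LinearMap.compRight k (ParityShift.mk k m k).toLinearMap ∘ₗ berFun act hact e ε)
    (berFun_mem_coind act hact e hε hh hs hχ)

theorem berCoind_apply (ω : e.Ber) (u : Env p k g) :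
    (berCoind act hact e hε hh hs hχ ω : Env p k g →ₗ[k] ParityShift k m k) u =
      ParityShift.mk k m k (berFun act hact e ε ω u) := rfl

theorem coe_berCoind (ω : e.Ber) :
    (berCoind act hact e hε hh hs hχ ω : Env p k g →ₗ[k] ParityShift k m k) =
      (ParityShift.mk k m k).toLinearMap ∘ₗ berFun act hact e ε ω := rfl

theorem berCoind_berLie (u : Env p k g) (ω : e.Ber) :
    berCoind act hact e hε hh hs hχ (berLie act hact e u ω) =
      coindAct h _ u (berCoind act hact e hε hh hs hχ ω) :=
  Subtype.ext <| LinearMap.ext fun v => by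
    rw [coindAct_apply, berCoind_apply, berCoind_apply, berFun_berLie]

theorem berCoind_volCls_one :
    (berCoind act hact e hε hh hs hχ (e.volCls 1) : Env p k g →ₗ[k] ParityShift k m k) 1 =
      ParityShift.mk k m k 1 := by
  rw [berCoind_apply, berFun_apply, map_one, Module.End.one_apply, e.lam_volCls, map_one]

theorem berCoind_mem {i : ZMod 2} {ω : e.Ber} (hω : ω ∈ e.berPart i) :
    berCoind act hact e hε hh hs hχ ω ∈ coindPart h (ParityShift.rep m (charRep χ)) i :=
  fun _ _ hu => mk_mem_part (berFun_mem act hact e hε hω hu)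

end Generic

end Iso

section Iso

variable {p : ℕ} {k g : Type*} [Field k] [AddCommGroup g] [Module k g]
  [LieSuperalgebra k g] [Restricted p k g] [NeZero (2 : k)]
  {h : RestrictedSub p k g}

theorem eq_zero_of_mem_coindPart {V : Type*} [AddCommGroup V] [Module k V] [Superspace k V]
    {ρ : Env p k h.carrier →ₐ[k] Module.End k V} {i : ZMod 2} {f : Coind h ρ}
    (h0 : f ∈ coindPart h ρ i) (h1 : f ∈ coindPart h ρ (i + 1)) : f = 0 := by
  have key : ∀ j, ∀ u ∈ part k (Env p k g) j, (f : Env p k g →ₗ[k] V) u = 0 := fun j u hu => by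
    rw [← comp_of_mem k (h0 j u hu)]
    refine comp_of_mem_ne k (h1 j u hu) ?_
    have : ∀ i j : ZMod 2, i + j ≠ i + 1 + j := by decide
    exact this i j
  refine Subtype.ext (LinearMap.ext fun u => ?_)
  rw [← comp_add_comp k u, map_add, key 0 _ (comp_mem k 0 u), key 1 _ (comp_mem k 1 u), add_zero]
  rfl

variable [Fact p.Prime] [CharP k p] {χ : Env p k h.carrier →ₐ[k] k}
  (hχ : ∀ x, χ (Env.ι p k h.carrier x) = -h.strad x)

section Generic

variable {A : Type*} [Ring A] [Algebra k A] [Superalgebra k A] [SuperCommutative k A]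
  (act : Env p k g →ₐ[k] Module.End k A)
  (hact : ∀ {i : ZMod 2} {x : g}, x ∈ part k g i → IsSuperDer k i (act (Env.ι p k g x)))
  {n m : ℕ} (e : HomBasis k A (DerDual k A) n m)
  {ε : A →ₐ[k] k} (hε : ∀ a, ε (σ k a) = ε a)
  (hh : ∀ (x : h.carrier) (a : A), ε (act (Env.ι p k g (x : g)) a) = 0)
  (hs : ∀ x : h.carrier,
    e.lam ε (berLie act hact e (Env.ι p k g (x : g)) (e.volCls 1)) = -h.strad x)

theorem coe_berCoind_berMul (a : A) (ω : e.Ber) :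
    (berCoind act hact e hε hh hs hχ (e.berMul a ω) : Env p k g →ₗ[k] ParityShift k m k) =
      conv (augFun act ε a) (berCoind act hact e hε hh hs hχ ω) := by
  rw [coe_berCoind, coe_berCoind, conv_comp, berFun_berMul act hact e hε]

/-- Every preimage splits into homogeneous components. If the image is homogeneous, the component of
wrong parity is sent into both parts, hence to zero. -/
theorem map_berPart (hinj : Function.Bijective (berCoind act hact e hε hh hs hχ)) (i : ZMod 2) :
    (e.berPart i).map (LinearEquiv.ofBijective (berCoind act hact e hε hh hs hχ) hinj).toLinearMap =
      coindPart h (ParityShift.rep m (charRep χ)) i := by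
  apply le_antisymm
  · rintro _ ⟨ω, hω, rfl⟩
    exact berCoind_mem act hact e hε hh hs hχ hω
  · intro f hf
    obtain ⟨ω, rfl⟩ := hinj.2 f
    obtain ⟨a, rfl⟩ := e.exists_eq_volCls ω
    have ha : a = comp k (i + m) a + comp k (i + 1 + m) a := by
      conv_lhs => rw [← comp_add_comp k a]
      rcases zmod_two_cases (i + m) with hi | hi
      · rw [add_right_comm, hi, zero_add]
      · rw [add_right_comm, hi, one_add_one, add_comm]
    have h0 := e.volCls_mem (comp_mem k (i + m) a)
    have h1 := berCoind_mem act hact e hε hh hs hχ (e.volCls_mem (comp_mem k (i + 1 + m) a))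
    rw [ha, e.volCls_add, map_add] at hf ⊢
    have h2 := (Submodule.add_mem_iff_right _ (berCoind_mem act hact e hε hh hs hχ h0)).1 hf
    rw [eq_zero_of_mem_coindPart h2 h1, add_zero]
    exact ⟨_, h0, rfl⟩

end Generic

variable [FiniteDimensional k (g ⧸ h.carrier)] {J : Type*} [LinearOrder J] [Fintype J]
  {par : J → ZMod 2} (C : Coordinates h par) {n m : ℕ}
  (e : HomBasis k (CoindAlg h) (DerDual k (CoindAlg h)) n m)
  (hcard : n + m = Module.finrank k (g ⧸ h.carrier))

/-- The map from the Berezinian module of `Der(Coind(k))^*` to the coinduced module. -/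
def Coordinates.berCoind : e.Ber →ₗ[k] Coind h (ParityShift.rep m (charRep χ)) :=
  SuperLie.berCoind (CoindAlg.act h) (CoindAlg.isSuperDer_δ h) e (CoindAlg.aug_σ h)
    (CoindAlg.aug_δ_coe h) (C.lam_berLie_volCls e hcard) hχ

theorem Coordinates.berCoind_berMul (a : CoindAlg h) (ω : e.Ber) :
    C.berCoind hχ e hcard (e.berMul a ω) =
      CoindAlg.smulCoind h _ a (C.berCoind hχ e hcard ω) := by
  refine Subtype.ext ((coe_berCoind_berMul hχ (CoindAlg.act h) (CoindAlg.isSuperDer_δ h) e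
    (CoindAlg.aug_σ h) (CoindAlg.aug_δ_coe h) (C.lam_berLie_volCls e hcard) a ω).trans ?_)
  rw [CoindAlg.augFun_act]
  rfl

theorem Coordinates.berCoind_volCls_one :
    (C.berCoind hχ e hcard (e.volCls 1) : Env p k g →ₗ[k] ParityShift k m k) 1 =
      ParityShift.mk k m k 1 :=
  SuperLie.berCoind_volCls_one (CoindAlg.act h) (CoindAlg.isSuperDer_δ h) e (CoindAlg.aug_σ h)
    (CoindAlg.aug_δ_coe h) (C.lam_berLie_volCls e hcard) hχ

/-- The volume class generates the Berezinian module and goes to a function `f₀` with value `1` at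
`1`. Multiplication of `f₀` by functions is injective by `eq_zero_of_smulCoind_eq_zero` and
surjective by `exists_smulCoind_eq`. -/
theorem Coordinates.berCoind_bijective : Function.Bijective (C.berCoind hχ e hcard) := by
  have h1 := C.berCoind_volCls_one hχ e hcard
  constructor
  · rw [← LinearMap.ker_eq_bot, LinearMap.ker_eq_bot']
    intro ω hω
    obtain ⟨a, rfl⟩ := e.exists_eq_berMul ω
    rw [C.berCoind_berMul] at hω
    have ha : a = 0 := eq_zero_of_smulCoind_eq_zero (by
      rw [h1, Ne, LinearEquiv.map_eq_zero_iff]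
      exact one_ne_zero) hω
    rw [ha, map_zero, LinearMap.zero_apply]
  · intro f
    obtain ⟨a, -, ha⟩ := C.exists_smulCoind_eq (f₀ := C.berCoind hχ e hcard (e.volCls 1))
      (fun v => ⟨(ParityShift.mk k m k).symm v, by
        rw [h1, ← map_smul, smul_eq_mul, mul_one, LinearEquiv.apply_symm_apply]⟩) f
    exact ⟨e.berMul a (e.volCls 1), by rw [C.berCoind_berMul, ← ha]⟩

theorem Coordinates.berCoind_berLie (u : Env p k g) (ω : e.Ber) :
    C.berCoind hχ e hcard (berLie (CoindAlg.act h) (CoindAlg.isSuperDer_δ h) e u ω) =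
      coindAct h _ u (C.berCoind hχ e hcard ω) :=
  SuperLie.berCoind_berLie (CoindAlg.act h) (CoindAlg.isSuperDer_δ h) e (CoindAlg.aug_σ h)
    (CoindAlg.aug_δ_coe h) (C.lam_berLie_volCls e hcard) hχ u ω

theorem Coordinates.map_berPart (i : ZMod 2) :
    (e.berPart i).map (LinearEquiv.ofBijective (C.berCoind hχ e hcard)
        (C.berCoind_bijective hχ e hcard)).toLinearMap =
      coindPart h (ParityShift.rep m (charRep χ)) i :=
  SuperLie.map_berPart hχ (CoindAlg.act h) (CoindAlg.isSuperDer_δ h) e (CoindAlg.aug_σ h)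
    (CoindAlg.aug_δ_coe h) (C.lam_berLie_volCls e hcard) (C.berCoind_bijective hχ e hcard) i

theorem Coordinates.finrank_quotient {n m : ℕ} {o : LinearOrder (Fin n ⊕ Fin m)}
    {par : Fin n ⊕ Fin m → ZMod 2} (C : Coordinates h par) :
    n + m = Module.finrank k (g ⧸ h.carrier) := by
  rw [Module.finrank_eq_card_basis C.basis, Fintype.card_sum, Fintype.card_fin, Fintype.card_fin]

/-- The homogeneous basis of `Der(Coind(k))^*` given by coordinates. -/
def Coordinates.derDualBasis {n m : ℕ} {o : LinearOrder (Fin n ⊕ Fin m)}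
    (C : Coordinates h (parity : Fin n ⊕ Fin m → ZMod 2)) :
    HomBasis k (CoindAlg h) (DerDual k (CoindAlg h)) n m :=
  HomBasis.ofDual C.pd C.pd_mem

include C e hcard in
/-- The character of `U'(h)` given by the opposite of the supertrace. -/
theorem Coordinates.exists_character : ∃ χ : Env p k h.carrier →ₐ[k] k,
    ∀ x : h.carrier, χ (Env.ι p k h.carrier x) = -h.strad x :=
  ⟨berChar (CoindAlg.act h) (CoindAlg.isSuperDer_δ h) e (CoindAlg.aug_σ h) h
    (CoindAlg.aug_δ_coe h) (C.lam_berLie_volCls e hcard),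
  berChar_ι (CoindAlg.act h) (CoindAlg.isSuperDer_δ h) e (CoindAlg.aug_σ h) h
    (CoindAlg.aug_δ_coe h) (C.lam_berLie_volCls e hcard)⟩

end Iso

end SuperLie

end

theorem mainTheorem4 {p : ℕ} {k g : Type*} [Field k] [Fact p.Prime] [CharP k p] [NeZero (2 : k)]
    [AddCommGroup g] [Module k g] [LieSuperalgebra k g] [Restricted p k g]
    (h : RestrictedSub p k g) [FiniteDimensional k (g ⧸ h.carrier)] :
    -- `-strad_{g/h}` is a character of `U'(h)`
    ∃ χ : Env p k h.carrier →ₐ[k] k, (∀ H : h.carrier, χ (Env.ι p k h.carrier H) = -h.strad H) ∧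
      -- `Der(𝒜)^*` is free of the dimension of `g/h`, so that its Berezinian is defined
      Nonempty (HomBasis k (CoindAlg h) (DerDual k (CoindAlg h)) h.evenDim h.oddDim) ∧
      ∀ e : HomBasis k (CoindAlg h) (DerDual k (CoindAlg h)) h.evenDim h.oddDim,
        -- `Ber(Der(𝒜)^*)` is an `𝒜`-module by `a · ω = a ω` ...
        ∃ α : CoindAlg h →ₐ[k] Module.End k e.Ber,
          (∀ a, e.Induces (LinearMap.mulLeft k (SymAlg.ofA k (CoindAlg h) _ a)) (α a)) ∧
          -- ... and a `U'(g)`-module by the Lie derivatives along the `δ_X`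
          ∃ ρ : Env p k g →ₐ[k] Module.End k e.Ber,
            (∀ (i : ZMod 2) (X : g) (hX : X ∈ part k g i),
              e.Induces (lieDerivative (CoindAlg.isSuperDer_δ h hX)) (ρ (Env.ι p k g X))) ∧
            -- the two structures are those of `Coind(Π^m k_χ)`
            ∃ Φ : e.Ber ≃ₗ[k] Coind h (ParityShift.rep h.oddDim (charRep χ)),
              (∀ a ω, Φ (α a ω) = CoindAlg.smulCoind h _ a (Φ ω)) ∧
              (∀ u ω, Φ (ρ u ω) = coindAct h _ u (Φ ω)) ∧
              ∀ i, (e.berPart i).map Φ.toLinearMap =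
                coindPart h (ParityShift.rep h.oddDim (charRep χ)) i := by
  obtain ⟨_, ⟨C⟩⟩ := nonempty_coordinates (h := h)
  have hcard := C.finrank_quotient
  -- One basis is used to construct the character. As only its values on `h` enter afterwards, the
  -- same character serves every basis `e`.
  have e₀ : HomBasis k (CoindAlg h) (DerDual k (CoindAlg h)) h.evenDim h.oddDim := C.derDualBasis
  have hchar : ∃ χ : Env p k h.carrier →ₐ[k] k,
      ∀ H : h.carrier, χ (Env.ι p k h.carrier H) = -h.strad H := C.exists_character e₀ hcard
  obtain ⟨χ, hχ⟩ := hchar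
  refine ⟨χ, hχ, ⟨e₀⟩, fun e => ?_⟩
  have h1 := e.berMul_induces
  have h2 : ∀ (i : ZMod 2) (X : g) (hX : X ∈ part k g i),
      e.Induces (lieDerivative (CoindAlg.isSuperDer_δ h hX))
        (berLie (CoindAlg.act h) (CoindAlg.isSuperDer_δ h) e (Env.ι p k g X)) :=
    fun i X hX => berLie_induces (CoindAlg.act h) (CoindAlg.isSuperDer_δ h) e hX
  have h3 := C.berCoind_berMul hχ e hcard
  have h4 := C.berCoind_berLie hχ e hcard
  have h5 := C.map_berPart hχ e hcard
  exact ⟨e.berMul, h1, berLie (CoindAlg.act h) (CoindAlg.isSuperDer_δ h) e, h2,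
    LinearEquiv.ofBijective (C.berCoind hχ e hcard) (C.berCoind_bijective hχ e hcard), h3, h4, h5⟩
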